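/- Fixed MCR is the following problem: given a point $r$, a simple polygon $P$ with $m\ge 3$ vertices (taken as the closed region that it bounds) and a set $S$ of $n$ points in the plane, compute an angle $\theta\in[0,2\pi)$ such that, after rotating $P$ clockwise around $r$ by $\theta$, the number of points of $S$ contained in $P$ is maximized. An in-event (out-event) of a point $p\in S$ is an angle $\theta\in[0,2\pi)$ such that $p$ belongs to the polygon rotated clockwise by $\theta$, but not to the polygon rotated by any slightly smaller (slightly larger) angle. Let $k$ be the total number of in-events and out-events over all points of $S$. Theorem. The number $k$ is always finite, with $k=O(nm)$. There is an algorithm (a single program for a real RAM which performs, in one unit of time each, exact arithmetic operations and comparisons on real numbers, square roots and arc tangents, and additions, subtractions and comparisons on integers used as memory addresses, without a floor function) that solves the Fixed MCR problem, for every instance, in $O((n+k)\log n+m\log m)$ time and $O(n+m+k)$ space. The constants in the $O$-notation are absolute, and space is measured by the largest memory address that is used. -/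

import Mathlib

namespace FixedMCR

/-! ## Simple polygons and the regions they bound

The plane is `ℂ`, the point with coordinates `(x, y)` being `x + y * I`. -/

/-- A polygon is simple if its vertices are distinct, two consecutive edges meet only in the
vertex that they share, and any two other edges are disjoint.  Its vertices may be listed in
either orientation, and an angle of `π` at a vertex is allowed. -/
def IsSimple {m : ℕ} (P : Polygon ℂ m) : Prop :=
  Function.Injective P.vertices ∧
  (∀ i : Fin m, P.edgeSet ℝ i ∩ P.edgeSet ℝ (finRotate m i) = {P (finRotate m i)}) ∧
  (∀ i j : Fin m, j ≠ i → j ≠ finRotate m i → i ≠ finRotate m j →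
    Disjoint (P.edgeSet ℝ i) (P.edgeSet ℝ j))

/-- The closed region bounded by a polygon: its boundary, together with the points whose
connected component in the complement of the boundary is bounded. -/
def region {m : ℕ} (P : Polygon ℂ m) : Set ℂ :=
  P.boundary ℝ ∪
    {x | x ∉ P.boundary ℝ ∧ Bornology.IsBounded (connectedComponentIn (P.boundary ℝ)ᶜ x)}

/-- Clockwise rotation of the plane around `r` by the angle `θ`. -/
noncomputable def rotateCW (r : ℂ) (θ : ℝ) (z : ℂ) : ℂ :=
  r + Complex.exp (-(θ * Complex.I)) * (z - r)

/-! ## The problem -/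

/-- An instance with `n` points and a polygon with `m` vertices: a rotation center, a simple
polygon and a set of `n` (distinct) points, listed in any order. -/
structure Instance (n m : ℕ) where
  center : ℂ
  polygon : Polygon ℂ m
  point : Fin n ↪ ℂ
  three_le : 3 ≤ m
  simple : IsSimple polygon

namespace Instance

variable {n m : ℕ} (I : Instance n m)

/-- The placement of the polygon after a clockwise rotation around the center by `θ`. -/
noncomputable def placement (θ : ℝ) : Set ℂ :=
  rotateCW I.center θ '' region I.polygon

/-- The number of given points that the placement at angle `θ` contains. -/
noncomputable def cover (θ : ℝ) : ℕ :=
  {j : Fin n | I.point j ∈ I.placement θ}.ncard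

/-- `θ` is a correct answer: an angle in `[0, 2π)` that maximizes the number of points
contained in the rotated polygon. -/
def IsSolution (θ : ℝ) : Prop :=
  θ ∈ Set.Ico 0 (2 * Real.pi) ∧ ∀ φ ∈ Set.Ico 0 (2 * Real.pi), I.cover φ ≤ I.cover θ

/-- The in-events of the `j`-th point: the angles at which it enters the polygon, that is, it
is in the placement at `θ`, but not just before. -/
def inEvents (j : Fin n) : Set ℝ :=
  {θ | θ ∈ Set.Ico 0 (2 * Real.pi) ∧ I.point j ∈ I.placement θ ∧
    ∀ᶠ φ in nhdsWithin θ (Set.Iio θ), I.point j ∉ I.placement φ}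

/-- The out-events of the `j`-th point: the angles at which it leaves the polygon, that is, it
is in the placement at `θ`, but not just after. -/
def outEvents (j : Fin n) : Set ℝ :=
  {θ | θ ∈ Set.Ico 0 (2 * Real.pi) ∧ I.point j ∈ I.placement θ ∧
    ∀ᶠ φ in nhdsWithin θ (Set.Ioi θ), I.point j ∉ I.placement φ}

/-- The total number `k` of in-events and out-events of the instance. -/
noncomputable def eventCount : ℕ :=
  ∑ j : Fin n, ((I.inEvents j).ncard + (I.outEvents j).ncard)

end Instance

/-! ## The real RAM

The machine has finitely many integer and real registers (those that occur in the program), an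
integer memory and a real memory, each with cells `0, 1, 2, …`, addressed through integer
registers.  Integers can be added, subtracted (truncated at `0`) and compared; reals can be
added, subtracted, multiplied, divided and compared, and square roots and arc tangents can be
taken (angles have to be computed).  There is no floor function, no other conversion of reals
to integers, and no real constant in a program except for integers.  Every instruction and
every test takes one unit of time. -/

/-- A configuration of the memory of the machine. -/
structure Store where
  /-- integer registers -/
  ireg : ℕ → ℕ
  /-- real registers -/
  rreg : ℕ → ℝ
  /-- integer memory -/
  imem : ℕ → ℕ
  /-- real memory -/
  rmem : ℕ → ℝ

/-- Unary operations on reals. -/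
inductive RUn
  | neg | sqrt | arctan

/-- Binary operations on reals. -/
inductive RBin
  | add | sub | mul | div

noncomputable def RUn.eval : RUn → ℝ → ℝ
  | .neg, x => -x
  | .sqrt, x => Real.sqrt x
  | .arctan, x => Real.arctan x

noncomputable def RBin.eval : RBin → ℝ → ℝ → ℝ
  | .add, x, y => x + y
  | .sub, x, y => x - y
  | .mul, x, y => x * y
  | .div, x, y => x / y

/-- Instructions; the first argument is the target register, except in the two instructions
`istore a b` and `rstore a b`, which write register `b` to the memory cell whose address is in
the integer register `a`. -/
inductive Instr
  | iconst (d c : ℕ)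
  | imove (d a : ℕ)
  | iadd (d a b : ℕ)
  | isub (d a b : ℕ)
  | iload (d a : ℕ)
  | istore (a b : ℕ)
  | rconst (d : ℕ) (c : ℤ)
  | rmove (d a : ℕ)
  | run (o : RUn) (d a : ℕ)
  | rbin (o : RBin) (d a b : ℕ)
  | rload (d a : ℕ)
  | rstore (a b : ℕ)

/-- The effect of an instruction. -/
noncomputable def Instr.step (s : Store) : Instr → Store
  | .iconst d c => { s with ireg := Function.update s.ireg d c }
  | .imove d a => { s with ireg := Function.update s.ireg d (s.ireg a) }
  | .iadd d a b => { s with ireg := Function.update s.ireg d (s.ireg a + s.ireg b) }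
  | .isub d a b => { s with ireg := Function.update s.ireg d (s.ireg a - s.ireg b) }
  | .iload d a => { s with ireg := Function.update s.ireg d (s.imem (s.ireg a)) }
  | .istore a b => { s with imem := Function.update s.imem (s.ireg a) (s.ireg b) }
  | .rconst d c => { s with rreg := Function.update s.rreg d (c : ℝ) }
  | .rmove d a => { s with rreg := Function.update s.rreg d (s.rreg a) }
  | .run o d a => { s with rreg := Function.update s.rreg d (o.eval (s.rreg a)) }
  | .rbin o d a b =>
      { s with rreg := Function.update s.rreg d (o.eval (s.rreg a) (s.rreg b)) }
  | .rload d a => { s with rreg := Function.update s.rreg d (s.rmem (s.ireg a)) }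
  | .rstore a b => { s with rmem := Function.update s.rmem (s.ireg a) (s.rreg b) }

/-- The number of memory cells up to and including the one that an instruction accesses (`0` if
it accesses none). -/
def Instr.cells (s : Store) : Instr → ℕ
  | .iload _ a => s.ireg a + 1
  | .istore a _ => s.ireg a + 1
  | .rload _ a => s.ireg a + 1
  | .rstore a _ => s.ireg a + 1
  | _ => 0

/-- Tests: comparisons of two registers. -/
inductive Test
  | ile (a b : ℕ)
  | ilt (a b : ℕ)
  | rle (a b : ℕ)
  | rlt (a b : ℕ)

def Test.Holds (s : Store) : Test → Prop
  | .ile a b => s.ireg a ≤ s.ireg b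
  | .ilt a b => s.ireg a < s.ireg b
  | .rle a b => s.rreg a ≤ s.rreg b
  | .rlt a b => s.rreg a < s.rreg b

/-- Programs. -/
inductive Program
  | skip
  | instr (i : Instr)
  | seq (p q : Program)
  | cond (b : Test) (p q : Program)
  | loop (b : Test) (p : Program)

/-- `Runs p s s' t c`: started in the store `s`, the program `p` halts in the store `s'` after
`t` steps, and every memory cell that it accesses has an address less than `c`, where `c` is
least possible.  `loop b p` repeats `p` while the test `b` holds. -/
inductive Runs : Program → Store → Store → ℕ → ℕ → Prop
  | skip (s : Store) : Runs .skip s s 1 0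
  | instr (i : Instr) (s : Store) : Runs (.instr i) s (i.step s) 1 (i.cells s)
  | seq {p q : Program} {s s' s'' : Store} {t t' c c' : ℕ} :
      Runs p s s' t c → Runs q s' s'' t' c' → Runs (.seq p q) s s'' (t + t') (max c c')
  | condTrue {b : Test} {p q : Program} {s s' : Store} {t c : ℕ} :
      b.Holds s → Runs p s s' t c → Runs (.cond b p q) s s' (t + 1) c
  | condFalse {b : Test} {p q : Program} {s s' : Store} {t c : ℕ} :
      ¬ b.Holds s → Runs q s s' t c → Runs (.cond b p q) s s' (t + 1) c
  | loopTrue {b : Test} {p : Program} {s s' s'' : Store} {t t' c c' : ℕ} :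
      b.Holds s → Runs p s s' t c → Runs (.loop b p) s' s'' t' c' →
        Runs (.loop b p) s s'' (t + t' + 1) (max c c')
  | loopFalse {b : Test} {p : Program} {s : Store} :
      ¬ b.Holds s → Runs (.loop b p) s s 1 0

/-- The machine is deterministic. -/
theorem Runs.deterministic {p : Program} {s s₁ s₂ : Store} {t₁ t₂ c₁ c₂ : ℕ}
    (h₁ : Runs p s s₁ t₁ c₁) (h₂ : Runs p s s₂ t₂ c₂) : s₁ = s₂ ∧ t₁ = t₂ ∧ c₁ = c₂ := by
  induction h₁ generalizing s₂ t₂ c₂ with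
  | skip => cases h₂; simp
  | instr => cases h₂; simp
  | seq _ _ ih ih' =>
    cases h₂ with
    | seq k k' =>
      obtain ⟨rfl, rfl, rfl⟩ := ih k
      obtain ⟨rfl, rfl, rfl⟩ := ih' k'
      simp
  | condTrue hb _ ih =>
    cases h₂ with
    | condTrue _ k => obtain ⟨rfl, rfl, rfl⟩ := ih k; simp
    | condFalse hb' _ => exact absurd hb hb'
  | condFalse hb _ ih =>
    cases h₂ with
    | condTrue hb' _ => exact absurd hb' hb
    | condFalse _ k => obtain ⟨rfl, rfl, rfl⟩ := ih k; simp
  | loopTrue hb _ _ ih ih' =>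
    cases h₂ with
    | loopTrue _ k k' =>
      obtain ⟨rfl, rfl, rfl⟩ := ih k
      obtain ⟨rfl, rfl, rfl⟩ := ih' k'
      simp
    | loopFalse hb' => exact absurd hb hb'
  | loopFalse hb =>
    cases h₂ with
    | loopTrue hb' _ _ => exact absurd hb' hb
    | loopFalse _ => simp

/-! ## Input -/

/-- The real numbers of the input: the two coordinates of the center, of the vertices in cyclic
order, and of the points. -/
def Instance.coordinates {n m : ℕ} (I : Instance n m) : List ℝ :=
  (I.center :: (List.ofFn I.polygon.vertices ++ List.ofFn I.point)).flatMap
    fun z => [z.re, z.im]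

/-- The initial store: `n` and `m` are in the integer registers `0` and `1`, the coordinates are
in the first cells of the real memory, and everything else is `0`. -/
def Instance.initial {n m : ℕ} (I : Instance n m) : Store where
  ireg := fun a => if a = 0 then n else if a = 1 then m else 0
  rreg := fun _ => 0
  imem := fun _ => 0
  rmem := fun a => I.coordinates.getD a 0

end FixedMCR

/-! Put the rotation center at the origin and, instead of rotating the polygon clockwise, rotate a
point `p` counterclockwise (`Instance.mem_placement`). Then `p` runs around the circle of radius
`|p|`, and its events are the places where this circle enters or leaves the region. All of them lie
on the boundary.

Items. Every edge is cut at its point nearest to the origin. Along each of the two pieces the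
distance to the origin is monotone, so that a circle meets the interior of a piece at most once.
There it crosses from one side of the edge to the other and produces exactly one event. The
remaining places are the vertices and the interior points of edges where a circle is tangent. There
the circle may cross, or touch from either side, so that each of them can carry an in-event, an
out-event, both or none; this is decided by comparing angles just before and just after the place.
The first kind of item is live for an open interval of squared radii, the second for a single value,
and only if it does carry an event. Hence the items that are live at `|p|²` are in bijection with
the events of `p` (`Poly.mem_pointEvents_iff`, `Poly.nodup_pointEvents`). There are `2m + 4m` items,
which gives `k ≤ 6nm`.

Topology. One has to know that exactly one side of the boundary is interior, and which one. The
status of either side is locally constant along the curve (`Poly.side_const`). Not both sides are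
interior, because a far point can be joined to one of the sides (`Poly.not_left_and_right`). Not
both are exterior, because the winding number vanishes outside but jumps across an edge
(`Poly.left_or_right`). The program finds the interior side at a farthest vertex, from which the
radial direction leads out of the region (`Poly.farthest`).

Time. The points are treated in the order of their distance from the origin, and the list of live
items is kept sorted by angle. Since the edges do not cross, the items on a growing circle keep
their cyclic order (`Poly.keepsOrder_strict`), so that the surviving part of the list, with updated
angles, has at most one descent. The sorting method is natural merge sort, whose cost for `N`
elements with `d` descents is of the order `N (1 + log d)` (`sortCode_wp`). Updating the list is
therefore linear in the number of its items before and after, that is, in numbers of events, apart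
from `log m` for every newly born item, of which there are `O(m)` in all (`sweepCode_wp`). The
events of each point are also produced in cyclic order, so that the array of all `k` events has at
most `4n` descents. Sorting it costs `O(k log n)`, up to an additive `O(log n)`, although `log k`
may be of the order `log m`.

Answer. The number of covered points at the angle `φ` is a constant plus the number of in-events at
angles `≤ φ` minus the number of out-events at angles `< φ` (`Instance.cover_count`). One scan of
the sorted events finds a maximum (`select_correct`).

Machine. The program is written in a small structured language with sixteen arrays, whose commands
are compiled to the real RAM with a constant slowdown (`Cmd.comp_halts`). Correctness, array bounds
and running time are proved together with weakest preconditions that carry a clock. `mainCode_wp`,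
`program_spec` and `time_bound` put the pieces together. -/

namespace FixedMCR

/-! ## A high-level language with named arrays, compiled to the real RAM -/

/-- A state of the high-level language: a read-only input of length `len`, integer and real
variables, and numbered integer and real arrays. -/
structure St where
  len : ℕ
  inp : ℕ → ℝ
  iv : ℕ → ℕ
  rv : ℕ → ℝ
  ia : ℕ → ℕ → ℕ
  ra : ℕ → ℕ → ℝ

/-- Integer expressions. -/
inductive IE
  | var (v : ℕ)
  | const (c : ℕ)
  | add (a b : IE)
  | sub (a b : IE)
  | get (k : ℕ) (i : IE)

/-- Real expressions; `ifle a b x y` is `x` if `a ≤ b` and `y` otherwise. -/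
inductive RE
  | var (v : ℕ)
  | const (c : ℤ)
  | un (o : RUn) (a : RE)
  | bin (o : RBin) (a b : RE)
  | get (k : ℕ) (i : IE)
  | inp (i : IE)
  | ifle (a b x y : RE)

/-- Boolean expressions. -/
inductive BE
  | ile (a b : IE)
  | ilt (a b : IE)
  | rle (a b : RE)
  | rlt (a b : RE)
  | and (a b : BE)
  | not (a : BE)

/-- Commands. -/
inductive Cmd
  | skip
  | iset (d : ℕ) (e : IE)
  | rset (d : ℕ) (e : RE)
  | iput (k : ℕ) (i e : IE)
  | rput (k : ℕ) (i : IE) (e : RE)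
  | seq (p q : Cmd)
  | ite (b : BE) (p q : Cmd)
  | loop (b : BE) (p : Cmd)

infixr:65 " ;; " => Cmd.seq

namespace IE

def eval (h : St) : IE → ℕ
  | var v => h.iv v
  | const c => c
  | add a b => a.eval h + b.eval h
  | sub a b => a.eval h - b.eval h
  | get k i => h.ia k (i.eval h)

/-- All array accesses are to existing arrays at indices below `M`. -/
def ok (M : ℕ) (h : St) : IE → Prop
  | var _ => True
  | const _ => True
  | add a b => a.ok M h ∧ b.ok M h
  | sub a b => a.ok M h ∧ b.ok M h
  | get k i => k < 16 ∧ i.ok M h ∧ i.eval h < M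

end IE

namespace RE

noncomputable def eval (h : St) : RE → ℝ
  | var v => h.rv v
  | const c => c
  | un o a => o.eval (a.eval h)
  | bin o a b => o.eval (a.eval h) (b.eval h)
  | get k i => h.ra k (i.eval h)
  | inp i => h.inp (i.eval h)
  | ifle a b x y => if a.eval h ≤ b.eval h then x.eval h else y.eval h

def ok (M : ℕ) (h : St) : RE → Prop
  | var _ => True
  | const _ => True
  | un _ a => a.ok M h
  | bin _ a b => a.ok M h ∧ b.ok M h
  | get k i => k < 16 ∧ i.ok M h ∧ i.eval h < M
  | inp i => i.ok M h ∧ i.eval h < h.len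
  | ifle a b x y => a.ok M h ∧ b.ok M h ∧ x.ok M h ∧ y.ok M h

end RE

namespace BE

def eval (h : St) : BE → Prop
  | ile a b => a.eval h ≤ b.eval h
  | ilt a b => a.eval h < b.eval h
  | rle a b => a.eval h ≤ b.eval h
  | rlt a b => a.eval h < b.eval h
  | and a b => a.eval h ∧ b.eval h
  | not a => ¬ a.eval h

def ok (M : ℕ) (h : St) : BE → Prop
  | ile a b => a.ok M h ∧ b.ok M h
  | ilt a b => a.ok M h ∧ b.ok M h
  | rle a b => a.ok M h ∧ b.ok M h
  | rlt a b => a.ok M h ∧ b.ok M h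
  | and a b => a.ok M h ∧ b.ok M h
  | not a => a.ok M h

end BE

namespace St

def seti (h : St) (d x : ℕ) : St := { h with iv := fun v => if v = d then x else h.iv v }

noncomputable def setr (h : St) (d : ℕ) (x : ℝ) : St :=
  { h with rv := fun v => if v = d then x else h.rv v }

def puti (h : St) (k j x : ℕ) : St :=
  { h with ia := fun k' j' => if k' = k ∧ j' = j then x else h.ia k' j' }

noncomputable def putr (h : St) (k j : ℕ) (x : ℝ) : St :=
  { h with ra := fun k' j' => if k' = k ∧ j' = j then x else h.ra k' j' }

variable (h : St) (d v k j k' j' x : ℕ) (y : ℝ)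

@[simp] theorem seti_iv : (h.seti d x).iv v = if v = d then x else h.iv v := rfl
@[simp] theorem seti_rv : (h.seti d x).rv = h.rv := rfl
@[simp] theorem seti_ia : (h.seti d x).ia = h.ia := rfl
@[simp] theorem seti_ra : (h.seti d x).ra = h.ra := rfl
@[simp] theorem seti_inp : (h.seti d x).inp = h.inp := rfl
@[simp] theorem seti_len : (h.seti d x).len = h.len := rfl
@[simp] theorem setr_rv : (h.setr d y).rv v = if v = d then y else h.rv v := rfl
@[simp] theorem setr_iv : (h.setr d y).iv = h.iv := rfl
@[simp] theorem setr_ia : (h.setr d y).ia = h.ia := rfl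
@[simp] theorem setr_ra : (h.setr d y).ra = h.ra := rfl
@[simp] theorem setr_inp : (h.setr d y).inp = h.inp := rfl
@[simp] theorem setr_len : (h.setr d y).len = h.len := rfl
@[simp] theorem puti_ia :
    (h.puti k j x).ia k' j' = if k' = k ∧ j' = j then x else h.ia k' j' := rfl
@[simp] theorem puti_iv : (h.puti k j x).iv = h.iv := rfl
@[simp] theorem puti_rv : (h.puti k j x).rv = h.rv := rfl
@[simp] theorem puti_ra : (h.puti k j x).ra = h.ra := rfl
@[simp] theorem puti_inp : (h.puti k j x).inp = h.inp := rfl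
@[simp] theorem puti_len : (h.puti k j x).len = h.len := rfl
@[simp] theorem putr_ra :
    (h.putr k j y).ra k' j' = if k' = k ∧ j' = j then y else h.ra k' j' := rfl
@[simp] theorem putr_iv : (h.putr k j y).iv = h.iv := rfl
@[simp] theorem putr_rv : (h.putr k j y).rv = h.rv := rfl
@[simp] theorem putr_ia : (h.putr k j y).ia = h.ia := rfl
@[simp] theorem putr_inp : (h.putr k j y).inp = h.inp := rfl
@[simp] theorem putr_len : (h.putr k j y).len = h.len := rfl

end St

/-- `Exec M c h h' t`: the command `c` takes the state `h` to `h'` in `t` steps and accesses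
arrays only at indices below `M`. -/
inductive Exec (M : ℕ) : Cmd → St → St → ℕ → Prop
  | skip (h : St) : Exec M .skip h h 1
  | iset {d : ℕ} {e : IE} {h : St} (_ : e.ok M h) :
      Exec M (.iset d e) h (h.seti d (e.eval h)) 1
  | rset {d : ℕ} {e : RE} {h : St} (_ : e.ok M h) :
      Exec M (.rset d e) h (h.setr d (e.eval h)) 1
  | iput {k : ℕ} {i e : IE} {h : St} (_ : k < 16) (_ : i.ok M h) (_ : e.ok M h)
      (_ : i.eval h < M) : Exec M (.iput k i e) h (h.puti k (i.eval h) (e.eval h)) 1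
  | rput {k : ℕ} {i : IE} {e : RE} {h : St} (_ : k < 16) (_ : i.ok M h) (_ : e.ok M h)
      (_ : i.eval h < M) : Exec M (.rput k i e) h (h.putr k (i.eval h) (e.eval h)) 1
  | seq {p q : Cmd} {h h' h'' : St} {t t' : ℕ} :
      Exec M p h h' t → Exec M q h' h'' t' → Exec M (.seq p q) h h'' (t + t')
  | iteTrue {b : BE} {p q : Cmd} {h h' : St} {t : ℕ} (_ : b.ok M h) :
      b.eval h → Exec M p h h' t → Exec M (.ite b p q) h h' (t + 1)
  | iteFalse {b : BE} {p q : Cmd} {h h' : St} {t : ℕ} (_ : b.ok M h) :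
      ¬ b.eval h → Exec M q h h' t → Exec M (.ite b p q) h h' (t + 1)
  | loopTrue {b : BE} {p : Cmd} {h h' h'' : St} {t t' : ℕ} (_ : b.ok M h) :
      b.eval h → Exec M p h h' t → Exec M (.loop b p) h' h'' t' →
        Exec M (.loop b p) h h'' (t + t' + 1)
  | loopFalse {b : BE} {p : Cmd} {h : St} (_ : b.ok M h) :
      ¬ b.eval h → Exec M (.loop b p) h h 1

/-! ### Compilation

The length of the input is kept in the integer register `1`, variables are kept in the even
registers, and the remaining odd registers hold intermediate results. -/

/-- Replaces the index in the `t`-th temporary by the address of that cell of the array `k`. -/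
def addrCode (k t : ℕ) : Program :=
  -- Four doublings multiply the index by 16. The sixteen arrays are interleaved behind the input,
  -- with cell `j` of array `k` at the address `len + 16 * j + k`; so none of them needs a length
  -- fixed beforehand.
  .seq (.instr (.iadd (2 * t + 3) (2 * t + 3) (2 * t + 3)))
  (.seq (.instr (.iadd (2 * t + 3) (2 * t + 3) (2 * t + 3)))
  (.seq (.instr (.iadd (2 * t + 3) (2 * t + 3) (2 * t + 3)))
  (.seq (.instr (.iadd (2 * t + 3) (2 * t + 3) (2 * t + 3)))
  (.seq (.instr (.iadd (2 * t + 3) (2 * t + 3) 1))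
  (.seq (.instr (.iconst (2 * t + 5) k))
  (.instr (.iadd (2 * t + 3) (2 * t + 3) (2 * t + 5))))))))

/-- The value is left in the integer register `2 * t + 3`, and temporaries with numbers below `t`
survive. Thus `t` is a stack height: the second operand is computed at `t + 1` while the first one
waits at `t`. -/
def IE.comp : IE → ℕ → Program
  | var v, t => .instr (.imove (2 * t + 3) (2 * v))
  | const c, t => .instr (.iconst (2 * t + 3) c)
  | add a b, t => .seq (a.comp t) (.seq (b.comp (t + 1))
      (.instr (.iadd (2 * t + 3) (2 * t + 3) (2 * t + 5))))
  | sub a b, t => .seq (a.comp t) (.seq (b.comp (t + 1))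
      (.instr (.isub (2 * t + 3) (2 * t + 3) (2 * t + 5))))
  | get k i, t => .seq (i.comp t) (.seq (addrCode k t)
      (.instr (.iload (2 * t + 3) (2 * t + 3))))

/-- The value is left in the real register `2 * t + 1`. Indices are computed in integer temporaries,
which do not interfere with the real ones. -/
def RE.comp : RE → ℕ → Program
  | var v, t => .instr (.rmove (2 * t + 1) (2 * v))
  | const c, t => .instr (.rconst (2 * t + 1) c)
  | un o a, t => .seq (a.comp t) (.instr (.run o (2 * t + 1) (2 * t + 1)))
  | bin o a b, t => .seq (a.comp t) (.seq (b.comp (t + 1))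
      (.instr (.rbin o (2 * t + 1) (2 * t + 1) (2 * t + 3))))
  | get k i, t => .seq (i.comp t) (.seq (addrCode k t)
      (.instr (.rload (2 * t + 1) (2 * t + 3))))
  | inp i, t => .seq (i.comp t) (.instr (.rload (2 * t + 1) (2 * t + 3)))
  | ifle a b x y, t => .seq (a.comp t) (.seq (b.comp (t + 1))
      (.cond (.rle (2 * t + 1) (2 * t + 3)) (x.comp t) (y.comp t)))

def BE.comp : BE → ℕ → Program
  | ile a b, t => .seq (a.comp t) (.seq (b.comp (t + 1))
      (.cond (.ile (2 * t + 3) (2 * t + 5)) (.instr (.iconst (2 * t + 3) 1))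
        (.instr (.iconst (2 * t + 3) 0))))
  | ilt a b, t => .seq (a.comp t) (.seq (b.comp (t + 1))
      (.cond (.ilt (2 * t + 3) (2 * t + 5)) (.instr (.iconst (2 * t + 3) 1))
        (.instr (.iconst (2 * t + 3) 0))))
  | rle a b, t => .seq (a.comp t) (.seq (b.comp (t + 1))
      (.cond (.rle (2 * t + 1) (2 * t + 3)) (.instr (.iconst (2 * t + 3) 1))
        (.instr (.iconst (2 * t + 3) 0))))
  | rlt a b, t => .seq (a.comp t) (.seq (b.comp (t + 1))
      (.cond (.rlt (2 * t + 1) (2 * t + 3)) (.instr (.iconst (2 * t + 3) 1))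
        (.instr (.iconst (2 * t + 3) 0))))
  -- For truth values `0` and `1`, the conjunction is the minimum and the negation of `a` is `1 -
  -- a`.
  | and a b, t => .seq (a.comp t) (.seq (b.comp (t + 1))
      (.cond (.ile (2 * t + 3) (2 * t + 5)) .skip
        (.instr (.imove (2 * t + 3) (2 * t + 5)))))
  | not a, t => .seq (a.comp t) (.seq (.instr (.iconst (2 * t + 5) 1))
      (.instr (.isub (2 * t + 3) (2 * t + 5) (2 * t + 3))))

/-- Evaluates a Boolean expression for the test `.ilt 5 3`. -/
def BE.test (b : BE) : Program := .seq (b.comp 0) (.instr (.iconst 5 0))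

/-- A machine loop can only test registers, so the condition of a loop is evaluated once before the
loop and again at the end of each round. -/
def Cmd.comp : Cmd → Program
  | skip => .skip
  | iset d e => .seq (e.comp 0) (.instr (.imove (2 * d) 3))
  | rset d e => .seq (e.comp 0) (.instr (.rmove (2 * d) 1))
  | iput k i e => .seq (i.comp 0) (.seq (addrCode k 0) (.seq (e.comp 1) (.instr (.istore 3 5))))
  | rput k i e => .seq (i.comp 0) (.seq (addrCode k 0) (.seq (e.comp 1) (.instr (.rstore 3 3))))
  | seq p q => .seq p.comp q.comp
  | ite b p q => .seq b.test (.cond (.ilt 5 3) p.comp q.comp)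
  | loop b p => .seq b.test (.loop (.ilt 5 3) (.seq p.comp b.test))

def IE.cost : IE → ℕ
  | var _ => 1
  | const _ => 1
  | add a b => a.cost + (b.cost + 1)
  | sub a b => a.cost + (b.cost + 1)
  | get _ i => i.cost + (7 + 1)

/-- An upper bound only: both branches of `ifle` are charged. -/
def RE.cost : RE → ℕ
  | var _ => 1
  | const _ => 1
  | un _ a => a.cost + 1
  | bin _ a b => a.cost + (b.cost + 1)
  | get _ i => i.cost + (7 + 1)
  | inp i => i.cost + 1
  | ifle a b x y => a.cost + (b.cost + (x.cost + y.cost + 1))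

def BE.cost : BE → ℕ
  | ile a b => a.cost + (b.cost + 2)
  | ilt a b => a.cost + (b.cost + 2)
  | rle a b => a.cost + (b.cost + 2)
  | rlt a b => a.cost + (b.cost + 2)
  | and a b => a.cost + (b.cost + 2)
  | not a => a.cost + (1 + 1)

/-- The factor by which compilation slows down a command. -/
def Cmd.fac : Cmd → ℕ
  | skip => 1
  | iset _ e => e.cost + 1
  | rset _ e => e.cost + 1
  | iput _ i e => i.cost + (7 + (e.cost + 1))
  | rput _ i e => i.cost + (7 + (e.cost + 1))
  | seq p q => p.fac + q.fac
  | ite b p q => b.cost + 1 + (p.fac + q.fac + 1)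
  | loop b p => b.cost + 1 + (p.fac + (b.cost + 1) + 1)

/-! ### Simulation of commands by compiled programs -/

/-- The store `s` represents the state `h`. -/
structure Rep (h : St) (s : Store) : Prop where
  base : s.ireg 1 = h.len
  iv : ∀ v, s.ireg (2 * v) = h.iv v
  rv : ∀ v, s.rreg (2 * v) = h.rv v
  ia : ∀ k < 16, ∀ j, s.imem (h.len + 16 * j + k) = h.ia k j
  ra : ∀ k < 16, ∀ j, s.rmem (h.len + 16 * j + k) = h.ra k j
  inp : ∀ a < h.len, s.rmem a = h.inp a

/-- Started in `s`, the program halts within `T` steps, accesses only addresses below `B`, and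
ends in a store with the property `R`. -/
def Halts (B : ℕ) (p : Program) (s : Store) (T : ℕ) (R : Store → Prop) : Prop :=
  ∃ s' t c, Runs p s s' t c ∧ t ≤ T ∧ c ≤ B ∧ R s'

namespace Halts

variable {B : ℕ} {p q : Program} {s : Store} {T T' : ℕ} {R R' : Store → Prop}

theorem seq (hp : Halts B p s T R) (hq : ∀ s', R s' → Halts B q s' T' R') :
    Halts B (.seq p q) s (T + T') R' := by
  obtain ⟨s', t, c, h1, h2, h3, h4⟩ := hp
  obtain ⟨s'', t', c', k1, k2, k3, k4⟩ := hq s' h4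
  exact ⟨s'', _, _, .seq h1 k1, by lia, by simp [h3, k3], k4⟩

theorem instr {i : Instr} (hc : i.cells s ≤ B) (hR : R (i.step s)) :
    Halts B (.instr i) s 1 R := ⟨_, _, _, .instr i s, le_rfl, hc, hR⟩

theorem cond {b : Test} (h1 : b.Holds s → Halts B p s T R) (h2 : ¬ b.Holds s → Halts B q s T R) :
    Halts B (.cond b p q) s (T + 1) R := by
  by_cases hb : b.Holds s
  · obtain ⟨s', t, c, h1, h2, h3, h4⟩ := h1 hb
    exact ⟨s', _, _, .condTrue hb h1, by lia, h3, h4⟩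
  · obtain ⟨s', t, c, h1, h2, h3, h4⟩ := h2 hb
    exact ⟨s', _, _, .condFalse hb h1, by lia, h3, h4⟩

theorem mono (hp : Halts B p s T R) (hT : T ≤ T') (hR : ∀ s', R s' → R' s') :
    Halts B p s T' R' := by
  obtain ⟨s', t, c, h1, h2, h3, h4⟩ := hp
  exact ⟨s', t, c, h1, h2.trans hT, h3, hR _ h4⟩

end Halts

/-- The two stores differ at most in temporaries with numbers `≥ t`. -/
structure TempEq (t : ℕ) (s s' : Store) : Prop where
  imem : s'.imem = s.imem
  rmem : s'.rmem = s.rmem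
  ireg : ∀ r, (r % 2 = 0 ∨ r < 2 * t + 3) → s'.ireg r = s.ireg r
  rreg : ∀ r, (r % 2 = 0 ∨ r < 2 * t + 1) → s'.rreg r = s.rreg r

theorem TempEq.trans {t : ℕ} {s s' s'' : Store} (h : TempEq t s s') (k : TempEq t s' s'') :
    TempEq t s s'' :=
  ⟨k.imem.trans h.imem, k.rmem.trans h.rmem, fun r hr => (k.ireg r hr).trans (h.ireg r hr),
    fun r hr => (k.rreg r hr).trans (h.rreg r hr)⟩

theorem TempEq.mono {t t' : ℕ} {s s' : Store} (h : TempEq t s s') (k : t' ≤ t) : TempEq t' s s' :=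
  ⟨h.imem, h.rmem, fun r hr => h.ireg r (by lia), fun r hr => h.rreg r (by lia)⟩

theorem TempEq.rep {t : ℕ} {h : St} {s s' : Store} (k : TempEq t s s') (hr : Rep h s) :
    Rep h s' where
  base := by rw [k.ireg 1 (by lia), hr.base]
  iv v := by rw [k.ireg _ (by lia), hr.iv]
  rv v := by rw [k.rreg _ (by lia), hr.rv]
  ia := by rw [k.imem]; exact hr.ia
  ra := by rw [k.rmem]; exact hr.ra
  inp := by rw [k.rmem]; exact hr.inp

theorem tempEq_ireg {t r x : ℕ} {s : Store} (hr : r % 2 = 1) (hr' : 2 * t + 3 ≤ r) :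
    TempEq t s { s with ireg := Function.update s.ireg r x } :=
  ⟨rfl, rfl, fun r' h => by simp only [Function.update_apply]; rw [if_neg (by lia)],
    fun _ _ => rfl⟩

theorem tempEq_rreg {t r : ℕ} {x : ℝ} {s : Store} (hr : r % 2 = 1) (hr' : 2 * t + 1 ≤ r) :
    TempEq t s { s with rreg := Function.update s.rreg r x } :=
  ⟨rfl, rfl, fun _ _ => rfl,
    fun r' h => by simp only [Function.update_apply]; rw [if_neg (by lia)]⟩

theorem addrCode_halts {B : ℕ} {h : St} {s : Store} (hs : Rep h s) (k t : ℕ) :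
    Halts B (addrCode k t) s 7 (fun s' => TempEq t s s' ∧
      s'.ireg (2 * t + 3) = h.len + 16 * s.ireg (2 * t + 3) + k) := by
  refine ⟨_, _, _, .seq (.instr _ _) (.seq (.instr _ _) (.seq (.instr _ _) (.seq (.instr _ _)
    (.seq (.instr _ _) (.seq (.instr _ _) (.instr _ _)))))), le_rfl, by simp [Instr.cells], ?_, ?_⟩
  · refine ⟨rfl, rfl, fun r hr => ?_, fun _ _ => rfl⟩
    have h1 : r ≠ 2 * t + 3 := by lia
    have h2 : r ≠ 2 * t + 5 := by lia
    simp [Instr.step, h1, h2]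
  · have h1 : (1 : ℕ) ≠ 2 * t + 3 := by lia
    have h2 : s.ireg 1 = h.len := hs.base
    simp [Instr.step, h2]
    ring

theorem IE.comp_halts {B M : ℕ} {h : St} (hB : h.len + 16 * M ≤ B) (e : IE) :
    ∀ (t : ℕ) (s : Store), Rep h s → e.ok M h → Halts B (e.comp t) s e.cost (fun s' =>
      TempEq t s s' ∧ s'.ireg (2 * t + 3) = e.eval h) := by
  induction e with
  | var v =>
    intro t s hs _
    exact .instr (by simp [Instr.cells]) ⟨tempEq_ireg (by lia) (by lia), by
      simp [Instr.step, hs.iv, IE.eval]⟩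
  | const c =>
    intro t s hs _
    exact .instr (by simp [Instr.cells]) ⟨tempEq_ireg (by lia) (by lia), by
      simp [Instr.step, IE.eval]⟩
  | add a b iha ihb =>
    intro t s hs hok
    refine (iha t s hs hok.1).seq fun s1 h1 => ?_
    refine (ihb (t + 1) s1 (h1.1.rep hs) hok.2).seq fun s2 h2 => ?_
    refine .instr (by simp [Instr.cells]) ⟨(h1.1.trans (h2.1.mono (by lia))).trans
      (tempEq_ireg (by lia) (by lia)), ?_⟩
    simp only [Instr.step, Function.update_self, IE.eval]
    rw [h2.1.ireg (2 * t + 3) (by lia), h1.2, ← h2.2]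
    rfl
  | sub a b iha ihb =>
    intro t s hs hok
    refine (iha t s hs hok.1).seq fun s1 h1 => ?_
    refine (ihb (t + 1) s1 (h1.1.rep hs) hok.2).seq fun s2 h2 => ?_
    refine .instr (by simp [Instr.cells]) ⟨(h1.1.trans (h2.1.mono (by lia))).trans
      (tempEq_ireg (by lia) (by lia)), ?_⟩
    simp only [Instr.step, Function.update_self, IE.eval]
    rw [h2.1.ireg (2 * t + 3) (by lia), h1.2, ← h2.2]
    rfl
  | get k i ih =>
    intro t s hs hok
    obtain ⟨hk, hi, hM⟩ := hok
    refine (ih t s hs hi).seq fun s1 h1 => ?_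
    have r1 := h1.1.rep hs
    refine (addrCode_halts r1 k t).seq fun s2 h2 => ?_
    have r2 := h2.1.rep r1
    refine .instr ?_ ⟨(h1.1.trans h2.1).trans (tempEq_ireg (by lia) (by lia)), ?_⟩
    · simp only [Instr.cells, h2.2, h1.2]; lia
    · simp only [Instr.step, Function.update_self, IE.eval, h2.2, h1.2]
      exact r2.ia k hk _

theorem RE.comp_halts {B M : ℕ} {h : St} (hB : h.len + 16 * M ≤ B) (e : RE) :
    ∀ (t : ℕ) (s : Store), Rep h s → e.ok M h → Halts B (e.comp t) s e.cost (fun s' =>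
      TempEq t s s' ∧ s'.rreg (2 * t + 1) = e.eval h) := by
  induction e with
  | var v =>
    intro t s hs _
    exact .instr (by simp [Instr.cells]) ⟨tempEq_rreg (by lia) (by lia), by
      simp [Instr.step, hs.rv, RE.eval]⟩
  | const c =>
    intro t s hs _
    exact .instr (by simp [Instr.cells]) ⟨tempEq_rreg (by lia) (by lia), by
      simp [Instr.step, RE.eval]⟩
  | un o a iha =>
    intro t s hs hok
    refine (iha t s hs hok).seq fun s1 h1 => ?_
    refine .instr (by simp [Instr.cells]) ⟨h1.1.trans (tempEq_rreg (by lia) (by lia)), ?_⟩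
    simp only [Instr.step, Function.update_self, RE.eval, h1.2]
  | bin o a b iha ihb =>
    intro t s hs hok
    refine (iha t s hs hok.1).seq fun s1 h1 => ?_
    refine (ihb (t + 1) s1 (h1.1.rep hs) hok.2).seq fun s2 h2 => ?_
    refine .instr (by simp [Instr.cells]) ⟨(h1.1.trans (h2.1.mono (by lia))).trans
      (tempEq_rreg (by lia) (by lia)), ?_⟩
    simp only [Instr.step, Function.update_self, RE.eval]
    rw [h2.1.rreg (2 * t + 1) (by lia), h1.2, ← h2.2]
    rfl
  | get k i =>
    intro t s hs hok
    obtain ⟨hk, hi, hM⟩ := hok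
    refine (i.comp_halts hB t s hs hi).seq fun s1 h1 => ?_
    have r1 := h1.1.rep hs
    refine (addrCode_halts r1 k t).seq fun s2 h2 => ?_
    have r2 := h2.1.rep r1
    refine .instr ?_ ⟨(h1.1.trans h2.1).trans (tempEq_rreg (by lia) (by lia)), ?_⟩
    · simp only [Instr.cells, h2.2, h1.2]; lia
    · simp only [Instr.step, Function.update_self, RE.eval, h2.2, h1.2]
      exact r2.ra k hk _
  | inp i =>
    intro t s hs hok
    refine (i.comp_halts hB t s hs hok.1).seq fun s1 h1 => ?_
    have r1 := h1.1.rep hs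
    have := hok.2
    refine .instr ?_ ⟨h1.1.trans (tempEq_rreg (by lia) (by lia)), ?_⟩
    · simp only [Instr.cells, h1.2]; lia
    · simp only [Instr.step, Function.update_self, RE.eval, h1.2]
      exact r1.inp _ hok.2
  | ifle a b x y iha ihb ihx ihy =>
    intro t s hs hok
    obtain ⟨ha, hb, hx, hy⟩ := hok
    refine (iha t s hs ha).seq fun s1 h1 => ?_
    refine (ihb (t + 1) s1 (h1.1.rep hs) hb).seq fun s2 h2 => ?_
    have e2 := h1.1.trans (h2.1.mono (by lia))
    have hT : (Test.rle (2 * t + 1) (2 * t + 3)).Holds s2 ↔ a.eval h ≤ b.eval h := by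
      rw [Test.Holds, h2.1.rreg (2 * t + 1) (by lia), h1.2, ← h2.2]; rfl
    refine .cond (fun k => ?_) (fun k => ?_)
    · refine (ihx t s2 (e2.rep hs) hx).mono (by lia) fun s3 h3 => ⟨e2.trans h3.1, ?_⟩
      rw [h3.2, RE.eval, if_pos (hT.1 k)]
    · refine (ihy t s2 (e2.rep hs) hy).mono (by lia) fun s3 h3 => ⟨e2.trans h3.1, ?_⟩
      rw [h3.2, RE.eval, if_neg (fun l => k (hT.2 l))]

open Classical in
theorem BE.comp_halts {B M : ℕ} {h : St} (hB : h.len + 16 * M ≤ B) (e : BE) :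
    ∀ (t : ℕ) (s : Store), Rep h s → e.ok M h → Halts B (e.comp t) s e.cost (fun s' =>
      TempEq t s s' ∧ s'.ireg (2 * t + 3) = if e.eval h then 1 else 0) := by
  have fin : ∀ (t : ℕ) (s s2 : Store) (b : Test) (e : BE), TempEq t s s2 →
      (b.Holds s2 ↔ e.eval h) →
      Halts B (.cond b (.instr (.iconst (2 * t + 3) 1)) (.instr (.iconst (2 * t + 3) 0))) s2 2
        (fun s' => TempEq t s s' ∧ s'.ireg (2 * t + 3) = if e.eval h then 1 else 0) := by
    intro t s s2 b e he hb
    refine .cond (fun k => ?_) (fun k => ?_)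
    · exact .instr (by simp [Instr.cells]) ⟨he.trans (tempEq_ireg (by lia) (by lia)), by
        simp [Instr.step, hb.1 k]⟩
    · exact .instr (by simp [Instr.cells]) ⟨he.trans (tempEq_ireg (by lia) (by lia)), by
        simp [Instr.step, mt hb.2 k]⟩
  induction e with
  | ile a b =>
    intro t s hs hok
    refine (a.comp_halts hB t s hs hok.1).seq fun s1 h1 => ?_
    refine (b.comp_halts hB (t + 1) s1 (h1.1.rep hs) hok.2).seq fun s2 h2 => ?_
    refine fin t s s2 _ _ (h1.1.trans (h2.1.mono (by lia))) ?_
    rw [Test.Holds, h2.1.ireg (2 * t + 3) (by lia), h1.2]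
    exact (congrArg (a.eval h ≤ ·) h2.2).to_iff
  | ilt a b =>
    intro t s hs hok
    refine (a.comp_halts hB t s hs hok.1).seq fun s1 h1 => ?_
    refine (b.comp_halts hB (t + 1) s1 (h1.1.rep hs) hok.2).seq fun s2 h2 => ?_
    refine fin t s s2 _ _ (h1.1.trans (h2.1.mono (by lia))) ?_
    rw [Test.Holds, h2.1.ireg (2 * t + 3) (by lia), h1.2]
    exact (congrArg (a.eval h < ·) h2.2).to_iff
  | rle a b =>
    intro t s hs hok
    refine (a.comp_halts hB t s hs hok.1).seq fun s1 h1 => ?_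
    refine (b.comp_halts hB (t + 1) s1 (h1.1.rep hs) hok.2).seq fun s2 h2 => ?_
    refine fin t s s2 _ _ (h1.1.trans (h2.1.mono (by lia))) ?_
    rw [Test.Holds, h2.1.rreg (2 * t + 1) (by lia), h1.2]
    exact (congrArg (a.eval h ≤ ·) h2.2).to_iff
  | rlt a b =>
    intro t s hs hok
    refine (a.comp_halts hB t s hs hok.1).seq fun s1 h1 => ?_
    refine (b.comp_halts hB (t + 1) s1 (h1.1.rep hs) hok.2).seq fun s2 h2 => ?_
    refine fin t s s2 _ _ (h1.1.trans (h2.1.mono (by lia))) ?_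
    rw [Test.Holds, h2.1.rreg (2 * t + 1) (by lia), h1.2]
    exact (congrArg (a.eval h < ·) h2.2).to_iff
  | and a b iha ihb =>
    intro t s hs hok
    refine (iha t s hs hok.1).seq fun s1 h1 => ?_
    refine (ihb (t + 1) s1 (h1.1.rep hs) hok.2).seq fun s2 h2 => ?_
    have e2 := h1.1.trans (h2.1.mono (by lia : t ≤ t + 1))
    have g1 : s2.ireg (2 * t + 3) = if a.eval h then 1 else 0 := by
      rw [h2.1.ireg (2 * t + 3) (by lia), h1.2]
    have g2 : s2.ireg (2 * t + 5) = if b.eval h then 1 else 0 := h2.2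
    refine .cond (T := 1) (fun k => ?_) (fun k => ?_)
    · refine ⟨s2, _, _, .skip _, le_rfl, by simp, e2, ?_⟩
      rw [Test.Holds, g1, g2] at k
      rw [g1, BE.eval]
      by_cases u : a.eval h <;> by_cases v : b.eval h <;> simp_all
    · refine .instr (by simp [Instr.cells]) ⟨e2.trans (tempEq_ireg (by lia) (by lia)), ?_⟩
      rw [Test.Holds, g1, g2] at k
      simp only [Instr.step, Function.update_self, g2, BE.eval]
      by_cases u : a.eval h <;> by_cases v : b.eval h <;> simp_all
  | not a iha =>
    intro t s hs hok
    refine (iha t s hs hok).seq fun s1 h1 => ?_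
    refine Halts.seq (R := fun s2 => TempEq t s1 s2 ∧ s2.ireg (2 * t + 5) = 1 ∧
      s2.ireg (2 * t + 3) = s1.ireg (2 * t + 3))
      (.instr (by simp [Instr.cells]) ⟨tempEq_ireg (by lia) (by lia), by
        simp [Instr.step], by simp [Instr.step]⟩) fun s2 h2 => ?_
    refine .instr (by simp [Instr.cells]) ⟨(h1.1.trans h2.1).trans
      (tempEq_ireg (by lia) (by lia)), ?_⟩
    simp only [Instr.step, Function.update_self, h2.2.1, h2.2.2, h1.2, BE.eval]
    by_cases u : a.eval h <;> simp [u]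

theorem BE.test_halts {B M : ℕ} {h : St} (hB : h.len + 16 * M ≤ B) (b : BE) {s : Store}
    (hs : Rep h s) (hok : b.ok M h) : Halts B b.test s (b.cost + 1) (fun s' => Rep h s' ∧
      ((Test.ilt 5 3).Holds s' ↔ b.eval h)) := by
  refine (b.comp_halts hB 0 s hs hok).seq fun s1 h1 => ?_
  refine .instr (by simp [Instr.cells]) ⟨(tempEq_ireg (t := 0) (by lia) (by lia)).rep
    (h1.1.rep hs), ?_⟩
  have := h1.2
  simp only [mul_zero, zero_add] at this
  by_cases k : b.eval h <;> simp [Test.Holds, Instr.step, this, k]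

/-- This lets the factor `Cmd.fac` absorb the constant costs of evaluating conditions, which are
then proportional to the number of steps. -/
theorem Exec.one_le {M : ℕ} {c : Cmd} {h h' : St} {t : ℕ} (e : Exec M c h h' t) : 1 ≤ t := by
  induction e <;> lia

theorem Exec.len_eq {M : ℕ} {c : Cmd} {h h' : St} {t : ℕ} (e : Exec M c h h' t) :
    h'.len = h.len := by
  induction e <;> simp_all

/-- Even a loop that stops at once tests its condition. The compiled loop evaluates the condition
for the next round at the end of the current one, so its safety is needed there. -/
theorem Exec.loop_ok {M : ℕ} {b : BE} {p : Cmd} {h h' : St} {t : ℕ}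
    (e : Exec M (.loop b p) h h' t) : b.ok M h := by
  cases e with
  | loopTrue ok => exact ok
  | loopFalse ok => exact ok

/-- The compiled program simulates the command. -/
theorem Cmd.comp_halts {B M : ℕ} (c : Cmd) : ∀ {h h' : St} {t : ℕ} {s : Store},
    Exec M c h h' t → h.len + 16 * M ≤ B → Rep h s →
    Halts B c.comp s (c.fac * t) (Rep h') := by
  induction c with
  | skip =>
    intro h h' t s e hB hs
    cases e
    exact ⟨s, _, _, .skip s, by simp [Cmd.fac], by simp, hs⟩
  | iset d e =>
    rintro h h' t s (_ | ⟨ok⟩) hB hs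
    rw [mul_one]
    refine (e.comp_halts hB 0 s hs ok).seq fun s1 h1 => ?_
    have r1 := h1.1.rep hs
    refine .instr (by simp [Instr.cells]) ?_
    refine ⟨?_, fun v => ?_, r1.rv, r1.ia, r1.ra, r1.inp⟩
    · simp only [Instr.step, Function.update_apply]
      rw [if_neg (by lia), r1.base]; rfl
    · simp only [Instr.step, Function.update_apply, St.seti_iv]
      by_cases hv : v = d
      · simp [hv, ← h1.2]
      · rw [if_neg (by lia), if_neg hv, r1.iv]
  | rset d e =>
    rintro h h' t s (_ | _ | ⟨ok⟩) hB hs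
    rw [mul_one]
    refine (e.comp_halts hB 0 s hs ok).seq fun s1 h1 => ?_
    have r1 := h1.1.rep hs
    refine .instr (by simp [Instr.cells]) ?_
    refine ⟨r1.base, r1.iv, fun v => ?_, r1.ia, r1.ra, r1.inp⟩
    simp only [Instr.step, Function.update_apply, St.setr_rv]
    by_cases hv : v = d
    · simp [hv, ← h1.2]
    · rw [if_neg (by lia), if_neg hv, r1.rv]
  | iput k i e =>
    rintro h h' t s e' hB hs
    cases e' with
    | iput hk hi he hM =>
    rw [mul_one]
    refine (i.comp_halts hB 0 s hs hi).seq fun s1 h1 => ?_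
    have r1 := h1.1.rep hs
    refine (addrCode_halts r1 k 0).seq fun s2 h2 => ?_
    have r2 := h2.1.rep r1
    refine (e.comp_halts hB 1 s2 r2 he).seq fun s3 h3 => ?_
    have r3 := h3.1.rep r2
    have a3 : s3.ireg 3 = h.len + 16 * i.eval h + k := by
      rw [h3.1.ireg 3 (by lia), ← h1.2]; exact h2.2
    have b3 : s3.ireg 5 = e.eval h := h3.2
    refine .instr (by simp only [Instr.cells, a3]; lia) ?_
    refine ⟨r3.base, r3.iv, r3.rv, fun k' hk' j => ?_, r3.ra, r3.inp⟩
    simp only [Instr.step, a3, b3, Function.update_apply, St.puti_ia, St.puti_len]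
    by_cases hv : k' = k ∧ j = i.eval h
    · rw [if_pos (by rw [hv.1, hv.2]), if_pos hv]
    · rw [if_neg (by lia), if_neg hv, r3.ia k' hk']
  | rput k i e =>
    rintro h h' t s e' hB hs
    cases e' with
    | rput hk hi he hM =>
    rw [mul_one]
    refine (i.comp_halts hB 0 s hs hi).seq fun s1 h1 => ?_
    have r1 := h1.1.rep hs
    refine (addrCode_halts r1 k 0).seq fun s2 h2 => ?_
    have r2 := h2.1.rep r1
    refine (e.comp_halts hB 1 s2 r2 he).seq fun s3 h3 => ?_
    have r3 := h3.1.rep r2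
    have a3 : s3.ireg 3 = h.len + 16 * i.eval h + k := by
      rw [h3.1.ireg 3 (by lia), ← h1.2]; exact h2.2
    have b3 : s3.rreg 3 = e.eval h := h3.2
    refine .instr (by simp only [Instr.cells, a3]; lia) ?_
    refine ⟨r3.base, r3.iv, r3.rv, r3.ia, fun k' hk' j => ?_, fun a ha => ?_⟩
    · simp only [Instr.step, a3, b3, Function.update_apply, St.putr_ra, St.putr_len]
      by_cases hv : k' = k ∧ j = i.eval h
      · rw [if_pos (by rw [hv.1, hv.2]), if_pos hv]
      · rw [if_neg (by lia), if_neg hv, r3.ra k' hk']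
    · simp only [St.putr_len] at ha
      simp only [Instr.step, a3, Function.update_apply]
      rw [if_neg (by lia), r3.inp a ha]; rfl
  | seq p q ihp ihq =>
    intro h h' t s e hB hs
    cases e with
    | @seq _ _ _ h1 _ t t' e1 e2 =>
    refine ((ihp e1 hB hs).seq fun s1 r1 => ihq e2 (by rw [e1.len_eq]; exact hB) r1).mono ?_
      fun _ => id
    simp only [Cmd.fac]; nlinarith
  | ite b p q ihp ihq =>
    intro h h' t s e hB hs
    cases e with
    | @iteTrue _ _ _ _ _ t ok hb e =>
      refine ((b.test_halts hB hs ok).seq fun s1 r1 => .cond (T := p.fac * t)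
        (fun _ => ihp e hB r1.1) (fun k => absurd (r1.2.2 hb) k)).mono ?_ fun _ => id
      simp only [Cmd.fac]; nlinarith
    | @iteFalse _ _ _ _ _ t ok hb e =>
      refine ((b.test_halts hB hs ok).seq fun s1 r1 => .cond (T := q.fac * t)
        (fun k => absurd (r1.2.1 k) hb) (fun _ => ihq e hB r1.1)).mono ?_ fun _ => id
      simp only [Cmd.fac]; nlinarith
  | loop b p ih =>
    intro h h' t s e hB hs
    -- Induction over the rounds of this one loop, from stores in which the value of the condition
    -- is already in its register. Each round pays for the body and for one new evaluation of the
    -- condition.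
    have main : ∀ c h h' t, Exec M c h h' t → c = .loop b p → h.len + 16 * M ≤ B → ∀ s, Rep h s →
        ((Test.ilt 5 3).Holds s ↔ b.eval h) →
        Halts B (.loop (.ilt 5 3) (.seq p.comp b.test)) s ((p.fac + (b.cost + 1) + 1) * t)
          (Rep h') := by
      clear e hB hs
      intro c h h' t e
      induction e with
      | loopTrue ok hb e1 e2 _ ih2 =>
        intro hc hB s hs hbs
        cases hc
        have hB' := hB
        rw [← e1.len_eq] at hB'
        have ok' := e2.loop_ok
        obtain ⟨s1, t1, c1, q1, q2, q3, q4, q5⟩ :=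
          (ih e1 hB hs).seq fun s1 r1 => b.test_halts hB' r1 ok'
        obtain ⟨s2, t2, c2, g1, g2, g3, g4⟩ := ih2 rfl hB' s1 q4 q5
        refine ⟨s2, _, _, .loopTrue (hbs.2 hb) q1 g1, ?_, by simp [q3, g3], g4⟩
        have := e1.one_le
        nlinarith
      | loopFalse ok hb =>
        intro hc hB s hs hbs
        cases hc
        exact ⟨s, _, _, .loopFalse (fun k => hb (hbs.1 k)), by lia, by simp, hs⟩
      | _ => intro hc; cases hc
    have ok := e.loop_ok
    refine ((b.test_halts hB hs ok).seq fun s1 r1 => main _ _ _ _ e rfl hB s1 r1.1 r1.2).mono ?_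
      fun _ => id
    have := e.one_le
    simp only [Cmd.fac]; nlinarith

/-! ### Weakest preconditions -/

/-- The command halts, accesses arrays at indices below `M` only, and ends in a state and at a
time with the property `Q`, if it is started in the state `h` at the time `τ`. -/
def wp (M : ℕ) (c : Cmd) (Q : St → ℕ → Prop) (h : St) (τ : ℕ) : Prop :=
  ∃ h' t, Exec M c h h' t ∧ Q h' (τ + t)

section wp

variable {M : ℕ} {Q Q' : St → ℕ → Prop} {h : St} {τ : ℕ}

theorem wp_skip (hQ : Q h (τ + 1)) : wp M .skip Q h τ := ⟨_, _, .skip h, hQ⟩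

theorem wp_iset {d : ℕ} {e : IE} (ok : e.ok M h) (hQ : Q (h.seti d (e.eval h)) (τ + 1)) :
    wp M (.iset d e) Q h τ := ⟨_, _, .iset ok, hQ⟩

theorem wp_iset_eq {d : ℕ} {e : IE} (ok : e.ok M h)
    (hQ : ∀ h', h' = h.seti d (e.eval h) → Q h' (τ + 1)) : wp M (.iset d e) Q h τ :=
  wp_iset ok (hQ _ rfl)

theorem wp_rset {d : ℕ} {e : RE} (ok : e.ok M h) (hQ : Q (h.setr d (e.eval h)) (τ + 1)) :
    wp M (.rset d e) Q h τ := ⟨_, _, .rset ok, hQ⟩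

theorem wp_iput {k : ℕ} {i e : IE} (ok : k < 16 ∧ i.ok M h ∧ e.ok M h ∧ i.eval h < M)
    (hQ : Q (h.puti k (i.eval h) (e.eval h)) (τ + 1)) : wp M (.iput k i e) Q h τ :=
  ⟨_, _, .iput ok.1 ok.2.1 ok.2.2.1 ok.2.2.2, hQ⟩

theorem wp_rput {k : ℕ} {i : IE} {e : RE} (ok : k < 16 ∧ i.ok M h ∧ e.ok M h ∧ i.eval h < M)
    (hQ : Q (h.putr k (i.eval h) (e.eval h)) (τ + 1)) : wp M (.rput k i e) Q h τ :=
  ⟨_, _, .rput ok.1 ok.2.1 ok.2.2.1 ok.2.2.2, hQ⟩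

theorem wp_seq {p q : Cmd} (hp : wp M p (wp M q Q) h τ) : wp M (p ;; q) Q h τ := by
  obtain ⟨h1, t1, e1, h2, t2, e2, hQ⟩ := hp
  exact ⟨h2, _, .seq e1 e2, by rwa [← add_assoc]⟩

theorem wp_ite {b : BE} {p q : Cmd} (ok : b.ok M h) (hp : b.eval h → wp M p Q h (τ + 1))
    (hq : ¬ b.eval h → wp M q Q h (τ + 1)) : wp M (.ite b p q) Q h τ := by
  by_cases hb : b.eval h
  · obtain ⟨h', t, e, hQ⟩ := hp hb
    exact ⟨h', _, .iteTrue ok hb e, by rwa [show τ + (t + 1) = τ + 1 + t by ring]⟩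
  · obtain ⟨h', t, e, hQ⟩ := hq hb
    exact ⟨h', _, .iteFalse ok hb e, by rwa [show τ + (t + 1) = τ + 1 + t by ring]⟩

theorem wp_mono {c : Cmd} (hc : wp M c Q h τ) (hQ : ∀ h' τ', Q h' τ' → Q' h' τ') :
    wp M c Q' h τ := by
  obtain ⟨h', t, e, q⟩ := hc
  exact ⟨h', t, e, hQ _ _ q⟩

/-- The rule for loops, with an invariant and a measure that decreases. -/
theorem wp_loop {b : BE} {p : Cmd} (Inv : St → ℕ → Prop) (μ : St → ℕ) (h0 : Inv h τ)
    (hok : ∀ h τ, Inv h τ → b.ok M h)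
    (hstep : ∀ h τ, Inv h τ → b.eval h →
      wp M p (fun h' τ' => Inv h' τ' ∧ μ h' < μ h) h (τ + 1))
    (hexit : ∀ h τ, Inv h τ → ¬ b.eval h → Q h (τ + 1)) : wp M (.loop b p) Q h τ := by
  induction hn : μ h using Nat.strong_induction_on generalizing h τ with
  | _ n ih =>
    by_cases hb : b.eval h
    · obtain ⟨h1, t1, e1, i1, m1⟩ := hstep h τ h0 hb
      obtain ⟨h2, t2, e2, q2⟩ := ih (μ h1) (hn ▸ m1) i1 rfl
      exact ⟨h2, _, .loopTrue (hok _ _ h0) hb e1 e2, by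
        rwa [show τ + (t1 + t2 + 1) = τ + 1 + t1 + t2 by ring]⟩
    · exact ⟨h, 1, .loopFalse (hok _ _ h0) hb, hexit h τ h0 hb⟩

end wp

/-! ### Variables and arrays that a command does not change -/

def Cmd.setsI : Cmd → ℕ → Prop
  | iset d _, v => v = d
  | seq p q, v => p.setsI v ∨ q.setsI v
  | ite _ p q, v => p.setsI v ∨ q.setsI v
  | loop _ p, v => p.setsI v
  | _, _ => False

def Cmd.setsR : Cmd → ℕ → Prop
  | rset d _, v => v = d
  | seq p q, v => p.setsR v ∨ q.setsR v
  | ite _ p q, v => p.setsR v ∨ q.setsR v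
  | loop _ p, v => p.setsR v
  | _, _ => False

def Cmd.putsI : Cmd → ℕ → Prop
  | iput k _ _, v => v = k
  | seq p q, v => p.putsI v ∨ q.putsI v
  | ite _ p q, v => p.putsI v ∨ q.putsI v
  | loop _ p, v => p.putsI v
  | _, _ => False

def Cmd.putsR : Cmd → ℕ → Prop
  | rput k _ _, v => v = k
  | seq p q, v => p.putsR v ∨ q.putsR v
  | ite _ p q, v => p.putsR v ∨ q.putsR v
  | loop _ p, v => p.putsR v
  | _, _ => False

/-- The states differ only in what the command `c` can change. -/
structure Frame (c : Cmd) (h h' : St) : Prop where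
  len : h'.len = h.len
  inp : h'.inp = h.inp
  iv : ∀ v, ¬ c.setsI v → h'.iv v = h.iv v
  rv : ∀ v, ¬ c.setsR v → h'.rv v = h.rv v
  ia : ∀ k, ¬ c.putsI k → h'.ia k = h.ia k
  ra : ∀ k, ¬ c.putsR k → h'.ra k = h.ra k

theorem Exec.frame {M : ℕ} {c : Cmd} {h h' : St} {t : ℕ} (e : Exec M c h h' t) :
    Frame c h h' := by
  induction e with
  | skip => exact ⟨rfl, rfl, fun _ _ => rfl, fun _ _ => rfl, fun _ _ => rfl, fun _ _ => rfl⟩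
  | iset => exact ⟨rfl, rfl, fun v hv => if_neg hv, fun _ _ => rfl, fun _ _ => rfl, fun _ _ => rfl⟩
  | rset => exact ⟨rfl, rfl, fun _ _ => rfl, fun v hv => if_neg hv, fun _ _ => rfl, fun _ _ => rfl⟩
  | iput => exact ⟨rfl, rfl, fun _ _ => rfl, fun _ _ => rfl,
      fun k hk => funext fun j => if_neg fun h => hk h.1, fun _ _ => rfl⟩
  | rput => exact ⟨rfl, rfl, fun _ _ => rfl, fun _ _ => rfl, fun _ _ => rfl,
      fun k hk => funext fun j => if_neg fun h => hk h.1⟩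
  | seq _ _ f g => exact ⟨g.len.trans f.len, g.inp.trans f.inp,
      fun v hv => (g.iv v fun k => hv (.inr k)).trans (f.iv v fun k => hv (.inl k)),
      fun v hv => (g.rv v fun k => hv (.inr k)).trans (f.rv v fun k => hv (.inl k)),
      fun v hv => (g.ia v fun k => hv (.inr k)).trans (f.ia v fun k => hv (.inl k)),
      fun v hv => (g.ra v fun k => hv (.inr k)).trans (f.ra v fun k => hv (.inl k))⟩
  | iteTrue _ _ _ f => exact ⟨f.len, f.inp, fun v hv => f.iv v fun k => hv (.inl k),
      fun v hv => f.rv v fun k => hv (.inl k), fun v hv => f.ia v fun k => hv (.inl k),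
      fun v hv => f.ra v fun k => hv (.inl k)⟩
  | iteFalse _ _ _ f => exact ⟨f.len, f.inp, fun v hv => f.iv v fun k => hv (.inr k),
      fun v hv => f.rv v fun k => hv (.inr k), fun v hv => f.ia v fun k => hv (.inr k),
      fun v hv => f.ra v fun k => hv (.inr k)⟩
  | loopTrue _ _ _ _ f g => exact ⟨g.len.trans f.len, g.inp.trans f.inp,
      fun v hv => (g.iv v hv).trans (f.iv v hv), fun v hv => (g.rv v hv).trans (f.rv v hv),
      fun v hv => (g.ia v hv).trans (f.ia v hv), fun v hv => (g.ra v hv).trans (f.ra v hv)⟩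
  | loopFalse => exact ⟨rfl, rfl, fun _ _ => rfl, fun _ _ => rfl, fun _ _ => rfl, fun _ _ => rfl⟩

/-- Postconditions may assume for free that whatever is not assigned in the text of the command is
unchanged; specifications below only describe what changes. -/
theorem wp_frame {M : ℕ} {Q : St → ℕ → Prop} {h : St} {τ : ℕ} {c : Cmd}
    (hc : wp M c (fun h' τ' => Frame c h h' → Q h' τ') h τ) : wp M c Q h τ := by
  obtain ⟨h', t, e, q⟩ := hc
  exact ⟨h', t, e, q e.frame⟩

end FixedMCR

namespace FixedMCR

/-! ## Natural merge sort -/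

attribute [simp] IE.eval IE.ok RE.eval RE.ok BE.eval BE.ok RUn.eval RBin.eval

theorem St.seti_seti (h : St) (d x y : ℕ) : (h.seti d x).seti d y = h.seti d y := by
  simp only [St.seti]
  congr 1
  funext v
  by_cases hv : v = d <;> simp [hv]

theorem St.seti_self (h : St) (d : ℕ) : h.seti d (h.iv d) = h := by
  simp only [St.seti]
  congr 1
  funext v
  by_cases hv : v = d <;> simp [hv]

/-- The multiset of the values of `f` on `[a, b)`. -/
def seg {α : Type*} (f : ℕ → α) (a b : ℕ) : Multiset α := (Multiset.Ico a b).map f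

section seg

variable {α β : Type*} (f g : ℕ → α) {a b c : ℕ}

theorem seg_self (a : ℕ) : seg f a a = 0 := by simp [seg]

theorem seg_add (hab : a ≤ b) (hbc : b ≤ c) : seg f a b + seg f b c = seg f a c := by
  rw [seg, seg, seg, ← Multiset.map_add, Multiset.Ico_add_Ico_eq_Ico hab hbc]

theorem seg_succ (hab : a ≤ b) : seg f a (b + 1) = seg f a b + {f b} := by
  rw [← seg_add f hab (Nat.le_succ b)]
  congr 1
  simp [seg, Multiset.Ico, Nat.Ico_succ_singleton]

theorem seg_congr {f g : ℕ → α} (h : ∀ l, a ≤ l → l < b → f l = g l) : seg f a b = seg g a b :=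
  Multiset.map_congr rfl fun l hl => by
    rw [Multiset.mem_Ico] at hl; exact h l hl.1 hl.2

theorem map_seg (φ : α → β) : (seg f a b).map φ = seg (φ ∘ f) a b := by
  simp [seg]

theorem card_seg : Multiset.card (seg f a b) = b - a := by
  rw [seg, Multiset.card_map]
  exact Nat.card_Ico a b

theorem mem_seg {x : α} : x ∈ seg f a b ↔ ∃ l, a ≤ l ∧ l < b ∧ f l = x := by
  simp only [seg, Multiset.mem_map, Multiset.mem_Ico, and_assoc]

end seg

/-- The number of descents of `f` in `[a, b)`. -/
noncomputable def desc (f : ℕ → ℝ) (a b : ℕ) : ℕ :=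
  ((Finset.Ioo a b).filter fun l => f l < f (l - 1)).card

section desc

variable {f g : ℕ → ℝ} {a b c : ℕ}

theorem desc_congr (h : ∀ l, a ≤ l → l < b → f l = g l) : desc f a b = desc g a b := by
  unfold desc
  congr 1
  refine Finset.filter_congr fun l hl => ?_
  rw [Finset.mem_Ioo] at hl
  rw [h l hl.1.le hl.2, h (l - 1) (by lia) (by lia)]

theorem desc_mono (h : b ≤ c) : desc f a b ≤ desc f a c :=
  Finset.card_le_card (Finset.filter_subset_filter _ (Finset.Ioo_subset_Ioo_right h))

theorem desc_eq_zero (h : ∀ l, a < l → l < b → f (l - 1) ≤ f l) : desc f a b = 0 := by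
  unfold desc
  rw [Finset.card_eq_zero, Finset.filter_eq_empty_iff]
  intro l hl
  rw [Finset.mem_Ioo] at hl
  exact not_lt.2 (h l hl.1 hl.2)

/-- When two stretches are joined, the only additional descent is at the joint `b`. -/
theorem desc_split (f : ℕ → ℝ) (a b c : ℕ) : desc f a c ≤ desc f a b + 1 + desc f b c := by
  unfold desc
  have : (Finset.Ioo a c).filter (fun l => f l < f (l - 1)) ⊆
      ((Finset.Ioo a b).filter fun l => f l < f (l - 1)) ∪ {b} ∪
        ((Finset.Ioo b c).filter fun l => f l < f (l - 1)) := by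
    intro l
    simp only [Finset.mem_filter, Finset.mem_Ioo, Finset.mem_union, Finset.mem_singleton]
    rintro ⟨⟨h1, h2⟩, h3⟩
    rcases lt_trichotomy l b with h | h | h <;> simp [*]
  refine (Finset.card_le_card this).trans ((Finset.card_union_le _ _).trans ?_)
  gcongr
  exact Finset.card_union_le _ _

/-- A run of the original array ends at a descent that lies beyond all descents counted so far; this
is how runs are charged to descents. -/
theorem desc_lt (hbc : b < c) (h : a < c) (hd : f c < f (c - 1)) :
    desc f a (b + 1) + 1 ≤ desc f a (c + 1) := by
  unfold desc
  have : insert c ((Finset.Ioo a (b + 1)).filter fun l => f l < f (l - 1)) ⊆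
      (Finset.Ioo a (c + 1)).filter fun l => f l < f (l - 1) := by
    intro l
    simp only [Finset.mem_filter, Finset.mem_Ioo, Finset.mem_insert]
    rintro (rfl | ⟨⟨h1, h2⟩, h3⟩)
    · exact ⟨⟨h, by lia⟩, hd⟩
    · exact ⟨⟨h1, by lia⟩, h3⟩
  refine le_trans ?_ (Finset.card_le_card this)
  rw [Finset.card_insert_of_notMem]
  simp only [Finset.mem_filter, Finset.mem_Ioo]
  lia

theorem desc_le (f : ℕ → ℝ) (a b : ℕ) : desc f a b ≤ b - a := by
  refine (Finset.card_filter_le _ _).trans ?_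
  rw [Nat.card_Ioo]; lia

end desc

/-! The array to be sorted has the number `k`, the buffer the number `3`; the range to be sorted is
`[x₄₀, x₄₁)`, where `xᵥ` is the integer variable with the number `v`. -/

/-- Extends a run that ends before `xᵥ`. -/
def scanCode (k v : ℕ) : Cmd :=
  .loop (.and (.ilt (.var v) (.var 41))
      (.rle (.get k (.sub (.var v) (.const 1))) (.get k (.var v))))
    (.iset v (.add (.var v) (.const 1)))

theorem scanCode_wp {M k v : ℕ} {Q : St → ℕ → Prop} {h : St} {τ : ℕ} (hk : k < 16) (hv : v ≠ 41)
    (hM : h.iv 41 < M) (hle : h.iv v ≤ h.iv 41)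
    (hQ : ∀ j, h.iv v ≤ j → j ≤ h.iv 41 →
      (∀ l, h.iv v ≤ l → l < j → h.ra k (l - 1) ≤ h.ra k l) →
      (j < h.iv 41 → h.ra k j < h.ra k (j - 1)) →
      Q (h.seti v j) (τ + 2 * (j - h.iv v) + 1)) :
    wp M (scanCode k v) Q h τ := by
  refine wp_loop (fun h' τ' => ∃ j, h' = h.seti v j ∧ τ' = τ + 2 * (j - h.iv v) ∧ h.iv v ≤ j ∧
    j ≤ h.iv 41 ∧ ∀ l, h.iv v ≤ l → l < j → h.ra k (l - 1) ≤ h.ra k l)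
    (fun h' => h.iv 41 - h'.iv v) ?_ ?_ ?_ ?_
  · exact ⟨h.iv v, by rw [St.seti_self], by simp, le_rfl, hle, by lia⟩
  · rintro _ _ ⟨j, rfl, rfl, h1, h2, h3⟩
    simp [hk]
    lia
  · rintro _ _ ⟨j, rfl, rfl, h1, h2, h3⟩ hb
    simp [hv.symm] at hb
    refine wp_iset (by simp) ⟨⟨j + 1, by simp [St.seti_seti], by lia, by lia, by lia,
      fun l l1 l2 => ?_⟩, by simp; lia⟩
    rcases Nat.lt_succ_iff_lt_or_eq.1 l2 with h | rfl
    · exact h3 l l1 h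
    · exact hb.2
  · rintro _ _ ⟨j, rfl, rfl, h1, h2, h3⟩ hb
    refine hQ j h1 h2 h3 fun h4 => ?_
    simpa [hv.symm, h4] using hb

/-- Merges the runs `[x₄₂, x₄₃)` and `[x₄₃, x₄₄)` into the buffer. -/
def mergeCode (k : ℕ) : Cmd :=
  .iset 45 (.var 42) ;; .iset 46 (.var 43) ;; .iset 47 (.var 42) ;;
  .loop (.ilt (.var 47) (.var 44))
    (.ite (.and (.ilt (.var 45) (.var 43)) (.not (.and (.ilt (.var 46) (.var 44))
          (.rlt (.get k (.var 46)) (.get k (.var 45))))))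
      (.rput 3 (.var 47) (.get k (.var 45)) ;; .iput 3 (.var 47) (.get k (.var 45)) ;;
        .iset 45 (.add (.var 45) (.const 1)))
      (.rput 3 (.var 47) (.get k (.var 46)) ;; .iput 3 (.var 47) (.get k (.var 46)) ;;
        .iset 46 (.add (.var 46) (.const 1))) ;;
    .iset 47 (.add (.var 47) (.const 1)))

/-- The pairs in the real and in the integer array with the number `k`. -/
def St.arr (h : St) (k : ℕ) : ℕ → ℝ × ℕ := fun j => (h.ra k j, h.ia k j)

theorem mergeCode_wp {M k : ℕ} {Q : St → ℕ → Prop} {h : St} {τ : ℕ} (hk : k < 16) (hk3 : k ≠ 3)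
    {i j e : ℕ} (hi : h.iv 42 = i) (hj : h.iv 43 = j) (he : h.iv 44 = e)
    (hM : e < M) (hij : i ≤ j) (hje : j ≤ e)
    (s1 : ∀ l, i < l → l < j → h.ra k (l - 1) ≤ h.ra k l)
    (s2 : ∀ l, j < l → l < e → h.ra k (l - 1) ≤ h.ra k l)
    (hQ : ∀ h', Frame (mergeCode k) h h' → seg (h'.arr 3) i e = seg (h.arr k) i e →
      (∀ l, i < l → l < e → h'.ra 3 (l - 1) ≤ h'.ra 3 l) →
      (∀ l, l < i ∨ e ≤ l → h'.arr 3 l = h.arr 3 l) →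
      Q h' (τ + 6 * (e - i) + 4)) :
    wp M (mergeCode k) Q h τ := by
  apply wp_frame
  refine wp_seq (wp_iset (by simp) (wp_seq (wp_iset (by simp) (wp_seq (wp_iset (by simp) ?_)))))
  simp only [IE.eval, St.seti_iv]
  norm_num
  rw [hi, hj]
  -- `x` and `y` are the read positions in the two runs, `w` is the write position. The last two
  -- clauses say that the last element written is at most the next element of either run, which
  -- keeps the output sorted.
  refine wp_loop (fun h' τ' => ∃ x y w, h'.iv 45 = x ∧ h'.iv 46 = y ∧ h'.iv 47 = w ∧
    h'.iv 43 = j ∧ h'.iv 44 = e ∧ h'.ra k = h.ra k ∧ h'.ia k = h.ia k ∧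
    i ≤ x ∧ x ≤ j ∧ j ≤ y ∧ y ≤ e ∧ w + j = x + y ∧ τ' = τ + 3 + 6 * (w - i) ∧
    seg (h'.arr 3) i w = seg (h.arr k) i x + seg (h.arr k) j y ∧
    (∀ l, i < l → l < w → h'.ra 3 (l - 1) ≤ h'.ra 3 l) ∧
    (∀ l, l < i ∨ w ≤ l → h'.arr 3 l = h.arr 3 l) ∧
    (i < w → x < j → h'.ra 3 (w - 1) ≤ h.ra k x) ∧
    (i < w → y < e → h'.ra 3 (w - 1) ≤ h.ra k y)) (fun h' => e - h'.iv 47) ?_ ?_ ?_ ?_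
  · refine ⟨i, j, i, ?_⟩
    simp [hij, hje, hj, he, seg_self, St.arr]
    lia
  · rintro h' τ' ⟨x, y, w, rfl, rfl, rfl, h1, h2, h3, h4, h5, h6, h7, h8, h9, h10, h11, h12, h13, h14, h15⟩
    simp
  · rintro h' τ' ⟨x, y, w, rfl, rfl, rfl, h1, h2, h3, h4, h5, h6, h7, h8, h9, h10, h11, h12, h13,
      h14, h15⟩ hb
    simp [h2] at hb
    refine wp_seq (wp_ite ?_ ?_ ?_)
    · simp [hk]; lia
    · intro hc
      simp [h1, h2, h3] at hc
      refine wp_seq (wp_rput ?_ (wp_seq (wp_iput ?_ (wp_iset (by simp)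
        (wp_iset_eq (by simp) fun h2' hh => ?_)))))
      · simp [hk]; lia
      · simp [hk]; lia
      simp only [RE.eval, IE.eval, St.putr_iv, St.putr_ia, St.puti_iv, St.seti_iv] at hh
      have e1 : ∀ l, h2'.arr 3 l = if l = h'.iv 47 then h.arr k (h'.iv 45) else h'.arr 3 l := by
        intro l
        by_cases hl : l = h'.iv 47 <;> simp [hh, St.arr, hl, h3, h4]
      have e2 : h2'.arr 3 (h'.iv 47) = h.arr k (h'.iv 45) := by rw [e1, if_pos rfl]
      have e3 : ∀ l, l ≠ h'.iv 47 → h2'.arr 3 l = h'.arr 3 l := fun l hl => by rw [e1, if_neg hl]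
      have e4 : h2'.ra 3 (h'.iv 47) = h.ra k (h'.iv 45) := congrArg Prod.fst e2
      have e5 : ∀ l, l ≠ h'.iv 47 → h2'.ra 3 l = h'.ra 3 l :=
        fun l hl => congrArg Prod.fst (e3 l hl)
      refine ⟨⟨h'.iv 45 + 1, h'.iv 46, h'.iv 47 + 1, by simp [hh], by simp [hh], by simp [hh],
        by simp [hh, h1], by simp [hh, h2], ?_, ?_, by lia, by lia, by lia, by lia, by lia, by lia,
        ?_, ?_, ?_, ?_, ?_⟩, by simp [hh]; lia⟩
      · funext l; simp [hh, hk3, h3]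
      · funext l; simp [hh, hk3, h4]
      · rw [seg_succ _ (by lia), e2, seg_succ _ (by lia), add_right_comm, ← h11]
        congr 1
        exact seg_congr fun l l1 l2 => e3 l (by lia)
      · intro l l1 l2
        rw [e5 (l - 1) (by lia)]
        by_cases hl : l = h'.iv 47
        · rw [hl, e4]; exact h14 (by lia) hc.1
        · rw [e5 l hl]; exact h12 l l1 (by lia)
      · intro l hl
        rw [e3 l (by lia)]; exact h13 l (by lia)
      · intro _ hx
        rw [Nat.add_sub_cancel, e4]
        exact s1 (h'.iv 45 + 1) (by lia) hx
      · intro _ hy'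
        rw [Nat.add_sub_cancel, e4]
        exact hc.2 hy'
    · intro hc
      simp [h1, h2, h3] at hc
      have hy : h'.iv 46 < e := by
        by_contra hy
        have := hc (by lia); lia
      refine wp_seq (wp_rput ?_ (wp_seq (wp_iput ?_ (wp_iset (by simp)
        (wp_iset_eq (by simp) fun h2' hh => ?_)))))
      · simp [hk]; lia
      · simp [hk]; lia
      simp only [RE.eval, IE.eval, St.putr_iv, St.putr_ia, St.puti_iv, St.seti_iv] at hh
      have e1 : ∀ l, h2'.arr 3 l = if l = h'.iv 47 then h.arr k (h'.iv 46) else h'.arr 3 l := by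
        intro l
        by_cases hl : l = h'.iv 47 <;> simp [hh, St.arr, hl, h3, h4]
      have e2 : h2'.arr 3 (h'.iv 47) = h.arr k (h'.iv 46) := by rw [e1, if_pos rfl]
      have e3 : ∀ l, l ≠ h'.iv 47 → h2'.arr 3 l = h'.arr 3 l := fun l hl => by rw [e1, if_neg hl]
      have e4 : h2'.ra 3 (h'.iv 47) = h.ra k (h'.iv 46) := congrArg Prod.fst e2
      have e5 : ∀ l, l ≠ h'.iv 47 → h2'.ra 3 l = h'.ra 3 l :=
        fun l hl => congrArg Prod.fst (e3 l hl)
      refine ⟨⟨h'.iv 45, h'.iv 46 + 1, h'.iv 47 + 1, by simp [hh], by simp [hh], by simp [hh],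
        by simp [hh, h1], by simp [hh, h2], ?_, ?_, by lia, by lia, by lia, by lia, by lia, by lia,
        ?_, ?_, ?_, ?_, ?_⟩, by simp [hh]; lia⟩
      · funext l; simp [hh, hk3, h3]
      · funext l; simp [hh, hk3, h4]
      · rw [seg_succ _ (by lia), e2, seg_succ _ (by lia), ← add_assoc, ← h11]
        congr 1
        exact seg_congr fun l l1 l2 => e3 l (by lia)
      · intro l l1 l2
        rw [e5 (l - 1) (by lia)]
        by_cases hl : l = h'.iv 47
        · rw [hl, e4]; exact h15 (by lia) hy
        · rw [e5 l hl]; exact h12 l l1 (by lia)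
      · intro l hl
        rw [e3 l (by lia)]; exact h13 l (by lia)
      · intro _ hx
        rw [Nat.add_sub_cancel, e4]
        exact (hc hx).2.le
      · intro _ hy'
        rw [Nat.add_sub_cancel, e4]
        exact s2 (h'.iv 46 + 1) (by lia) hy'
  · rintro h' τ' ⟨x, y, w, rfl, rfl, rfl, h1, h2, h3, h4, h5, h6, h7, h8, h9, h10, h11, h12, h13, h14, h15⟩ hb
    simp [h2] at hb
    intro hf
    have a1 : h'.iv 45 = j := by lia
    have a2 : h'.iv 46 = e := by lia
    have a3 : h'.iv 47 = e := by lia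
    rw [a1, a2, a3, seg_add _ hij hje] at h11
    rw [a3] at h10 h12 h13
    rw [h10, show τ + 3 + 6 * (e - i) + 1 = τ + 6 * (e - i) + 4 by lia]
    exact hQ h' hf h11 h12 h13

/-- Merges consecutive pairs of runs of the array `k` into the buffer and counts the pairs. -/
def passCode (k : ℕ) : Cmd :=
  .iset 48 (.const 0) ;; .iset 42 (.var 40) ;;
  .loop (.ilt (.var 42) (.var 41))
    (.iset 43 (.add (.var 42) (.const 1)) ;; scanCode k 43 ;;
    .ite (.ilt (.var 43) (.var 41)) (.iset 44 (.add (.var 43) (.const 1)))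
      (.iset 44 (.var 43)) ;;
    scanCode k 44 ;; mergeCode k ;;
    .iset 42 (.var 44) ;; .iset 48 (.add (.var 48) (.const 1)))

/-- A pass at least halves the number `d` of descents. Merging runs in pairs leaves `t` sorted
blocks, hence at most `t - 1` descents, and each pair except possibly the last uses up two descents,
so that `2 * t ≤ d + 2`. -/
theorem passCode_wp {M k : ℕ} {Q : St → ℕ → Prop} {h : St} {τ : ℕ} (hk : k < 16) (hk3 : k ≠ 3)
    {lo hi : ℕ} (hlo : h.iv 40 = lo) (hhi : h.iv 41 = hi) (hle : lo ≤ hi) (hM : hi < M)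
    (hQ : ∀ h' τ', Frame (passCode k) h h' → seg (h'.arr 3) lo hi = seg (h.arr k) lo hi →
      desc (h'.ra 3) lo hi ≤ h'.iv 48 - 1 → 2 * h'.iv 48 ≤ desc (h.ra k) lo hi + 2 →
      τ' ≤ τ + 20 * (hi - lo) + 3 → Q h' τ') :
    wp M (passCode k) Q h τ := by
  apply wp_frame
  refine wp_seq (wp_iset (by simp) (wp_seq (wp_iset (by simp) ?_)))
  -- While the pass is not finished, the descents are counted up to and including index `i`, because
  -- `i` itself, where the last run ended, is a descent. The last pair may lack its inner descent
  -- and its final one, hence the `+ 2` at the end.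
  refine wp_loop (fun h' τ' => ∃ i t, h'.iv 42 = i ∧ h'.iv 48 = t ∧ h'.iv 41 = hi ∧
    h'.ra k = h.ra k ∧ h'.ia k = h.ia k ∧ lo ≤ i ∧ i ≤ hi ∧
    seg (h'.arr 3) lo i = seg (h.arr k) lo i ∧ desc (h'.ra 3) lo i ≤ t - 1 ∧
    (t = 0 → i = lo) ∧ (i < hi → 2 * t ≤ desc (h.ra k) lo (i + 1)) ∧
    (i = hi → 2 * t ≤ desc (h.ra k) lo hi + 2) ∧ τ' ≤ τ + 2 + 20 * (i - lo))
    (fun h' => hi - h'.iv 42) ?_ ?_ ?_ ?_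
  · refine ⟨lo, 0, by simp [hlo], by simp, by simp [hhi], by simp, by simp, le_rfl, hle,
      by simp [seg_self], ?_, by simp, by simp, by simp, by lia⟩
    exact (desc_eq_zero (by lia)).le
  · intro h' τ' _
    simp
  · rintro h' τ' ⟨i, t, rfl, rfl, h1, h2, h3, h4, h5, h6, h7, h8, h9, h10, h11⟩ hb
    simp [h1] at hb
    generalize hi' : h'.iv 42 = i at *
    generalize ht' : h'.iv 48 = t at *
    refine wp_seq (wp_iset_eq (by simp) fun a1 ha1 => wp_seq (scanCode_wp hk (by lia)
      (by simp [ha1, h1, hM]) (by simp [ha1, h1, hi']; lia) ?_))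
    intro j j1 j2 j3 j4
    simp [ha1, h1, h2, hi'] at j1 j2 j3 j4
    -- The rest of a round, for both ways to find a second run: it begins at `j` and the scan for
    -- its end starts at `c = j + 1`, or the range is exhausted and the second run is empty, with `c
    -- = j`.
    have hs : ∀ c, (c = j ∨ c = j + 1) → c ≤ hi → (j < hi → c = j + 1) →
        ∀ a2 T, a2 = (a1.seti 43 j).seti 44 c → T ≤ τ' + 2 * (j - (i + 1)) + 5 →
        wp M (scanCode k 44 ;; mergeCode k ;; .iset 42 (.var 44) ;;
          .iset 48 (.add (.var 48) (.const 1)))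
        (fun h' τ' => (∃ i t, h'.iv 42 = i ∧ h'.iv 48 = t ∧ h'.iv 41 = hi ∧
          h'.ra k = h.ra k ∧ h'.ia k = h.ia k ∧ lo ≤ i ∧ i ≤ hi ∧
          seg (h'.arr 3) lo i = seg (h.arr k) lo i ∧ desc (h'.ra 3) lo i ≤ t - 1 ∧
          (t = 0 → i = lo) ∧ (i < hi → 2 * t ≤ desc (h.ra k) lo (i + 1)) ∧
          (i = hi → 2 * t ≤ desc (h.ra k) lo hi + 2) ∧ τ' ≤ τ + 2 + 20 * (i - lo)) ∧
          hi - h'.iv 42 < hi - i) a2 T := by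
      intro c hc hc2 hc3 a2 T ha2 hT
      refine wp_seq (scanCode_wp hk (by lia) (by simp [ha1, ha2, h1, hM])
        (by simp [ha1, ha2, h1, hc2]) ?_)
      intro e e1 e2 e3 e4
      simp [ha1, ha2, h1, h2] at e1 e2 e3 e4
      refine wp_seq (mergeCode_wp hk hk3 (i := i) (j := j) (e := e) (by simp [ha1, ha2, hi'])
        (by simp [ha1, ha2]) (by simp) (by lia) (by lia) (by lia) ?_ ?_ ?_)
      · intro l l1 l2
        simpa [ha1, ha2, h2] using j3 l (by lia) l2
      · intro l l1 l2
        simpa [ha1, ha2, h2] using e3 l (by lia) l2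
      intro a3 fr g1 g2 g3
      have x1 : a3.iv 41 = hi := by
        rw [fr.iv 41 (by simp [mergeCode, Cmd.setsI])]; simp [ha1, ha2, h1]
      have x2 : a3.iv 44 = e := by
        rw [fr.iv 44 (by simp [mergeCode, Cmd.setsI])]; simp
      have x3 : a3.iv 48 = t := by
        rw [fr.iv 48 (by simp [mergeCode, Cmd.setsI])]; simp [ha1, ha2, ht']
      have x4 : a3.ra k = h.ra k := by
        rw [fr.ra k (by simp [mergeCode, Cmd.putsR, hk3])]; simp [ha1, ha2, h2]
      have x5 : a3.ia k = h.ia k := by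
        rw [fr.ia k (by simp [mergeCode, Cmd.putsI, hk3])]; simp [ha1, ha2, h3]
      have y1 : ∀ l < i, a3.arr 3 l = h'.arr 3 l := by
        intro l hl
        rw [g3 l (.inl hl)]; simp [St.arr, ha1, ha2]
      have y2 : seg (a3.arr 3) i e = seg (h.arr k) i e := by
        rw [g1]; exact seg_congr fun l _ _ => by simp [St.arr, ha1, ha2, h2, h3]
      have y3 : desc (a3.ra 3) lo i = desc (h'.ra 3) lo i :=
        desc_congr fun l _ hl => congrArg Prod.fst (y1 l hl)
      have y4 : desc (a3.ra 3) i e = 0 := desc_eq_zero g2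
      have y5 := desc_split (a3.ra 3) lo i e
      have y6 : i = lo → desc (a3.ra 3) lo e = 0 := by rintro rfl; exact y4
      have y7 : j < hi → desc (h.ra k) lo (i + 1) + 1 ≤ desc (h.ra k) lo (j + 1) :=
        fun hj => desc_lt (by lia) (by lia) (j4 hj)
      have y8 : e < hi → desc (h.ra k) lo (j + 1) + 1 ≤ desc (h.ra k) lo (e + 1) :=
        fun he => desc_lt (by lia) (by lia) (e4 he)
      have y9 : desc (h.ra k) lo (i + 1) ≤ desc (h.ra k) lo hi := desc_mono (by lia)
      refine wp_seq (wp_iset (by simp) ?_)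
      refine wp_iset_eq (by simp) ?_
      rintro a4 ha4
      simp only [IE.eval, St.seti_iv] at ha4
      simp [x2, x3] at ha4
      refine ⟨⟨e, t + 1, by simp [ha4], by simp [ha4], by simp [ha4, x1], by simp [ha4, x4],
        by simp [ha4, x5], by lia, e2, ?_, ?_, by simp, fun he => ?_, fun he => ?_, ?_⟩, ?_⟩
      · have y10 : a4.arr 3 = a3.arr 3 := by rw [ha4]; rfl
        rw [y10, ← seg_add _ (by lia : lo ≤ i) (by lia : i ≤ e),
          ← seg_add (h.arr k) (by lia : lo ≤ i) (by lia : i ≤ e), ← y2, ← h6]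
        congr 1
        exact seg_congr fun l _ l2 => y1 l l2
      · simp only [ha4, St.seti_ra]
        lia
      · have := h9 (by lia)
        have := y7 (by lia)
        have := y8 he
        lia
      · have := h9 (by lia)
        lia
      · simp [ha2]
        lia
      · simp [ha4]; lia
    refine wp_seq (wp_ite (by simp) (fun hc => ?_) (fun hc => ?_))
    · simp [ha1, h1] at hc
      refine wp_iset_eq (by simp) fun a2 ha2 => hs (j + 1) (by lia) (by lia) (by lia) a2 _
        (by simpa using ha2) ?_
      simp [ha1, hi']
      lia
    · simp [ha1, h1] at hc
      refine wp_iset_eq (by simp) fun a2 ha2 => hs j (by lia) (by lia) (by lia) a2 _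
        (by simpa using ha2) ?_
      simp [ha1, hi']
      lia
  · rintro h' τ' ⟨i, t, rfl, rfl, h1, h2, h3, h4, h5, h6, h7, h8, h9, h10, h11⟩ hb
    simp [h1] at hb
    intro hf
    have : h'.iv 42 = hi := by lia
    rw [this] at h6 h7 h11
    exact hQ h' _ hf h6 h7 (h10 this) (by lia)

/-- Copies the buffer to the array `k`. -/
def copyCode (k : ℕ) : Cmd :=
  .iset 42 (.var 40) ;;
  .loop (.ilt (.var 42) (.var 41))
    (.rput k (.var 42) (.get 3 (.var 42)) ;; .iput k (.var 42) (.get 3 (.var 42)) ;;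
    .iset 42 (.add (.var 42) (.const 1)))

theorem copyCode_wp {M k : ℕ} {Q : St → ℕ → Prop} {h : St} {τ : ℕ} (hk : k < 16) (hk3 : k ≠ 3)
    {lo hi : ℕ} (hlo : h.iv 40 = lo) (hhi : h.iv 41 = hi) (hle : lo ≤ hi) (hM : hi < M)
    (hQ : ∀ h', Frame (copyCode k) h h' → (∀ l, lo ≤ l → l < hi → h'.arr k l = h.arr 3 l) →
      (∀ l, l < lo ∨ hi ≤ l → h'.arr k l = h.arr k l) → Q h' (τ + 4 * (hi - lo) + 2)) :
    wp M (copyCode k) Q h τ := by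
  apply wp_frame
  refine wp_seq (wp_iset (by simp) ?_)
  refine wp_loop (fun h' τ' => ∃ i, h'.iv 42 = i ∧ h'.iv 41 = hi ∧ h'.arr 3 = h.arr 3 ∧
    lo ≤ i ∧ i ≤ hi ∧ (∀ l, lo ≤ l → l < i → h'.arr k l = h.arr 3 l) ∧
    (∀ l, l < lo ∨ i ≤ l → h'.arr k l = h.arr k l) ∧ τ' = τ + 1 + 4 * (i - lo))
    (fun h' => hi - h'.iv 42) ?_ ?_ ?_ ?_
  · exact ⟨lo, by simp [hlo], by simp [hhi], rfl, le_rfl, hle, by lia, fun l _ => rfl, by lia⟩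
  · intro h' τ' _
    simp
  · rintro h' τ' ⟨i, rfl, h1, h2, h3, h4, h5, h6, h7⟩ hb
    simp [h1] at hb
    refine wp_seq (wp_rput (by simp [hk]; lia) (wp_seq (wp_iput (by simp [hk]; lia)
      (wp_iset_eq (by simp) fun a ha => ?_))))
    simp only [RE.eval, IE.eval, St.putr_iv, St.putr_ia, St.puti_iv] at ha
    have e1 : ∀ l, a.arr k l = if l = h'.iv 42 then h'.arr 3 l else h'.arr k l := by
      intro l
      by_cases hl : l = h'.iv 42 <;> simp [ha, St.arr, hl]
    refine ⟨⟨h'.iv 42 + 1, by simp [ha], by simp [ha, h1], ?_, by lia, by lia, ?_, ?_, by lia⟩,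
      by simp [ha]; lia⟩
    · rw [← h2]
      funext l
      simp [ha, St.arr, hk3.symm]
    · intro l l1 l2
      rw [e1]
      split_ifs with hl
      · rw [h2]
      · exact h5 l l1 (by lia)
    · intro l hl
      rw [e1, if_neg (by lia)]
      exact h6 l (by lia)
  · rintro h' τ' ⟨i, rfl, h1, h2, h3, h4, h5, h6, h7⟩ hb hf
    simp [h1] at hb
    have : h'.iv 42 = hi := by lia
    rw [this] at h5 h6 h7
    rw [h7, show τ + 1 + 4 * (hi - lo) + 1 = τ + 4 * (hi - lo) + 2 by lia]
    exact hQ h' hf h5 h6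

/-- Natural merge sort. -/
def sortCode (k : ℕ) : Cmd :=
  .iset 48 (.const 2) ;; .loop (.ilt (.const 1) (.var 48)) (passCode k ;; copyCode k)

/-- The number of descents is halved in every pass, so about `log₂ d + 1` linear passes are enough.
A bound by descents instead of the length is essential: all long lists that are sorted later have
few descents. -/
theorem sortCode_wp {M k : ℕ} {Q : St → ℕ → Prop} {h : St} {τ : ℕ} (hk : k < 16) (hk3 : k ≠ 3)
    {lo hi : ℕ} (hlo : h.iv 40 = lo) (hhi : h.iv 41 = hi) (hle : lo ≤ hi) (hM : hi < M)
    (hQ : ∀ h' τ', Frame (sortCode k) h h' → seg (h'.arr k) lo hi = seg (h.arr k) lo hi →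
      (∀ l, l < lo ∨ hi ≤ l → h'.arr k l = h.arr k l) →
      (∀ a b, lo ≤ a → a ≤ b → b < hi → h'.ra k a ≤ h'.ra k b) →
      τ' ≤ τ + 24 * (hi - lo + 1) * (Nat.log 2 (desc (h.ra k) lo hi) + 1) + 2 → Q h' τ') :
    wp M (sortCode k) Q h τ := by
  apply wp_frame
  refine wp_seq (wp_iset (by simp) ?_)
  -- The clock is bounded together with the cost of the passes still to come. When a pass has formed
  -- two or more blocks, the logarithm has dropped by at least one; with at most one block, the
  -- array is sorted and nothing remains to be paid.
  refine wp_loop (fun h' τ' => h'.iv 40 = lo ∧ h'.iv 41 = hi ∧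
    seg (h'.arr k) lo hi = seg (h.arr k) lo hi ∧
    (∀ l, l < lo ∨ hi ≤ l → h'.arr k l = h.arr k l) ∧
    (h'.iv 48 ≤ 1 → desc (h'.ra k) lo hi = 0) ∧
    τ' + 24 * (hi - lo + 1) * (if 1 < h'.iv 48 then Nat.log 2 (desc (h'.ra k) lo hi) + 1 else 0)
      ≤ τ + 1 + 24 * (hi - lo + 1) * (Nat.log 2 (desc (h.ra k) lo hi) + 1))
    (fun h' => if 1 < h'.iv 48 then desc (h'.ra k) lo hi + 1 else 0) ?_ ?_ ?_ ?_
  · exact ⟨by simp [hlo], by simp [hhi], rfl, fun _ _ => rfl, by simp, by simp⟩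
  · intro h' τ' _
    simp
  · rintro h' τ' ⟨h1, h2, h3, h4, h5, h6⟩ hb
    simp at hb
    rw [if_pos hb] at h6
    refine wp_seq (passCode_wp hk hk3 h1 h2 hle hM fun a1 τ1 fr1 p1 p2 p3 p4 => ?_)
    refine copyCode_wp hk hk3 (lo := lo) (hi := hi) ?_ ?_ hle hM fun a2 fr2 q1 q2 => ?_
    · rw [fr1.iv 40 (by simp [passCode, mergeCode, scanCode, Cmd.setsI]), h1]
    · rw [fr1.iv 41 (by simp [passCode, mergeCode, scanCode, Cmd.setsI]), h2]
    have x1 : a2.iv 40 = lo := by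
      rw [fr2.iv 40 (by simp [copyCode, Cmd.setsI]),
        fr1.iv 40 (by simp [passCode, mergeCode, scanCode, Cmd.setsI]), h1]
    have x2 : a2.iv 41 = hi := by
      rw [fr2.iv 41 (by simp [copyCode, Cmd.setsI]),
        fr1.iv 41 (by simp [passCode, mergeCode, scanCode, Cmd.setsI]), h2]
    have x3 : a2.iv 48 = a1.iv 48 := fr2.iv 48 (by simp [copyCode, Cmd.setsI])
    have x4 : a1.arr k = h'.arr k := by
      funext l
      rw [St.arr, St.arr, fr1.ra k (by simp [passCode, mergeCode, scanCode, Cmd.putsR, hk3]),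
        fr1.ia k (by simp [passCode, mergeCode, scanCode, Cmd.putsI, hk3])]
    have x5 : desc (a2.ra k) lo hi = desc (a1.ra 3) lo hi :=
      desc_congr fun l l1 l2 => congrArg Prod.fst (q1 l l1 l2)
    rw [x5, x3]
    refine ⟨⟨x1, x2, ?_, ?_, by lia, ?_⟩, ?_⟩
    · rw [seg_congr q1, p1, h3]
    · intro l hl
      rw [q2 l hl, x4, h4 l hl]
    · split_ifs with ht
      · have : Nat.log 2 (desc (a1.ra 3) lo hi) + 1 ≤ Nat.log 2 (desc (h'.ra k) lo hi) := by
          rw [Nat.log_of_one_lt_of_le one_lt_two (by lia : 2 ≤ desc (h'.ra k) lo hi)]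
          exact Nat.add_le_add_right (Nat.log_mono_right (by lia)) 1
        nlinarith
      · nlinarith
    · rw [if_pos hb]
      split_ifs <;> lia
  · rintro h' τ' ⟨h1, h2, h3, h4, h5, h6⟩ hb hf
    simp at hb
    rw [if_neg (by lia)] at h6
    refine hQ h' _ hf h3 h4 ?_ (by lia)
    have h7 := h5 hb
    rw [desc, Finset.card_eq_zero, Finset.filter_eq_empty_iff] at h7
    intro a b ha hab
    induction b, hab using Nat.le_induction with
    | base => intro; exact le_rfl
    | succ b hab ih =>
      intro hb
      exact (ih (by lia)).trans (not_lt.1 (h7 (Finset.mem_Ioo.2 ⟨by lia, hb⟩)))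

end FixedMCR

namespace FixedMCR

/-! ## The sweep -/

theorem Frame.refl (c : Cmd) (h : St) : Frame c h h :=
  ⟨rfl, rfl, fun _ _ => rfl, fun _ _ => rfl, fun _ _ => rfl, fun _ _ => rfl⟩

theorem Frame.trans {c : Cmd} {h h' h'' : St} (f : Frame c h h') (g : Frame c h' h'') :
    Frame c h h'' :=
  ⟨g.len.trans f.len, g.inp.trans f.inp,
    fun v hv => (g.iv v hv).trans (f.iv v hv), fun v hv => (g.rv v hv).trans (f.rv v hv),
    fun v hv => (g.ia v hv).trans (f.ia v hv), fun v hv => (g.ra v hv).trans (f.ra v hv)⟩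

/-- The rule for loops, with the frame condition for free. -/
theorem wp_loop_frame {M : ℕ} {Q : St → ℕ → Prop} {h : St} {τ : ℕ} {b : BE} {p : Cmd}
    (Inv : St → ℕ → Prop) (μ : St → ℕ) (h0 : Inv h τ)
    (hok : ∀ h' τ', Frame p h h' → Inv h' τ' → b.ok M h')
    (hstep : ∀ h' τ', Frame p h h' → Inv h' τ' → b.eval h' →
      wp M p (fun h'' τ'' => Inv h'' τ'' ∧ μ h'' < μ h') h' (τ' + 1))
    (hexit : ∀ h' τ', Frame p h h' → Inv h' τ' → ¬ b.eval h' → Q h' (τ' + 1)) :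
    wp M (.loop b p) Q h τ := by
  refine wp_loop (fun h' τ' => Frame p h h' ∧ Inv h' τ') μ ⟨.refl p h, h0⟩
    (fun h' τ' i => hok h' τ' i.1 i.2) (fun h' τ' i hb => ?_)
    (fun h' τ' i hb => hexit h' τ' i.1 i.2 hb)
  exact wp_frame (wp_mono (hstep h' τ' i.1 i.2 hb) fun h'' τ'' q f =>
    ⟨⟨i.1.trans f, q.1⟩, q.2⟩)

/-- The angle in `[0, 2π)` of the vector `(x, y)`. -/
noncomputable def ang (x y : ℝ) : ℝ :=
  -- This is the nonnegative real axis, including the zero vector. For any other vector with polar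
  -- angle `φ`, the quotient below is the cotangent of `φ / 2`, so that its arc tangent is `π / 2 -
  -- φ / 2`. The number `π` is obtained as `4 * arctan 1`, as no real constants except integers are
  -- available.
  if √(x * x + y * y) ≤ x then 0
  else 4 * Real.arctan 1 - 2 * Real.arctan (y / (√(x * x + y * y) - x))

/-- The length of a vector. -/
def RE.norm (x y : RE) : RE := .un .sqrt (.bin .add (.bin .mul x x) (.bin .mul y y))

def RE.ang (x y : RE) : RE :=
  .ifle (.norm x y) x (.const 0)
    (.bin .sub (.bin .mul (.const 4) (.un .arctan (.const 1)))
      (.bin .mul (.const 2) (.un .arctan (.bin .div y (.bin .sub (.norm x y) x)))))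

@[simp] theorem RE.norm_eval (x y : RE) (h : St) : (RE.norm x y).eval h =
    √(x.eval h * x.eval h + y.eval h * y.eval h) := rfl

@[simp] theorem RE.norm_ok (x y : RE) (M : ℕ) (h : St) :
    (RE.norm x y).ok M h ↔ x.ok M h ∧ y.ok M h := by
  simp [RE.norm]

@[simp] theorem RE.ang_eval (x y : RE) (h : St) :
    (RE.ang x y).eval h = FixedMCR.ang (x.eval h) (y.eval h) := by
  simp [RE.ang, FixedMCR.ang]

@[simp] theorem RE.ang_ok (x y : RE) (M : ℕ) (h : St) :
    (RE.ang x y).ok M h ↔ x.ok M h ∧ y.ok M h := by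
  simp [RE.ang]; tauto

/-- `x ≤ y` or `x < y`. -/
def rel (c : Bool) (x y : ℝ) : Prop := if c then x ≤ y else x < y

def BE.rel (c : Bool) (x y : RE) : BE := if c then .rle x y else .rlt x y

@[simp] theorem BE.rel_eval (c : Bool) (x y : RE) (h : St) :
    (BE.rel c x y).eval h ↔ FixedMCR.rel c (x.eval h) (y.eval h) := by
  cases c <;> simp [BE.rel, FixedMCR.rel]

@[simp] theorem BE.rel_ok (c : Bool) (x y : RE) (M : ℕ) (h : St) :
    (BE.rel c x y).ok M h ↔ x.ok M h ∧ y.ok M h := by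
  cases c <;> simp [BE.rel]

theorem rel_of_rel_of_le {c : Bool} {x y z : ℝ} (h : rel c x y) (h' : y ≤ z) : rel c x z := by
  cases c
  · exact lt_of_lt_of_le (b := y) h h'
  · exact le_trans (b := y) h h'

theorem rel_of_le_of_rel {c : Bool} {x y z : ℝ} (h' : x ≤ y) (h : rel c y z) : rel c x z := by
  cases c
  · exact lt_of_le_of_lt (b := y) h' h
  · exact le_trans (b := y) h' h

/-- The items of the sweep, as they are stored in the arrays. -/
structure Items where
  hi : ℕ → ℝ
  lab : ℕ → ℕ
  fx : ℕ → ℝ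
  fy : ℕ → ℝ
  ux : ℕ → ℝ
  uy : ℕ → ℝ

/-- The angle at which the circle with squared radius `q` meets the `t`-th item. -/
noncomputable def Items.key (D : Items) (t : ℕ) (q : ℝ) : ℝ :=
  ang (D.fx t + √(q - (D.fx t * D.fx t + D.fy t * D.fy t)) * D.ux t)
    (D.fy t + √(q - (D.fx t * D.fx t + D.fy t * D.fy t)) * D.uy t)

/-- The arrays of the state that describe the items. -/
def St.items (h : St) : Items := ⟨h.ra 7, h.ia 7, h.ra 8, h.ra 9, h.ra 10, h.ra 11⟩

/-- The coordinate of the position of the item `x₁₇` at the squared radius `y₁`. -/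
def coordE (a b : ℕ) : RE :=
  .bin .add (.get a (.var 17)) (.bin .mul (.un .sqrt (.bin .sub (.var 1)
    (.bin .add (.bin .mul (.get 8 (.var 17)) (.get 8 (.var 17)))
      (.bin .mul (.get 9 (.var 17)) (.get 9 (.var 17)))))) (.get b (.var 17)))

/-- Appends the item `x₁₇` to the array `1` of length `x₁₆`, if it does not end before the squared
radius `y₁`. -/
def pushCode (c : Bool) : Cmd :=
  .ite (.rel c (.var 1) (.get 7 (.var 17)))
    (.rset 3 (coordE 8 10) ;; .rset 4 (coordE 9 11) ;;
      .rput 1 (.var 16) (.ang (.var 3) (.var 4)) ;; .iput 1 (.var 16) (.var 17) ;;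
      .iset 16 (.add (.var 16) (.const 1)))
    .skip

theorem pushCode_wp {M : ℕ} {c : Bool} {Q : St → ℕ → Prop} {h : St} {τ : ℕ}
    (ht : h.iv 17 < M) (hx : h.iv 16 < M)
    (h1 : ∀ h' τ', Frame (pushCode c) h h' → rel c (h.rv 1) (h.items.hi (h.iv 17)) →
      h'.iv 16 = h.iv 16 + 1 → h'.arr 1 (h.iv 16) = (h.items.key (h.iv 17) (h.rv 1), h.iv 17) →
      (∀ l, l ≠ h.iv 16 → h'.arr 1 l = h.arr 1 l) → τ' ≤ τ + 6 → Q h' τ')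
    (h2 : ∀ h' τ', Frame (pushCode c) h h' → ¬ rel c (h.rv 1) (h.items.hi (h.iv 17)) →
      h'.iv 16 = h.iv 16 → h'.arr 1 = h.arr 1 → τ' ≤ τ + 6 → Q h' τ') :
    wp M (pushCode c) Q h τ := by
  apply wp_frame
  refine wp_ite (by simp [ht]) (fun hc => ?_) (fun hc => ?_)
  · refine wp_seq (wp_rset (by simp [coordE, ht]) (wp_seq (wp_rset (by simp [coordE, ht])
      (wp_seq (wp_rput (by simp [hx]) (wp_seq (wp_iput (by simp [hx])
        (wp_iset_eq (by simp) fun a ha fr => ?_))))))))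
    have hk : a.arr 1 (h.iv 16) = (h.items.key (h.iv 17) (h.rv 1), h.iv 17) := by
      simp [ha, St.arr, St.items, Items.key, coordE]
    refine h1 a _ fr (by simpa [St.items] using hc) (by simp [ha]) hk (fun l hl => ?_) le_rfl
    simp [ha, St.arr, hl]
  · exact wp_skip fun fr => h2 h _ fr (by simpa [St.items] using hc) rfl rfl (by lia)

/-- Removes from the array `1` of length `x₁₃` the items that end before the squared radius `y₁`,
and updates the angles of the others. -/
def filterCode (c : Bool) : Cmd :=
  .iset 15 (.const 0) ;; .iset 16 (.const 0) ;;
  .loop (.ilt (.var 15) (.var 13))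
    (.iset 17 (.get 1 (.var 15)) ;; pushCode c ;; .iset 15 (.add (.var 15) (.const 1)))

open Classical in
-- The list is compacted in place, which is safe because the write position never overtakes the read
-- position. A relation `R` along the list is inherited by the sublist; it will be the order of the
-- angles at the previous radius.
theorem filterCode_wp {M : ℕ} {c : Bool} {Q : St → ℕ → Prop} {h : St} {τ : ℕ}
    {w : ℕ} (hw : h.iv 13 = w) (hM : w < M) (hp : ∀ j < w, h.ia 1 j < M) (R : ℕ → ℕ → Prop)
    (hR : ∀ a b, a ≤ b → b < w → R (h.ia 1 a) (h.ia 1 b))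
    (hQ : ∀ h' τ' x, Frame (filterCode c) h h' → h'.iv 16 = x → x ≤ w →
      seg (h'.ia 1) 0 x = (seg (h.ia 1) 0 w).filter (fun t => rel c (h.rv 1) (h.items.hi t)) →
      (∀ j < x, h'.ra 1 j = h.items.key (h'.ia 1 j) (h.rv 1)) →
      (∀ a b, a ≤ b → b < x → R (h'.ia 1 a) (h'.ia 1 b)) → τ' ≤ τ + 9 * w + 3 → Q h' τ') :
    wp M (filterCode c) Q h τ := by
  apply wp_frame
  refine wp_seq (wp_iset (by simp) (wp_seq (wp_iset_eq (by simp) fun a0 ha0 => ?_)))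
  simp only [IE.eval] at ha0
  refine wp_loop_frame (fun h' τ' => ∃ j x, h'.iv 15 = j ∧ h'.iv 16 = x ∧ x ≤ j ∧ j ≤ w ∧
    seg (h'.ia 1) 0 x = (seg (h.ia 1) 0 j).filter (fun t => rel c (h.rv 1) (h.items.hi t)) ∧
    (∀ l < x, h'.ra 1 l = h.items.key (h'.ia 1 l) (h.rv 1)) ∧
    (∀ a < x, ∃ a' < j, h'.ia 1 a = h.ia 1 a') ∧
    (∀ a b, a ≤ b → b < x → R (h'.ia 1 a) (h'.ia 1 b)) ∧
    (∀ l, j ≤ l → h'.ia 1 l = h.ia 1 l) ∧ τ' ≤ τ + 2 + 9 * j) (fun h' => w - h'.iv 15) ?_ ?_ ?_ ?_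
  · exact ⟨0, 0, by simp [ha0], by simp [ha0], by simp, by simp, by simp [seg_self], by simp,
      by simp, by simp, by simp [ha0], by simp⟩
  · intro h' τ' _ _
    simp
  · rintro h' τ' fr ⟨j, x, rfl, rfl, i1, i2, i3, i4, i5, i6, i7, i8⟩ hb
    have e13 : h'.iv 13 = w := by
      rw [fr.iv 13 (by simp [pushCode, Cmd.setsI])]; simp [ha0, hw]
    have e1 : h'.rv 1 = h.rv 1 := by
      rw [fr.rv 1 (by simp [pushCode, Cmd.setsR])]; simp [ha0]
    have eD : h'.items = h.items := by
      simp only [St.items]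
      rw [fr.ra 7 (by simp [pushCode, Cmd.putsR]), fr.ra 8 (by simp [pushCode, Cmd.putsR]),
        fr.ra 9 (by simp [pushCode, Cmd.putsR]), fr.ra 10 (by simp [pushCode, Cmd.putsR]),
        fr.ra 11 (by simp [pushCode, Cmd.putsR]), fr.ia 7 (by simp [pushCode, Cmd.putsI])]
      simp [ha0]
    simp [e13] at hb
    refine wp_seq (wp_iset_eq (by simp; lia) fun a1 ha1 => wp_seq ?_)
    simp only [IE.eval] at ha1
    rw [i7 _ le_rfl] at ha1
    have eD1 : a1.items = h.items := by rw [← eD]; simp [ha1, St.items]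
    have f17 : a1.iv 17 = h.ia 1 (h'.iv 15) := by simp [ha1]
    have f16 : a1.iv 16 = h'.iv 16 := by simp [ha1]
    have f1 : a1.rv 1 = h.rv 1 := by simp [ha1, e1]
    have fa : a1.arr 1 = h'.arr 1 := by rw [ha1]; rfl
    refine pushCode_wp (by rw [f17]; exact hp _ hb) (by rw [f16]; lia) ?_ ?_
    · intro a2 T fr2 r1 r2 r3 r4 r5
      rw [eD1, f17, f1] at r1
      rw [eD1, f16, f17, f1] at r3
      rw [f16, fa] at r4
      rw [f16] at r2
      have g1 : ∀ l, l ≠ h'.iv 16 → a2.ia 1 l = h'.ia 1 l :=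
        fun l hl => congrArg Prod.snd (r4 l hl)
      have g2 : ∀ l, l ≠ h'.iv 16 → a2.ra 1 l = h'.ra 1 l :=
        fun l hl => congrArg Prod.fst (r4 l hl)
      have g3 : a2.ia 1 (h'.iv 16) = h.ia 1 (h'.iv 15) := congrArg Prod.snd r3
      have g4 : a2.ra 1 (h'.iv 16) = h.items.key (h.ia 1 (h'.iv 15)) (h.rv 1) :=
        congrArg Prod.fst r3
      have g5 : a2.iv 15 = h'.iv 15 := by
        rw [fr2.iv 15 (by simp [pushCode, Cmd.setsI])]; simp [ha1]
      refine wp_iset_eq (by simp) fun a3 ha3 => ?_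
      simp only [IE.eval, g5] at ha3
      have k1 : a3.ia 1 = a2.ia 1 := by simp [ha3]
      have k2 : a3.ra 1 = a2.ra 1 := by simp [ha3]
      refine ⟨⟨h'.iv 15 + 1, h'.iv 16 + 1, by simp [ha3], by simp [ha3, r2], by lia, by lia,
        ?_, ?_, ?_, ?_, ?_, by lia⟩, by simp [ha3]; lia⟩
      · rw [k1, seg_succ _ (Nat.zero_le _), seg_succ _ (Nat.zero_le _), Multiset.filter_add, ← i3,
          g3, Multiset.filter_singleton, if_pos r1]
        congr 1
        exact seg_congr fun l _ hl => g1 l (by lia)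
      · intro l hl
        rw [k1, k2]
        by_cases hl' : l = h'.iv 16
        · rw [hl', g3, g4]
        · rw [g1 l hl', g2 l hl']; exact i4 l (by lia)
      · intro a ha
        rw [k1]
        by_cases hl' : a = h'.iv 16
        · exact ⟨h'.iv 15, by lia, by rw [hl', g3]⟩
        · obtain ⟨a', q1, q2⟩ := i5 a (by lia)
          exact ⟨a', by lia, by rw [g1 a hl', q2]⟩
      · intro a b hab hb'
        rw [k1]
        by_cases hl' : b = h'.iv 16
        · rw [hl', g3]
          by_cases hl2 : a = h'.iv 16
          · rw [hl2, g3]; exact hR _ _ le_rfl hb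
          · obtain ⟨a', q1, q2⟩ := i5 a (by lia)
            rw [g1 a hl2, q2]; exact hR _ _ q1.le hb
        · rw [g1 b hl', g1 a (by lia)]; exact i6 a b hab (by lia)
      · intro l hl
        rw [k1, g1 l (by lia)]; exact i7 l (by lia)
    · intro a2 T fr2 r1 r2 r3 r4
      rw [eD1, f17, f1] at r1
      rw [fa] at r3
      rw [f16] at r2
      have g1 : a2.ia 1 = h'.ia 1 := funext fun l => congrArg Prod.snd (congrFun r3 l)
      have g2 : a2.ra 1 = h'.ra 1 := funext fun l => congrArg Prod.fst (congrFun r3 l)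
      have g5 : a2.iv 15 = h'.iv 15 := by
        rw [fr2.iv 15 (by simp [pushCode, Cmd.setsI])]; simp [ha1]
      refine wp_iset_eq (by simp) fun a3 ha3 => ?_
      simp only [IE.eval, g5] at ha3
      have k1 : a3.ia 1 = h'.ia 1 := by simp [ha3, g1]
      have k2 : a3.ra 1 = h'.ra 1 := by simp [ha3, g2]
      refine ⟨⟨h'.iv 15 + 1, h'.iv 16, by simp [ha3], by simp [ha3, r2], by lia, by lia,
        ?_, ?_, ?_, ?_, ?_, by lia⟩, by simp [ha3]; lia⟩
      · rw [k1, seg_succ _ (Nat.zero_le _), Multiset.filter_add, ← i3,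
          Multiset.filter_singleton, if_neg r1]
        simp
      · rw [k1, k2]; exact i4
      · intro a ha
        obtain ⟨a', q1, q2⟩ := i5 a ha
        exact ⟨a', by lia, by rw [k1, q2]⟩
      · rw [k1]; exact i6
      · intro l hl
        rw [k1]; exact i7 l (by lia)
  · rintro h' τ' fr ⟨j, x, rfl, rfl, i1, i2, i3, i4, i5, i6, i7, i8⟩ hb hf
    have e13 : h'.iv 13 = w := by
      rw [fr.iv 13 (by simp [pushCode, Cmd.setsI])]; simp [ha0, hw]
    simp [e13] at hb
    have : h'.iv 15 = w := by lia
    rw [this] at i3 i1 i8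
    exact hQ h' _ _ hf rfl i1 i3 i4 i6 (by lia)

/-- Appends to the array `1` the next items of the array `4` that begin before the squared
radius `y₁` and do not end before it. -/
def bornCode (c : Bool) : Cmd :=
  .loop (.and (.ilt (.var 12) (.var 10)) (.rel c (.get 4 (.var 12)) (.var 1)))
    (.iset 17 (.get 4 (.var 12)) ;; pushCode c ;; .iset 12 (.add (.var 12) (.const 1)))

open Classical in
-- The pointer into the items sorted by birth only moves forward, so each item is inspected once per
-- sweep and the cost is proportional to `q' - q`. An item that was born and has died since the
-- previous point is never inserted.
theorem bornCode_wp {M : ℕ} {c : Bool} {Q : St → ℕ → Prop} {h : St} {τ : ℕ}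
    {N q x : ℕ} (hN : h.iv 10 = N) (hq : h.iv 12 = q) (hqN : q ≤ N) (hx : h.iv 16 = x)
    (hxq : x ≤ q) (hM : N < M) (hp : ∀ j < N, h.ia 4 j < M)
    (hQ : ∀ h' τ' q' x', Frame (bornCode c) h h' → h'.iv 12 = q' → h'.iv 16 = x' → q ≤ q' →
      q' ≤ N → x ≤ x' → x' - x ≤ q' - q →
      (∀ j, q ≤ j → j < q' → rel c (h.ra 4 j) (h.rv 1)) →
      (q' < N → ¬ rel c (h.ra 4 q') (h.rv 1)) →
      seg (h'.ia 1) x x' = (seg (h.ia 4) q q').filter (fun t => rel c (h.rv 1) (h.items.hi t)) →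
      (∀ j, x ≤ j → j < x' → h'.ra 1 j = h.items.key (h'.ia 1 j) (h.rv 1)) →
      (∀ j < x, h'.arr 1 j = h.arr 1 j) → τ' ≤ τ + 9 * (q' - q) + 1 → Q h' τ') :
    wp M (bornCode c) Q h τ := by
  apply wp_frame
  refine wp_loop_frame (fun h' τ' => ∃ q' x', h'.iv 12 = q' ∧ h'.iv 16 = x' ∧ q ≤ q' ∧ q' ≤ N ∧
    x ≤ x' ∧ x' - x ≤ q' - q ∧ (∀ j, q ≤ j → j < q' → rel c (h.ra 4 j) (h.rv 1)) ∧
    seg (h'.ia 1) x x' = (seg (h.ia 4) q q').filter (fun t => rel c (h.rv 1) (h.items.hi t)) ∧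
    (∀ j, x ≤ j → j < x' → h'.ra 1 j = h.items.key (h'.ia 1 j) (h.rv 1)) ∧
    (∀ j < x, h'.arr 1 j = h.arr 1 j) ∧ τ' ≤ τ + 9 * (q' - q)) (fun h' => N - h'.iv 12) ?_ ?_ ?_ ?_
  · exact ⟨q, x, hq, hx, le_rfl, hqN, le_rfl, by simp, by lia, by simp [seg_self], by lia,
      by simp, by simp⟩
  · rintro h' τ' fr ⟨q', x', rfl, rfl, i1, i2, -⟩
    simp
    lia
  · rintro h' τ' fr ⟨q', x', rfl, rfl, i1, i2, i3, i4, i5, i6, i7, i8, i9⟩ hb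
    have e10 : h'.iv 10 = N := by rw [fr.iv 10 (by simp [pushCode, Cmd.setsI]), hN]
    have e1 : h'.rv 1 = h.rv 1 := fr.rv 1 (by simp [pushCode, Cmd.setsR])
    have e4 : h'.ra 4 = h.ra 4 := fr.ra 4 (by simp [pushCode, Cmd.putsR])
    have e5 : h'.ia 4 = h.ia 4 := fr.ia 4 (by simp [pushCode, Cmd.putsI])
    have eD : h'.items = h.items := by
      simp only [St.items]
      rw [fr.ra 7 (by simp [pushCode, Cmd.putsR]), fr.ra 8 (by simp [pushCode, Cmd.putsR]),
        fr.ra 9 (by simp [pushCode, Cmd.putsR]), fr.ra 10 (by simp [pushCode, Cmd.putsR]),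
        fr.ra 11 (by simp [pushCode, Cmd.putsR]), fr.ia 7 (by simp [pushCode, Cmd.putsI])]
    simp [e10, e4, e1] at hb
    refine wp_seq (wp_iset_eq (by simp; lia) fun a1 ha1 => wp_seq ?_)
    simp only [IE.eval, e5] at ha1
    have eD1 : a1.items = h.items := by rw [← eD]; simp [ha1, St.items]
    have f17 : a1.iv 17 = h.ia 4 (h'.iv 12) := by simp [ha1]
    have f16 : a1.iv 16 = h'.iv 16 := by simp [ha1]
    have f1 : a1.rv 1 = h.rv 1 := by simp [ha1, e1]
    have fa : a1.arr 1 = h'.arr 1 := by rw [ha1]; rfl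
    have hrel : ∀ j, q ≤ j → j < h'.iv 12 + 1 → rel c (h.ra 4 j) (h.rv 1) := by
      intro j j1 j2
      rcases Nat.lt_succ_iff_lt_or_eq.1 j2 with j3 | rfl
      · exact i5 j j1 j3
      · exact hb.2
    refine pushCode_wp (by rw [f17]; exact hp _ hb.1) (by rw [f16]; lia) ?_ ?_
    · intro a2 T fr2 r1 r2 r3 r4 r5
      rw [eD1, f17, f1] at r1
      rw [eD1, f16, f17, f1] at r3
      rw [f16, fa] at r4
      rw [f16] at r2
      have g1 : ∀ l, l ≠ h'.iv 16 → a2.ia 1 l = h'.ia 1 l :=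
        fun l hl => congrArg Prod.snd (r4 l hl)
      have g2 : ∀ l, l ≠ h'.iv 16 → a2.ra 1 l = h'.ra 1 l :=
        fun l hl => congrArg Prod.fst (r4 l hl)
      have g3 : a2.ia 1 (h'.iv 16) = h.ia 4 (h'.iv 12) := congrArg Prod.snd r3
      have g4 : a2.ra 1 (h'.iv 16) = h.items.key (h.ia 4 (h'.iv 12)) (h.rv 1) :=
        congrArg Prod.fst r3
      have g5 : a2.iv 12 = h'.iv 12 := by
        rw [fr2.iv 12 (by simp [pushCode, Cmd.setsI])]; simp [ha1]
      refine wp_iset_eq (by simp) fun a3 ha3 => ?_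
      simp only [IE.eval, g5] at ha3
      have k1 : a3.ia 1 = a2.ia 1 := by simp [ha3]
      have k2 : a3.ra 1 = a2.ra 1 := by simp [ha3]
      have k3 : a3.arr 1 = a2.arr 1 := by rw [ha3]; rfl
      refine ⟨⟨h'.iv 12 + 1, h'.iv 16 + 1, by simp [ha3], by simp [ha3, r2], by lia, by lia,
        by lia, by lia, hrel, ?_, ?_, ?_, by lia⟩, by simp [ha3]; lia⟩
      · rw [k1, seg_succ _ i3, seg_succ _ i1, Multiset.filter_add, ← i6,
          g3, Multiset.filter_singleton, if_pos r1]
        congr 1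
        exact seg_congr fun l _ hl => g1 l (by lia)
      · intro l hl hl2
        rw [k1, k2]
        by_cases hl' : l = h'.iv 16
        · rw [hl', g3, g4]
        · rw [g1 l hl', g2 l hl']; exact i7 l hl (by lia)
      · intro l hl
        rw [k3, r4 l (by lia)]; exact i8 l hl
    · intro a2 T fr2 r1 r2 r3 r4
      rw [eD1, f17, f1] at r1
      rw [fa] at r3
      rw [f16] at r2
      have g1 : a2.ia 1 = h'.ia 1 := funext fun l => congrArg Prod.snd (congrFun r3 l)
      have g2 : a2.ra 1 = h'.ra 1 := funext fun l => congrArg Prod.fst (congrFun r3 l)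
      have g5 : a2.iv 12 = h'.iv 12 := by
        rw [fr2.iv 12 (by simp [pushCode, Cmd.setsI])]; simp [ha1]
      refine wp_iset_eq (by simp) fun a3 ha3 => ?_
      simp only [IE.eval, g5] at ha3
      have k1 : a3.ia 1 = h'.ia 1 := by simp [ha3, g1]
      have k2 : a3.ra 1 = h'.ra 1 := by simp [ha3, g2]
      have k3 : a3.arr 1 = h'.arr 1 := by rw [← r3, ha3]; rfl
      refine ⟨⟨h'.iv 12 + 1, h'.iv 16, by simp [ha3], by simp [ha3, r2], by lia, by lia,
        by lia, by lia, hrel, ?_, ?_, ?_, by lia⟩, by simp [ha3]; lia⟩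
      · rw [k1, seg_succ _ i1, Multiset.filter_add, ← i6,
          Multiset.filter_singleton, if_neg r1]
        simp
      · rw [k1, k2]; exact i7
      · rw [k3]; exact i8
  · rintro h' τ' fr ⟨q', x', rfl, rfl, i1, i2, i3, i4, i5, i6, i7, i8, i9⟩ hb hf
    have e10 : h'.iv 10 = N := by rw [fr.iv 10 (by simp [pushCode, Cmd.setsI]), hN]
    have e1 : h'.rv 1 = h.rv 1 := fr.rv 1 (by simp [pushCode, Cmd.setsR])
    have e4 : h'.ra 4 = h.ra 4 := fr.ra 4 (by simp [pushCode, Cmd.putsR])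
    simp [e10, e4, e1] at hb
    exact hQ h' _ _ _ hf rfl rfl i1 i2 i3 i4 i5 hb i6 i7 i8 (by lia)

/-- The angle `x` in `(-2π, 2π)` up to multiples of `2π`. -/
noncomputable def wrap (x : ℝ) : ℝ := if 0 ≤ x then x else x + 2 * (4 * Real.arctan 1)

/-- Appends to the array `2` of length `x₁₁` the events of a point with angle `y₂`. -/
def emitCode : Cmd :=
  .iset 15 (.const 0) ;;
  .loop (.ilt (.var 15) (.var 13))
    (.rset 5 (.bin .sub (.get 1 (.var 15)) (.var 2)) ;;
    .rput 2 (.var 11) (.ifle (.const 0) (.var 5) (.var 5) (.bin .add (.var 5)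
      (.bin .mul (.const 2) (.bin .mul (.const 4) (.un .arctan (.const 1)))))) ;;
    .iput 2 (.var 11) (.get 7 (.get 1 (.var 15))) ;;
    .iset 11 (.add (.var 11) (.const 1)) ;; .iset 15 (.add (.var 15) (.const 1)))

theorem emitCode_wp {M : ℕ} {Q : St → ℕ → Prop} {h : St} {τ : ℕ} {w e : ℕ} (hw : h.iv 13 = w)
    (he : h.iv 11 = e) (hM : w < M) (hM' : e + w ≤ M) (hp : ∀ j < w, h.ia 1 j < M)
    (hQ : ∀ h', Frame emitCode h h' → h'.iv 11 = e + w →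
      (∀ l < e, h'.arr 2 l = h.arr 2 l) →
      (∀ j < w, h'.arr 2 (e + j) = (wrap (h.ra 1 j - h.rv 2), h.ia 7 (h.ia 1 j))) →
      Q h' (τ + 6 * w + 2)) :
    wp M emitCode Q h τ := by
  apply wp_frame
  refine wp_seq (wp_iset_eq (by simp) fun a0 ha0 => ?_)
  simp only [IE.eval] at ha0
  refine wp_loop_frame (fun h' τ' => ∃ i, h'.iv 15 = i ∧ i ≤ w ∧ h'.iv 11 = e + i ∧
    (∀ l < e, h'.arr 2 l = h.arr 2 l) ∧
    (∀ j < i, h'.arr 2 (e + j) = (wrap (h.ra 1 j - h.rv 2), h.ia 7 (h.ia 1 j))) ∧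
    τ' = τ + 1 + 6 * i) (fun h' => w - h'.iv 15) ?_ ?_ ?_ ?_
  · exact ⟨0, by simp [ha0], by simp, by simp [ha0, he], by simp [ha0, St.arr], by simp, by simp⟩
  · intro h' τ' _ _
    simp
  · rintro h' τ' fr ⟨i, rfl, i1, i2, i3, i4, i5⟩ hb
    have e13 : h'.iv 13 = w := by rw [fr.iv 13 (by simp [Cmd.setsI])]; simp [ha0, hw]
    have e2 : h'.rv 2 = h.rv 2 := by rw [fr.rv 2 (by simp [Cmd.setsR])]; simp [ha0]
    have e3 : h'.ra 1 = h.ra 1 := by rw [fr.ra 1 (by simp [Cmd.putsR])]; simp [ha0]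
    have e4 : h'.ia 1 = h.ia 1 := by rw [fr.ia 1 (by simp [Cmd.putsI])]; simp [ha0]
    have e5 : h'.ia 7 = h.ia 7 := by rw [fr.ia 7 (by simp [Cmd.putsI])]; simp [ha0]
    simp [e13] at hb
    have := hp _ hb
    refine wp_seq (wp_rset (by simp; lia) (wp_seq (wp_rput (by simp; lia) (wp_seq
      (wp_iput (by simp [e4]; lia) (wp_seq (wp_iset (by simp) (wp_iset_eq (by simp)
        fun a ha => ?_))))))))
    simp only [IE.eval, RE.eval, St.seti_iv, St.puti_iv, St.putr_iv, St.setr_iv, i2] at ha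
    have k1 : ∀ l, a.arr 2 l = if l = e + h'.iv 15 then
        (wrap (h.ra 1 (h'.iv 15) - h.rv 2), h.ia 7 (h.ia 1 (h'.iv 15))) else h'.arr 2 l := by
      intro l
      by_cases hl : l = e + h'.iv 15 <;> simp [ha, St.arr, hl, e2, e3, e4, e5, wrap]
    refine ⟨⟨h'.iv 15 + 1, by simp [ha], by lia, by simp [ha]; lia, fun l hl => ?_,
      fun j hj => ?_, by lia⟩, by simp [ha]; lia⟩
    · rw [k1, if_neg (by lia), i3 l hl]
    · rw [k1]
      by_cases hj' : j = h'.iv 15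
      · rw [if_pos (by rw [hj']), hj']
      · rw [if_neg (by lia), i4 j (by lia)]
  · rintro h' τ' fr ⟨i, rfl, i1, i2, i3, i4, i5⟩ hb hf
    have e13 : h'.iv 13 = w := by rw [fr.iv 13 (by simp [Cmd.setsI])]; simp [ha0, hw]
    simp [e13] at hb
    have : h'.iv 15 = w := by lia
    rw [this] at i4 i2 i5
    rw [i5, show τ + 1 + 6 * w + 1 = τ + 6 * w + 2 by lia]
    exact hQ h' hf i2 i3 i4

end FixedMCR

/-! ### One step of the sweep and its amortized cost -/

namespace FixedMCR

theorem desc_shift (f : ℕ → ℝ) (e w : ℕ) : desc (fun j => f (e + j)) 0 w = desc f e (e + w) := by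
  unfold desc
  rw [← Finset.card_map (addLeftEmbedding e)]
  congr 1
  ext l
  simp only [Finset.mem_map, Finset.mem_filter, Finset.mem_Ioo, addLeftEmbedding_apply]
  constructor
  · rintro ⟨a, ⟨⟨h1, h2⟩, h3⟩, rfl⟩
    exact ⟨⟨by lia, by lia⟩, by rwa [show e + a - 1 = e + (a - 1) by lia]⟩
  · rintro ⟨⟨h1, h2⟩, h3⟩
    exact ⟨l - e, ⟨⟨by lia, by lia⟩, by
      rwa [show e + (l - e) = l by lia, show e + (l - e - 1) = l - 1 by lia]⟩, by lia⟩

/-- Reducing a sorted sequence minus `β` modulo `2π` creates a descent only where the sequence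
passes from values `< β` to values `≥ β`, which happens at most once. -/
theorem desc_wrap_le {f : ℕ → ℝ} {w : ℕ} (β : ℝ)
    (hf : ∀ a b, a ≤ b → b < w → f a ≤ f b) : desc (fun j => wrap (f j - β)) 0 w ≤ 1 := by
  have key : ∀ l, l < w → wrap (f l - β) < wrap (f (l - 1) - β) → f (l - 1) < β ∧ β ≤ f l := by
    intro l hl hd
    have h1 := hf (l - 1) l (by lia) hl
    simp only [wrap] at hd
    split_ifs at hd with h2 h3 h3
    · linarith
    · constructor <;> linarith
    · linarith
    · linarith
  refine Finset.card_le_one.2 fun a ha b hb => ?_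
  simp only [Finset.mem_filter, Finset.mem_Ioo] at ha hb
  have ka := key a ha.1.2 ha.2
  have kb := key b hb.1.2 hb.2
  rcases lt_trichotomy a b with h | h | h
  · exact absurd (hf a (b - 1) (by lia) (by lia)) (by linarith [ka.2, kb.1])
  · exact h
  · exact absurd (hf b (a - 1) (by lia) (by lia)) (by linarith [kb.2, ka.1])

theorem seg_injOn {α : Type*} {f : ℕ → α} {w : ℕ} (h : (seg f 0 w).Nodup) :
    ∀ a < w, ∀ b < w, f a = f b → a = b := fun a ha b hb hab =>
  Multiset.inj_on_of_nodup_map h a (by simpa using ha) b (by simpa using hb) hab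

theorem seg_add_right {α : Type*} (f : ℕ → α) (e w : ℕ) :
    seg f e (e + w) = seg (fun j => f (e + j)) 0 w := by
  induction w with
  | zero => simp [seg_self]
  | succ w ih => rw [← add_assoc, seg_succ _ (by lia), ih, seg_succ _ (Nat.zero_le _)]

/-- The index in the input of the first coordinate of the point with the number `a`. -/
def pointE (a : IE) : IE :=
  .add (.add a (.add (.var 1) (.const 1))) (.add a (.add (.var 1) (.const 1)))

/-- The point with the number `a` relative to the center. -/
def relX (a : IE) : RE := .bin .sub (.inp (pointE a)) (.inp (.const 0))
def relY (a : IE) : RE := .bin .sub (.inp (.add (pointE a) (.const 1))) (.inp (.const 1))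

/-- The angle of the `p`-th point as seen from the center. -/
noncomputable def St.beta (h : St) (p : ℕ) : ℝ :=
  ang (h.inp (2 * (1 + h.iv 1 + p)) - h.inp 0) (h.inp (2 * (1 + h.iv 1 + p) + 1) - h.inp 1)

def sweepBody (c : Bool) : Cmd :=
  .rset 1 (.get 0 (.var 14)) ;; filterCode c ;; .iset 18 (.var 16) ;; bornCode c ;;
  .iset 40 (.var 18) ;; .iset 41 (.var 16) ;; sortCode 1 ;; .iset 40 (.const 0) ;; sortCode 1 ;;
  .iset 13 (.var 16) ;; .rset 2 (.ang (relX (.get 0 (.var 14))) (relY (.get 0 (.var 14)))) ;;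
  emitCode ;; .iset 14 (.add (.var 14) (.const 1))

/-- Appends the events of all points at the items in the array `4` to the array `2`. -/
def sweepCode (c : Bool) : Cmd :=
  .iset 12 (.const 0) ;; .iset 13 (.const 0) ;; .iset 14 (.const 0) ;;
  .loop (.ilt (.var 14) (.var 0)) (sweepBody c)

open Classical in
/-- The items that meet the circle with squared radius `q`. -/
noncomputable def active (c : Bool) (N : ℕ) (lo hi : ℕ → ℝ) (q : ℝ) : Multiset ℕ :=
  (Multiset.range N).filter fun t => rel c (lo t) q ∧ rel c q (hi t)

/-- The angles at which items meet a growing circle keep their cyclic order. -/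
def KeepsOrder (c : Bool) (N : ℕ) (lo : ℕ → ℝ) (D : Items) : Prop :=
  ∀ (p : ℕ → ℕ) (w : ℕ) (q q' : ℝ), q ≤ q' →
    (∀ j < w, p j ∈ active c N lo D.hi q ∧ p j ∈ active c N lo D.hi q') →
    (∀ a < w, ∀ b < w, p a = p b → a = b) →
    (∀ a b, a ≤ b → b < w → D.key (p a) q ≤ D.key (p b) q) →
    desc (fun j => D.key (p j) q') 0 w ≤ 1

open Classical in
theorem mem_active {c : Bool} {N : ℕ} {lo hi : ℕ → ℝ} {q : ℝ} {t : ℕ} :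
    t ∈ active c N lo hi q ↔ t < N ∧ rel c (lo t) q ∧ rel c q (hi t) := by
  simp [active]

open Classical in
theorem card_active_le (c : Bool) (N : ℕ) (lo hi : ℕ → ℝ) (q : ℝ) :
    Multiset.card (active c N lo hi q) ≤ N :=
  (Multiset.card_le_card (Multiset.filter_le _ _)).trans (by simp)

open Classical in
-- In the order of birth, the items born before the radius in question form a prefix of length `k`;
-- the live ones are those in the prefix that have not died.
theorem active_eq_filter {c : Bool} {N : ℕ} {lo hi : ℕ → ℝ} {q : ℝ} {f : ℕ → ℝ} {g : ℕ → ℕ}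
    (h : seg (fun j => (f j, g j)) 0 N = (Multiset.range N).map fun t => (lo t, t))
    (hs : ∀ a b, a ≤ b → b < N → f a ≤ f b) {k : ℕ} (hk : k ≤ N)
    (h1 : ∀ j < k, rel c (f j) q) (h2 : k < N → ¬ rel c (f k) q) :
    active c N lo hi q = (seg g 0 k).filter fun t => rel c q (hi t) := by
  have hlo : ∀ j < N, f j = lo (g j) := by
    intro j hj
    have : (f j, g j) ∈ seg (fun j => (f j, g j)) 0 N :=
      (mem_seg _).2 ⟨j, Nat.zero_le _, hj, rfl⟩
    rw [h, Multiset.mem_map] at this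
    obtain ⟨t, -, ht⟩ := this
    simp only [Prod.mk.injEq] at ht
    rw [← ht.1, ← ht.2]
  have hg : seg g 0 N = Multiset.range N := by
    have := congrArg (Multiset.map Prod.snd) h
    rw [map_seg, Multiset.map_map] at this
    simpa [Function.comp_def] using this
  rw [active, ← hg, ← seg_add g (Nat.zero_le k) hk, Multiset.filter_add]
  have e1 : (seg g k N).filter (fun t => rel c (lo t) q ∧ rel c q (hi t)) = 0 := by
    refine Multiset.filter_eq_nil.2 fun t ht hr => ?_
    obtain ⟨j, j1, j2, rfl⟩ := (mem_seg _).1 ht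
    rw [← hlo j j2] at hr
    exact h2 (by lia) (rel_of_le_of_rel (hs k j j1 j2) hr.1)
  rw [e1, add_zero]
  refine Multiset.filter_congr fun t ht => ?_
  obtain ⟨j, j1, j2, rfl⟩ := (mem_seg _).1 ht
  rw [← hlo j (by lia)]
  simp [h1 j j2]

/-- The preconditions of the sweep. -/
structure SweepPre (c : Bool) (M n N : ℕ) (lo : ℕ → ℝ) (h : St) : Prop where
  iv0 : h.iv 0 = n
  iv10 : h.iv 10 = N
  len : h.len = 2 * (1 + h.iv 1 + n)
  nM : n < M
  NM : N < M
  pts : ∀ i < n, h.ia 0 i < n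
  sorted : ∀ i j, i ≤ j → j < n → h.ra 0 i ≤ h.ra 0 j
  items : seg (h.arr 4) 0 N = (Multiset.range N).map fun t => (lo t, t)
  itemsSorted : ∀ a b, a ≤ b → b < N → h.ra 4 a ≤ h.ra 4 b
  order : KeepsOrder c N lo h.items

/-- The events at the items that are met at the squared radius `q` by a point with the
angle `β`. -/
noncomputable def Items.events (D : Items) (c : Bool) (N : ℕ) (lo : ℕ → ℝ) (q β : ℝ) :
    Multiset (ℝ × ℕ) :=
  (active c N lo D.hi q).map fun t => (wrap (D.key t q - β), D.lab t)

theorem sortCode_frame_items {h h' : St} (fr : Frame (sortCode 1) h h') : h'.items = h.items := by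
  simp [St.items, fr.ra 7 (by simp [sortCode, passCode, mergeCode, scanCode, copyCode, Cmd.putsR]),
    fr.ra 8 (by simp [sortCode, passCode, mergeCode, scanCode, copyCode, Cmd.putsR]),
    fr.ra 9 (by simp [sortCode, passCode, mergeCode, scanCode, copyCode, Cmd.putsR]),
    fr.ra 10 (by simp [sortCode, passCode, mergeCode, scanCode, copyCode, Cmd.putsR]),
    fr.ra 11 (by simp [sortCode, passCode, mergeCode, scanCode, copyCode, Cmd.putsR]),
    fr.ia 7 (by simp [sortCode, passCode, mergeCode, scanCode, copyCode, Cmd.putsI])]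

theorem Cmd.sets_sort {v : ℕ} (k : ℕ) (hv : v < 42 ∨ 48 < v) : ¬ (sortCode k).setsI v := by
  simp [sortCode, passCode, mergeCode, scanCode, copyCode, Cmd.setsI]; omega

theorem Cmd.puts_sort {v k : ℕ} (hv : v ≠ k ∧ v ≠ 3) :
    ¬ (sortCode k).putsI v ∧ ¬ (sortCode k).putsR v := by
  simp [sortCode, passCode, mergeCode, scanCode, copyCode, Cmd.putsI, Cmd.putsR]; omega

/-- `d` and `d'` are the numbers of descents before the two sorts. The new items, at most `q' - q`
in number, are sorted from scratch at the price of `log N` each. The whole list has at most two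
descents afterwards, so sorting it is linear. -/
theorem sweep_time {τ τ₁ τ₃ τ₆ τ₈ w q q' x y N d d' : ℕ} (h1 : τ₁ ≤ τ + 1 + 9 * w + 3)
    (h3 : τ₃ ≤ τ₁ + 1 + 9 * (q' - q) + 1)
    (h6 : τ₆ ≤ τ₃ + 1 + 1 + 24 * (x - y + 1) * (Nat.log 2 d + 1) + 2)
    (h8 : τ₈ ≤ τ₆ + 1 + 24 * (x - 0 + 1) * (Nat.log 2 d' + 1) + 2)
    (hd : d ≤ x - y) (hd' : d' ≤ 2) (hx : x ≤ N) (hy : x - y ≤ q' - q) :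
    τ₈ + 1 + 1 + 6 * x + 2 + 1 ≤
      τ + 9 * w + 54 * x + 57 * (Nat.log 2 N + 1) * (q' - q) + 130 := by
  have t1 : 24 * (x - y + 1) * (Nat.log 2 d + 1) ≤ 24 + 48 * ((Nat.log 2 N + 1) * (q' - q)) := by
    -- Without new items the sort costs a constant, and no logarithm may be charged.
    rcases Nat.eq_zero_or_pos (x - y) with hz | hz
    · rw [hz] at hd ⊢
      rw [Nat.le_zero.1 hd]; simp
    · have b2 : Nat.log 2 d ≤ Nat.log 2 N := Nat.log_mono_right (by lia)
      calc 24 * (x - y + 1) * (Nat.log 2 d + 1)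
          ≤ 24 * (2 * (q' - q)) * (Nat.log 2 N + 1) := by gcongr; lia
        _ = 48 * ((Nat.log 2 N + 1) * (q' - q)) := by ring
        _ ≤ _ := Nat.le_add_left _ _
  have t2 : 24 * (x - 0 + 1) * (Nat.log 2 d' + 1) ≤ 48 * x + 48 := by
    have b2 : Nat.log 2 d' ≤ 1 := Nat.lt_succ_iff.1 (Nat.log_lt_of_lt_pow' (by simp) (by omega))
    calc 24 * (x - 0 + 1) * (Nat.log 2 d' + 1)
        ≤ 24 * (x - 0 + 1) * (1 + 1) := by gcongr
      _ = _ := by rw [Nat.sub_zero]; ring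
  have t3 : q' - q ≤ (Nat.log 2 N + 1) * (q' - q) := Nat.le_mul_of_pos_left _ (Nat.succ_pos _)
  rw [mul_assoc 57]
  generalize (Nat.log 2 N + 1) * (q' - q) = A at t1 t3 ⊢
  generalize 24 * (x - y + 1) * (Nat.log 2 d + 1) = B at t1 h6
  generalize 24 * (x - 0 + 1) * (Nat.log 2 d' + 1) = C at t2 h8
  omega

open Classical in
/-- One step of the sweep. -/
theorem sweepBody_wp {M n N : ℕ} {c : Bool} {lo : ℕ → ℝ} {Q : St → ℕ → Prop} {h : St} {τ : ℕ}
    (pre : SweepPre c M n N lo h) {i q w e : ℕ} (hi : h.iv 14 = i) (hin : i < n)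
    (hq : h.iv 12 = q) (hw : h.iv 13 = w) (he : h.iv 11 = e) (hqN : q ≤ N) (hwq : w ≤ q)
    (qp : ℝ) (hqp : qp ≤ h.ra 0 i)
    (hL : seg (h.ia 1) 0 w = (seg (h.ia 4) 0 q).filter fun t => rel c qp (h.items.hi t))
    (hq1 : ∀ j < q, rel c (h.ra 4 j) qp)
    (hs : ∀ a b, a ≤ b → b < w → h.items.key (h.ia 1 a) qp ≤ h.items.key (h.ia 1 b) qp)
    (heM : e + Multiset.card (active c N lo h.items.hi (h.ra 0 i)) ≤ M)
    (hQ : ∀ h' τ' q' w', h'.iv 14 = i + 1 → h'.iv 12 = q' → h'.iv 13 = w' → h'.iv 11 = e + w' →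
      q ≤ q' → q' ≤ N → w' ≤ q' → w' = Multiset.card (active c N lo h.items.hi (h.ra 0 i)) →
      seg (h'.ia 1) 0 w' = (seg (h.ia 4) 0 q').filter
        (fun t => rel c (h.ra 0 i) (h.items.hi t)) →
      (∀ j < q', rel c (h.ra 4 j) (h.ra 0 i)) →
      (∀ a b, a ≤ b → b < w' →
        h.items.key (h'.ia 1 a) (h.ra 0 i) ≤ h.items.key (h'.ia 1 b) (h.ra 0 i)) →
      seg (h'.arr 2) 0 (e + w') = seg (h.arr 2) 0 e +
        h.items.events c N lo (h.ra 0 i) (h.beta (h.ia 0 i)) →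
      desc (h'.ra 2) 0 (e + w') ≤ desc (h.ra 2) 0 e + 2 →
      τ' ≤ τ + 9 * w + 54 * w' + 57 * (Nat.log 2 N + 1) * (q' - q) + 130 → Q h' τ') :
    wp M (sweepBody c) Q h τ := by
  have p4 := pre.items
  have range4 : ∀ j < N, h.ia 4 j < N := by
    intro j hj
    have : h.arr 4 j ∈ seg (h.arr 4) 0 N := (mem_seg _).2 ⟨j, Nat.zero_le _, hj, rfl⟩
    rw [p4, Multiset.mem_map] at this
    obtain ⟨t, ht, ht'⟩ := this
    have := congrArg Prod.snd ht'
    simp only [St.arr] at this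
    rw [← this]; simpa using ht
  have nodup4 : ∀ k ≤ N, (seg (h.ia 4) 0 k).Nodup := by
    intro k hk
    have : seg (h.ia 4) 0 N = Multiset.range N := by
      have := congrArg (Multiset.map Prod.snd) p4
      rw [map_seg, Multiset.map_map] at this
      exact this.trans (by simp)
    rw [← seg_add _ (Nat.zero_le k) hk] at this
    exact Multiset.nodup_of_le (Multiset.le_add_right _ _) (this ▸ Multiset.nodup_range N)
  have hlo4 : ∀ j < N, h.ra 4 j = lo (h.ia 4 j) := by
    intro j hj
    have : h.arr 4 j ∈ seg (h.arr 4) 0 N := (mem_seg _).2 ⟨j, Nat.zero_le _, hj, rfl⟩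
    rw [p4, Multiset.mem_map] at this
    obtain ⟨t, -, ht'⟩ := this
    rw [St.arr, Prod.mk.injEq] at ht'
    rw [← ht'.1, ← ht'.2]
  have memL : ∀ j < w, h.ia 1 j ∈ active c N lo h.items.hi qp := by
    intro j hj
    have : h.ia 1 j ∈ seg (h.ia 1) 0 w := (mem_seg _).2 ⟨j, Nat.zero_le _, hj, rfl⟩
    rw [hL, Multiset.mem_filter] at this
    obtain ⟨l, -, l2, l3⟩ := (mem_seg _).1 this.1
    rw [mem_active, ← l3, ← hlo4 l (by lia)]
    exact ⟨range4 l (by lia), hq1 l l2, l3 ▸ this.2⟩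
  have hnM := pre.nM
  have hNM := pre.NM
  refine wp_seq (wp_rset (by simp [hi]; lia) (wp_seq ?_))
  generalize ha0 : h.setr 1 (RE.eval h (RE.get 0 (IE.var 14))) = a0
  simp only [RE.eval, IE.eval, hi] at ha0
  refine filterCode_wp (w := w) (by simp [← ha0, hw]) (by lia) (fun j hj => ?_)
    (fun s t => h.items.key s qp ≤ h.items.key t qp) (by simpa [← ha0] using hs) ?_
  · simp only [← ha0, St.setr_ia]
    exact (mem_active.1 (memL j hj)).1.trans hNM
  intro a1 τ1 y fr1 y1 y2 y3 y4 y5 y6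
  have e0D : a0.items = h.items := by rw [← ha0]; rfl
  have e01 : a0.ia 1 = h.ia 1 := by rw [← ha0]; rfl
  have e0r : a0.rv 1 = h.ra 0 i := by simp [← ha0]
  rw [e0D, e01, e0r] at y3
  rw [e0D, e0r] at y4
  have e1D : a1.items = h.items := by
    rw [← e0D]
    simp only [St.items]
    rw [fr1.ra 7 (by simp [filterCode, pushCode, Cmd.putsR]),
      fr1.ra 8 (by simp [filterCode, pushCode, Cmd.putsR]),
      fr1.ra 9 (by simp [filterCode, pushCode, Cmd.putsR]),
      fr1.ra 10 (by simp [filterCode, pushCode, Cmd.putsR]),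
      fr1.ra 11 (by simp [filterCode, pushCode, Cmd.putsR]),
      fr1.ia 7 (by simp [filterCode, pushCode, Cmd.putsI])]
  have e1r : a1.rv 1 = h.ra 0 i := by rw [fr1.rv 1 (by simp [filterCode, pushCode, Cmd.setsR]), e0r]
  have e1a : a1.ra 4 = h.ra 4 := by
    rw [fr1.ra 4 (by simp [filterCode, pushCode, Cmd.putsR]), ← ha0]; rfl
  have e1b : a1.ia 4 = h.ia 4 := by
    rw [fr1.ia 4 (by simp [filterCode, pushCode, Cmd.putsI]), ← ha0]; rfl
  refine wp_seq (wp_iset_eq (by simp) fun a2 ha2 => wp_seq ?_)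
  simp only [IE.eval, y1] at ha2
  refine bornCode_wp (N := N) (q := q) (x := y) ?_ ?_ hqN (by simp [ha2, y1]) (by lia) hNM ?_ ?_
  · simp only [ha2, St.seti_iv]
    rw [if_neg (by lia), fr1.iv 10 (by simp [filterCode, pushCode, Cmd.setsI]), ← ha0]
    exact pre.iv10
  · simp only [ha2, St.seti_iv]
    rw [if_neg (by lia), fr1.iv 12 (by simp [filterCode, pushCode, Cmd.setsI]), ← ha0]
    exact hq
  · intro j hj
    simp only [ha2, St.seti_ia, e1b]
    exact (range4 j hj).trans hNM
  intro a3 τ3 q' x fr3 x1 x2 x3 x4 x5 x6 x7 x8 x9 x10 x11 x12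
  have e2D : a2.items = h.items := by rw [← e1D, ha2]; rfl
  have e2r : a2.rv 1 = h.ra 0 i := by simp [ha2, e1r]
  have e2a : a2.ra 4 = h.ra 4 := by rw [← e1a, ha2]; rfl
  have e2b : a2.ia 4 = h.ia 4 := by rw [← e1b, ha2]; rfl
  have e2c : a2.arr 1 = a1.arr 1 := by rw [ha2]; rfl
  rw [e2D, e2b, e2r] at x9
  rw [e2D, e2r] at x10
  rw [e2a, e2r] at x7 x8
  rw [e2c] at x11
  have e3D : a3.items = h.items := by
    rw [← e2D]
    simp only [St.items]
    rw [fr3.ra 7 (by simp [bornCode, pushCode, Cmd.putsR]),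
      fr3.ra 8 (by simp [bornCode, pushCode, Cmd.putsR]),
      fr3.ra 9 (by simp [bornCode, pushCode, Cmd.putsR]),
      fr3.ra 10 (by simp [bornCode, pushCode, Cmd.putsR]),
      fr3.ra 11 (by simp [bornCode, pushCode, Cmd.putsR]),
      fr3.ia 7 (by simp [bornCode, pushCode, Cmd.putsI])]
  have rel4 : ∀ j < q', rel c (h.ra 4 j) (h.ra 0 i) := by
    intro j hj
    by_cases hjq : j < q
    · exact rel_of_rel_of_le (hq1 j hjq) hqp
    · exact x7 j (by lia) hj
  have hact : active c N lo h.items.hi (h.ra 0 i) =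
      (seg (h.ia 4) 0 q').filter fun t => rel c (h.ra 0 i) (h.items.hi t) :=
    active_eq_filter p4 pre.itemsSorted x4 rel4 x8
  have e31 : ∀ j < y, a3.ia 1 j = a1.ia 1 j := fun j hj => congrArg Prod.snd (x11 j hj)
  have e31' : ∀ j < y, a3.ra 1 j = a1.ra 1 j := fun j hj => congrArg Prod.fst (x11 j hj)
  have seg3 : seg (a3.ia 1) 0 x = active c N lo h.items.hi (h.ra 0 i) := by
    rw [hact, ← seg_add _ (Nat.zero_le q) x3, Multiset.filter_add, ← x9,
      ← seg_add _ (Nat.zero_le y) x5]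
    congr 1
    rw [seg_congr (g := a1.ia 1) fun l _ hl => e31 l hl, y3, hL, Multiset.filter_filter]
    refine Multiset.filter_congr fun t _ => ⟨fun k => k.1, fun k => ⟨k, rel_of_le_of_rel hqp k⟩⟩
  have hx : x = Multiset.card (active c N lo h.items.hi (h.ra 0 i)) := by
    rw [← seg3, card_seg, Nat.sub_zero]
  have key3 : ∀ j < x, a3.ra 1 j = h.items.key (a3.ia 1 j) (h.ra 0 i) := by
    intro j hj
    by_cases hjy : j < y
    · rw [e31' j hjy, e31 j hjy]; exact y4 j hjy
    · exact x10 j (by lia) hj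
  have mem1 : ∀ j < y, a1.ia 1 j ∈ active c N lo h.items.hi qp ∧
      a1.ia 1 j ∈ active c N lo h.items.hi (h.ra 0 i) := by
    intro j hj
    have h1 : a1.ia 1 j ∈ seg (a1.ia 1) 0 y := (mem_seg _).2 ⟨j, Nat.zero_le _, hj, rfl⟩
    rw [y3, Multiset.mem_filter] at h1
    obtain ⟨l, -, l2, l3⟩ := (mem_seg _).1 h1.1
    have h2 := memL l l2
    rw [l3] at h2
    refine ⟨h2, ?_⟩
    rw [mem_active] at h2 ⊢
    exact ⟨h2.1, rel_of_rel_of_le h2.2.1 hqp, h1.2⟩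
  have nodup1 : (seg (a1.ia 1) 0 y).Nodup := by
    rw [y3, hL]
    exact ((nodup4 q hqN).filter _).filter _
  -- The survivors were sorted by their angles at the previous radius and keep their cyclic order,
  -- so their new angles have at most one descent.
  have desc1 : desc (a3.ra 1) 0 y ≤ 1 := by
    rw [desc_congr (g := fun j => h.items.key (a1.ia 1 j) (h.ra 0 i)) fun l _ hl => by
      rw [e31' l hl, y4 l hl]]
    exact pre.order _ _ qp _ hqp mem1 (seg_injOn nodup1) y5
  -- the new items are sorted
  refine wp_seq (wp_iset_eq (by simp) fun a4 ha4 => wp_seq (wp_iset_eq (by simp)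
    fun a5 ha5 => wp_seq ?_))
  simp only [IE.eval] at ha4 ha5
  have e3y : a3.iv 18 = y := by
    rw [fr3.iv 18 (by simp [bornCode, pushCode, Cmd.setsI])]; simp [ha2]
  rw [e3y] at ha4
  have e5a : a5.arr 1 = a3.arr 1 := by rw [ha5, ha4]; rfl
  have e5r : a5.ra 1 = a3.ra 1 := by rw [ha5, ha4]; rfl
  have e5D : a5.items = h.items := by rw [← e3D, ha5, ha4]; rfl
  refine sortCode_wp (lo := y) (hi := x) (by lia) (by lia) (by simp [ha5, ha4])
    (by simp [ha5, ha4, x2]) x5 (by lia) ?_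
  intro a6 τ6 fr6 z1 z2 z3 z4
  rw [e5a] at z1 z2
  rw [e5r] at z4
  have e6D : a6.items = h.items := by rw [← e5D]; exact sortCode_frame_items fr6
  have seg6 : seg (a6.arr 1) 0 x = seg (a3.arr 1) 0 x := by
    rw [← seg_add _ (Nat.zero_le y) x5, ← seg_add (a3.arr 1) (Nat.zero_le y) x5, z1,
      seg_congr fun l _ hl => z2 l (.inl hl)]
  -- One descent among the survivors, one at the joint `y`, and none in the sorted block of new
  -- items.
  have desc6 : desc (a6.ra 1) 0 x ≤ 2 := by
    have d1 := desc_split (a6.ra 1) 0 y x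
    have d2 : desc (a6.ra 1) y x = 0 := desc_eq_zero fun l l1 l2 => z3 _ _ (by lia) (by lia) l2
    have d3 : desc (a6.ra 1) 0 y = desc (a3.ra 1) 0 y :=
      desc_congr fun l _ hl => congrArg Prod.fst (z2 l (.inl hl))
    lia
  refine wp_seq (wp_iset_eq (by simp) fun a7 ha7 => wp_seq ?_)
  simp only [IE.eval] at ha7
  have e7a : a7.arr 1 = a6.arr 1 := by rw [ha7]; rfl
  have e7r : a7.ra 1 = a6.ra 1 := by rw [ha7]; rfl
  have e7D : a7.items = h.items := by rw [← e6D, ha7]; rfl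
  refine sortCode_wp (lo := 0) (hi := x) (by lia) (by lia) (by simp [ha7])
    ?_ (Nat.zero_le _) (by lia) ?_
  · simp only [ha7, St.seti_iv]
    rw [if_neg (by lia), fr6.iv 41 (Cmd.sets_sort 1 (by lia))]
    simp [ha5, ha4, x2]
  intro a8 τ8 fr8 u1 u2 u3 u4
  rw [e7a] at u1 u2
  rw [e7r] at u4
  have e8D : a8.items = h.items := by rw [← e7D]; exact sortCode_frame_items fr8
  have seg8 : seg (a8.arr 1) 0 x = seg (a3.arr 1) 0 x := by rw [u1, seg6]
  have seg8' : seg (a8.ia 1) 0 x = active c N lo h.items.hi (h.ra 0 i) := by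
    have := congrArg (Multiset.map Prod.snd) seg8
    rw [map_seg, map_seg] at this
    rw [← seg3]
    exact this
  have key8 : ∀ j < x, a8.ra 1 j = h.items.key (a8.ia 1 j) (h.ra 0 i) := by
    intro j hj
    have : a8.arr 1 j ∈ seg (a8.arr 1) 0 x := (mem_seg _).2 ⟨j, Nat.zero_le _, hj, rfl⟩
    rw [seg8] at this
    obtain ⟨l, -, l2, l3⟩ := (mem_seg _).1 this
    have k := key3 l l2
    rw [St.arr, St.arr, Prod.mk.injEq] at l3
    rw [← l3.1, ← l3.2, k]
  -- variables and arrays that are unchanged since the beginning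
  have back : ∀ v, v < 10 ∨ v = 11 ∨ v = 14 → a8.iv v = h.iv v := by
    intro v hv
    rw [fr8.iv v (Cmd.sets_sort 1 (by lia)), ha7, St.seti_iv, if_neg (by lia),
      fr6.iv v (Cmd.sets_sort 1 (by lia)), ha5, St.seti_iv, if_neg (by lia), ha4, St.seti_iv,
      if_neg (by lia), fr3.iv v (by simp [bornCode, pushCode, Cmd.setsI]; lia), ha2, St.seti_iv,
      if_neg (by lia), fr1.iv v (by simp [filterCode, pushCode, Cmd.setsI]; lia), ← ha0,
      St.setr_iv]
  have backa : ∀ v, v ≠ 1 → v ≠ 3 → a8.ia v = h.ia v ∧ a8.ra v = h.ra v := by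
    intro v hv hv3
    constructor
    · rw [fr8.ia v (Cmd.puts_sort ⟨hv, hv3⟩).1, ha7, St.seti_ia, fr6.ia v (Cmd.puts_sort ⟨hv, hv3⟩).1,
      ha5, St.seti_ia, ha4, St.seti_ia, fr3.ia v (by simp [bornCode, pushCode, Cmd.putsI]; lia),
      ha2, St.seti_ia, fr1.ia v (by simp [filterCode, pushCode, Cmd.putsI]; lia), ← ha0,
      St.setr_ia]
    · rw [fr8.ra v (Cmd.puts_sort ⟨hv, hv3⟩).2, ha7, St.seti_ra, fr6.ra v (Cmd.puts_sort ⟨hv, hv3⟩).2,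
      ha5, St.seti_ra, ha4, St.seti_ra, fr3.ra v (by simp [bornCode, pushCode, Cmd.putsR]; lia),
      ha2, St.seti_ra, fr1.ra v (by simp [filterCode, pushCode, Cmd.putsR]; lia), ← ha0,
      St.setr_ra]
  have backlen : a8.len = h.len := by
    rw [fr8.len, ha7, St.seti_len, fr6.len, ha5, St.seti_len, ha4, St.seti_len, fr3.len, ha2,
      St.seti_len, fr1.len, ← ha0, St.setr_len]
  have backinp : a8.inp = h.inp := by
    rw [fr8.inp, ha7, St.seti_inp, fr6.inp, ha5, St.seti_inp, ha4, St.seti_inp, fr3.inp, ha2,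
      St.seti_inp, fr1.inp, ← ha0, St.setr_inp]
  have e8x : a8.iv 16 = x := by
    rw [fr8.iv 16 (Cmd.sets_sort 1 (by lia)), ha7, St.seti_iv, if_neg (by lia),
      fr6.iv 16 (Cmd.sets_sort 1 (by lia)), ha5, ha4]
    simp [x2]
  have e8q : a8.iv 12 = q' := by
    rw [fr8.iv 12 (Cmd.sets_sort 1 (by lia)), ha7, St.seti_iv, if_neg (by lia),
      fr6.iv 12 (Cmd.sets_sort 1 (by lia)), ha5, ha4]
    simp [x1]
  have hpt := pre.pts i hin
  have hlen := pre.len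
  refine wp_seq (wp_iset_eq (by simp) fun a9 ha9 => wp_seq (wp_rset ?_ (wp_seq ?_)))
  · simp [relX, relY, pointE, ha9, back, backa, backlen, hi]
    lia
  simp only [IE.eval, e8x] at ha9
  generalize ha10 : a9.setr 2 _ = a10
  have e10b : a10.rv 2 = h.beta (h.ia 0 i) := by
    simp [← ha10, ha9, relX, relY, pointE, St.beta, back, backa, backinp, hi]
    congr 2 <;> congr 2 <;> ring
  have e10a : a10.arr 1 = a8.arr 1 := by rw [← ha10, ha9]; rfl
  refine emitCode_wp (w := x) (e := e) (by simp [← ha10, ha9]) (by simp [← ha10, ha9, back, he])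
    (by lia) (by lia) (fun j hj => ?_) ?_
  · have : a8.ia 1 j ∈ seg (a8.ia 1) 0 x := (mem_seg _).2 ⟨j, Nat.zero_le _, hj, rfl⟩
    rw [seg8', mem_active] at this
    simp only [← ha10, ha9, St.setr_ia, St.seti_ia]
    lia
  intro a11 fr11 v1 v2 v3
  refine wp_iset_eq (by simp) fun a12 ha12 => ?_
  simp only [IE.eval] at ha12
  have e12a : a12.arr 2 = a11.arr 2 := by rw [ha12]; rfl
  have e12r : a12.ra 2 = a11.ra 2 := by rw [ha12]; rfl
  have e10D : a10.items = h.items := by rw [← e8D, ← ha10, ha9]; rfl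
  have e10r : a10.ra 1 = a8.ra 1 := by rw [← ha10, ha9]; rfl
  have e10i : a10.ia 1 = a8.ia 1 := by rw [← ha10, ha9]; rfl
  have e10l : a10.ia 7 = h.items.lab := congrArg Items.lab e10D
  have e10c : a10.arr 2 = h.arr 2 := by
    funext l
    simp [St.arr, ← ha10, ha9, backa]
  have e11i : a11.ia 1 = a8.ia 1 := by
    rw [fr11.ia 1 (by simp [emitCode, Cmd.putsI]), e10i]
  have e12i : a12.ia 1 = a8.ia 1 := by rw [← e11i, ha12]; rfl
  rw [e10c] at v2
  rw [e10r, e10i, e10b, e10l] at v3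
  refine hQ a12 _ q' x ?_ ?_ ?_ ?_ x3 x4 (by lia) hx ?_ rel4 ?_ ?_ ?_ ?_
  · simp only [ha12, St.seti_iv, if_true]
    rw [fr11.iv 14 (by simp [emitCode, Cmd.setsI]), ← ha10, St.setr_iv, ha9, St.seti_iv,
      if_neg (by lia), back 14 (by lia), hi]
  · simp only [ha12, St.seti_iv]
    rw [if_neg (by lia), fr11.iv 12 (by simp [emitCode, Cmd.setsI]), ← ha10, St.setr_iv, ha9,
      St.seti_iv, if_neg (by lia), e8q]
  · simp only [ha12, St.seti_iv]
    rw [if_neg (by lia), fr11.iv 13 (by simp [emitCode, Cmd.setsI]), ← ha10, St.setr_iv, ha9,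
      St.seti_iv, if_pos rfl]
  · simp only [ha12, St.seti_iv]
    rw [if_neg (by lia), v1]
  · rw [e12i, seg8', hact]
  · intro a b hab hb
    rw [e12i, ← key8 a (by lia), ← key8 b hb]
    exact u3 a b (by lia) hab hb
  · rw [e12a, ← seg_add _ (Nat.zero_le e) (by lia), seg_congr fun l _ hl => v2 l hl,
      seg_add_right, Items.events, ← seg8', map_seg]
    congr 1
    refine seg_congr fun l _ hl => ?_
    rw [v3 l hl, key8 l hl]
    rfl
  · rw [e12r]
    -- The events of a point add at most two descents: one where they are appended, and one where
    -- the angles relative to the point wrap around.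
    have d1 := desc_split (a11.ra 2) 0 e (e + x)
    have d2 : desc (a11.ra 2) 0 e = desc (h.ra 2) 0 e :=
      desc_congr fun l _ hl => congrArg Prod.fst (v2 l hl)
    have d3 : desc (a11.ra 2) e (e + x) ≤ 1 := by
      rw [← desc_shift, desc_congr (f := fun j => a11.ra 2 (e + j))
        (g := fun j => wrap (a8.ra 1 j - h.beta (h.ia 0 i)))
        fun l _ hl => congrArg Prod.fst (v3 l hl)]
      exact desc_wrap_le _ fun a b hab hb => u3 a b (by lia) hab hb
    lia
  · exact sweep_time y6 x12 z4 u4 (desc_le _ _ _) desc6 (by lia) x6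

theorem Frame.sweepBody {c : Bool} {h h' : St} (f : Frame (sweepBody c) h h') :
    (∀ v, v < 2 ∨ v = 10 → h'.iv v = h.iv v) ∧
      (∀ v, v = 0 ∨ 3 < v → h'.ia v = h.ia v ∧ h'.ra v = h.ra v) ∧ h'.items = h.items ∧
      h'.beta = h.beta := by
  have h1 : ∀ v, v < 2 ∨ v = 10 → h'.iv v = h.iv v := fun v hv => f.iv v (by
    simp [FixedMCR.sweepBody, filterCode, bornCode, pushCode, emitCode, sortCode, passCode,
      mergeCode, scanCode, copyCode, Cmd.setsI]; omega)
  have h2 : ∀ v, v = 0 ∨ 3 < v → h'.ia v = h.ia v := fun v hv => f.ia v (by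
    simp [FixedMCR.sweepBody, filterCode, bornCode, pushCode, emitCode, sortCode, passCode,
      mergeCode, scanCode, copyCode, Cmd.putsI]; omega)
  have h3 : ∀ v, v = 0 ∨ 3 < v → h'.ra v = h.ra v := fun v hv => f.ra v (by
    simp [FixedMCR.sweepBody, filterCode, bornCode, pushCode, emitCode, sortCode, passCode,
      mergeCode, scanCode, copyCode, Cmd.putsR]; omega)
  refine ⟨h1, fun v hv => ⟨h2 v hv, h3 v hv⟩, ?_, ?_⟩
  · simp [St.items, h2 7 (by simp), h3 7 (by simp), h3 8 (by simp), h3 9 (by simp),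
      h3 10 (by simp), h3 11 (by simp)]
  · funext p
    simp [St.beta, f.inp, h1 1 (by simp)]

theorem SweepPre.of_frame {c : Bool} {M n N : ℕ} {lo : ℕ → ℝ} {h h' : St}
    (pre : SweepPre c M n N lo h) (f : Frame (sweepBody c) h h') : SweepPre c M n N lo h' := by
  obtain ⟨h1, h2, h3, -⟩ := f.sweepBody
  have h4 : h'.arr 4 = h.arr 4 := by
    funext j
    rw [St.arr, St.arr, (h2 4 (by simp)).1, (h2 4 (by simp)).2]
  constructor
  · rw [h1 0 (by simp), pre.iv0]
  · rw [h1 10 (by simp), pre.iv10]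
  · rw [f.len, h1 1 (by simp), pre.len]
  · exact pre.nM
  · exact pre.NM
  · rw [(h2 0 (by simp)).1]; exact pre.pts
  · rw [(h2 0 (by simp)).2]; exact pre.sorted
  · rw [h4]; exact pre.items
  · rw [(h2 4 (by simp)).2]; exact pre.itemsSorted
  · rw [h3]; exact pre.order

open Classical in
-- Amortization: the length of the list at a point is the number of events just emitted for it, so
-- scanning the list for the next point is paid by these events. Births cost `log N` each, and there
-- are at most `N` of them in the sweep.
theorem sweepCode_wp {M n N : ℕ} {c : Bool} {lo : ℕ → ℝ} {Q : St → ℕ → Prop} {h : St} {τ : ℕ}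
    (pre : SweepPre c M n N lo h) {e K : ℕ} (he : h.iv 11 = e)
    (hK : K = ∑ i ∈ Finset.range n, Multiset.card (active c N lo h.items.hi (h.ra 0 i)))
    (hM : e + K ≤ M)
    (hQ : ∀ h' τ', Frame (sweepCode c) h h' → h'.iv 11 = e + K →
      seg (h'.arr 2) 0 (e + K) = seg (h.arr 2) 0 e +
        ∑ i ∈ Finset.range n, h.items.events c N lo (h.ra 0 i) (h.beta (h.ia 0 i)) →
      desc (h'.ra 2) 0 (e + K) ≤ desc (h.ra 2) 0 e + 2 * n →
      τ' ≤ τ + 63 * K + 57 * (Nat.log 2 N + 1) * N + 131 * n + 4 → Q h' τ') :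
    wp M (sweepCode c) Q h τ := by
  apply wp_frame
  refine wp_seq (wp_iset (by simp) (wp_seq (wp_iset (by simp) (wp_seq (wp_iset_eq (by simp)
    fun a0 ha0 => ?_)))))
  simp only [IE.eval] at ha0
  have pre0 : SweepPre c M n N lo a0 := by
    obtain ⟨p1, p2, p3, p4, p5, p6, p7, p8, p9, p10⟩ := pre
    constructor
    any_goals assumption
    all_goals simp [*]
    · exact p6
    · exact p7
    · exact p8
    · exact p9
    · exact p10
  have b0 : a0.items = h.items := by rw [ha0]; rfl
  have b1 : a0.ra 0 = h.ra 0 := by rw [ha0]; rfl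
  have b2 : a0.ia 0 = h.ia 0 := by rw [ha0]; rfl
  have b3 : a0.beta = h.beta := by funext p; simp [ha0, St.beta]
  have b4 : a0.ia 4 = h.ia 4 := by rw [ha0]; rfl
  have b5 : a0.ra 4 = h.ra 4 := by rw [ha0]; rfl
  set A : ℕ → ℕ := fun i => Multiset.card (active c N lo h.items.hi (h.ra 0 i)) with hA
  refine wp_loop_frame (fun h' τ' => ∃ i q w e' qp, h'.iv 14 = i ∧ i ≤ n ∧ h'.iv 12 = q ∧
    h'.iv 13 = w ∧ h'.iv 11 = e' ∧ q ≤ N ∧ w ≤ q ∧ (i < n → qp ≤ h.ra 0 i) ∧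
    seg (h'.ia 1) 0 w = (seg (h.ia 4) 0 q).filter (fun t => rel c qp (h.items.hi t)) ∧
    (∀ j < q, rel c (h.ra 4 j) qp) ∧
    (∀ a b, a ≤ b → b < w → h.items.key (h'.ia 1 a) qp ≤ h.items.key (h'.ia 1 b) qp) ∧
    e' = e + ∑ l ∈ Finset.range i, A l ∧
    seg (h'.arr 2) 0 e' = seg (h.arr 2) 0 e +
      ∑ l ∈ Finset.range i, h.items.events c N lo (h.ra 0 l) (h.beta (h.ia 0 l)) ∧
    desc (h'.ra 2) 0 e' ≤ desc (h.ra 2) 0 e + 2 * i ∧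
    -- The summand `9 * w` prepays the scan of the current list at the next point; thus an event is
    -- charged `54 + 9 = 63`.
    τ' + 9 * w ≤ τ + 3 + 63 * (∑ l ∈ Finset.range i, A l) + 57 * (Nat.log 2 N + 1) * q + 131 * i)
    (fun h' => n - h'.iv 14) ?_ ?_ ?_ ?_
  · have r2 : a0.arr 2 = h.arr 2 := by rw [ha0]; rfl
    have r3 : a0.ra 2 = h.ra 2 := by rw [ha0]; rfl
    exact ⟨0, 0, 0, e, h.ra 0 0, by simp [ha0], Nat.zero_le _, by simp [ha0], by simp [ha0],
      by simp [ha0, he], Nat.zero_le _, le_rfl, fun _ => le_rfl, by simp [seg_self], by simp,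
      by simp, by simp, by simp [r2], by simp [r3], by simp⟩
  · intro h' τ' _ _
    simp
  · rintro h' τ' fr ⟨i, q, w, e', qp, i1, i2, i3, i4, i5, i6, i7, i8, i9, i10, i11, i12, i13, i14,
      i15⟩ hb
    have pre' := pre0.of_frame fr
    obtain ⟨-, f2, f3, f4⟩ := fr.sweepBody
    simp only [BE.eval, IE.eval, i1, pre'.iv0] at hb
    rw [b0] at f3
    rw [b3] at f4
    have g1 : h'.ra 0 = h.ra 0 := by rw [(f2 0 (by simp)).2, b1]
    have g2 : h'.ia 0 = h.ia 0 := by rw [(f2 0 (by simp)).1, b2]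
    have g3 : h'.ra 4 = h.ra 4 := by rw [(f2 4 (by simp)).2, b5]
    have g4 : h'.ia 4 = h.ia 4 := by rw [(f2 4 (by simp)).1, b4]
    have hsum : e' + A i ≤ M := by
      have : ∑ l ∈ Finset.range (i + 1), A l ≤ K := by
        rw [hK]
        exact Finset.sum_le_sum_of_subset (Finset.range_mono hb)
      rw [Finset.sum_range_succ] at this
      lia
    refine sweepBody_wp pre' i1 hb i3 i4 i5 i6 i7 qp (by rw [g1]; exact i8 hb)
      (by rw [g4, f3]; exact i9) (by rw [g3]; exact i10) (by rw [f3]; exact i11)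
      (by rw [f3, g1]; exact hsum) ?_
    rw [f3, f4, g1, g2, g3, g4]
    intro h'' τ'' q' w' j1 j2 j3 j4 j5 j6 j7 j8 j9 j10 j11 j12 j13 j14
    have j8' : w' = A i := j8
    refine ⟨⟨i + 1, q', w', e' + w', h.ra 0 i, j1, hb, j2, j3, j4, j6, j7,
      fun hi => pre.sorted _ _ (by lia) hi, j9, j10, j11, ?_, ?_, by lia, ?_⟩, by lia⟩
    · rw [Finset.sum_range_succ, i12, j8']; ring
    · rw [j12, i13, Finset.sum_range_succ, add_assoc]
    · rw [Finset.sum_range_succ, ← j8']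
      have : 57 * (Nat.log 2 N + 1) * q' =
          57 * (Nat.log 2 N + 1) * q + 57 * (Nat.log 2 N + 1) * (q' - q) := by
        rw [← mul_add]; congr 1; lia
      rw [this]
      generalize 57 * (Nat.log 2 N + 1) * (q' - q) = X at j14 ⊢
      generalize 57 * (Nat.log 2 N + 1) * q = Y at i15 ⊢
      clear * - i15 j14
      omega
  · rintro h' τ' fr ⟨i, q, w, e', qp, i1, i2, i3, i4, i5, i6, i7, i8, i9, i10, i11, i12, i13, i14,
      i15⟩ hb hf
    have pre' := pre0.of_frame fr
    simp only [BE.eval, IE.eval, i1, pre'.iv0] at hb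
    obtain rfl : i = n := by lia
    rw [← hK] at i12 i15
    subst i12
    refine hQ h' _ hf i5 i13 i14 ?_
    have : 57 * (Nat.log 2 N + 1) * q ≤ 57 * (Nat.log 2 N + 1) * N := by gcongr
    clear * - i15 this
    omega

end FixedMCR

namespace FixedMCR

/-! ## The items of the sweeps -/

/-- `p` for all values of the variable `v` below `b`. -/
def forCode (v : ℕ) (b : IE) (p : Cmd) : Cmd :=
  .iset v (.const 0) ;; .loop (.ilt (.var v) b) (p ;; .iset v (.add (.var v) (.const 1)))

/-- The invariant has to be insensitive to the variables of type integer that the loop control sets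
(`hinv`). Two units per round, besides the cost `T` of the body, pay for the increment and the test.
-/
theorem wp_for {M v N : ℕ} {b : IE} {p : Cmd} {Q : St → ℕ → Prop} {h : St} {τ : ℕ} (T : ℕ)
    (hv : ¬ p.setsI v) (Inv : ℕ → St → Prop)
    (hb : ∀ h', Frame (forCode v b p) h h' → b.ok M h' ∧ b.eval h' = N)
    (hinv : ∀ i h' x, Inv i h' → Inv i (h'.seti v x)) (h0 : Inv 0 h)
    (step : ∀ i < N, ∀ h' τ', Frame (forCode v b p) h h' → h'.iv v = i → Inv i h' →
      wp M p (fun h'' τ'' => Inv (i + 1) h'' ∧ τ'' ≤ τ' + T) h' τ')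
    (hQ : ∀ h' τ', Frame (forCode v b p) h h' → Inv N h' → τ' ≤ τ + (T + 2) * N + 2 → Q h' τ') :
    wp M (forCode v b p) Q h τ := by
  refine wp_seq (wp_iset_eq (by simp) fun a0 ha0 => ?_)
  have fr0 : ∀ h', Frame (p ;; .iset v (.add (.var v) (.const 1))) a0 h' →
      Frame (forCode v b p) h h' := by
    intro h' f
    simp only [IE.eval] at ha0
    refine ⟨by rw [f.len, ha0]; rfl, by rw [f.inp, ha0]; rfl, fun x hx => ?_, fun x hx => ?_,
      fun x hx => ?_, fun x hx => ?_⟩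
    · simp [forCode, Cmd.setsI] at hx
      rw [f.iv x (by simp [Cmd.setsI]; tauto), ha0, St.seti_iv, if_neg hx.1]
    · simp [forCode, Cmd.setsR] at hx
      rw [f.rv x (by simp [Cmd.setsR]; tauto), ha0]; rfl
    · simp [forCode, Cmd.putsI] at hx
      rw [f.ia x (by simp [Cmd.putsI]; tauto), ha0]; rfl
    · simp [forCode, Cmd.putsR] at hx
      rw [f.ra x (by simp [Cmd.putsR]; tauto), ha0]; rfl
  refine wp_loop_frame (fun h' τ' => ∃ i, h'.iv v = i ∧ i ≤ N ∧ Inv i h' ∧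
    τ' ≤ τ + 1 + (T + 2) * i) (fun h' => N - h'.iv v) ?_ ?_ ?_ ?_
  · exact ⟨0, by simp [ha0], Nat.zero_le _, by rw [ha0]; exact hinv _ _ _ h0, by simp⟩
  · intro h' τ' f _
    simpa using (hb h' (fr0 h' f)).1
  · rintro h' τ' f ⟨i, i1, i2, i3, i4⟩ hlt
    simp only [BE.eval, IE.eval, (hb h' (fr0 h' f)).2, i1] at hlt
    refine wp_seq (wp_frame (wp_mono (step i hlt h' _ (fr0 h' f) i1 i3) ?_))
    rintro a1 τ1 ⟨j1, j2⟩ f1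
    have e : a1.iv v = i := by rw [f1.iv v hv, i1]
    refine wp_iset (by simp) ⟨⟨i + 1, by simp [e], hlt, hinv _ _ _ j1, ?_⟩, by simp [e, i1]; lia⟩
    rw [mul_add]; lia
  · rintro h' τ' f ⟨i, i1, i2, i3, i4⟩ hlt
    simp only [BE.eval, IE.eval, (hb h' (fr0 h' f)).2, i1] at hlt
    obtain rfl : i = N := by lia
    exact hQ h' _ (fr0 h' f) i3 (by lia)

/-- The argument in `[0, 2π)`. -/
noncomputable def argPos (z : ℂ) : ℝ := ang z.re z.im

/-- Complex expressions. -/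
structure CE where
  x : RE
  y : RE

namespace CE

noncomputable def eval (z : CE) (h : St) : ℂ := ⟨z.x.eval h, z.y.eval h⟩

def ok (z : CE) (M : ℕ) (h : St) : Prop := z.x.ok M h ∧ z.y.ok M h

def sub (z w : CE) : CE := ⟨.bin .sub z.x w.x, .bin .sub z.y w.y⟩

def smul (c : RE) (z : CE) : CE := ⟨.bin .mul c z.x, .bin .mul c z.y⟩

def neg (z : CE) : CE := ⟨.un .neg z.x, .un .neg z.y⟩

def mulI (z : CE) : CE := ⟨.un .neg z.y, z.x⟩

def zero : CE := ⟨.const 0, .const 0⟩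

/-- The product with the conjugate. -/
def mulConj (z w : CE) : CE :=
  ⟨.bin .add (.bin .mul z.x w.x) (.bin .mul z.y w.y),
    .bin .sub (.bin .mul z.y w.x) (.bin .mul z.x w.y)⟩

def normSq (z : CE) : RE := .bin .add (.bin .mul z.x z.x) (.bin .mul z.y z.y)

def argPos (z : CE) : RE := .ang z.x z.y

variable (z w : CE) (c : RE) (M : ℕ) (h : St)

@[simp] theorem sub_eval : (z.sub w).eval h = z.eval h - w.eval h := rfl

@[simp] theorem smul_eval : (smul c z).eval h = c.eval h * z.eval h := by
  apply Complex.ext <;> simp [smul, eval]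

@[simp] theorem neg_eval : z.neg.eval h = -z.eval h := rfl

@[simp] theorem mulI_eval : z.mulI.eval h = Complex.I * z.eval h := by
  apply Complex.ext <;> simp [mulI, eval]

@[simp] theorem zero_eval : zero.eval h = 0 := by
  apply Complex.ext <;> simp [zero, eval]

@[simp] theorem mulConj_eval : (z.mulConj w).eval h =
    z.eval h * (starRingEnd ℂ) (w.eval h) := by
  apply Complex.ext <;> simp [mulConj, eval]
  ring

@[simp] theorem x_eval : z.x.eval h = (z.eval h).re := rfl
@[simp] theorem y_eval : z.y.eval h = (z.eval h).im := rfl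

@[simp] theorem normSq_eval : z.normSq.eval h = Complex.normSq (z.eval h) := by
  simp [normSq, Complex.normSq]

@[simp] theorem argPos_eval : z.argPos.eval h = FixedMCR.argPos (z.eval h) := by
  simp [argPos, FixedMCR.argPos]

@[simp] theorem sub_ok : (z.sub w).ok M h ↔ z.ok M h ∧ w.ok M h := by
  simp [sub, ok]; tauto
@[simp] theorem smul_ok : (smul c z).ok M h ↔ c.ok M h ∧ z.ok M h := by
  simp [smul, ok]; tauto
@[simp] theorem neg_ok : z.neg.ok M h ↔ z.ok M h := by simp [neg, ok]
@[simp] theorem mulI_ok : z.mulI.ok M h ↔ z.ok M h := by simp [mulI, ok]; tauto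
@[simp] theorem zero_ok : zero.ok M h := by simp [zero, ok]
@[simp] theorem mulConj_ok : (z.mulConj w).ok M h ↔ z.ok M h ∧ w.ok M h := by
  simp [mulConj, ok]; tauto
@[simp] theorem normSq_ok : z.normSq.ok M h ↔ z.ok M h := by simp [normSq, ok]
@[simp] theorem argPos_ok : z.argPos.ok M h ↔ z.ok M h := by simp [argPos, ok]

end CE

/-- The complex numbers in the arrays `5` and `6`. -/
noncomputable def St.V (h : St) (i : ℕ) : ℂ := ⟨h.ra 5 i, h.ra 6 i⟩

def CE.V (i : IE) : CE := ⟨.get 5 i, .get 6 i⟩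

@[simp] theorem CE.V_eval (i : IE) (h : St) : (CE.V i).eval h = h.V (i.eval h) := rfl

@[simp] theorem CE.V_ok (i : IE) (M : ℕ) (h : St) :
    (CE.V i).ok M h ↔ i.ok M h ∧ i.eval h < M := by
  simp [CE.V, CE.ok]

/-- An item of the sweep: it is met by the circles with squared radius between `lo` and `hi`. -/
structure Item where
  lo : ℝ
  hi : ℝ
  lab : ℕ
  f : ℂ
  u : ℂ

/-- The point where the circle with squared radius `q` meets the item. -/
noncomputable def Item.pos (D : Item) (q : ℝ) : ℂ := D.f + √(q - Complex.normSq D.f) * D.u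

noncomputable def St.item (h : St) (t : ℕ) : Item :=
  ⟨h.ra 4 t, h.ra 7 t, h.ia 7 t, ⟨h.ra 8 t, h.ra 9 t⟩, ⟨h.ra 10 t, h.ra 11 t⟩⟩

/-- Writes the item with the number `t`. -/
def itemCode (t : IE) (lo hi : RE) (lab : IE) (f u : CE) : Cmd :=
  .rput 4 t lo ;; .iput 4 t t ;; .rput 7 t hi ;; .iput 7 t lab ;; .rput 8 t f.x ;; .rput 9 t f.y ;;
    .rput 10 t u.x ;; .rput 11 t u.y

/-- The eight writes go to the arrays 4 and 7 to 11, whereas the expressions only read the vertices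
and the variables. So `hev` and `hok` are required in all states with the same vertices and
variables, which covers the intermediate ones. -/
theorem itemCode_wp {M T : ℕ} {t lab : IE} {lo hi : RE} {f u : CE} {D : Item}
    {Q : St → ℕ → Prop} {h : St} {τ : ℕ} (hT : T < M)
    (hev : ∀ h' : St, h'.V = h.V → h'.iv = h.iv → h'.rv = h.rv → t.eval h' = T ∧
      lo.eval h' = D.lo ∧ hi.eval h' = D.hi ∧ lab.eval h' = D.lab ∧ f.eval h' = D.f ∧
      u.eval h' = D.u)
    (hok : ∀ h' : St, h'.V = h.V → h'.iv = h.iv → h'.rv = h.rv → t.ok M h' ∧ lo.ok M h' ∧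
      hi.ok M h' ∧ lab.ok M h' ∧ f.ok M h' ∧ u.ok M h')
    (hQ : ∀ h' : St, h'.V = h.V → h'.iv = h.iv → h'.rv = h.rv → h'.item T = D → h'.ia 4 T = T →
      (∀ l, l ≠ T → h'.item l = h.item l ∧ h'.ia 4 l = h.ia 4 l) → Q h' (τ + 8)) :
    wp M (itemCode t lo hi lab f u) Q h τ := by
  have key : ∀ a : St, a.V = h.V → a.iv = h.iv → a.rv = h.rv → t.ok M a ∧ t.eval a = T :=
    fun a h1 h2 h3 => ⟨(hok a h1 h2 h3).1, (hev a h1 h2 h3).1⟩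
  have pr : ∀ (a : St) (k j : ℕ) (x : ℝ), 6 < k ∨ k = 4 → a.V = h.V → (a.putr k j x).V = h.V := by
    intro a k j x hk ha
    rw [← ha]; funext i
    simp only [St.V, St.putr_ra]
    rw [if_neg (by lia), if_neg (by lia)]
  have pi : ∀ (a : St) (k j : ℕ) (x : ℕ), a.V = h.V → (a.puti k j x).V = h.V :=
    fun a k j x ha => ha
  have s1 := key h rfl rfl rfl
  have e1 := hev h rfl rfl rfl
  have o1 := hok h rfl rfl rfl
  refine wp_seq (wp_rput ⟨by simp, o1.1, o1.2.1, by rwa [e1.1]⟩ (wp_seq ?_))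
  rw [e1.1, e1.2.1]
  generalize ha1 : h.putr 4 T D.lo = a1
  have v1 : a1.V = h.V := ha1 ▸ pr _ _ _ _ (by simp) rfl
  have i1 : a1.iv = h.iv := by rw [← ha1]; rfl
  have r1 : a1.rv = h.rv := by rw [← ha1]; rfl
  have e1 := hev a1 v1 i1 r1
  have o1 := hok a1 v1 i1 r1
  refine wp_iput ⟨by simp, o1.1, o1.1, by rwa [e1.1]⟩ (wp_seq ?_)
  rw [e1.1]
  generalize ha2 : a1.puti 4 T T = a2
  have v2 : a2.V = h.V := ha2 ▸ pi _ _ _ _ v1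
  have i2 : a2.iv = h.iv := by rw [← ha2]; exact i1
  have r2 : a2.rv = h.rv := by rw [← ha2]; exact r1
  have e1 := hev a2 v2 i2 r2
  have o1 := hok a2 v2 i2 r2
  refine wp_rput ⟨by simp, o1.1, o1.2.2.1, by rwa [e1.1]⟩ (wp_seq ?_)
  rw [e1.1, e1.2.2.1]
  generalize ha3 : a2.putr 7 T D.hi = a3
  have v3 : a3.V = h.V := ha3 ▸ pr _ _ _ _ (by simp) v2
  have i3 : a3.iv = h.iv := by rw [← ha3]; exact i2
  have r3 : a3.rv = h.rv := by rw [← ha3]; exact r2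
  have e1 := hev a3 v3 i3 r3
  have o1 := hok a3 v3 i3 r3
  refine wp_iput ⟨by simp, o1.1, o1.2.2.2.1, by rwa [e1.1]⟩ (wp_seq ?_)
  rw [e1.1, e1.2.2.2.1]
  generalize ha4 : a3.puti 7 T D.lab = a4
  have v4 : a4.V = h.V := ha4 ▸ pi _ _ _ _ v3
  have i4 : a4.iv = h.iv := by rw [← ha4]; exact i3
  have r4 : a4.rv = h.rv := by rw [← ha4]; exact r3
  have e1 := hev a4 v4 i4 r4
  have o1 := hok a4 v4 i4 r4
  refine wp_rput ⟨by simp, o1.1, o1.2.2.2.2.1.1, by rwa [e1.1]⟩ (wp_seq ?_)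
  rw [e1.1, CE.x_eval, e1.2.2.2.2.1]
  generalize ha5 : a4.putr 8 T D.f.re = a5
  have v5 : a5.V = h.V := ha5 ▸ pr _ _ _ _ (by simp) v4
  have i5 : a5.iv = h.iv := by rw [← ha5]; exact i4
  have r5 : a5.rv = h.rv := by rw [← ha5]; exact r4
  have e1 := hev a5 v5 i5 r5
  have o1 := hok a5 v5 i5 r5
  refine wp_rput ⟨by simp, o1.1, o1.2.2.2.2.1.2, by rwa [e1.1]⟩ (wp_seq ?_)
  rw [e1.1, CE.y_eval, e1.2.2.2.2.1]
  generalize ha6 : a5.putr 9 T D.f.im = a6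
  have v6 : a6.V = h.V := ha6 ▸ pr _ _ _ _ (by simp) v5
  have i6 : a6.iv = h.iv := by rw [← ha6]; exact i5
  have r6 : a6.rv = h.rv := by rw [← ha6]; exact r5
  have e1 := hev a6 v6 i6 r6
  have o1 := hok a6 v6 i6 r6
  refine wp_rput ⟨by simp, o1.1, o1.2.2.2.2.2.1, by rwa [e1.1]⟩ ?_
  rw [e1.1, CE.x_eval, e1.2.2.2.2.2]
  generalize ha7 : a6.putr 10 T D.u.re = a7
  have v7 : a7.V = h.V := ha7 ▸ pr _ _ _ _ (by simp) v6
  have i7 : a7.iv = h.iv := by rw [← ha7]; exact i6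
  have r7 : a7.rv = h.rv := by rw [← ha7]; exact r6
  have e1 := hev a7 v7 i7 r7
  have o1 := hok a7 v7 i7 r7
  refine wp_rput ⟨by simp, o1.1, o1.2.2.2.2.2.2, by rwa [e1.1]⟩ ?_
  rw [e1.1, CE.y_eval, e1.2.2.2.2.2]
  refine hQ _ (pr _ _ _ _ (by simp) v7) i7 r7 ?_ ?_ fun l hl => ?_
  · simp [St.item, ← ha7, ← ha6, ← ha5, ← ha4, ← ha3, ← ha2, ← ha1]
  · simp [← ha7, ← ha6, ← ha5, ← ha4, ← ha3, ← ha2, ← ha1]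
  · simp [St.item, ← ha7, ← ha6, ← ha5, ← ha4, ← ha3, ← ha2, ← ha1, hl]

/-- The parameter on the line through `a` and `b` of the point `a`, where that of the point next
to the origin is `0` and that of `b` is greater by `1`. -/
noncomputable def footTau (a b : ℂ) : ℝ :=
  (a * (starRingEnd ℂ) (b - a)).re / Complex.normSq (b - a)

/-- The point of the line through `a` and `b` that is next to the origin. -/
noncomputable def foot (a b : ℂ) : ℂ := a - footTau a b * (b - a)

/-- The part of the edge from `a` to `b` on which the distance to the origin increases. -/
noncomputable def plusItem (a b : ℂ) (lab : ℕ) : Item where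
  -- On the line, `a` and `b` have the parameters `τ` and `τ + 1` as measured from the foot, and the
  -- squared distance at a parameter follows from Pythagoras. Clipping at `0` selects the part
  -- beyond the foot; if there is none, then `lo = hi` and the open interval is empty.
  lo := Complex.normSq (foot a b) + max (footTau a b) 0 ^ 2 * Complex.normSq (b - a)
  hi := Complex.normSq (foot a b) + max (footTau a b + 1) 0 ^ 2 * Complex.normSq (b - a)
  lab := lab
  f := foot a b
  u := (1 / √(Complex.normSq (b - a)) : ℝ) * (b - a)

/-- The part of the edge from `a` to `b` on which the distance to the origin decreases. -/
noncomputable def minusItem (a b : ℂ) (lab : ℕ) : Item where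
  lo := Complex.normSq (foot a b) + min (footTau a b + 1) 0 ^ 2 * Complex.normSq (b - a)
  hi := Complex.normSq (foot a b) + min (footTau a b) 0 ^ 2 * Complex.normSq (b - a)
  lab := lab
  f := foot a b
  u := (-1 / √(Complex.normSq (b - a)) : ℝ) * (b - a)

/-- On a circle around the origin, the points just after the point `x` of the boundary are to the
left of the boundary, where `A` is the direction of the boundary before `x`, and `B` after it. -/
def afterLeft (x A B : ℂ) : Prop :=
  -- The circle leaves `x` in the direction `I * x`. Measured from `B`, the left side of the
  -- boundary is the sector from `0` to the angle of `-A`. Ties are decided by the curvature: the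
  -- circle bends to its left, so a start along `B` gets into the sector and a start along `-A`
  -- leaves it.
  argPos (Complex.I * x * (starRingEnd ℂ) B) < argPos (-A * (starRingEnd ℂ) B)

/-- On a circle around the origin, the points just before the point `x` of the boundary are to the
left of the boundary. -/
def beforeLeft (x A B : ℂ) : Prop :=
  -- Backwards the circle bends the other way, hence the opposite treatment of ties: the direction
  -- `B` is excluded and the direction `-A` is included.
  0 < argPos (-(Complex.I * x) * (starRingEnd ℂ) B) ∧
    argPos (-(Complex.I * x) * (starRingEnd ℂ) B) ≤ argPos (-A * (starRingEnd ℂ) B)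

open Classical in
/-- The point `x`, if the condition holds. -/
noncomputable def nodeItem (p : Prop) (x : ℂ) (lab : ℕ) : Item where
  lo := Complex.normSq x
  -- With `hi = -1` below `lo ≥ 0` the item is never live. A node at the center is discarded, since
  -- a point at the center has no events.
  hi := if p ∧ 0 < Complex.normSq x then Complex.normSq x else -1
  lab := lab
  f := x
  u := 0

/-- The items in the first sweep: the parts of the edges without their ends. -/
noncomputable def strictItem (V : ℕ → ℂ) (σ t : ℕ) : Item :=
  -- Where the boundary leads away from the origin, the counterclockwise circle crosses it from
  -- right to left. This is an in-event, with label `0`, exactly if the interior is to the left,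
  -- that is, if `σ = 1`; on the other part it is the reverse.
  if t % 2 = 0 then plusItem (V (t / 2)) (V (t / 2 + 1)) (1 - σ)
  else minusItem (V (t / 2)) (V (t / 2 + 1)) σ

/-- The items in the second sweep: vertices, and interior points of edges where the circle is
tangent to the edge. -/
noncomputable def pointItem (V : ℕ → ℂ) (σ t : ℕ) : Item :=
  let a := V (t / 4)
  let b := V (t / 4 + 1)
  let d := V (t / 4 + 2)
  -- Four items for each edge: in-event and out-event at its end `b`, and the same at its foot. An
  -- in-event needs that the circle is outside just before, which means that being on the left and
  -- the interior being on the left disagree.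
  if t % 4 = 0 then nodeItem (¬ (beforeLeft b (b - a) (d - b) ↔ 0 < σ)) b 0
  else if t % 4 = 1 then nodeItem (¬ (afterLeft b (b - a) (d - b) ↔ 0 < σ)) b 1
  else if t % 4 = 2 then nodeItem ((footTau a b < 0 ∧ 0 < footTau a b + 1) ∧
    ¬ (beforeLeft (foot a b) (b - a) (b - a) ↔ 0 < σ)) (foot a b) 0
  else nodeItem ((footTau a b < 0 ∧ 0 < footTau a b + 1) ∧
    ¬ (afterLeft (foot a b) (b - a) (b - a) ↔ 0 < σ)) (foot a b) 1

section expressions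

variable (a b x A B : CE) (c d : RE) (M : ℕ) (h : St)

def RE.max0 : RE := .ifle (.const 0) c c (.const 0)
def RE.min0 : RE := .ifle (.const 0) c (.const 0) c

@[simp] theorem RE.max0_eval : c.max0.eval h = max (c.eval h) 0 := by
  simp only [RE.max0, RE.eval, Int.cast_zero]
  split_ifs with h1
  · rw [max_eq_left h1]
  · rw [max_eq_right (not_le.1 h1).le]

@[simp] theorem RE.min0_eval : c.min0.eval h = min (c.eval h) 0 := by
  simp only [RE.min0, RE.eval, Int.cast_zero]
  split_ifs with h1
  · rw [min_eq_right h1]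
  · rw [min_eq_left (not_le.1 h1).le]

@[simp] theorem RE.max0_ok : c.max0.ok M h ↔ c.ok M h := by simp [RE.max0]
@[simp] theorem RE.min0_ok : c.min0.ok M h ↔ c.ok M h := by simp [RE.min0]

def CE.tau : RE := .bin .div (a.mulConj (b.sub a)).x (b.sub a).normSq
def CE.tau1 : RE := .bin .add (a.tau b) (.const 1)
def CE.foot : CE := a.sub (.smul (a.tau b) (b.sub a))
/-- The squared distance from the origin at the parameter `c` on the line through `a`, `b`. -/
def CE.sqAt : RE :=
  .bin .add (a.foot b).normSq (.bin .mul (.bin .mul c c) (b.sub a).normSq)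
def CE.dir (e : ℤ) : CE := .smul (.bin .div (.const e) (.un .sqrt (b.sub a).normSq)) (b.sub a)

@[simp] theorem CE.tau_eval : (a.tau b).eval h = footTau (a.eval h) (b.eval h) := by
  simp [CE.tau, footTau]
@[simp] theorem CE.tau1_eval : (a.tau1 b).eval h = footTau (a.eval h) (b.eval h) + 1 := by
  simp [CE.tau1]
@[simp] theorem CE.foot_eval : (a.foot b).eval h = FixedMCR.foot (a.eval h) (b.eval h) := by
  simp [CE.foot, FixedMCR.foot]
@[simp] theorem CE.sqAt_eval : (a.sqAt b c).eval h =
    Complex.normSq (FixedMCR.foot (a.eval h) (b.eval h)) +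
      c.eval h ^ 2 * Complex.normSq (b.eval h - a.eval h) := by
  simp [CE.sqAt, sq]
@[simp] theorem CE.dir_eval (e : ℤ) : (a.dir b e).eval h =
    (e / √(Complex.normSq (b.eval h - a.eval h)) : ℝ) * (b.eval h - a.eval h) := by
  simp [CE.dir]
@[simp] theorem CE.tau_ok : (a.tau b).ok M h ↔ a.ok M h ∧ b.ok M h := by
  simp only [CE.tau, RE.ok, CE.normSq_ok, CE.sub_ok]
  constructor
  · exact fun k => k.2.symm
  · exact fun k => ⟨((CE.mulConj_ok _ _ _ _).2 ⟨k.1, (CE.sub_ok _ _ _ _).2 k.symm⟩).1, k.symm⟩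
@[simp] theorem CE.tau1_ok : (a.tau1 b).ok M h ↔ a.ok M h ∧ b.ok M h := by simp [CE.tau1]
@[simp] theorem CE.foot_ok : (a.foot b).ok M h ↔ a.ok M h ∧ b.ok M h := by
  simp [CE.foot]; tauto
@[simp] theorem CE.sqAt_ok : (a.sqAt b c).ok M h ↔ c.ok M h ∧ a.ok M h ∧ b.ok M h := by
  simp [CE.sqAt]; tauto
@[simp] theorem CE.dir_ok (e : ℤ) : (a.dir b e).ok M h ↔ a.ok M h ∧ b.ok M h := by
  simp [CE.dir]; tauto

def BE.afterLeft : BE := .rlt (x.mulI.mulConj B).argPos (A.neg.mulConj B).argPos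
def BE.beforeLeft : BE :=
  .and (.rlt (.const 0) (x.mulI.neg.mulConj B).argPos)
    (.rle (x.mulI.neg.mulConj B).argPos (A.neg.mulConj B).argPos)

@[simp] theorem BE.afterLeft_eval : (BE.afterLeft x A B).eval h ↔
    FixedMCR.afterLeft (x.eval h) (A.eval h) (B.eval h) := by
  simp [BE.afterLeft, FixedMCR.afterLeft]
@[simp] theorem BE.beforeLeft_eval : (BE.beforeLeft x A B).eval h ↔
    FixedMCR.beforeLeft (x.eval h) (A.eval h) (B.eval h) := by
  simp [BE.beforeLeft, FixedMCR.beforeLeft]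
@[simp] theorem BE.afterLeft_ok : (BE.afterLeft x A B).ok M h ↔
    x.ok M h ∧ A.ok M h ∧ B.ok M h := by
  simp [BE.afterLeft]; tauto
@[simp] theorem BE.beforeLeft_ok : (BE.beforeLeft x A B).ok M h ↔
    x.ok M h ∧ A.ok M h ∧ B.ok M h := by
  simp [BE.beforeLeft]; tauto

def BE.xor (p q : BE) : BE := .and (.not (.and p q)) (.not (.and (.not p) (.not q)))

@[simp] theorem BE.xor_eval (p q : BE) : (BE.xor p q).eval h ↔ ¬ (p.eval h ↔ q.eval h) := by
  simp [BE.xor]; tauto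
@[simp] theorem BE.xor_ok (p q : BE) : (BE.xor p q).ok M h ↔ p.ok M h ∧ q.ok M h := by
  simp [BE.xor]

end expressions

/-- Writes the items of the edge with the number `x₁₄` for the first sweep; `x₁₉` tells whether
the interior is to the left of the boundary. -/
def strictBody : Cmd :=
  let a := CE.V (.var 14)
  let b := CE.V (.add (.var 14) (.const 1))
  itemCode (.add (.var 14) (.var 14)) (a.sqAt b (a.tau b).max0) (a.sqAt b (a.tau1 b).max0)
    (.sub (.const 1) (.var 19)) (a.foot b) (a.dir b 1) ;;
  itemCode (.add (.add (.var 14) (.var 14)) (.const 1)) (a.sqAt b (a.tau1 b).min0)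
    (a.sqAt b (a.tau b).min0) (.var 19) (a.foot b) (a.dir b (-1))

theorem strictBody_wp {M i σ : ℕ} {Q : St → ℕ → Prop} {h : St} {τ : ℕ} (hi : h.iv 14 = i)
    (hσ : h.iv 19 = σ) (hM : 2 * i + 1 < M)
    (hQ : ∀ h' : St, h'.V = h.V → (∀ t, t / 2 = i → h'.item t = strictItem h.V σ t ∧ h'.ia 4 t = t) →
      (∀ l, l / 2 ≠ i → h'.item l = h.item l ∧ h'.ia 4 l = h.ia 4 l) → Q h' (τ + 16)) :
    wp M strictBody Q h τ := by
  refine wp_seq (itemCode_wp (T := 2 * i) (D := plusItem (h.V i) (h.V (i + 1)) (1 - σ)) (by lia)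
    ?_ ?_ ?_)
  · intro h' h1 h2 h3
    simp [h1, h2, hi, hσ, plusItem, two_mul]
  · intro h' h1 h2 h3
    simp [h2, hi]
    lia
  intro a1 v1 i1 r1 p1 p2 p3
  refine itemCode_wp (T := 2 * i + 1) (D := minusItem (h.V i) (h.V (i + 1)) σ) (by lia) ?_ ?_ ?_
  · intro h' h1 h2 h3
    simp [h1, h2, v1, i1, hi, hσ, minusItem, two_mul]
  · intro h' h1 h2 h3
    simp [h2, i1, hi]
    lia
  intro a2 v2 i2 r2 q1 q2 q3
  refine hQ a2 (v2.trans v1) (fun t ht => ?_) fun l hl => ?_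
  · rcases (by lia : t = 2 * i ∨ t = 2 * i + 1) with rfl | rfl
    · rw [(q3 _ (by lia)).1, (q3 _ (by lia)).2, p1, p2, strictItem, if_pos (by lia), ht]
      exact ⟨rfl, rfl⟩
    · rw [q1, q2, strictItem, if_neg (by lia), ht]
      exact ⟨rfl, rfl⟩
  · rw [(q3 l (by lia)).1, (q3 l (by lia)).2, (p3 l (by lia)).1, (p3 l (by lia)).2]
    exact ⟨rfl, rfl⟩

/-- Writes one item for the second sweep. -/
def nodeCode (t : IE) (p : BE) (x : CE) (lab : ℕ) : Cmd :=
  .ite (.and p (.rlt (.const 0) x.normSq)) (.rset 6 x.normSq) (.rset 6 (.const (-1))) ;;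
    itemCode t x.normSq (.var 6) (.const lab) x .zero

theorem nodeCode_wp {M T lab : ℕ} {t : IE} {p : BE} {x : CE} {P : Prop} {X : ℂ}
    {Q : St → ℕ → Prop} {h : St} {τ : ℕ} (hT : T < M)
    (hp : (p.eval h ↔ P) ∧ p.ok M h)
    (hev : ∀ h' : St, h'.V = h.V → h'.iv = h.iv → t.eval h' = T ∧ x.eval h' = X)
    (hok : ∀ h' : St, h'.V = h.V → h'.iv = h.iv → t.ok M h' ∧ x.ok M h')
    (hQ : ∀ h' : St, h'.V = h.V → h'.iv = h.iv → h'.item T = nodeItem P X lab → h'.ia 4 T = T →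
      (∀ l, l ≠ T → h'.item l = h.item l ∧ h'.ia 4 l = h.ia 4 l) → Q h' (τ + 10)) :
    wp M (nodeCode t p x lab) Q h τ := by
  have e0 := hev h rfl rfl
  have o0 := hok h rfl rfl
  have main : ∀ y : ℝ, y = (nodeItem P X lab).hi →
      wp M (itemCode t x.normSq (.var 6) (.const lab) x .zero) Q (h.setr 6 y) (τ + 1 + 1) := by
    intro y hy
    refine itemCode_wp (T := T) (D := nodeItem P X lab) hT ?_ ?_ ?_
    · intro h' h1 h2 h3
      have := hev h' h1 h2
      simp [this, h3, hy]
      simp [nodeItem]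
    · intro h' h1 h2 h3
      have := hok h' h1 h2
      simp [this]
    · intro h' h1 h2 h3 h4 h5 h6
      exact hQ h' h1 h2 h4 h5 h6
  refine wp_seq (wp_ite (by simp [hp.2, o0.2]) (fun hb => ?_) fun hb => ?_)
  · simp [hp.1, e0.2] at hb
    refine wp_rset (by simp [o0.2]) (main _ ?_)
    rw [nodeItem, if_pos (by simpa using hb)]
    simp [e0.2]
  · simp [hp.1, e0.2] at hb
    refine wp_rset (by simp) (main _ ?_)
    rw [nodeItem, if_neg (by simpa using hb)]
    simp

/-- Writes the items of the edge with the number `x₁₄` for the second sweep. -/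
def pointBody : Cmd :=
  let a := CE.V (.var 14)
  let b := CE.V (.add (.var 14) (.const 1))
  let d := CE.V (.add (.var 14) (.const 2))
  let t : IE := .add (.add (.var 14) (.var 14)) (.add (.var 14) (.var 14))
  let s : BE := .ilt (.const 0) (.var 19)
  let ex : BE := .and (.rlt (a.tau b) (.const 0)) (.rlt (.const 0) (a.tau1 b))
  nodeCode t (.xor (.beforeLeft b (b.sub a) (d.sub b)) s) b 0 ;;
  nodeCode (.add t (.const 1)) (.xor (.afterLeft b (b.sub a) (d.sub b)) s) b 1 ;;
  nodeCode (.add t (.const 2)) (.and ex (.xor (.beforeLeft (a.foot b) (b.sub a) (b.sub a)) s))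
    (a.foot b) 0 ;;
  nodeCode (.add t (.const 3)) (.and ex (.xor (.afterLeft (a.foot b) (b.sub a) (b.sub a)) s))
    (a.foot b) 1

theorem pointBody_wp {M i σ : ℕ} {Q : St → ℕ → Prop} {h : St} {τ : ℕ} (hi : h.iv 14 = i)
    (hσ : h.iv 19 = σ) (hM : 4 * i + 3 < M)
    (hQ : ∀ h' : St, h'.V = h.V → (∀ t, t / 4 = i → h'.item t = pointItem h.V σ t ∧ h'.ia 4 t = t) →
      (∀ l, l / 4 ≠ i → h'.item l = h.item l ∧ h'.ia 4 l = h.ia 4 l) → Q h' (τ + 40)) :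
    wp M pointBody Q h τ := by
  set a := h.V i with ha
  set b := h.V (i + 1) with hb
  set d := h.V (i + 2) with hd
  refine wp_seq (nodeCode_wp (T := 4 * i) (X := b)
    (P := ¬ (beforeLeft b (b - a) (d - b) ↔ 0 < σ)) (by lia) ?_ ?_ ?_ ?_)
  · constructor
    · simp [hi, hσ, ha, hb, hd]
    · simp [hi]; lia
  · intro h' h1 h2
    simp [h1, h2, hi, hb]; lia
  · intro h' h1 h2
    simp [h2, hi]; lia
  intro a1 v1 i1 p1 p2 p3
  refine wp_seq (nodeCode_wp (T := 4 * i + 1) (X := b)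
    (P := ¬ (afterLeft b (b - a) (d - b) ↔ 0 < σ)) (by lia) ?_ ?_ ?_ ?_)
  · constructor
    · simp [hi, hσ, ha, hb, hd, v1, i1]
    · simp [hi, i1]; lia
  · intro h' h1 h2
    simp [h1, h2, v1, i1, hi, hb]; lia
  · intro h' h1 h2
    simp [h2, i1, hi]; lia
  intro a2 v2 i2 q1 q2 q3
  refine wp_seq (nodeCode_wp (T := 4 * i + 2) (X := foot a b)
    (P := (footTau a b < 0 ∧ 0 < footTau a b + 1) ∧
      ¬ (beforeLeft (foot a b) (b - a) (b - a) ↔ 0 < σ)) (by lia) ?_ ?_ ?_ ?_)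
  · constructor
    · simp [hi, hσ, ha, hb, v1, i1, v2, i2]
    · simp [hi, i1, i2]; lia
  · intro h' h1 h2
    simp [h1, h2, v1, i1, v2, i2, hi, hb, ha]; lia
  · intro h' h1 h2
    simp [h2, i1, i2, hi]; lia
  intro a3 v3 i3 s1 s2 s3
  refine nodeCode_wp (T := 4 * i + 3) (X := foot a b)
    (P := (footTau a b < 0 ∧ 0 < footTau a b + 1) ∧
      ¬ (afterLeft (foot a b) (b - a) (b - a) ↔ 0 < σ)) (by lia) ?_ ?_ ?_ ?_
  · constructor
    · simp [hi, hσ, ha, hb, v1, i1, v2, i2, v3, i3]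
    · simp [hi, i1, i2, i3]; lia
  · intro h' h1 h2
    simp [h1, h2, v1, i1, v2, i2, v3, i3, hi, hb, ha]; lia
  · intro h' h1 h2
    simp [h2, i1, i2, i3, hi]; lia
  intro a4 v4 i4 u1 u2 u3
  refine hQ a4 (v4.trans (v3.trans (v2.trans v1))) (fun t ht => ?_) fun l hl => ?_
  · rcases (by lia : t = 4 * i ∨ t = 4 * i + 1 ∨ t = 4 * i + 2 ∨ t = 4 * i + 3) with
      rfl | rfl | rfl | rfl
    · rw [(u3 _ (by lia)).1, (u3 _ (by lia)).2, (s3 _ (by lia)).1, (s3 _ (by lia)).2,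
        (q3 _ (by lia)).1, (q3 _ (by lia)).2, p1, p2, pointItem, if_pos (by lia), ht]
      exact ⟨rfl, rfl⟩
    · rw [(u3 _ (by lia)).1, (u3 _ (by lia)).2, (s3 _ (by lia)).1, (s3 _ (by lia)).2, q1, q2,
        pointItem, if_neg (by lia), if_pos (by lia), ht]
      exact ⟨rfl, rfl⟩
    · rw [(u3 _ (by lia)).1, (u3 _ (by lia)).2, s1, s2, pointItem, if_neg (by lia),
        if_neg (by lia), if_pos (by lia), ht]
      exact ⟨rfl, rfl⟩
    · rw [u1, u2, pointItem, if_neg (by lia), if_neg (by lia), if_neg (by lia), ht]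
      exact ⟨rfl, rfl⟩
  · rw [(u3 l (by lia)).1, (u3 l (by lia)).2, (s3 l (by lia)).1, (s3 l (by lia)).2,
      (q3 l (by lia)).1, (q3 l (by lia)).2, (p3 l (by lia)).1, (p3 l (by lia)).2]
    exact ⟨rfl, rfl⟩

end FixedMCR

namespace FixedMCR

/-! ## The program -/

/-- The vertices and the points of the input relative to the center. -/
noncomputable def St.vtx (h : St) (i : ℕ) : ℂ :=
  ⟨h.inp (2 * (1 + i)) - h.inp 0, h.inp (2 * (1 + i) + 1) - h.inp 1⟩

noncomputable def St.pt (h : St) (p : ℕ) : ℂ :=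
  ⟨h.inp (2 * (1 + h.iv 1 + p)) - h.inp 0, h.inp (2 * (1 + h.iv 1 + p) + 1) - h.inp 1⟩

theorem St.beta_eq (h : St) (p : ℕ) : h.beta p = argPos (h.pt p) := rfl

theorem seg_zero {α : Type*} (f : ℕ → α) (n : ℕ) : seg f 0 n = (Multiset.range n).map f := by
  rw [seg]
  congr 1
  exact congrArg Finset.val (Finset.range_eq_Ico n).symm

/-- Writes the squared radii of the points to the array `0` and sorts it. -/
def pointsCode : Cmd :=
  forCode 14 (.var 0) (.rput 0 (.var 14) (CE.normSq ⟨relX (.var 14), relY (.var 14)⟩) ;;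
    .iput 0 (.var 14) (.var 14)) ;;
  .iset 40 (.const 0) ;; .iset 41 (.var 0) ;; sortCode 0

theorem pointsCode_wp {M n m : ℕ} {Q : St → ℕ → Prop} {h : St} {τ : ℕ} (hn : h.iv 0 = n)
    (hm : h.iv 1 = m) (hlen : h.len = 2 * (1 + m + n)) (hM : n < M)
    (hQ : ∀ h' τ', Frame pointsCode h h' →
      seg (h'.arr 0) 0 n = (Multiset.range n).map (fun p => (Complex.normSq (h.pt p), p)) →
      (∀ a b, a ≤ b → b < n → h'.ra 0 a ≤ h'.ra 0 b) →
      τ' ≤ τ + 4 * n + 24 * (n + 1) * (Nat.log 2 n + 1) + 6 → Q h' τ') :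
    wp M pointsCode Q h τ := by
  apply wp_frame
  refine wp_seq (wp_for (N := n) 2 (by simp [Cmd.setsI]) (fun i h' => ∀ p < i,
    h'.arr 0 p = (Complex.normSq (h.pt p), p)) ?_ (fun i h' x hi => hi) (by simp) ?_ ?_)
  · intro h' f
    rw [← hn]
    exact ⟨by simp, f.iv 0 (by simp [forCode, Cmd.setsI])⟩
  · intro i hi h' τ' f e14 inv
    have e1 : h'.iv 1 = m := by rw [f.iv 1 (by simp [forCode, Cmd.setsI]), hm]
    have el : h'.len = 2 * (1 + m + n) := by rw [f.len, hlen]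
    refine wp_seq (wp_rput ?_ (wp_iput ?_ ⟨?_, le_rfl⟩))
    · simp [CE.ok, relX, relY, pointE, e14, e1, el]
      lia
    · simp [e14]; lia
    · intro p hp
      by_cases hpi : p = i
      · have := f.inp
        have q1 : i + (m + 1) + (i + (m + 1)) = 2 * (1 + m + i) := by ring
        simp [St.arr, hpi, e14, CE.eval, relX, relY, pointE, this, St.pt, e1, hm, q1]
      · simp [St.arr, e14, hpi]
        simpa [St.arr] using inv p (by lia)
  intro a1 τ1 f1 inv t1
  refine wp_seq (wp_iset (by simp) (wp_seq (wp_iset_eq (by simp) fun a2 ha2 => ?_)))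
  have e0 : a1.iv 0 = n := by rw [f1.iv 0 (by simp [forCode, Cmd.setsI]), hn]
  have ea : a2.arr 0 = a1.arr 0 := by rw [ha2]; rfl
  refine sortCode_wp (lo := 0) (hi := n) (by lia) (by lia) (by simp [ha2]) (by simp [ha2, e0])
    (Nat.zero_le _) hM ?_
  intro a3 τ3 f3 s1 s2 s3 s4 fr
  refine hQ a3 τ3 fr ?_ (fun a b hab hb => s3 a b (Nat.zero_le _) hab hb) ?_
  · rw [s1, ea, seg_congr (g := fun p => (Complex.normSq (h.pt p), p)) fun l _ hl => inv l hl]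
    exact seg_zero _ _
  · have : Nat.log 2 (desc (a2.ra 0) 0 n) ≤ Nat.log 2 n :=
      Nat.log_mono_right ((desc_le _ _ _).trans (by lia))
    have h2 : 24 * (n - 0 + 1) * (Nat.log 2 (desc (a2.ra 0) 0 n) + 1) ≤
        24 * (n + 1) * (Nat.log 2 n + 1) := by
      rw [Nat.sub_zero]; gcongr
    generalize 24 * (n - 0 + 1) * (Nat.log 2 (desc (a2.ra 0) 0 n) + 1) = A at s4 h2
    generalize 24 * (n + 1) * (Nat.log 2 n + 1) = B at h2 ⊢
    clear * - s4 h2 t1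
    omega

/-- Writes the vertices to the arrays `5` and `6`, the first two also after the last one. -/
def vertsCode : Cmd :=
  let i : IE := .add (.add (.var 14) (.const 1)) (.add (.var 14) (.const 1))
  forCode 14 (.var 1) (.rput 5 (.var 14) (.bin .sub (.inp i) (.inp (.const 0))) ;;
    .rput 6 (.var 14) (.bin .sub (.inp (.add i (.const 1))) (.inp (.const 1)))) ;;
  .rput 5 (.var 1) (.get 5 (.const 0)) ;; .rput 6 (.var 1) (.get 6 (.const 0)) ;;
  .rput 5 (.add (.var 1) (.const 1)) (.get 5 (.const 1)) ;;
  .rput 6 (.add (.var 1) (.const 1)) (.get 6 (.const 1))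

theorem vertsCode_wp {M m : ℕ} {Q : St → ℕ → Prop} {h : St} {τ : ℕ}
    (hm : h.iv 1 = m) (hm2 : 2 ≤ m) (hlen : 2 * (1 + m) ≤ h.len) (hM : m + 1 < M)
    (hQ : ∀ h' τ', Frame vertsCode h h' → (∀ i < m, h'.V i = h.vtx i) → h'.V m = h.vtx 0 →
      h'.V (m + 1) = h.vtx 1 → τ' ≤ τ + 4 * m + 6 → Q h' τ') :
    wp M vertsCode Q h τ := by
  apply wp_frame
  refine wp_seq (wp_for (N := m) 2 (by simp [Cmd.setsI]) (fun i h' => ∀ p < i, h'.V p = h.vtx p)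
    ?_ (fun i h' x hi => hi) (by simp) ?_ ?_)
  · intro h' f
    rw [← hm]
    exact ⟨by simp, f.iv 1 (by simp [forCode, Cmd.setsI])⟩
  · intro i hi h' τ' f e14 inv
    have el : h'.len = h.len := f.len
    refine wp_seq (wp_rput ?_ (wp_rput ?_ ⟨?_, le_rfl⟩))
    · simp [e14, el]
      lia
    · simp [e14, el]
      lia
    · intro p hp
      by_cases hpi : p = i
      · have := f.inp
        have q1 : i + 1 + (i + 1) = 2 * (1 + i) := by ring
        simp [St.V, hpi, e14, this, St.vtx, q1]
      · simp [St.V, e14, hpi]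
        simpa [St.V] using inv p (by lia)
  intro a1 τ1 f1 inv t1
  have e1 : a1.iv 1 = m := by rw [f1.iv 1 (by simp [forCode, Cmd.setsI]), hm]
  refine wp_seq (wp_rput ?_ (wp_seq (wp_rput ?_ (wp_seq (wp_rput ?_ (wp_rput ?_ fun fr =>
    hQ _ _ fr (fun i hi => ?_) ?_ ?_ (by lia)))))))
  any_goals simp [e1]; lia
  · rw [← inv i hi]
    have n1 : i ≠ m := by lia
    have n2 : i ≠ m + 1 := by lia
    simp [St.V, e1, n1, n2]
  · rw [← inv 0 (by lia)]
    have n1 : 0 ≠ m := by lia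
    simp [St.V, e1]
  · rw [← inv 1 (by lia)]
    have n1 : 1 ≠ m := by lia
    simp [St.V, e1, n1]

/-- Sets `x₁₉` to `1` if the interior is to the left of the boundary, and otherwise to `0`. -/
def orientCode : Cmd :=
  let b : CE := CE.V (.add (.var 14) (.const 1))
  let A : CE := CE.V (.var 20)
  let B : CE := CE.V (.add (.var 20) (.const 1))
  let D : CE := CE.V (.add (.var 20) (.const 2))
  .rset 7 (.const (-1)) ;;
  forCode 14 (.var 1) (.ite (.rlt (.var 7) b.normSq) (.rset 7 b.normSq ;; .iset 20 (.var 14)) .skip) ;;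
  .ite (.rlt (B.mulConj (D.sub B)).argPos ((B.sub A).neg.mulConj (D.sub B)).argPos)
    (.iset 19 (.const 0)) (.iset 19 (.const 1))

/-- A farthest vertex is searched, with the maximum starting at `-1`, below every squared norm.
There the test compares the radial direction with the left sector; by `H` it succeeds exactly if the
left side is outside. -/
theorem orientCode_wp {M m σ : ℕ} {Q : St → ℕ → Prop} {h : St} {τ : ℕ}
    (hm : h.iv 1 = m) (hm2 : 0 < m) (hM : m + 1 < M) (hσ : σ ≤ 1)
    (H : ∀ i < m, (∀ j < m, Complex.normSq (h.V (j + 1)) ≤ Complex.normSq (h.V (i + 1))) →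
      (argPos (h.V (i + 1) * (starRingEnd ℂ) (h.V (i + 2) - h.V (i + 1))) <
        argPos (-(h.V (i + 1) - h.V i) * (starRingEnd ℂ) (h.V (i + 2) - h.V (i + 1))) ↔ σ = 0))
    (hQ : ∀ h' τ', Frame orientCode h h' → h'.iv 19 = σ → τ' ≤ τ + 5 * m + 5 → Q h' τ') :
    wp M orientCode Q h τ := by
  apply wp_frame
  refine wp_seq (wp_rset (by simp) (wp_seq ?_))
  generalize ha0 : h.setr 7 _ = a0
  have e01 : a0.iv 1 = m := by rw [← ha0, St.setr_iv, hm]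
  have e0V : a0.V = h.V := by rw [← ha0]; rfl
  refine wp_for (N := m) 3 (by simp [Cmd.setsI]) (fun i h' =>
    (i = 0 ∧ h'.rv 7 = -1 ∨ h'.iv 20 < m ∧ h'.rv 7 = Complex.normSq (h.V (h'.iv 20 + 1))) ∧
      ∀ j < i, Complex.normSq (h.V (j + 1)) ≤ h'.rv 7) ?_ ?_ ?_ ?_ ?_
  · intro h' f
    rw [← e01]
    exact ⟨by simp, f.iv 1 (by simp [forCode, Cmd.setsI])⟩
  · rintro i h' x inv
    simpa using inv
  · simp [← ha0]
  · intro i hi h' τ' f e14 inv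
    have eV : h'.V = h.V := by
      rw [← e0V]; funext j
      rw [St.V, St.V, f.ra 5 (by simp [forCode, Cmd.putsR]), f.ra 6 (by simp [forCode, Cmd.putsR])]
    refine wp_ite (by simp [e14]; lia) (fun hb => ?_) (fun hb => ?_)
    · simp [e14, eV] at hb
      refine wp_seq (wp_rset (by simp [e14]; lia) (wp_iset (by simp) ⟨⟨.inr ?_, ?_⟩, by lia⟩))
      · simp [e14, eV, hi]
      · intro j hj
        simp [e14, eV]
        rcases Nat.lt_succ_iff_lt_or_eq.1 hj with hj | rfl
        · exact (inv.2 j hj).trans hb.le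
        · exact le_rfl
    · simp [e14, eV] at hb
      refine wp_skip ⟨⟨?_, ?_⟩, by lia⟩
      · rcases inv.1 with k | k
        · rw [k.2] at hb
          exact absurd (Complex.normSq_nonneg (h.V (i + 1))) (by linarith)
        · exact .inr k
      · intro j hj
        rcases Nat.lt_succ_iff_lt_or_eq.1 hj with hj | rfl
        · exact inv.2 j hj
        · exact hb
  intro a1 τ1 f1 inv t1
  obtain ⟨k1, k2⟩ := inv.1.resolve_left (by lia)
  have eV : a1.V = h.V := by
    rw [← e0V]; funext j
    rw [St.V, St.V, f1.ra 5 (by simp [forCode, Cmd.putsR]), f1.ra 6 (by simp [forCode, Cmd.putsR])]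
  have HH := H _ k1 (k2 ▸ inv.2)
  refine wp_ite ?_ (fun hb => ?_) (fun hb => ?_)
  · simp; lia
  · simp only [BE.eval, CE.argPos_eval, CE.mulConj_eval, CE.neg_eval, CE.sub_eval, CE.V_eval,
      IE.eval, eV, HH] at hb
    exact wp_iset (by simp) fun fr => hQ _ _ fr (by simp [hb]) (by lia)
  · simp only [BE.eval, CE.argPos_eval, CE.mulConj_eval, CE.neg_eval, CE.sub_eval, CE.V_eval,
      IE.eval, eV, HH] at hb
    exact wp_iset (by simp) fun fr => hQ _ _ fr (by simp; lia) (by lia)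

/-- The arrays that describe a family of items. -/
noncomputable def itemsOf (D : ℕ → Item) : Items :=
  ⟨fun t => (D t).hi, fun t => (D t).lab, fun t => (D t).f.re, fun t => (D t).f.im,
    fun t => (D t).u.re, fun t => (D t).u.im⟩

theorem itemsOf_key (D : ℕ → Item) (t : ℕ) (q : ℝ) :
    (itemsOf D).key t q = argPos ((D t).pos q) := by
  simp [itemsOf, Items.key, argPos, Item.pos, Complex.normSq]

open Classical in
theorem active_congr {c : Bool} {N : ℕ} {lo lo' hi hi' : ℕ → ℝ} {q : ℝ}
    (h : ∀ t < N, lo t = lo' t ∧ hi t = hi' t) : active c N lo hi q = active c N lo' hi' q :=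
  Multiset.filter_congr fun t ht => by
    rw [(h t (Multiset.mem_range.1 ht)).1, (h t (Multiset.mem_range.1 ht)).2]

theorem KeepsOrder.congr {c : Bool} {N : ℕ} {lo : ℕ → ℝ} {D D' : Items}
    (H : KeepsOrder c N lo D) (hi : ∀ t < N, D'.hi t = D.hi t)
    (hk : ∀ t < N, ∀ q, D'.key t q = D.key t q) : KeepsOrder c N lo D' := by
  intro p w q q' hq h1 h2 h3
  rw [active_congr (hi' := D.hi) (lo' := lo) fun t ht => ⟨rfl, hi t ht⟩,
    active_congr (hi' := D.hi) (lo' := lo) fun t ht => ⟨rfl, hi t ht⟩] at h1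
  have hp : ∀ j < w, p j < N := fun j hj => (mem_active.1 (h1 j hj).1).1
  rw [desc_congr (g := fun j => D.key (p j) q') fun l _ hl => hk _ (hp l hl) _]
  refine H p w q q' hq h1 h2 fun a b hab hb => ?_
  rw [← hk _ (hp a (by lia)), ← hk _ (hp b hb)]
  exact h3 a b hab hb

theorem Items.events_congr {c : Bool} {N : ℕ} {lo : ℕ → ℝ} {D D' : Items} {q β : ℝ}
    (hi : ∀ t < N, D'.hi t = D.hi t) (hl : ∀ t < N, D'.lab t = D.lab t)
    (hk : ∀ t < N, ∀ q, D'.key t q = D.key t q) :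
    D'.events c N lo q β = D.events c N lo q β := by
  rw [Items.events, Items.events, active_congr (hi' := D.hi) (lo' := lo) fun t ht => ⟨rfl, hi t ht⟩]
  refine Multiset.map_congr rfl fun t ht => ?_
  have := (mem_active.1 ht).1
  rw [hl t this, hk t this]

/-- Sorts the items and performs the sweep. -/
def phaseCode (c : Bool) (N : IE) : Cmd :=
  .iset 10 N ;; .iset 40 (.const 0) ;; .iset 41 (.var 10) ;; sortCode 4 ;; sweepCode c

/-- Only the pairs of birth and index in array 4 are sorted. The other data of the items stay in
place and are reached through the index. -/
theorem phaseCode_wp {M n N : ℕ} {c : Bool} {NE : IE} {D : ℕ → Item} {Q : St → ℕ → Prop} {h : St}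
    {τ : ℕ} (hN : NE.eval h = N ∧ NE.ok M h)
    (hD : ∀ t < N, h.item t = D t ∧ h.ia 4 t = t) (hn : h.iv 0 = n)
    (hlen : h.len = 2 * (1 + h.iv 1 + n)) (hnM : n < M) (hNM : N < M)
    (pts : ∀ i < n, h.ia 0 i < n) (sorted : ∀ i j, i ≤ j → j < n → h.ra 0 i ≤ h.ra 0 j)
    (order : KeepsOrder c N (fun t => (D t).lo) (itemsOf D)) {e K : ℕ} (he : h.iv 11 = e)
    (hK : K = ∑ i ∈ Finset.range n,
      Multiset.card (active c N (fun t => (D t).lo) (fun t => (D t).hi) (h.ra 0 i)))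
    (hM : e + K ≤ M)
    (hQ : ∀ h' τ', Frame (phaseCode c NE) h h' → h'.iv 11 = e + K →
      seg (h'.arr 2) 0 (e + K) = seg (h.arr 2) 0 e + ∑ i ∈ Finset.range n,
        (itemsOf D).events c N (fun t => (D t).lo) (h.ra 0 i) (h.beta (h.ia 0 i)) →
      desc (h'.ra 2) 0 (e + K) ≤ desc (h.ra 2) 0 e + 2 * n →
      τ' ≤ τ + 63 * K + 81 * (Nat.log 2 N + 1) * (N + 1) + 131 * n + 9 → Q h' τ') :
    wp M (phaseCode c NE) Q h τ := by
  apply wp_frame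
  refine wp_seq (wp_iset hN.2 (wp_seq (wp_iset (by simp) (wp_seq (wp_iset_eq (by simp)
    fun a0 ha0 => wp_seq ?_)))))
  simp only [IE.eval, hN.1] at ha0
  have ea : a0.arr 4 = h.arr 4 := by rw [ha0]; rfl
  refine sortCode_wp (lo := 0) (hi := N) (by lia) (by lia) (by simp [ha0]) (by simp [ha0])
    (Nat.zero_le _) hNM ?_
  intro a1 τ1 f1 s1 s2 s3 s4
  have b : ∀ v, v < 40 → v ≠ 10 → a1.iv v = h.iv v := by
    intro v hv hv'
    rw [f1.iv v (Cmd.sets_sort 4 (by lia)), ha0]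
    simp only [St.seti_iv]
    rw [if_neg (by lia), if_neg (by lia), if_neg (by lia)]
  have ba : ∀ v, v ≠ 4 → v ≠ 3 → a1.ia v = h.ia v ∧ a1.ra v = h.ra v := by
    intro v hv hv'
    rw [f1.ia v (Cmd.puts_sort ⟨hv, hv'⟩).1, f1.ra v (Cmd.puts_sort ⟨hv, hv'⟩).2, ha0]
    exact ⟨rfl, rfl⟩
  have eD : a1.items = h.items := by
    simp [St.items, ba]
  have elen : a1.len = h.len := by rw [f1.len, ha0]; rfl
  have einp : a1.inp = h.inp := by rw [f1.inp, ha0]; rfl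
  have ebeta : a1.beta = h.beta := by funext p; simp [St.beta, einp, b]
  have hi : ∀ t < N, h.items.hi t = (itemsOf D).hi t := by
    intro t ht
    have := congrArg Item.hi (hD t ht).1
    exact this
  have hl : ∀ t < N, h.items.lab t = (itemsOf D).lab t := by
    intro t ht
    have := congrArg Item.lab (hD t ht).1
    exact this
  have hk : ∀ t < N, ∀ q, h.items.key t q = (itemsOf D).key t q := by
    intro t ht q
    simp only [Items.key, itemsOf, ← (hD t ht).1]
    rfl
  have hact : ∀ q, active c N (fun t => (D t).lo) h.items.hi q =
      active c N (fun t => (D t).lo) (fun t => (D t).hi) q :=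
    fun q => active_congr fun t ht => ⟨rfl, hi t ht⟩
  have pre : SweepPre c M n N (fun t => (D t).lo) a1 := by
    constructor
    · rw [b 0 (by lia) (by lia), hn]
    · rw [f1.iv 10 (Cmd.sets_sort 4 (by lia)), ha0]; simp
    · rw [elen, b 1 (by lia) (by lia), hlen]
    · exact hnM
    · exact hNM
    · rw [(ba 0 (by lia) (by lia)).1]; exact pts
    · rw [(ba 0 (by lia) (by lia)).2]; exact sorted
    · rw [s1, ea, seg_congr (g := fun t => ((D t).lo, t)) fun l _ hl => ?_]
      · exact seg_zero _ _
      · rw [St.arr, (hD l hl).2, ← (hD l hl).1]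
        rfl
    · exact fun a b hab hb => s3 a b (Nat.zero_le _) hab hb
    · rw [eD]
      exact order.congr hi hk
  refine sweepCode_wp pre (e := e) (K := K) (by rw [b 11 (by lia) (by lia), he]) ?_ hM ?_
  · rw [hK, eD, (ba 0 (by lia) (by lia)).2]
    simp only [hact]
  · rw [eD, ebeta, (ba 0 (by lia) (by lia)).2, (ba 0 (by lia) (by lia)).1,
      (ba 2 (by lia) (by lia)).2]
    have e2 : a1.arr 2 = h.arr 2 := by
      funext l; rw [St.arr, St.arr, (ba 2 (by lia) (by lia)).1, (ba 2 (by lia) (by lia)).2]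
    rw [e2]
    intro h' τ' f' g1 g2 g3 g4 fr
    refine hQ h' τ' fr g1 ?_ g3 ?_
    · rw [g2]
      congr 1
      exact Finset.sum_congr rfl fun i _ => Items.events_congr hi hl hk
    · have : Nat.log 2 (desc (a0.ra 4) 0 N) ≤ Nat.log 2 N :=
        Nat.log_mono_right ((desc_le _ _ _).trans (by lia))
      have h2 : 24 * (N - 0 + 1) * (Nat.log 2 (desc (a0.ra 4) 0 N) + 1) ≤
          24 * ((Nat.log 2 N + 1) * (N + 1)) := by
        rw [Nat.sub_zero, mul_assoc, mul_comm (N + 1)]; gcongr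
      have h3 : 57 * (Nat.log 2 N + 1) * N ≤ 57 * ((Nat.log 2 N + 1) * (N + 1)) := by
        rw [mul_assoc]; gcongr; lia
      rw [mul_assoc 81]
      generalize (Nat.log 2 N + 1) * (N + 1) = B at h2 h3 ⊢
      generalize 24 * (N - 0 + 1) * (Nat.log 2 (desc (a0.ra 4) 0 N) + 1) = A at s4 h2
      generalize 57 * (Nat.log 2 N + 1) * N = C at h3 g4
      clear * - s4 h2 h3 g4
      omega

end FixedMCR

/-! ### Counting events and selecting the best angle -/

namespace FixedMCR

section counting

/-- The number of elements that satisfy `p`. -/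
noncomputable def cnt {α : Type*} (E : Multiset α) (p : α → Prop) : ℕ :=
  @Multiset.countP α p (Classical.decPred p) E

variable {α : Type*} {p q : α → Prop}

theorem cnt_zero : cnt (0 : Multiset α) p = 0 := rfl

theorem cnt_add (E F : Multiset α) : cnt (E + F) p = cnt E p + cnt F p :=
  @Multiset.countP_add α p (Classical.decPred p) E F

theorem cnt_mono {E : Multiset α} (h : ∀ e, p e → q e) : cnt E p ≤ cnt E q := by
  classical
  rw [cnt, cnt, Multiset.countP_eq_card_filter, Multiset.countP_eq_card_filter]
  exact Multiset.card_le_card (Multiset.monotone_filter_right _ h)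

theorem cnt_congr {E : Multiset α} (h : ∀ e ∈ E, (p e ↔ q e)) : cnt E p = cnt E q := by
  classical
  exact Multiset.countP_congr rfl fun x hx => propext (h x hx)

theorem cnt_eq_zero {E : Multiset α} (h : ∀ e ∈ E, ¬ p e) : cnt E p = 0 := by
  classical
  exact Multiset.countP_eq_zero.2 h

theorem cnt_seg_eq_zero {a : ℕ → α} {i j : ℕ} (h : ∀ l, i ≤ l → l < j → ¬ p (a l)) :
    cnt (seg a i j) p = 0 := by
  refine cnt_eq_zero fun x hx => ?_
  obtain ⟨l, h1, h2, rfl⟩ := (mem_seg _).1 hx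
  exact h l h1 h2

theorem cnt_seg_congr {a : ℕ → α} {i j : ℕ} (h : ∀ l, i ≤ l → l < j → (p (a l) ↔ q (a l))) :
    cnt (seg a i j) p = cnt (seg a i j) q := by
  refine cnt_congr fun x hx => ?_
  obtain ⟨l, h1, h2, rfl⟩ := (mem_seg _).1 hx
  exact h l h1 h2

open Classical in
theorem cnt_seg_succ {a : ℕ → α} {i : ℕ} :
    cnt (seg a 0 (i + 1)) p = cnt (seg a 0 i) p + if p (a i) then 1 else 0 := by
  rw [seg_succ _ (Nat.zero_le _), cnt_add]
  congr 1
  rw [cnt, ← Multiset.cons_zero, Multiset.countP_cons]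
  simp

/-- The number of in-events up to the angle `φ`. -/
noncomputable def insE (E : Multiset (ℝ × ℕ)) (φ : ℝ) : ℕ := cnt E fun e => e.2 = 0 ∧ e.1 ≤ φ

/-- The number of out-events before the angle `φ`. -/
noncomputable def outsE (E : Multiset (ℝ × ℕ)) (φ : ℝ) : ℕ := cnt E fun e => e.2 = 1 ∧ e.1 < φ

/-- The number of in-events with an index up to `l`. -/
noncomputable def insAt (a : ℕ → ℝ × ℕ) (l : ℕ) : ℕ := cnt (seg a 0 (l + 1)) fun e => e.2 = 0

/-- The number of out-events that are less than the event with index `l`. -/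
noncomputable def outsAt (a : ℕ → ℝ × ℕ) (l : ℕ) : ℕ :=
  cnt (seg a 0 (l + 1)) fun e => e.2 = 1 ∧ e.1 < (a l).1

variable {a : ℕ → ℝ × ℕ} {K : ℕ} (hs : ∀ i j, i ≤ j → j < K → (a i).1 ≤ (a j).1)
include hs

theorem outsE_eq {l : ℕ} (hl : l < K) : outsE (seg a 0 K) (a l).1 = outsAt a l := by
  rw [outsE, outsAt, ← seg_add a (Nat.zero_le (l + 1)) hl, cnt_add,
    cnt_seg_eq_zero (i := l + 1) fun x h1 h2 h3 => ?_, add_zero]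
  exact absurd (hs l x (by lia) h2) (not_le.2 h3.2)

theorem le_insE {l : ℕ} (hl : l < K) : insAt a l ≤ insE (seg a 0 K) (a l).1 := by
  rw [insE, insAt, ← seg_add a (Nat.zero_le (l + 1)) hl, cnt_add,
    cnt_seg_congr (q := fun e => e.2 = 0 ∧ e.1 ≤ (a l).1) fun x h1 h2 =>
      ⟨fun h => ⟨h, hs x l (by lia) hl⟩, fun h => h.1⟩]
  exact Nat.le_add_right _ _

/-- For an angle `φ`, let `l` be the last index of an event at an angle `≤ φ`. The in-events up to
`φ` are those up to `l`, and the out-events before `φ` include those before the angle of `l`; so `φ`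
is no better than index `l`, which was examined. Differences are written as sums because all numbers
are natural. In-events with the same angle but a later index may be missing from `insAt a l`; this
only underestimates, and `l` is the last one here. -/
theorem select_correct {bi bo : ℕ} {θ : ℝ} (h0 : ∀ l < K, 0 ≤ (a l).1)
    (hb : bi = 0 ∧ bo = 0 ∧ θ = 0 ∨
      ∃ l < K, θ = (a l).1 ∧ bi = insAt a l ∧ bo = outsAt a l) (hbo : bo ≤ bi)
    (H : ∀ l < K, insAt a l + bo ≤ bi + outsAt a l) (φ : ℝ) :
    insE (seg a 0 K) φ + outsE (seg a 0 K) θ ≤ insE (seg a 0 K) θ + outsE (seg a 0 K) φ := by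
  classical
  have h1 : outsE (seg a 0 K) θ = bo ∧ bi ≤ insE (seg a 0 K) θ := by
    rcases hb with ⟨rfl, rfl, rfl⟩ | ⟨l, hl, rfl, rfl, rfl⟩
    · refine ⟨cnt_seg_eq_zero fun l _ hl h => ?_, Nat.zero_le _⟩
      exact absurd h.2 (not_lt.2 (h0 l hl))
    · exact ⟨outsE_eq hs hl, le_insE hs hl⟩
  -- The least such index is the first event after `φ`, or `K` if there is none.
  have ex : ∃ l, l < K → φ < (a l).1 := ⟨K, fun h => absurd h (lt_irrefl _)⟩
  have h2 : ∀ l < Nat.find ex, l < K ∧ (a l).1 ≤ φ := by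
    intro l hl
    have := Nat.find_min ex hl
    push Not at this
    exact this
  have h3 : ∀ l, Nat.find ex ≤ l → l < K → φ < (a l).1 := fun l h4 h5 =>
    (Nat.find_spec ex (by lia)).trans_le (hs _ l h4 h5)
  have hfK : Nat.find ex ≤ K := Nat.find_le fun h => absurd h (lt_irrefl _)
  have h4 : insE (seg a 0 K) φ = cnt (seg a 0 (Nat.find ex)) fun e => e.2 = 0 := by
    rw [insE, ← seg_add a (Nat.zero_le _) hfK, cnt_add,
      cnt_seg_eq_zero (i := Nat.find ex) fun l h5 h6 h7 =>
        absurd (h3 l h5 h6) (not_lt.2 h7.2), add_zero]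
    exact cnt_seg_congr fun l _ h5 => ⟨fun h => h.1, fun h => ⟨h, (h2 l h5).2⟩⟩
  rcases Nat.eq_zero_or_pos (Nat.find ex) with hz | hz
  · rw [hz, seg_self, cnt_zero] at h4
    lia
  · obtain ⟨l, hl⟩ := Nat.exists_eq_succ_of_ne_zero hz.ne'
    have h5 := h2 l (by lia)
    have h6 : insE (seg a 0 K) φ = insAt a l := by rw [h4, hl]; rfl
    have h7 : outsAt a l ≤ outsE (seg a 0 K) φ := by
      rw [← outsE_eq hs h5.1]
      exact cnt_mono fun e he => ⟨he.1, he.2.trans_le h5.2⟩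
    have := H l h5.1
    lia

end counting

def selectBody : Cmd :=
  .ite (.rlt (.var 8) (.get 2 (.var 14))) (.iset 22 (.var 23)) .skip ;;
  .rset 8 (.get 2 (.var 14)) ;; .iset 23 (.add (.var 23) (.get 2 (.var 14))) ;;
  .iset 21 (.add (.var 21) (.sub (.const 1) (.get 2 (.var 14)))) ;;
  .ite (.ilt (.add (.var 24) (.var 22)) (.add (.var 21) (.var 25)))
    (.iset 24 (.var 21) ;; .iset 25 (.var 22) ;; .rset 0 (.var 8)) .skip

/-- Selects the best angle from the sorted events in the array `2`. -/
def selectCode : Cmd :=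
  .rset 8 (.const (-1)) ;; .rset 0 (.const 0) ;; .iset 21 (.const 0) ;; .iset 22 (.const 0) ;;
    .iset 23 (.const 0) ;; .iset 24 (.const 0) ;; .iset 25 (.const 0) ;;
    forCode 14 (.var 11) selectBody

theorem selectCode_wp {M K : ℕ} {Q : St → ℕ → Prop} {h : St} {τ : ℕ} (hK : h.iv 11 = K)
    (hM : K ≤ M) (hs : ∀ i j, i ≤ j → j < K → h.ra 2 i ≤ h.ra 2 j)
    (h0 : ∀ l < K, 0 ≤ h.ra 2 l ∧ h.ia 2 l ≤ 1)
    (hQ : ∀ h' τ', (∀ φ, insE (seg (h.arr 2) 0 K) φ + outsE (seg (h.arr 2) 0 K) (h'.rv 0) ≤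
        insE (seg (h.arr 2) 0 K) (h'.rv 0) + outsE (seg (h.arr 2) 0 K) φ) →
      (h'.rv 0 = 0 ∨ ∃ e ∈ seg (h.arr 2) 0 K, h'.rv 0 = e.1) → τ' ≤ τ + 11 * K + 9 → Q h' τ') :
    wp M selectCode Q h τ := by
  refine wp_seq (wp_rset (by simp) (wp_seq (wp_rset (by simp) (wp_seq (wp_iset (by simp)
    (wp_seq (wp_iset (by simp) (wp_seq (wp_iset (by simp) (wp_seq (wp_iset (by simp)
    (wp_seq (wp_iset_eq (by simp) fun a0 ha0 => ?_)))))))))))))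
  have e11 : a0.iv 11 = K := by simp [ha0, hK]
  -- `x₂₁` and `x₂₃` count the in- and out-events read so far, `x₂₂` the out-events strictly before
  -- the current angle `y₈`, and `x₂₄`, `x₂₅`, `y₀` are the best counts and their angle. The default
  -- is angle `0` with score `0`; the initial `y₈ = -1` is below all angles of events, so that the
  -- first event always counts as a new angle.
  refine wp_for (N := K) 9 (by simp [selectBody, Cmd.setsI]) (fun i h' =>
    h'.iv 23 = cnt (seg (h.arr 2) 0 i) (fun e => e.2 = 1) ∧
    h'.iv 21 = cnt (seg (h.arr 2) 0 i) (fun e => e.2 = 0) ∧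
    h'.rv 8 = (if i = 0 then -1 else h.ra 2 (i - 1)) ∧
    h'.iv 22 = cnt (seg (h.arr 2) 0 i) (fun e => e.2 = 1 ∧ e.1 < h'.rv 8) ∧
    (∀ l < i, insAt (h.arr 2) l + h'.iv 25 ≤ h'.iv 24 + outsAt (h.arr 2) l) ∧
    h'.iv 25 ≤ h'.iv 24 ∧
    (h'.iv 24 = 0 ∧ h'.iv 25 = 0 ∧ h'.rv 0 = 0 ∨ ∃ l < i, h'.rv 0 = h.ra 2 l ∧
      h'.iv 24 = insAt (h.arr 2) l ∧ h'.iv 25 = outsAt (h.arr 2) l)) ?_ ?_ ?_ ?_ ?_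
  · intro h' f
    rw [← e11]
    exact ⟨by simp, f.iv 11 (by simp [forCode, selectBody, Cmd.setsI])⟩
  · intro i h' x inv
    simpa using inv
  · simp [ha0, seg_self, cnt_zero]
  · rintro i hi h' τ' f e14 ⟨i1, i2, i3, i4, i5, i6, i7⟩
    have er : h'.ra 2 = h.ra 2 := by
      rw [f.ra 2 (by simp [forCode, selectBody, Cmd.putsR]), ha0]; rfl
    have ei : h'.ia 2 = h.ia 2 := by
      rw [f.ia 2 (by simp [forCode, selectBody, Cmd.putsI]), ha0]; rfl
    have hprev : ∀ l < i, h.ra 2 l ≤ h'.rv 8 := by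
      intro l hl
      rw [i3, if_neg (by lia)]
      exact hs _ _ (by lia) (by lia)
    have hle : h'.rv 8 ≤ h.ra 2 i := by
      rw [i3]
      split_ifs with hz
      · linarith [(h0 i hi).1]
      · exact hs _ _ (by lia) hi
    have hlab := (h0 i hi).2
    have c1 : cnt (seg (h.arr 2) 0 i) (fun e => e.2 = 1) + h.ia 2 i =
        cnt (seg (h.arr 2) 0 (i + 1)) (fun e => e.2 = 1) := by
      rw [cnt_seg_succ]
      congr 1
      simp only [St.arr]
      split_ifs <;> lia
    have c2 : cnt (seg (h.arr 2) 0 i) (fun e => e.2 = 0) + (1 - h.ia 2 i) =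
        insAt (h.arr 2) i := by
      rw [insAt, cnt_seg_succ]
      congr 1
      simp only [St.arr]
      split_ifs <;> lia
    have c3 : (if h'.rv 8 < h.ra 2 i then h'.iv 23 else h'.iv 22) = outsAt (h.arr 2) i := by
      rw [outsAt, cnt_seg_succ,
        if_neg (fun k => lt_irrefl _ k.2 : ¬ ((h.arr 2 i).2 = 1 ∧ (h.arr 2 i).1 < (h.arr 2 i).1)),
        add_zero]
      split_ifs with hlt
      · rw [i1]
        refine cnt_seg_congr fun l _ hl => ⟨fun k => ⟨k, ?_⟩, fun k => k.1⟩
        exact (hprev l hl).trans_lt hlt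
      · rw [i4]
        have : h'.rv 8 = h.ra 2 i := le_antisymm hle (not_lt.1 hlt)
        rw [this]; rfl
    have main : ∀ b : St, b.ra = h'.ra → b.ia = h'.ia → b.iv 14 = i → b.iv 23 = h'.iv 23 →
        b.iv 21 = h'.iv 21 → b.iv 22 = outsAt (h.arr 2) i → b.iv 24 = h'.iv 24 →
        b.iv 25 = h'.iv 25 → b.rv 0 = h'.rv 0 →
        wp M (.rset 8 (.get 2 (.var 14)) ;; .iset 23 (.add (.var 23) (.get 2 (.var 14))) ;;
          .iset 21 (.add (.var 21) (.sub (.const 1) (.get 2 (.var 14)))) ;;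
          .ite (.ilt (.add (.var 24) (.var 22)) (.add (.var 21) (.var 25)))
            (.iset 24 (.var 21) ;; .iset 25 (.var 22) ;; .rset 0 (.var 8)) .skip)
          (fun h'' τ'' => (h''.iv 23 = cnt (seg (h.arr 2) 0 (i + 1)) (fun e => e.2 = 1) ∧
            h''.iv 21 = cnt (seg (h.arr 2) 0 (i + 1)) (fun e => e.2 = 0) ∧
            h''.rv 8 = (if i + 1 = 0 then -1 else h.ra 2 (i + 1 - 1)) ∧
            h''.iv 22 = cnt (seg (h.arr 2) 0 (i + 1)) (fun e => e.2 = 1 ∧ e.1 < h''.rv 8) ∧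
            (∀ l < i + 1, insAt (h.arr 2) l + h''.iv 25 ≤ h''.iv 24 + outsAt (h.arr 2) l) ∧
            h''.iv 25 ≤ h''.iv 24 ∧
            (h''.iv 24 = 0 ∧ h''.iv 25 = 0 ∧ h''.rv 0 = 0 ∨ ∃ l < i + 1, h''.rv 0 = h.ra 2 l ∧
              h''.iv 24 = insAt (h.arr 2) l ∧ h''.iv 25 = outsAt (h.arr 2) l)) ∧
              τ'' ≤ τ' + 9) b (τ' + 1 + 1) := by
      intro b br bi b14 b23 b21 b22 b24 b25 b0
      refine wp_seq (wp_rset (by simp [b14]; lia) (wp_seq (wp_iset (by simp [b14]; lia) (wp_seq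
        (wp_iset_eq (by simp [b14]; lia) fun b1 hb1 => ?_)))))
      have g14 : b1.iv 14 = i := by simp [hb1, b14]
      have g23 : b1.iv 23 = cnt (seg (h.arr 2) 0 (i + 1)) (fun e => e.2 = 1) := by
        rw [← c1]; simp [hb1, b14, bi, ei, b23, i1]
      have g21 : b1.iv 21 = insAt (h.arr 2) i := by
        rw [← c2]; simp [hb1, b14, bi, ei, b21, i2]
      have g22 : b1.iv 22 = outsAt (h.arr 2) i := by simp [hb1, b22]
      have g24 : b1.iv 24 = h'.iv 24 := by simp [hb1, b24]
      have g25 : b1.iv 25 = h'.iv 25 := by simp [hb1, b25]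
      have g8 : b1.rv 8 = h.ra 2 i := by simp [hb1, b14, br, er]
      have g0 : b1.rv 0 = h'.rv 0 := by simp [hb1, b0]
      refine wp_ite (by simp) (fun hb => ?_) (fun hb => ?_)
      · simp only [BE.eval, IE.eval, g24, g22, g21, g25] at hb
        refine wp_seq (wp_iset (by simp) (wp_seq (wp_iset (by simp) (wp_rset (by simp)
          ⟨⟨?_, ?_, ?_, ?_, ?_, ?_, .inr ⟨i, by lia, ?_, ?_, ?_⟩⟩, by lia⟩))))
        · simp [g23]
        · simp [g21]; rfl
        · simp [g8]
        · simp [g8, g22]; rfl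
        · intro l hl
          simp only [St.setr_iv, St.seti_iv, IE.eval]
          simp [g21, g22]
          rcases Nat.lt_succ_iff_lt_or_eq.1 hl with hl | rfl
          · have := i5 l hl; lia
          · lia
        · simp [g21, g22]; lia
        · simp [g8]
        · simp [g21]
        · simp [g22]
      · simp only [BE.eval, IE.eval, g24, g22, g21, g25] at hb
        refine wp_skip ⟨⟨g23, g21, by simp [g8], ?_, ?_, by rw [g24, g25]; exact i6, ?_⟩, by lia⟩
        · simp [g8, g22]; rfl
        · intro l hl
          rw [g24, g25]
          rcases Nat.lt_succ_iff_lt_or_eq.1 hl with hl | rfl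
          · exact i5 l hl
          · lia
        · rw [g24, g25, g0]
          rcases i7 with k | ⟨l, k1, k2⟩
          · exact .inl k
          · exact .inr ⟨l, by lia, k2⟩
    refine wp_seq (wp_ite (by simp [e14]; lia) (fun hb => ?_) (fun hb => ?_))
    · simp only [BE.eval, RE.eval, IE.eval, e14, er] at hb
      rw [if_pos hb] at c3
      exact wp_iset (by simp) (main _ rfl rfl (by simp [e14]) (by simp) (by simp)
        (by simpa using c3) (by simp) (by simp) rfl)
    · simp only [BE.eval, RE.eval, IE.eval, e14, er] at hb
      rw [if_neg hb] at c3
      exact wp_skip (main _ rfl rfl e14 rfl rfl c3 rfl rfl rfl)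
  · rintro a1 τ1 - ⟨-, -, -, -, i5, i6, i7⟩ t1
    refine hQ a1 _ (select_correct (a := h.arr 2) hs (fun l hl => (h0 l hl).1) i7 i6 i5) ?_
      (by lia)
    rcases i7 with k | ⟨l, k1, k2, -⟩
    · exact .inl k.2.2
    · exact .inr ⟨_, (mem_seg _).2 ⟨l, Nat.zero_le _, k1, rfl⟩, k2⟩

/-! ### The complete program and its running time -/

/-- What the program needs to know about the vertices `V` and the points `P`, relative to the
center: `σ` is `1` if the interior is to the left of the boundary and `0` otherwise, and `E` are
the events. -/
structure Valid (m n : ℕ) (V P : ℕ → ℂ) (σ : ℕ) (E : Multiset (ℝ × ℕ)) : Prop where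
  le_one : σ ≤ 1
  orient : ∀ i < m, (∀ j < m, Complex.normSq (V (j + 1)) ≤ Complex.normSq (V (i + 1))) →
    (argPos (V (i + 1) * (starRingEnd ℂ) (V (i + 2) - V (i + 1))) <
      argPos (-(V (i + 1) - V i) * (starRingEnd ℂ) (V (i + 2) - V (i + 1))) ↔ σ = 0)
  order_strict : KeepsOrder false (2 * m) (fun t => (strictItem V σ t).lo)
    (itemsOf (strictItem V σ))
  order_point : KeepsOrder true (4 * m) (fun t => (pointItem V σ t).lo) (itemsOf (pointItem V σ))
  events : ∑ p ∈ Finset.range n,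
    ((itemsOf (strictItem V σ)).events false (2 * m) (fun t => (strictItem V σ t).lo)
        (Complex.normSq (P p)) (argPos (P p)) +
      (itemsOf (pointItem V σ)).events true (4 * m) (fun t => (pointItem V σ t).lo)
        (Complex.normSq (P p)) (argPos (P p))) = E
  nonneg : ∀ e ∈ E, 0 ≤ e.1 ∧ e.2 ≤ 1

def mainCode : Cmd :=
  pointsCode ;; vertsCode ;; orientCode ;; .iset 11 (.const 0) ;;
  forCode 14 (.var 1) strictBody ;; phaseCode false (.add (.var 1) (.var 1)) ;;
  forCode 14 (.var 1) pointBody ;;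
  phaseCode true (.add (.add (.var 1) (.var 1)) (.add (.var 1) (.var 1))) ;;
  .iset 40 (.const 0) ;; .iset 41 (.var 11) ;; sortCode 2 ;; selectCode

/-- The sweeps visit the points in sorted order, while the events are defined by a sum in the order
of the input. -/
theorem sum_of_seg_eq {A : Type*} [AddCommMonoid A] {n : ℕ} {a f : ℕ → ℝ × ℕ}
    (h : seg a 0 n = (Multiset.range n).map f) (G : ℝ × ℕ → A) :
    ∑ i ∈ Finset.range n, G (a i) = ∑ p ∈ Finset.range n, G (f p) := by
  have := congrArg (fun s => (Multiset.map G s).sum) h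
  simp only [seg_zero, Multiset.map_map] at this
  exact this

theorem main_time {n m K K₁ K₂ d : ℕ} (hm : 3 ≤ m) (hK : K₁ + K₂ = K) (hd : d ≤ 4 * n) :
    4 * n + 24 * (n + 1) * (Nat.log 2 n + 1) + 6 + (4 * m + 6) + (5 * m + 5) + 1 +
      (18 * m + 2) + (63 * K₁ + 81 * (Nat.log 2 (2 * m) + 1) * (2 * m + 1) + 131 * n + 9) +
      (42 * m + 2) + (63 * K₂ + 81 * (Nat.log 2 (4 * m) + 1) * (4 * m + 1) + 131 * n + 9) + 2 +
      (24 * (K - 0 + 1) * (Nat.log 2 d + 1) + 2) + (11 * K + 9) ≤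
    2000 * ((n + K + 1) * (Nat.log 2 (4 * n) + 1) + m * (Nat.log 2 (4 * m) + 1)) := by
  have a1 : n + K + 1 ≤ (n + K + 1) * (Nat.log 2 (4 * n) + 1) :=
    Nat.le_mul_of_pos_right _ (Nat.succ_pos _)
  have a2 : m ≤ m * (Nat.log 2 (4 * m) + 1) := Nat.le_mul_of_pos_right _ (Nat.succ_pos _)
  have b1 : 24 * (n + 1) * (Nat.log 2 n + 1) ≤ 24 * ((n + K + 1) * (Nat.log 2 (4 * n) + 1)) := by
    rw [mul_assoc]
    have : Nat.log 2 n ≤ Nat.log 2 (4 * n) := Nat.log_mono_right (by lia)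
    gcongr
    lia
  have b2 : 24 * (K - 0 + 1) * (Nat.log 2 d + 1) ≤
      24 * ((n + K + 1) * (Nat.log 2 (4 * n) + 1)) := by
    rw [mul_assoc]
    have : Nat.log 2 d ≤ Nat.log 2 (4 * n) := Nat.log_mono_right hd
    gcongr
    lia
  have b3 : 81 * (Nat.log 2 (2 * m) + 1) * (2 * m + 1) ≤
      243 * (m * (Nat.log 2 (4 * m) + 1)) := by
    have : Nat.log 2 (2 * m) ≤ Nat.log 2 (4 * m) := Nat.log_mono_right (by lia)
    calc 81 * (Nat.log 2 (2 * m) + 1) * (2 * m + 1)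
        ≤ 81 * (Nat.log 2 (4 * m) + 1) * (3 * m) := by gcongr; lia
      _ = _ := by ring
  have b4 : 81 * (Nat.log 2 (4 * m) + 1) * (4 * m + 1) ≤
      405 * (m * (Nat.log 2 (4 * m) + 1)) := by
    calc 81 * (Nat.log 2 (4 * m) + 1) * (4 * m + 1)
        ≤ 81 * (Nat.log 2 (4 * m) + 1) * (5 * m) := by gcongr; lia
      _ = _ := by ring
  generalize (n + K + 1) * (Nat.log 2 (4 * n) + 1) = A at *
  generalize m * (Nat.log 2 (4 * m) + 1) = B at *
  generalize 24 * (n + 1) * (Nat.log 2 n + 1) = X1 at *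
  generalize 24 * (K - 0 + 1) * (Nat.log 2 d + 1) = X2 at *
  generalize 81 * (Nat.log 2 (2 * m) + 1) * (2 * m + 1) = X3 at *
  generalize 81 * (Nat.log 2 (4 * m) + 1) * (4 * m + 1) = X4 at *
  omega

/-- The side `σ` and the validity of the items are only asked for once the vertices are in memory,
for any `V` that agrees with the closed list of vertices at the indices `0` to `m + 1`. `M` has room
for the points, the `4 * m` items and the `K` events. -/
theorem mainCode_wp {M n m K : ℕ} {E : Multiset (ℝ × ℕ)} {Q : St → ℕ → Prop} {h : St} {τ : ℕ}
    (hn : h.iv 0 = n) (hm : h.iv 1 = m) (hm3 : 3 ≤ m) (hlen : h.len = 2 * (1 + m + n))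
    (hK : Multiset.card E = K) (hM : n + 4 * m + K + 3 ≤ M)
    (H : ∀ V, (∀ i < m, V i = h.vtx i) → V m = h.vtx 0 → V (m + 1) = h.vtx 1 →
      ∃ σ, Valid m n V h.pt σ E)
    (hQ : ∀ h' τ', (∀ φ, insE E φ + outsE E (h'.rv 0) ≤ insE E (h'.rv 0) + outsE E φ) →
      (h'.rv 0 = 0 ∨ ∃ e ∈ E, h'.rv 0 = e.1) → τ' ≤ τ +
        2000 * ((n + K + 1) * (Nat.log 2 (4 * n) + 1) + m * (Nat.log 2 (4 * m) + 1)) → Q h' τ') :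
    wp M mainCode Q h τ := by
  refine wp_seq (pointsCode_wp hn hm hlen (by lia) fun a1 τ1 f1 p1 p2 t1 => ?_)
  have n1 : a1.iv 0 = n := by
    rw [f1.iv 0 (by simp [pointsCode, forCode, sortCode, passCode, mergeCode, scanCode, copyCode,
      Cmd.setsI]), hn]
  have m1 : a1.iv 1 = m := by
    rw [f1.iv 1 (by simp [pointsCode, forCode, sortCode, passCode, mergeCode, scanCode, copyCode,
      Cmd.setsI]), hm]
  have l1 : a1.len = 2 * (1 + m + n) := by rw [f1.len, hlen]
  have v1 : a1.vtx = h.vtx := by funext i; simp [St.vtx, f1.inp]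
  refine wp_seq (vertsCode_wp m1 (by lia) (by lia) (by lia) fun a2 τ2 f2 q1 q2 q3 t2 => ?_)
  rw [v1] at q1 q2 q3
  obtain ⟨σ, hv⟩ := H a2.V q1 q2 q3
  have n2 : a2.iv 0 = n := by
    rw [f2.iv 0 (by simp [vertsCode, forCode, Cmd.setsI]), n1]
  have m2 : a2.iv 1 = m := by
    rw [f2.iv 1 (by simp [vertsCode, forCode, Cmd.setsI]), m1]
  have l2 : a2.len = 2 * (1 + m + n) := by rw [f2.len, l1]
  have ar2 : a2.ra 0 = a1.ra 0 := f2.ra 0 (by simp [vertsCode, forCode, Cmd.putsR])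
  have ai2 : a2.ia 0 = a1.ia 0 := f2.ia 0 (by simp [vertsCode, forCode, Cmd.putsI])
  refine wp_seq (orientCode_wp m2 (by lia) (by lia) hv.le_one hv.orient fun a3 τ3 f3 s3 t3 => ?_)
  have n3 : a3.iv 0 = n := by rw [f3.iv 0 (by simp [orientCode, forCode, Cmd.setsI]), n2]
  have m3 : a3.iv 1 = m := by rw [f3.iv 1 (by simp [orientCode, forCode, Cmd.setsI]), m2]
  have l3 : a3.len = 2 * (1 + m + n) := by rw [f3.len, l2]
  have ar3 : a3.ra = a2.ra := by
    funext k; exact f3.ra k (by simp [orientCode, forCode, Cmd.putsR])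
  have ai3 : a3.ia = a2.ia := by
    funext k; exact f3.ia k (by simp [orientCode, forCode, Cmd.putsI])
  have V3 : a3.V = a2.V := by funext i; simp [St.V, ar3]
  refine wp_seq (wp_iset_eq (by simp) fun a4 ha4 => wp_seq ?_)
  have n4 : a4.iv 0 = n := by simp [ha4, n3]
  have m4 : a4.iv 1 = m := by simp [ha4, m3]
  have l4 : a4.len = 2 * (1 + m + n) := by simp [ha4, l3]
  have V4 : a4.V = a2.V := by rw [← V3, ha4]; rfl
  refine wp_for (N := m) 16 (by simp [strictBody, itemCode, Cmd.setsI]) (fun i h' =>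
    h'.V = a2.V ∧ ∀ t < 2 * i, h'.item t = strictItem a2.V σ t ∧ h'.ia 4 t = t) ?_ ?_ ?_ ?_ ?_
  · intro h' f
    rw [← m4]
    exact ⟨by simp, f.iv 1 (by simp [forCode, strictBody, itemCode, Cmd.setsI])⟩
  · exact fun i h' x inv => inv
  · exact ⟨V4, by simp⟩
  · rintro i hi h' τ' f e14 ⟨i1, i2⟩
    refine strictBody_wp (σ := σ) e14 ?_ (by lia) fun h'' g1 g2 g3 => ⟨⟨g1.trans i1, ?_⟩, le_rfl⟩
    · rw [f.iv 19 (by simp [forCode, strictBody, itemCode, Cmd.setsI])]; simp [ha4, s3]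
    · intro t ht
      rw [i1] at g2
      by_cases hti : t / 2 = i
      · exact g2 t hti
      · rw [(g3 t hti).1, (g3 t hti).2]; exact i2 t (by lia)
  rintro a5 τ5 f5 ⟨V5, D5⟩ t5
  have iv5 : ∀ v, v ≠ 14 → a5.iv v = a4.iv v :=
    fun v hv => f5.iv v (by simp [forCode, strictBody, itemCode, Cmd.setsI, hv])
  have n5 : a5.iv 0 = n := by rw [iv5 0 (by lia), n4]
  have m5 : a5.iv 1 = m := by rw [iv5 1 (by lia), m4]
  have l5 : a5.len = 2 * (1 + m + n) := by rw [f5.len, l4]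
  have ar5 : a5.ra 0 = a1.ra 0 := by
    rw [f5.ra 0 (by simp [forCode, strictBody, itemCode, Cmd.putsR]), ha4, St.seti_ra, ar3, ar2]
  have ai5 : a5.ia 0 = a1.ia 0 := by
    rw [f5.ia 0 (by simp [forCode, strictBody, itemCode, Cmd.putsI]), ha4, St.seti_ia, ai3, ai2]
  have inp5 : a5.inp = h.inp := by
    rw [f5.inp, ha4, St.seti_inp, f3.inp, f2.inp, f1.inp]
  have b5 : a5.beta = fun p => argPos (h.pt p) := by
    funext p; simp [St.beta_eq, St.pt, inp5, m5, hm]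
  have pts1 : ∀ i < n, a1.ia 0 i < n := by
    intro i hi
    have : a1.arr 0 i ∈ seg (a1.arr 0) 0 n := (mem_seg _).2 ⟨i, Nat.zero_le _, hi, rfl⟩
    rw [p1, Multiset.mem_map] at this
    obtain ⟨t, ht, ht'⟩ := this
    have := congrArg Prod.snd ht'
    simp only [St.arr] at this
    rw [← this]; simpa using ht
  set D₁ := strictItem a2.V σ with hD₁
  set D₂ := pointItem a2.V σ with hD₂
  set K₁ := ∑ i ∈ Finset.range n, Multiset.card (active false (2 * m) (fun t => (D₁ t).lo)
    (fun t => (D₁ t).hi) (a1.ra 0 i)) with hK₁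
  set K₂ := ∑ i ∈ Finset.range n, Multiset.card (active true (4 * m) (fun t => (D₂ t).lo)
    (fun t => (D₂ t).hi) (a1.ra 0 i)) with hK₂
  set E₁ := ∑ i ∈ Finset.range n, (itemsOf D₁).events false (2 * m) (fun t => (D₁ t).lo)
    (a1.ra 0 i) (argPos (h.pt (a1.ia 0 i))) with hE₁
  set E₂ := ∑ i ∈ Finset.range n, (itemsOf D₂).events true (4 * m) (fun t => (D₂ t).lo)
    (a1.ra 0 i) (argPos (h.pt (a1.ia 0 i))) with hE₂
  have hE : E₁ + E₂ = E := by
    rw [← hv.events, hE₁, hE₂, ← Finset.sum_add_distrib]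
    exact sum_of_seg_eq p1 fun x =>
      (itemsOf D₁).events false (2 * m) (fun t => (D₁ t).lo) x.1 (argPos (h.pt x.2)) +
      (itemsOf D₂).events true (4 * m) (fun t => (D₂ t).lo) x.1 (argPos (h.pt x.2))
  have hKK : K₁ + K₂ = K := by
    have e1 : Multiset.card E₁ = K₁ := by
      rw [hE₁, hK₁, Multiset.card_sum]
      exact Finset.sum_congr rfl fun i _ => Multiset.card_map _ _
    have e2 : Multiset.card E₂ = K₂ := by
      rw [hE₂, hK₂, Multiset.card_sum]
      exact Finset.sum_congr rfl fun i _ => Multiset.card_map _ _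
    rw [← e1, ← e2, ← Multiset.card_add, hE, hK]
  refine wp_seq (phaseCode_wp (N := 2 * m) (D := D₁) ⟨by simp [m5]; lia, by simp⟩ D5 n5
    (by rw [l5, m5]) (by lia) (by lia) (by rw [ai5]; exact pts1) (by rw [ar5]; exact p2)
    hv.order_strict (e := 0) (K := K₁) (by rw [iv5 11 (by lia), ha4]; simp)
    (by rw [hK₁, ar5]) (by lia) ?_)
  intro a6 τ6 f6 g1 g2 g3 t6
  rw [seg_self, zero_add, zero_add, b5, ar5, ai5] at g2
  have g2 : seg (a6.arr 2) 0 K₁ = E₁ := g2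
  have iv6 : ∀ v, v = 0 ∨ v = 1 ∨ v = 19 → a6.iv v = a5.iv v := fun v hv => f6.iv v (by
    rcases hv with rfl | rfl | rfl <;>
    simp [phaseCode, sweepCode, sweepBody, filterCode, bornCode, pushCode, emitCode, sortCode,
      passCode, mergeCode, scanCode, copyCode, Cmd.setsI])
  have ra6 : ∀ v, v = 0 ∨ v = 5 ∨ v = 6 → a6.ra v = a5.ra v := fun v hv => f6.ra v (by
    rcases hv with rfl | rfl | rfl <;>
    simp [phaseCode, sweepCode, sweepBody, filterCode, bornCode, pushCode, emitCode, sortCode,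
      passCode, mergeCode, scanCode, copyCode, Cmd.putsR])
  have ia6 : a6.ia 0 = a5.ia 0 := f6.ia 0 (by
    simp [phaseCode, sweepCode, sweepBody, filterCode, bornCode, pushCode, emitCode, sortCode,
      passCode, mergeCode, scanCode, copyCode, Cmd.putsI])
  have V6 : a6.V = a2.V := by
    rw [← V5]; funext i; simp [St.V, ra6]
  have m6 : a6.iv 1 = m := by rw [iv6 1 (by simp), m5]
  have s6 : a6.iv 19 = σ := by rw [iv6 19 (by simp), iv5 19 (by lia), ha4]; simp [s3]
  refine wp_seq (wp_for (N := m) 40 (by simp [pointBody, nodeCode, itemCode, Cmd.setsI])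
    (fun i h' => h'.V = a2.V ∧ ∀ t < 4 * i, h'.item t = D₂ t ∧ h'.ia 4 t = t) ?_ ?_ ?_ ?_ ?_)
  · intro h' f
    rw [← m6]
    exact ⟨by simp, f.iv 1 (by simp [forCode, pointBody, nodeCode, itemCode, Cmd.setsI])⟩
  · exact fun i h' x inv => inv
  · exact ⟨V6, by simp⟩
  · rintro i hi h' τ' f e14 ⟨i1, i2⟩
    refine pointBody_wp (σ := σ) e14 ?_ (by lia) fun h'' g1 g2 g3 => ⟨⟨g1.trans i1, ?_⟩, le_rfl⟩
    · rw [f.iv 19 (by simp [forCode, pointBody, nodeCode, itemCode, Cmd.setsI]), s6]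
    · intro t ht
      rw [i1] at g2
      by_cases hti : t / 4 = i
      · exact g2 t hti
      · rw [(g3 t hti).1, (g3 t hti).2]; exact i2 t (by lia)
  rintro a7 τ7 f7 ⟨V7, D7⟩ t7
  have iv7 : ∀ v, v ≠ 14 → a7.iv v = a6.iv v :=
    fun v hv => f7.iv v (by simp [forCode, pointBody, nodeCode, itemCode, Cmd.setsI, hv])
  have n7 : a7.iv 0 = n := by rw [iv7 0 (by lia), iv6 0 (by simp), n5]
  have m7 : a7.iv 1 = m := by rw [iv7 1 (by lia), m6]
  have l7 : a7.len = 2 * (1 + m + n) := by rw [f7.len, f6.len, l5]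
  have ar7 : a7.ra 0 = a1.ra 0 := by
    rw [f7.ra 0 (by simp [forCode, pointBody, nodeCode, itemCode, Cmd.putsR]), ra6 0 (by simp), ar5]
  have ai7 : a7.ia 0 = a1.ia 0 := by
    rw [f7.ia 0 (by simp [forCode, pointBody, nodeCode, itemCode, Cmd.putsI]), ia6, ai5]
  have ar7' : a7.ra 2 = a6.ra 2 :=
    f7.ra 2 (by simp [forCode, pointBody, nodeCode, itemCode, Cmd.putsR])
  have ai7' : a7.ia 2 = a6.ia 2 :=
    f7.ia 2 (by simp [forCode, pointBody, nodeCode, itemCode, Cmd.putsI])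
  have arr7 : a7.arr 2 = a6.arr 2 := by funext l; rw [St.arr, St.arr, ar7', ai7']
  have b7 : a7.beta = fun p => argPos (h.pt p) := by
    funext p; simp [St.beta_eq, St.pt, f7.inp, f6.inp, inp5, m7, hm]
  refine wp_seq (phaseCode_wp (N := 4 * m) (D := D₂) ⟨by simp [m7]; lia, by simp⟩ D7 n7
    (by rw [l7, m7]) (by lia) (by lia) (by rw [ai7]; exact pts1) (by rw [ar7]; exact p2)
    hv.order_point (e := K₁) (K := K₂) (by rw [iv7 11 (by lia), g1, zero_add])
    (by rw [hK₂, ar7]) (by lia) ?_)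
  intro a8 τ8 f8 k1 k2 k3 t8
  rw [arr7, g2, b7, ar7, ai7, hKK] at k2
  have k2 : seg (a8.arr 2) 0 K = E := by rw [k2, ← hE]
  rw [hKK] at k1
  rw [ar7', hKK] at k3
  rw [zero_add] at g3
  -- Two descents per point in each of the two sweeps. This is why the final sort costs `log n`, and
  -- not `log K`, per event.
  have hd : desc (a8.ra 2) 0 K ≤ 4 * n := by
    have : desc (a5.ra 2) 0 0 = 0 := Nat.le_zero.1 (desc_le _ _ _)
    lia
  refine wp_seq (wp_iset (by simp) (wp_seq (wp_iset_eq (by simp) fun a9 ha9 => wp_seq ?_)))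
  have e9 : a9.arr 2 = a8.arr 2 := by rw [ha9]; rfl
  have e9' : a9.ra 2 = a8.ra 2 := by rw [ha9]; rfl
  refine sortCode_wp (lo := 0) (hi := K) (by lia) (by lia) (by simp [ha9])
    (by simp [ha9, k1]) (Nat.zero_le _) (by lia) ?_
  intro a10 τ10 f10 w1 w2 w3 w4
  have segE : seg (a10.arr 2) 0 K = E := by rw [w1, e9, k2]
  rw [e9'] at w4
  refine selectCode_wp (K := K) ?_ (by lia) (fun a b hab hb => w3 a b (Nat.zero_le _) hab hb) ?_ ?_
  · rw [f10.iv 11 (Cmd.sets_sort 2 (by lia)), ha9]; simp [k1]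
  · intro l hl
    exact hv.nonneg (a10.arr 2 l) (segE ▸ (mem_seg _).2 ⟨l, Nat.zero_le _, hl, rfl⟩)
  · rw [segE]
    intro h' τ' r1 r2 r3
    refine hQ h' τ' r1 r2 (le_trans ?_ (Nat.add_le_add_left (main_time (n := n) hm3 hKK hd) τ))
    clear * - r3 w4 t8 t7 t6 t5 t3 t2 t1
    generalize 24 * (n + 1) * (Nat.log 2 n + 1) = X1 at *
    generalize 24 * (K - 0 + 1) * (Nat.log 2 (desc (a8.ra 2) 0 K) + 1) = X2 at *
    generalize 81 * (Nat.log 2 (2 * m) + 1) * (2 * m + 1) = X3 at *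
    generalize 81 * (Nat.log 2 (4 * m) + 1) * (4 * m + 1) = X4 at *
    omega

end FixedMCR

namespace FixedMCR

/-! ## Angles -/

open Complex (exp I)
open Real (pi arctan)

theorem four_mul_arctan_one : 4 * arctan 1 = pi := by
  rw [Real.arctan_one]; ring

/-- Half-angle formulas: `sin φ / (1 - cos φ)` is the cotangent of `φ / 2`, the tangent of `π / 2 -
φ / 2`, and the latter angle is in the range of the arc tangent. -/
theorem argPos_polar {r φ : ℝ} (hr : 0 < r) (h0 : 0 ≤ φ) (h1 : φ < 2 * pi) :
    argPos (r * exp (φ * I)) = φ := by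
  have hre : ((r : ℂ) * exp (φ * I)).re = r * Real.cos φ := by
    rw [Complex.re_ofReal_mul, Complex.exp_ofReal_mul_I_re]
  have him : ((r : ℂ) * exp (φ * I)).im = r * Real.sin φ := by
    rw [Complex.im_ofReal_mul, Complex.exp_ofReal_mul_I_im]
  have hn : √(r * Real.cos φ * (r * Real.cos φ) + r * Real.sin φ * (r * Real.sin φ)) = r := by
    rw [show r * Real.cos φ * (r * Real.cos φ) + r * Real.sin φ * (r * Real.sin φ) =
      r ^ 2 * (Real.cos φ ^ 2 + Real.sin φ ^ 2) by ring, Real.cos_sq_add_sin_sq, mul_one,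
      Real.sqrt_sq hr.le]
  rw [argPos, ang, hre, him, hn]
  rcases h0.eq_or_lt with rfl | h0
  · simp
  have hs : 0 < Real.sin (φ / 2) := Real.sin_pos_of_pos_of_lt_pi (by linarith) (by linarith)
  have hc : Real.cos φ = 1 - 2 * Real.sin (φ / 2) ^ 2 := by
    have := Real.cos_two_mul (φ / 2)
    rw [show 2 * (φ / 2) = φ by ring] at this
    have := Real.sin_sq_add_cos_sq (φ / 2)
    linarith
  have hsin : Real.sin φ = 2 * Real.sin (φ / 2) * Real.cos (φ / 2) := by
    rw [← Real.sin_two_mul]; congr 1; ring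
  rw [if_neg (by rw [hc]; nlinarith [mul_pos hr (pow_pos hs 2)])]
  have : r * Real.sin φ / (r - r * Real.cos φ) = Real.tan (pi / 2 - φ / 2) := by
    rw [Real.tan_pi_div_two_sub, Real.tan_eq_sin_div_cos, inv_div, hc, hsin]
    field_simp
    ring
  rw [this, Real.arctan_tan (by linarith) (by linarith), four_mul_arctan_one]
  ring

theorem exists_polar (z : ℂ) : ∃ φ : ℝ, 0 ≤ φ ∧ φ < 2 * pi ∧ (‖z‖ : ℂ) * exp (φ * I) = z := by
  refine ⟨toIcoMod Real.two_pi_pos 0 z.arg, (toIcoMod_mem_Ico _ _ _).1, ?_, ?_⟩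
  · simpa using (toIcoMod_mem_Ico Real.two_pi_pos 0 z.arg).2
  · rw [toIcoMod]
    conv_rhs => rw [← Complex.norm_mul_exp_arg_mul_I z]
    congr 1
    push_cast
    rw [sub_mul, Complex.exp_sub]
    have : exp (((toIcoDiv Real.two_pi_pos 0 z.arg • (2 * pi) : ℝ) : ℂ) * I) = 1 := by
      rw [Complex.exp_eq_one_iff]
      exact ⟨toIcoDiv Real.two_pi_pos 0 z.arg, by push_cast [zsmul_eq_mul]; ring⟩
    push_cast [zsmul_eq_mul] at this ⊢
    rw [this, div_one]

@[simp] theorem argPos_zero : argPos 0 = 0 := by simp [argPos, ang]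

theorem argPos_spec (z : ℂ) :
    0 ≤ argPos z ∧ argPos z < 2 * pi ∧ (‖z‖ : ℂ) * exp (argPos z * I) = z := by
  rcases eq_or_ne z 0 with rfl | hz
  · simp [Real.pi_pos]
  obtain ⟨φ, h0, h1, h2⟩ := exists_polar z
  have : argPos z = φ := by
    conv_lhs => rw [← h2]
    exact argPos_polar (norm_pos_iff.2 hz) h0 h1
  rw [this]
  exact ⟨h0, h1, h2⟩

theorem argPos_nonneg (z : ℂ) : 0 ≤ argPos z := (argPos_spec z).1

theorem argPos_lt (z : ℂ) : argPos z < 2 * pi := (argPos_spec z).2.1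

theorem norm_mul_exp_argPos (z : ℂ) : (‖z‖ : ℂ) * exp (argPos z * I) = z := (argPos_spec z).2.2

theorem argPos_mul_exp {z : ℂ} (hz : z ≠ 0) {δ : ℝ} (h0 : 0 ≤ argPos z + δ)
    (h1 : argPos z + δ < 2 * pi) : argPos (z * exp (δ * I)) = argPos z + δ := by
  conv_lhs => rw [← norm_mul_exp_argPos z, mul_assoc, ← Complex.exp_add, ← add_mul]
  have := argPos_polar (norm_pos_iff.2 hz) h0 h1
  push_cast at this
  exact this

theorem argPos_ofReal_mul {c : ℝ} (hc : 0 < c) (z : ℂ) : argPos (c * z) = argPos z := by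
  rcases eq_or_ne z 0 with rfl | hz
  · simp
  conv_lhs => rw [← norm_mul_exp_argPos z, ← mul_assoc, ← Complex.ofReal_mul]
  exact argPos_polar (mul_pos hc (norm_pos_iff.2 hz)) (argPos_nonneg z) (argPos_lt z)

/-- The two numbers differ by the positive factor `|B|²`. The program uses the product, the proofs
use the quotient. -/
theorem argPos_mul_conj {B : ℂ} (hB : B ≠ 0) (z : ℂ) :
    argPos (z * (starRingEnd ℂ) B) = argPos (z / B) := by
  have : z * (starRingEnd ℂ) B = (Complex.normSq B : ℝ) * (z / B) := by
    rw [← Complex.mul_conj]; field_simp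
  rw [this, argPos_ofReal_mul (Complex.normSq_pos.2 hB)]

theorem exists_pos_mul_of_argPos_eq {z w : ℂ} (hz : z ≠ 0) (hw : w ≠ 0)
    (h : argPos z = argPos w) : ∃ c : ℝ, 0 < c ∧ z = c * w := by
  refine ⟨‖z‖ / ‖w‖, div_pos (norm_pos_iff.2 hz) (norm_pos_iff.2 hw), ?_⟩
  have h1 := norm_mul_exp_argPos z
  have h2 := norm_mul_exp_argPos w
  have h3 : (‖w‖ : ℂ) ≠ 0 := by simpa using hw
  push_cast
  rw [div_mul_eq_mul_div, eq_div_iff h3, ← h1, h]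
  conv_rhs => rw [← h2]
  simp
  ring

/-- The chord of the unit circle over the angle `δ` has the signed length `2 sin (δ / 2)` and the
direction of the tangent in the middle of the arc. So it deviates from the tangent at its start by
exactly `δ / 2`, which decides all tangential cases. -/
theorem exp_sub_one (δ : ℝ) :
    exp (δ * I) - 1 = (2 * Real.sin (δ / 2) : ℝ) * (I * exp ((δ / 2 : ℝ) * I)) := by
  have h1 : exp (δ * I) = exp ((δ / 2 : ℝ) * I) * exp ((δ / 2 : ℝ) * I) := by
    rw [← Complex.exp_add]; congr 1; push_cast; ring
  have h2 : exp ((δ / 2 : ℝ) * I) = Complex.cos (δ / 2 : ℝ) + Complex.sin (δ / 2 : ℝ) * I :=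
    Complex.exp_mul_I _
  have h3 := Complex.sin_sq_add_cos_sq ((δ / 2 : ℝ) : ℂ)
  rw [h1, h2]
  push_cast at h3 ⊢
  linear_combination h3 - Complex.sin (δ / 2) ^ 2 * Complex.I_sq

theorem argPos_ofReal_pos {c : ℝ} (hc : 0 < c) : argPos c = 0 := by
  have := argPos_polar hc le_rfl Real.two_pi_pos
  simpa using this

theorem argPos_neg_one : argPos (-1) = pi := by
  have := argPos_polar one_pos Real.pi_pos.le (by linarith [Real.pi_pos])
  simpa using this

theorem im_eq_sin (z : ℂ) : z.im = ‖z‖ * Real.sin (argPos z) := by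
  conv_lhs => rw [← norm_mul_exp_argPos z]
  rw [Complex.im_ofReal_mul, Complex.exp_ofReal_mul_I_im]

theorem argPos_of_im_pos {z : ℂ} (hz : 0 < z.im) : 0 < argPos z ∧ argPos z < pi := by
  rw [im_eq_sin] at hz
  have hs : 0 < Real.sin (argPos z) := by
    by_contra h
    exact absurd hz (not_lt.2 (mul_nonpos_of_nonneg_of_nonpos (norm_nonneg _) (not_lt.1 h)))
  constructor
  · rcases (argPos_nonneg z).eq_or_lt with h | h
    · rw [← h, Real.sin_zero] at hs; exact absurd hs (lt_irrefl _)
    · exact h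
  · by_contra h
    have := Real.sin_nonneg_of_nonneg_of_le_pi (x := argPos z - pi) (by linarith)
      (by linarith [argPos_lt z])
    rw [Real.sin_sub_pi] at this
    linarith

theorem argPos_of_im_neg {z : ℂ} (hz : z.im < 0) : pi < argPos z := by
  rw [im_eq_sin] at hz
  by_contra h
  have := Real.sin_nonneg_of_nonneg_of_le_pi (argPos_nonneg z) (not_lt.1 h)
  exact absurd hz (not_lt.2 (mul_nonneg (norm_nonneg _) this))

theorem wrap_spec {x : ℝ} (h1 : -(2 * pi) < x) (h2 : x < 2 * pi) :
    0 ≤ wrap x ∧ wrap x < 2 * pi ∧ exp (wrap x * I) = exp (x * I) := by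
  rw [wrap, four_mul_arctan_one]
  split_ifs with h
  · exact ⟨h, h2, rfl⟩
  · refine ⟨by linarith, by linarith, ?_⟩
    push_cast
    rw [add_mul, Complex.exp_add, Complex.exp_two_pi_mul_I, mul_one]

theorem exp_injOn {θ θ' : ℝ} (h : θ ∈ Set.Ico 0 (2 * pi)) (h' : θ' ∈ Set.Ico 0 (2 * pi))
    (he : exp (θ * I) = exp (θ' * I)) : θ = θ' := by
  have h1 := argPos_polar one_pos h.1 h.2
  have h2 := argPos_polar one_pos h'.1 h'.2
  rw [he] at h1
  exact h1.symm.trans h2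

theorem wrap_argPos_sub (x p : ℂ) : wrap (argPos x - argPos p) ∈ Set.Ico 0 (2 * pi) := by
  have h := wrap_spec (x := argPos x - argPos p)
    (by linarith [argPos_nonneg x, argPos_lt p]) (by linarith [argPos_lt x, argPos_nonneg p])
  exact ⟨h.1, h.2.1⟩

theorem mul_exp_wrap {x p : ℂ} (h : ‖x‖ = ‖p‖) :
    p * exp (wrap (argPos x - argPos p) * I) = x := by
  rw [(wrap_spec (by linarith [argPos_nonneg x, argPos_lt p])
    (by linarith [argPos_lt x, argPos_nonneg p])).2.2]
  calc p * exp ((argPos x - argPos p : ℝ) * I)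
      = ‖p‖ * exp (argPos p * I) * exp ((argPos x - argPos p : ℝ) * I) := by
        rw [norm_mul_exp_argPos]
    _ = ‖x‖ * exp (argPos x * I) := by
        rw [mul_assoc, ← Complex.exp_add, h]
        congr 2
        push_cast
        ring
    _ = x := norm_mul_exp_argPos x

end FixedMCR

namespace FixedMCR

/-! ## Simple closed polygonal curves -/

open Complex (exp I)
open Real (pi)
open Set hiding pi
open Filter hiding pi
open Topology

/-- The vertices `v 0, v 1, …`, which repeat with period `m`, are those of a simple polygon. -/
structure Poly (m : ℕ) (v : ℕ → ℂ) : Prop where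
  three_le : 3 ≤ m
  per : ∀ i, v (i + m) = v i
  uniq : ∀ (i j : ℕ) (s t : ℝ), s ∈ Ico (0 : ℝ) 1 → t ∈ Ico (0 : ℝ) 1 →
    v i + s * (v (i + 1) - v i) = v j + t * (v (j + 1) - v j) → i % m = j % m ∧ s = t

/-- The curve through the vertices. -/
noncomputable def path (v : ℕ → ℂ) (u : ℝ) : ℂ :=
  v ⌊u⌋₊ + (u - ⌊u⌋₊ : ℝ) * (v (⌊u⌋₊ + 1) - v ⌊u⌋₊)

/-- The direction of the curve after `u`. -/
noncomputable def dirB (v : ℕ → ℂ) (u : ℝ) : ℂ := v (⌊u⌋₊ + 1) - v ⌊u⌋₊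

/-- The direction of the curve before `u`. -/
noncomputable def dirA (v : ℕ → ℂ) (u : ℝ) : ℂ := v (⌈u⌉₊ - 1 + 1) - v (⌈u⌉₊ - 1)

/-- The angle from the curve after `u` to the curve before `u`. -/
noncomputable def psi (v : ℕ → ℂ) (u : ℝ) : ℝ := argPos (-dirA v u / dirB v u)

/-- The image of the curve. -/
def bd (v : ℕ → ℂ) : Set ℂ :=
  {x | ∃ i : ℕ, ∃ t ∈ Icc (0 : ℝ) 1, x = v i + t * (v (i + 1) - v i)}

/-- For `u` in `(c, c + 1]` the number `⌈u⌉₊ - 1` is `c`, the edge on which the curve arrives at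
`u`. Places on the curve are parametrized by `(0, m]`, so that an edge before them exists in spite
of the truncated subtraction. -/
theorem ceil_spec {u : ℝ} (hu : 0 < u) :
    ((⌈u⌉₊ - 1 : ℕ) : ℝ) < u ∧ u ≤ ((⌈u⌉₊ - 1 : ℕ) : ℝ) + 1 := by
  have h1 : 0 < ⌈u⌉₊ := Nat.ceil_pos.2 hu
  have h2 : ((⌈u⌉₊ - 1 : ℕ) : ℝ) + 1 = ⌈u⌉₊ := by
    rw [← Nat.cast_succ]; congr 1; lia
  exact ⟨by have := Nat.ceil_lt_add_one hu.le; linarith, h2 ▸ Nat.le_ceil u⟩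

theorem floor_eq {u : ℝ} {c : ℕ} (h1 : (c : ℝ) ≤ u) (h2 : u < c + 1) : ⌊u⌋₊ = c :=
  (Nat.floor_eq_iff ((Nat.cast_nonneg c).trans h1)).2 ⟨h1, h2⟩

theorem ceil_eq {u : ℝ} {c : ℕ} (h1 : (c : ℝ) < u) (h2 : u ≤ c + 1) : ⌈u⌉₊ = c + 1 :=
  (Nat.ceil_eq_iff (by lia)).2 ⟨by simpa using h1, by push_cast; exact h2⟩

/-- The formula for the curve on a closed edge. -/
theorem path_eq {v : ℕ → ℂ} {u : ℝ} {c : ℕ} (h1 : (c : ℝ) ≤ u) (h2 : u ≤ c + 1) :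
    path v u = v c + (u - c : ℝ) * (v (c + 1) - v c) := by
  rcases h2.lt_or_eq with h2 | h2
  · rw [path, floor_eq h1 h2]
  · have : ⌊u⌋₊ = c + 1 := floor_eq (by push_cast; linarith) (by push_cast; linarith)
    rw [path, this, h2]
    push_cast
    ring

theorem path_add {v : ℕ → ℂ} {u s : ℝ} (hu : 0 ≤ u) (hs : 0 ≤ s) (h : u + s ≤ ⌊u⌋₊ + 1) :
    path v (u + s) = path v u + s * dirB v u := by
  have h1 := Nat.floor_le hu
  rw [path_eq (c := ⌊u⌋₊) (by linarith) h, path, dirB]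
  push_cast
  ring

theorem path_sub {v : ℕ → ℂ} {u s : ℝ} (hu : 0 < u) (hs : 0 ≤ s)
    (h : ((⌈u⌉₊ - 1 : ℕ) : ℝ) ≤ u - s) : path v (u - s) = path v u - s * dirA v u := by
  have h1 := ceil_spec hu
  rw [path_eq (c := ⌈u⌉₊ - 1) h (by linarith), path_eq (c := ⌈u⌉₊ - 1) h1.1.le h1.2, dirA]
  push_cast
  ring

theorem dirs_add {v : ℕ → ℂ} {u s : ℝ} (hu : 0 ≤ u) (hs : 0 < s) (h : u + s < ⌊u⌋₊ + 1) :
    dirA v (u + s) = dirB v u ∧ dirB v (u + s) = dirB v u := by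
  have h1 := Nat.floor_le hu
  rw [dirA, dirB, dirB, ceil_eq (c := ⌊u⌋₊) (by linarith) h.le, floor_eq (c := ⌊u⌋₊) (by linarith) h]
  simp

theorem dirs_sub {v : ℕ → ℂ} {u s : ℝ} (hu : 0 < u) (hs : 0 < s)
    (h : ((⌈u⌉₊ - 1 : ℕ) : ℝ) < u - s) :
    dirA v (u - s) = dirA v u ∧ dirB v (u - s) = dirA v u := by
  have h1 := ceil_spec hu
  have h2 : ⌈u - s⌉₊ = ⌈u⌉₊ - 1 + 1 := ceil_eq h (by linarith)
  rw [dirA, dirA, dirB, h2, floor_eq (c := ⌈u⌉₊ - 1) h.le (by linarith)]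
  simp

theorem path_mem_bd (v : ℕ → ℂ) {u : ℝ} (hu : 0 ≤ u) : path v u ∈ bd v :=
  ⟨⌊u⌋₊, u - ⌊u⌋₊, ⟨by linarith [Nat.floor_le hu], by linarith [Nat.lt_floor_add_one u]⟩, rfl⟩

namespace Poly

variable {m : ℕ} {v : ℕ → ℂ} (P : Poly m v)
include P

theorem per_mul (i k : ℕ) : v (i + k * m) = v i := by
  induction k with
  | zero => simp
  | succ k ih => rw [Nat.succ_mul, ← add_assoc, P.per, ih]

theorem congr {i j : ℕ} (h : i % m = j % m) : v i = v j := by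
  rw [← Nat.mod_add_div i m, ← Nat.mod_add_div j m, mul_comm m, mul_comm m, P.per_mul, P.per_mul, h]

theorem congr_succ {i j : ℕ} (h : i % m = j % m) : v (i + 1) = v (j + 1) :=
  P.congr (by rw [Nat.add_mod, h, ← Nat.add_mod])

theorem mod_succ_ne (i : ℕ) : i % m ≠ (i + 1) % m := by
  have := P.three_le
  intro h
  have h1 : (i + 1) ≡ (i + 0) [MOD m] := by simpa [Nat.ModEq] using h.symm
  have h2 := Nat.ModEq.add_left_cancel' i h1
  rw [Nat.ModEq, Nat.mod_eq_of_lt (by lia), Nat.mod_eq_of_lt (by lia)] at h2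
  lia

theorem edge_ne_zero (i : ℕ) : v (i + 1) - v i ≠ 0 := by
  intro h
  refine P.mod_succ_ne i (P.uniq i (i + 1) 0 0 (by simp) (by simp) ?_).1
  simp [sub_eq_zero.1 h]

theorem dirA_ne (u : ℝ) : dirA v u ≠ 0 := P.edge_ne_zero _
theorem dirB_ne (u : ℝ) : dirB v u ≠ 0 := P.edge_ne_zero _

theorem path_inj {u u' : ℝ} (hu : 0 ≤ u) (hu' : 0 ≤ u') (h : path v u = path v u') :
    ⌊u⌋₊ % m = ⌊u'⌋₊ % m ∧ u - ⌊u⌋₊ = u' - ⌊u'⌋₊ :=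
  P.uniq _ _ _ _ ⟨by linarith [Nat.floor_le hu], by linarith [Nat.lt_floor_add_one u]⟩
    ⟨by linarith [Nat.floor_le hu'], by linarith [Nat.lt_floor_add_one u']⟩ h

theorem exists_path {x : ℂ} (hx : x ∈ bd v) : ∃ u : ℝ, 0 < u ∧ u ≤ m ∧ path v u = x := by
  obtain ⟨i, t, ht, rfl⟩ := hx
  have hm := P.three_le
  have hm' : (0 : ℝ) < m := by exact_mod_cast (by lia : 0 < m)
  have hi : i % m < m := Nat.mod_lt _ (by lia)
  have hi' : ((i % m : ℕ) : ℝ) + 1 ≤ m := by exact_mod_cast hi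
  rcases eq_or_lt_of_le (add_nonneg (Nat.cast_nonneg (α := ℝ) (i % m)) ht.1) with h0 | h0
  · have h1 : ((i % m : ℕ) : ℝ) = 0 := by
      linarith [ht.1, Nat.cast_nonneg (α := ℝ) (i % m)]
    have h2 : t = 0 := by linarith
    have h3 : i % m = 0 := by exact_mod_cast h1
    refine ⟨m, hm', le_rfl, ?_⟩
    rw [path, Nat.floor_natCast, h2, P.congr (i := i) (j := m) (by simp [h3])]
    simp
  · refine ⟨(i % m : ℕ) + t, h0, by linarith [ht.2], ?_⟩
    rw [path_eq (c := i % m) (by linarith [ht.1]) (by linarith [ht.2]),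
      P.congr (i := i % m) (j := i) (by simp), P.congr_succ (i := i % m) (j := i) (by simp)]
    simp

theorem bd_eq : bd v = ⋃ i ∈ Finset.range m, (fun t : ℝ => v i + t * (v (i + 1) - v i)) '' Icc 0 1 := by
  have hm := P.three_le
  ext x
  simp only [bd, mem_ofPred_eq, mem_iUnion, mem_image, Finset.mem_range]
  constructor
  · rintro ⟨i, t, ht, rfl⟩
    exact ⟨i % m, Nat.mod_lt _ (by lia), t, ht, by
      rw [P.congr (i := i % m) (j := i) (by simp), P.congr_succ (i := i % m) (j := i) (by simp)]⟩
  · rintro ⟨i, -, t, ht, rfl⟩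
    exact ⟨i, t, ht, rfl⟩

theorem isCompact_bd : IsCompact (bd v) := by
  rw [P.bd_eq]
  exact (Finset.range m).isCompact_biUnion fun i _ => isCompact_Icc.image (by fun_prop)

/-- Near a point of the curve, the curve consists of two straight parts. -/
theorem bd_near {u : ℝ} (hu : 0 < u) : ∀ᶠ y in 𝓝 (path v u), y ∈ bd v →
    (∃ s : ℝ, 0 ≤ s ∧ y = path v u - s * dirA v u) ∨
      ∃ s : ℝ, 0 ≤ s ∧ y = path v u + s * dirB v u := by
  have h1 : ∀ i ∈ Finset.range m, ∀ᶠ y in 𝓝 (path v u),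
      y ∈ (fun t : ℝ => v i + t * (v (i + 1) - v i)) '' Icc (0 : ℝ) 1 →
      (∃ s : ℝ, 0 ≤ s ∧ y = path v u - s * dirA v u) ∨
        ∃ s : ℝ, 0 ≤ s ∧ y = path v u + s * dirB v u := by
    intro i _
    by_cases hx : path v u ∈ (fun t : ℝ => v i + t * (v (i + 1) - v i)) '' Icc (0 : ℝ) 1
    · refine Eventually.of_forall ?_
      rintro y ⟨t', ht', rfl⟩
      obtain ⟨t, ht, hx⟩ := hx
      have hfr : u - ⌊u⌋₊ ∈ Ico (0 : ℝ) 1 :=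
        ⟨by linarith [Nat.floor_le hu.le], by linarith [Nat.lt_floor_add_one u]⟩
      simp only at hx ⊢
      rcases ht.2.lt_or_eq with h1 | h1
      · obtain ⟨e1, e2⟩ := P.uniq i ⌊u⌋₊ t (u - ⌊u⌋₊) ⟨ht.1, h1⟩ hfr hx
        have eB : dirB v u = v (i + 1) - v i := by rw [dirB, P.congr e1, P.congr_succ e1]
        rcases le_or_gt t t' with h2 | h2
        · exact .inr ⟨t' - t, by linarith, by rw [← hx, eB]; push_cast; ring⟩
        · have h3 := ceil_eq (u := u) (c := ⌊u⌋₊) (by linarith [ht'.1])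
            (Nat.lt_floor_add_one u).le
          have eA : dirA v u = v (i + 1) - v i := by
            rw [dirA, h3, P.congr e1, P.congr_succ e1]; simp
          exact .inl ⟨t - t', by linarith, by rw [← hx, eA]; push_cast; ring⟩
      · have hx' : v (i + 1) + (0 : ℝ) * (v (i + 1 + 1) - v (i + 1)) = path v u := by
          rw [← hx, h1]; push_cast; ring
        obtain ⟨e1, e2⟩ := P.uniq (i + 1) ⌊u⌋₊ 0 (u - ⌊u⌋₊) (by simp) hfr hx'
        have h4 : u = ⌊u⌋₊ := by linarith
        have h5 : 0 < ⌊u⌋₊ := by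
          rcases Nat.eq_zero_or_pos ⌊u⌋₊ with h | h
          · rw [h] at h4; simp at h4; exact absurd hu (by rw [h4]; exact lt_irrefl _)
          · exact h
        have h6 : ⌈u⌉₊ = ⌊u⌋₊ := by
          conv_lhs => rw [h4]
          exact Nat.ceil_natCast _
        have e3 : i % m = (⌊u⌋₊ - 1) % m := by
          have : (i + 1) ≡ (⌊u⌋₊ - 1 + 1) [MOD m] := by
            rw [Nat.ModEq, e1]; congr 1; lia
          exact Nat.ModEq.add_right_cancel' 1 this
        have eA : dirA v u = v (i + 1) - v i := by
          rw [dirA, h6, P.congr e3, P.congr_succ e3]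
        exact .inl ⟨1 - t', by linarith [ht'.2], by rw [← hx, eA, h1]; push_cast; ring⟩
    · have hc : IsClosed ((fun t : ℝ => v i + t * (v (i + 1) - v i)) '' Icc (0 : ℝ) 1) :=
        (isCompact_Icc.image (by fun_prop)).isClosed
      filter_upwards [hc.isOpen_compl.mem_nhds hx] with y hy hy'
      exact absurd hy' hy
  have h2 := (eventually_all_finset (Finset.range m)).2 h1
  filter_upwards [h2] with y hy hyb
  rw [P.bd_eq] at hyb
  simp only [mem_iUnion] at hyb
  obtain ⟨i, hi, hyi⟩ := hyb
  exact hy i hi hyi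

/-- If the angle were zero, then the curve would run back along itself after `u`, so that points
shortly before and shortly after `u` would coincide. -/
theorem psi_pos {u : ℝ} (hu : 0 < u) : 0 < psi v u := by
  refine (argPos_nonneg _).lt_of_ne fun h => ?_
  have hA := P.dirA_ne u
  have hB := P.dirB_ne u
  obtain ⟨c, hc, he⟩ := exists_pos_mul_of_argPos_eq (z := -dirA v u / dirB v u) (w := 1)
    (div_ne_zero (neg_ne_zero.2 hA) hB) one_ne_zero
    (by rw [← h]; simpa using (argPos_ofReal_pos one_pos).symm)
  rw [mul_one, div_eq_iff hB] at he
  have h1 := ceil_spec hu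
  have h2 := Nat.lt_floor_add_one u
  obtain ⟨s, hs, hs1, hs2⟩ : ∃ s : ℝ, 0 < s ∧ ((⌈u⌉₊ - 1 : ℕ) : ℝ) < u - s ∧
      u + s * c < ⌊u⌋₊ + 1 := by
    set a := u - ((⌈u⌉₊ - 1 : ℕ) : ℝ)
    set b := ⌊u⌋₊ + 1 - u
    have ha : 0 < a := by linarith
    have hb : 0 < b := by linarith
    refine ⟨min (a / 2) (b / (2 * c)), by positivity, ?_, ?_⟩
    · have := min_le_left (a / 2) (b / (2 * c))
      linarith
    · have := mul_le_mul_of_nonneg_right (min_le_right (a / 2) (b / (2 * c))) hc.le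
      have e : b / (2 * c) * c = b / 2 := by field_simp
      linarith
  have e1 := path_sub (v := v) hu hs.le hs1.le
  have e2 := path_add (v := v) hu.le (mul_pos hs hc).le hs2.le
  have e3 : path v (u - s) = path v (u + s * c) := by
    rw [e1, e2]
    push_cast
    linear_combination (s : ℂ) * he
  have f1 : ⌊u - s⌋₊ = ⌈u⌉₊ - 1 := floor_eq hs1.le (by linarith)
  have f2 : ⌊u + s * c⌋₊ = ⌊u⌋₊ :=
    floor_eq (by linarith [Nat.floor_le hu.le, mul_pos hs hc]) hs2
  have hpos : 0 ≤ u - s := le_trans (Nat.cast_nonneg _) hs1.le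
  obtain ⟨k1, k2⟩ := P.path_inj hpos (by linarith [mul_pos hs hc]) e3
  rw [f1, f2] at k1 k2
  rcases h1.2.lt_or_eq with h3 | h3
  · rw [floor_eq h1.1.le h3] at k2
    linarith [mul_pos hs hc]
  · have : ⌊u⌋₊ = ⌈u⌉₊ - 1 + 1 := floor_eq (by push_cast; linarith) (by push_cast; linarith)
    rw [this] at k1
    exact P.mod_succ_ne _ k1

end Poly

theorem psi_lt (v : ℕ → ℂ) (u : ℝ) : psi v u < 2 * pi := argPos_lt _

theorem psi_straight {v : ℕ → ℂ} {u : ℝ} (h : dirA v u = dirB v u) (h' : dirB v u ≠ 0) :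
    psi v u = pi := by
  rw [psi, h, neg_div, div_self h', argPos_neg_one]

/-- A sector of a disk. -/
def sector (x B : ℂ) (a b ε : ℝ) : Set ℂ :=
  {y | 0 < ‖y - x‖ ∧ ‖y - x‖ < ε ∧ a < argPos ((y - x) / B) ∧ argPos ((y - x) / B) < b}

theorem sector_mono {x B : ℂ} {a b ε ε' : ℝ} (h : ε ≤ ε') : sector x B a b ε ⊆ sector x B a b ε' :=
  fun _ hy => ⟨hy.1, hy.2.1.trans_le h, hy.2.2⟩

theorem sector_eq {x B : ℂ} (hB : B ≠ 0) {a b ε : ℝ} (ha : 0 ≤ a) (hb : b ≤ 2 * pi) :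
    sector x B a b ε = (fun p : ℝ × ℝ => x + p.1 * exp (p.2 * I) * (B / ‖B‖)) ''
      (Ioo 0 ε ×ˢ Ioo a b) := by
  have hB' : (‖B‖ : ℂ) ≠ 0 := by simpa using hB
  have hn : 0 < ‖B‖ := norm_pos_iff.2 hB
  ext y
  constructor
  · rintro ⟨h1, h2, h3, h4⟩
    refine ⟨(‖y - x‖, argPos ((y - x) / B)), ⟨⟨h1, h2⟩, h3, h4⟩, ?_⟩
    have := norm_mul_exp_argPos ((y - x) / B)
    rw [norm_div, eq_div_iff hB] at this
    push_cast at this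
    simp only
    linear_combination this
  · rintro ⟨⟨ρ, φ⟩, ⟨⟨h1, h2⟩, h3, h4⟩, rfl⟩
    simp only at h1 h2 h3 h4
    have e1 : ‖x + ρ * exp (φ * I) * (B / ‖B‖) - x‖ = ρ := by
      rw [add_sub_cancel_left, norm_mul, norm_mul, Complex.norm_exp_ofReal_mul_I, norm_div]
      simp [abs_of_pos h1, hn.ne']
    have e2 : (x + ρ * exp (φ * I) * (B / ‖B‖) - x) / B = (ρ / ‖B‖ : ℝ) * exp (φ * I) := by
      push_cast
      field_simp
      ring
    have e3 := argPos_polar (div_pos h1 hn) (ha.trans h3.le) (h4.trans_le hb)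
    refine ⟨?_, ?_, ?_, ?_⟩
    · rwa [e1]
    · rwa [e1]
    · rwa [e2, e3]
    · rwa [e2, e3]

theorem isPreconnected_sector {x B : ℂ} (hB : B ≠ 0) {a b ε : ℝ} (ha : 0 ≤ a) (hb : b ≤ 2 * pi) :
    IsPreconnected (sector x B a b ε) := by
  rw [sector_eq hB ha hb]
  exact (isPreconnected_Ioo.prod isPreconnected_Ioo).image _ (by fun_prop)

/-- The points that are near to the point `path v u` on the left side of the curve. -/
def leftAt (v : ℕ → ℂ) (u ε : ℝ) : Set ℂ := sector (path v u) (dirB v u) 0 (psi v u) ε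

/-- The points that are near to the point `path v u` on the right side of the curve. -/
def rightAt (v : ℕ → ℂ) (u ε : ℝ) : Set ℂ := sector (path v u) (dirB v u) (psi v u) (2 * pi) ε

/-- In a small disk the curve consists of the two segments in the directions `dirB` and `-dirA`, and
removing the corresponding rays from the punctured disk leaves the two open sectors. -/
theorem Poly.exists_local {m : ℕ} {v : ℕ → ℂ} (P : Poly m v) {u : ℝ} (hu : 0 < u) :
    ∃ ε > 0, (∀ y ∈ leftAt v u ε, y ∉ bd v) ∧ (∀ y ∈ rightAt v u ε, y ∉ bd v) ∧
      ∀ y ∉ bd v, ‖y - path v u‖ < ε → y ∈ leftAt v u ε ∨ y ∈ rightAt v u ε := by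
  obtain ⟨ε₁, h1, hε₁⟩ := Metric.eventually_nhds_iff.1 (P.bd_near hu)
  have hA := P.dirA_ne u
  have hB := P.dirB_ne u
  have c1 := ceil_spec hu
  have c2 := Nat.lt_floor_add_one u
  -- `ε₂` and `ε₃` are the lengths of the straight pieces after and before `u`; within these
  -- distances, every point on one of the two rays is on the curve.
  set ε₂ := ‖dirB v u‖ * (⌊u⌋₊ + 1 - u)
  set ε₃ := ‖dirA v u‖ * (u - (⌈u⌉₊ - 1 : ℕ))
  have h2 : 0 < ε₂ := mul_pos (norm_pos_iff.2 hB) (by linarith)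
  have h3 : 0 < ε₃ := mul_pos (norm_pos_iff.2 hA) (by linarith)
  have hψ := P.psi_pos hu
  have key : ∀ y, ‖y - path v u‖ < ε₁ → 0 < ‖y - path v u‖ → y ∈ bd v →
      argPos ((y - path v u) / dirB v u) = 0 ∨ argPos ((y - path v u) / dirB v u) = psi v u := by
    intro y hy hy0 hyb
    rcases hε₁ (by rwa [dist_eq_norm]) hyb with ⟨s, hs, rfl⟩ | ⟨s, hs, rfl⟩
    · have hs : 0 < s := hs.lt_of_ne (by rintro rfl; simp at hy0)
      right
      rw [psi, ← argPos_ofReal_mul hs (-dirA v u / dirB v u)]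
      congr 1; ring
    · have hs : 0 < s := hs.lt_of_ne (by rintro rfl; simp at hy0)
      left
      rw [add_sub_cancel_left, mul_div_assoc, div_self hB, mul_one, argPos_ofReal_pos hs]
  refine ⟨min ε₁ (min ε₂ ε₃), by positivity, ?_, ?_, ?_⟩
  · rintro y ⟨k1, k2, k3, k4⟩ hyb
    rcases key y (k2.trans_le (min_le_left _ _)) k1 hyb with h | h
    · rw [h] at k3; exact lt_irrefl _ k3
    · rw [h] at k4; exact lt_irrefl _ k4
  · rintro y ⟨k1, k2, k3, k4⟩ hyb
    rcases key y (k2.trans_le (min_le_left _ _)) k1 hyb with h | h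
    · rw [h] at k3; exact absurd k3 (not_lt.2 hψ.le)
    · rw [h] at k3; exact lt_irrefl _ k3
  · intro y hyb hy
    have hy2 : ‖y - path v u‖ < ε₂ := hy.trans_le ((min_le_right _ _).trans (min_le_left _ _))
    have hy3 : ‖y - path v u‖ < ε₃ := hy.trans_le ((min_le_right _ _).trans (min_le_right _ _))
    have hne : y - path v u ≠ 0 := by
      intro h
      rw [sub_eq_zero.1 h] at hyb
      exact hyb (path_mem_bd v hu.le)
    have hy0 := norm_pos_iff.2 hne
    have n0 : argPos ((y - path v u) / dirB v u) ≠ 0 := by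
      intro h
      obtain ⟨c, hc, he⟩ := exists_pos_mul_of_argPos_eq (w := 1) (div_ne_zero hne hB)
        one_ne_zero (by rw [h]; simpa using (argPos_ofReal_pos one_pos).symm)
      rw [mul_one, div_eq_iff hB] at he
      have hcn : c * ‖dirB v u‖ < ε₂ := by
        rw [he, norm_mul] at hy2
        simpa [abs_of_pos hc] using hy2
      rw [mul_comm] at hcn
      have hc2 := lt_of_mul_lt_mul_left hcn (norm_nonneg _)
      apply hyb
      have := path_add (v := v) hu.le hc.le (by linarith)
      rw [← he, add_sub_cancel] at this
      rw [← this]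
      exact path_mem_bd v (by linarith)
    have n1 : argPos ((y - path v u) / dirB v u) ≠ psi v u := by
      intro h
      obtain ⟨c, hc, he⟩ := exists_pos_mul_of_argPos_eq (div_ne_zero hne hB)
        (div_ne_zero (neg_ne_zero.2 hA) hB) h
      rw [div_eq_iff hB, mul_assoc, div_mul_cancel₀ _ hB] at he
      have hcn : c * ‖dirA v u‖ < ε₃ := by
        rw [he, norm_mul] at hy3
        simpa [abs_of_pos hc] using hy3
      rw [mul_comm] at hcn
      have hc2 := lt_of_mul_lt_mul_left hcn (norm_nonneg _)
      apply hyb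
      have : path v (u - c) = y := by
        rw [path_sub hu hc.le (by linarith)]
        linear_combination -he
      rw [← this]
      exact path_mem_bd v (le_trans (Nat.cast_nonneg (⌈u⌉₊ - 1)) (by linarith))
    rcases lt_or_gt_of_ne n1 with h | h
    · exact .inl ⟨hy0, hy, (argPos_nonneg _).lt_of_ne n0.symm, h⟩
    · exact .inr ⟨hy0, hy, h, argPos_lt _⟩

end FixedMCR

/-! ### The interior along the two sides of the curve -/

namespace FixedMCR

open Complex (exp I)
open Real (pi)
open Set hiding pi
open Filter hiding pi
open Topology

/-- The point is in the interior of the region that is bounded by the curve. -/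
def Inner (v : ℕ → ℂ) (y : ℂ) : Prop :=
  y ∉ bd v ∧ Bornology.IsBounded (connectedComponentIn (bd v)ᶜ y)

theorem inner_iff_of_isPreconnected {v : ℕ → ℂ} {S : Set ℂ} (hS : IsPreconnected S)
    (h : ∀ y ∈ S, y ∉ bd v) {y z : ℂ} (hy : y ∈ S) (hz : z ∈ S) : Inner v y ↔ Inner v z := by
  have : z ∈ connectedComponentIn (bd v)ᶜ y := hS.subset_connectedComponentIn hy h hz
  rw [Inner, Inner, connectedComponentIn_eq this]
  simp [h y hy, h z hz]

/-- The points just to the left of `path v u` are in the interior. -/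
def leftInner (v : ℕ → ℂ) (u : ℝ) : Prop := ∃ ε > 0, ∀ y ∈ leftAt v u ε, Inner v y

/-- The points just to the right of `path v u` are in the interior. -/
def rightInner (v : ℕ → ℂ) (u : ℝ) : Prop := ∃ ε > 0, ∀ y ∈ rightAt v u ε, Inner v y

theorem norm_exp_sub_one_le (η : ℝ) : ‖exp (η * I) - 1‖ ≤ |η| := by
  rw [mul_comm]
  exact Real.norm_exp_I_mul_ofReal_sub_one_le

theorem im_mul_exp_sub_one (κ η : ℝ) : ((κ : ℂ) * (exp (η * I) - 1)).im = κ * Real.sin η := by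
  rw [Complex.im_ofReal_mul, Complex.sub_im, Complex.exp_ofReal_mul_I_im]
  simp

/-- The points at a given direction and distance from a point are in a sector. -/
theorem mem_sector_polar {x B : ℂ} (hB : B ≠ 0) {a b ε r φ : ℝ} (hr : 0 < r) (hε : r * ‖B‖ < ε)
    (h0 : 0 ≤ φ) (h1 : φ < 2 * pi) (ha : a < φ) (hb : φ < b) :
    x + r * exp (φ * I) * B ∈ sector x B a b ε := by
  have e1 : ‖x + r * exp (φ * I) * B - x‖ = r * ‖B‖ := by
    rw [add_sub_cancel_left, norm_mul, norm_mul, Complex.norm_exp_ofReal_mul_I]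
    simp [abs_of_pos hr]
  have e2 : argPos ((x + r * exp (φ * I) * B - x) / B) = φ := by
    rw [add_sub_cancel_left, mul_div_assoc, div_self hB, mul_one, argPos_polar hr h0 h1]
  refine ⟨?_, ?_, ?_, ?_⟩
  · rw [e1]; exact mul_pos hr (norm_pos_iff.2 hB)
  · rwa [e1]
  · rwa [e2]
  · rwa [e2]

namespace Poly

variable {m : ℕ} {v : ℕ → ℂ} (P : Poly m v)
include P

/-- Each of the two sectors is connected and misses the curve, so it is either completely interior
or completely not. Any smaller sector with the same apex and directions therefore tells the status.
-/
theorem exists_side {u : ℝ} (hu : 0 < u) :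
    ∃ ε > 0, (∀ y ∈ leftAt v u ε, y ∉ bd v ∧ (Inner v y ↔ leftInner v u)) ∧
      (∀ y ∈ rightAt v u ε, y ∉ bd v ∧ (Inner v y ↔ rightInner v u)) ∧
      ∀ y ∉ bd v, ‖y - path v u‖ < ε → y ∈ leftAt v u ε ∨ y ∈ rightAt v u ε := by
  obtain ⟨ε, hε, h1, h2, h3⟩ := P.exists_local hu
  have hψ := P.psi_pos hu
  have hψ2 := psi_lt v u
  have hB := P.dirB_ne u
  have gen : ∀ a b : ℝ, 0 ≤ a → b ≤ 2 * pi → a < b →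
      (∀ y ∈ sector (path v u) (dirB v u) a b ε, y ∉ bd v) →
      ∀ y ∈ sector (path v u) (dirB v u) a b ε, (Inner v y ↔
        ∃ ε > 0, ∀ y ∈ sector (path v u) (dirB v u) a b ε, Inner v y) := by
    intro a b ha hb hab hbd y hy
    constructor
    · intro hi
      exact ⟨ε, hε, fun z hz => (inner_iff_of_isPreconnected
        (isPreconnected_sector hB ha hb) hbd hy hz).1 hi⟩
    · rintro ⟨ε', hε', h⟩
      set r := min ε ε' / (2 * ‖dirB v u‖)
      have hn := norm_pos_iff.2 hB
      have hm : 0 < min ε ε' := lt_min hε hε'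
      have hr : 0 < r := by positivity
      have hr' : r * ‖dirB v u‖ < min ε ε' := by
        have : r * ‖dirB v u‖ = min ε ε' / 2 := by simp only [r]; field_simp
        linarith
      have hz := mem_sector_polar (x := path v u) hB (a := a) (b := b) (φ := (a + b) / 2) hr hr'
        (by linarith) (by linarith) (by linarith) (by linarith)
      exact (inner_iff_of_isPreconnected (isPreconnected_sector hB ha hb) hbd hy
        (sector_mono (min_le_left _ _) hz)).2 (h _ (sector_mono (min_le_right _ _) hz))
  exact ⟨ε, hε, fun y hy => ⟨h1 y hy, gen _ _ le_rfl hψ2.le hψ h1 y hy⟩,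
    fun y hy => ⟨h2 y hy, gen _ _ hψ.le le_rfl hψ2 h2 y hy⟩, h3⟩

/-- Turning the displacement from `path v u` to `path v u'` by a small angle around `path v u` gives
a point that is both in a sector at `u` and in the sector on the same side at `u'`. At `u'` the
curve is straight, so that the sign of the imaginary part of the turned displacement, relative to
the direction `d`, decides the side. -/
theorem side_step {u u' κ : ℝ} (hu : 0 < u) (hu' : 0 < u') (hκ : κ ≠ 0) {d : ℂ}
    (hx : path v u' = path v u + κ * d) (hA : dirA v u' = d) (hB : dirB v u' = d) {ε : ℝ}
    (hε : |κ| * ‖d‖ < ε)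
    (hs : (∀ y ∈ leftAt v u ε, y ∉ bd v ∧ (Inner v y ↔ leftInner v u)) ∧
      (∀ y ∈ rightAt v u ε, y ∉ bd v ∧ (Inner v y ↔ rightInner v u)))
    (hd : κ = |κ| ∧ d = dirB v u ∨ κ = -|κ| ∧ d = dirA v u) :
    (leftInner v u ↔ leftInner v u') ∧ (rightInner v u ↔ rightInner v u') := by
  obtain ⟨ε', hε', l1, r1, -⟩ := P.exists_side hu'
  have hd0 : d ≠ 0 := hB ▸ P.dirB_ne u'
  have hBu := P.dirB_ne u
  have hAu := P.dirA_ne u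
  have hψ := P.psi_pos hu
  have hψ2 := psi_lt v u
  have hψ' : psi v u' = pi := by rw [psi_straight (by rw [hA, hB]) (by rwa [hB])]
  have hκ' := abs_pos.2 hκ
  have hdn := norm_pos_iff.2 hd0
  -- a small angle
  obtain ⟨η, hη, hη1, hη2, hη3, hη4⟩ : ∃ η : ℝ, 0 < η ∧ η < psi v u ∧ η < 2 * pi - psi v u ∧
      η < pi ∧ |κ| * ‖d‖ * η < ε' := by
    set b := ε' / (|κ| * ‖d‖)
    have hb : 0 < b := by positivity
    set c := min (psi v u) (min (2 * pi - psi v u) (min pi b))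
    have hc : 0 < c := lt_min hψ (lt_min (by linarith) (lt_min Real.pi_pos hb))
    have c1 : c ≤ psi v u := min_le_left _ _
    have c2 : c ≤ 2 * pi - psi v u := (min_le_right _ _).trans (min_le_left _ _)
    have c3 : c ≤ pi := (min_le_right _ _).trans ((min_le_right _ _).trans (min_le_left _ _))
    have c4 : c ≤ b := (min_le_right _ _).trans ((min_le_right _ _).trans (min_le_right _ _))
    refine ⟨c / 2, by linarith, by linarith, by linarith, by linarith, ?_⟩
    have : |κ| * ‖d‖ * b = ε' := by simp only [b]; field_simp
    rw [← this]
    exact mul_lt_mul_of_pos_left (by linarith) (mul_pos hκ' hdn)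
  -- the point at the angle `θ` from `u'`, as seen from `u'`
  have near : ∀ θ : ℝ, |θ| = η → ∀ a b : ℝ, 0 < ‖(κ : ℂ) * (exp (θ * I) - 1)‖ →
      a < argPos ((κ : ℂ) * (exp (θ * I) - 1)) → argPos ((κ : ℂ) * (exp (θ * I) - 1)) < b →
      path v u + κ * exp (θ * I) * d ∈ sector (path v u') (dirB v u') a b ε' := by
    intro θ hθ a b h0 ha hb
    have e1 : path v u + κ * exp (θ * I) * d - path v u' = (κ : ℂ) * (exp (θ * I) - 1) * d := by
      rw [hx]; ring
    refine ⟨?_, ?_, ?_, ?_⟩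
    · rw [e1, norm_mul]; exact mul_pos h0 hdn
    · rw [e1, norm_mul, norm_mul, Complex.norm_real, Real.norm_eq_abs]
      have := norm_exp_sub_one_le θ
      rw [hθ] at this
      calc |κ| * ‖exp (θ * I) - 1‖ * ‖d‖ ≤ |κ| * η * ‖d‖ := by gcongr
        _ = |κ| * ‖d‖ * η := by ring
        _ < ε' := hη4
    · rw [e1, hB, mul_div_assoc, div_self hd0, mul_one]; exact ha
    · rw [e1, hB, mul_div_assoc, div_self hd0, mul_one]; exact hb
  have hsin : 0 < Real.sin η := Real.sin_pos_of_pos_of_lt_pi hη hη3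
  have inLeft : ∀ θ : ℝ, |θ| = η → 0 < κ * Real.sin θ →
      path v u + κ * exp (θ * I) * d ∈ leftAt v u' ε' := by
    intro θ hθ hs
    rw [← im_mul_exp_sub_one] at hs
    have := argPos_of_im_pos hs
    refine near θ hθ 0 _ (norm_pos_iff.2 fun h => ?_) this.1 (by rw [hψ']; exact this.2)
    rw [h] at hs; simp at hs
  have inRight : ∀ θ : ℝ, |θ| = η → κ * Real.sin θ < 0 →
      path v u + κ * exp (θ * I) * d ∈ rightAt v u' ε' := by
    intro θ hθ hs
    rw [← im_mul_exp_sub_one] at hs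
    have := argPos_of_im_neg hs
    refine near θ hθ _ _ (norm_pos_iff.2 fun h => ?_) (by rw [hψ']; exact this) (argPos_lt _)
    rw [h] at hs; simp at hs
  have habs : |η| = η := abs_of_pos hη
  rcases hd with ⟨hk, hd⟩ | ⟨hk, hd⟩
  · have hk0 : 0 < κ := by rw [hk]; exact hκ'
    rw [← hk] at hε
    have L1 : path v u + κ * exp (η * I) * d ∈ leftAt v u ε := by
      rw [hd] at hε ⊢
      exact mem_sector_polar hBu hk0 hε hη.le (by linarith) hη hη1
    have R1 : path v u + κ * exp ((-η : ℝ) * I) * d ∈ rightAt v u ε := by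
      have : exp ((-η : ℝ) * I) = exp ((2 * pi - η : ℝ) * I) := by
        push_cast
        rw [show ((2 : ℂ) * pi - η) * I = -η * I + 2 * pi * I by ring, Complex.exp_add,
          Complex.exp_two_pi_mul_I, mul_one]
      rw [this]
      rw [hd] at hε ⊢
      exact mem_sector_polar hBu hk0 hε (by linarith) (by linarith) (by linarith) (by linarith)
    refine ⟨?_, ?_⟩
    · rw [← (hs.1 _ L1).2, (l1 _ (inLeft η habs (mul_pos hk0 hsin))).2]
    · rw [← (hs.2 _ R1).2, (r1 _ (inRight (-η) (by rw [abs_neg, habs]) ?_)).2]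
      rw [Real.sin_neg]; nlinarith
  -- Backwards the displacement has the angle `psi v u` as seen from `u`, so turning it by `-η`
  -- leads to the left and by `η` to the right.
  · have hk0 : κ < 0 := by rw [hk]; linarith
    have pol : ∀ θ : ℝ, |θ| = η → ∀ a b, 0 ≤ a → b ≤ 2 * pi → a < psi v u + θ → psi v u + θ < b →
        path v u + κ * exp (θ * I) * d ∈ sector (path v u) (dirB v u) a b ε := by
      intro θ hθ a b ha hb h1 h2
      have e1 : path v u + κ * exp (θ * I) * d - path v u =
          (|κ| : ℝ) * (-dirA v u) * exp (θ * I) := by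
        rw [hd, hk, abs_neg, abs_abs]; push_cast; ring
      have e2 : argPos ((path v u + κ * exp (θ * I) * d - path v u) / dirB v u) = psi v u + θ := by
        rw [e1, show ((|κ| : ℝ) : ℂ) * (-dirA v u) * exp (θ * I) / dirB v u =
          (|κ| : ℝ) * ((-dirA v u / dirB v u) * exp (θ * I)) by ring, argPos_ofReal_mul hκ']
        exact argPos_mul_exp (div_ne_zero (neg_ne_zero.2 hAu) hBu) (by
          change 0 ≤ psi v u + θ; linarith) (by change psi v u + θ < _; linarith)
      have e3 : ‖path v u + κ * exp (θ * I) * d - path v u‖ = |κ| * ‖d‖ := by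
        rw [add_sub_cancel_left, norm_mul, norm_mul, Complex.norm_exp_ofReal_mul_I]
        simp
      refine ⟨?_, ?_, ?_, ?_⟩
      · rw [e3]; positivity
      · rwa [e3]
      · rwa [e2]
      · rwa [e2]
    have L1 := pol (-η) (by rw [abs_neg, habs]) 0 (psi v u) le_rfl hψ2.le (by linarith)
      (by linarith)
    have R1 := pol η habs (psi v u) (2 * pi) hψ.le le_rfl (by linarith) (by linarith)
    refine ⟨?_, ?_⟩
    · rw [← (hs.1 _ L1).2, (l1 _ (inLeft (-η) (by rw [abs_neg, habs]) ?_)).2]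
      rw [Real.sin_neg]; nlinarith
    · rw [← (hs.2 _ R1).2, (r1 _ (inRight η habs (mul_neg_of_neg_of_pos hk0 hsin))).2]

/-- The interior is on the same side everywhere along the curve. -/
theorem side_const {u u' : ℝ} (hu : 0 < u) (hu' : 0 < u') :
    (leftInner v u ↔ leftInner v u') ∧ (rightInner v u ↔ rightInner v u') := by
  refine isPreconnected_Ioi.induction₂ (s := Ioi (0 : ℝ)) (fun u u' =>
    (leftInner v u ↔ leftInner v u') ∧ (rightInner v u ↔ rightInner v u'))
    (fun u hu => ?_) (fun x y z _ _ _ h1 h2 => ⟨h1.1.trans h2.1, h1.2.trans h2.2⟩)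
    (fun x y _ _ h => ⟨h.1.symm, h.2.symm⟩) hu hu'
  rw [mem_Ioi] at hu
  obtain ⟨ε, hε, l, r, -⟩ := P.exists_side hu
  have c1 := ceil_spec hu
  have c2 := Nat.lt_floor_add_one u
  have hA := norm_pos_iff.2 (P.dirA_ne u)
  have hB := norm_pos_iff.2 (P.dirB_ne u)
  have f1 : ∀ᶠ u' in 𝓝 u, ((⌈u⌉₊ - 1 : ℕ) : ℝ) < u' := eventually_gt_nhds c1.1
  have f2 : ∀ᶠ u' in 𝓝 u, u' < (⌊u⌋₊ : ℝ) + 1 := eventually_lt_nhds c2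
  have f3 : ∀ᶠ u' in 𝓝 u, |u' - u| * ‖dirA v u‖ < ε := by
    have : Tendsto (fun u' => |u' - u| * ‖dirA v u‖) (𝓝 u) (𝓝 (|u - u| * ‖dirA v u‖)) :=
      Continuous.tendsto (by fun_prop) u
    exact this.eventually_lt_const (by simpa using hε)
  have f4 : ∀ᶠ u' in 𝓝 u, |u' - u| * ‖dirB v u‖ < ε := by
    have : Tendsto (fun u' => |u' - u| * ‖dirB v u‖) (𝓝 u) (𝓝 (|u - u| * ‖dirB v u‖)) :=
      Continuous.tendsto (by fun_prop) u
    exact this.eventually_lt_const (by simpa using hε)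
  filter_upwards [f1.filter_mono nhdsWithin_le_nhds, f2.filter_mono nhdsWithin_le_nhds,
    f3.filter_mono nhdsWithin_le_nhds, f4.filter_mono nhdsWithin_le_nhds, self_mem_nhdsWithin]
    with u' h1 h2 h3 h4 hu'
  rw [mem_Ioi] at hu'
  rcases lt_trichotomy u' u with h | h | h
  · have e : u - (u - u') = u' := by ring
    have d := dirs_sub (v := v) hu (s := u - u') (by linarith) (by linarith)
    have p := path_sub (v := v) hu (s := u - u') (by linarith) (by linarith)
    rw [e] at d p
    have habs : |u' - u| = u - u' := by rw [abs_of_neg (by linarith)]; ring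
    exact P.side_step hu hu' (κ := u' - u) (by linarith) (d := dirA v u)
      (by rw [p]; push_cast; ring) d.1 d.2 h3 ⟨l, r⟩ (.inr ⟨by rw [habs]; ring, rfl⟩)
  · rw [h]; simp
  · have e : u + (u' - u) = u' := by ring
    have d := dirs_add (v := v) hu.le (s := u' - u) (by linarith) (by linarith)
    have p := path_add (v := v) hu.le (s := u' - u) (by linarith) (by linarith)
    rw [e] at d p
    have habs : |u' - u| = u' - u := abs_of_pos (by linarith)
    exact P.side_step hu hu' (κ := u' - u) (by linarith) (d := dirB v u) p d.1 d.2 h4 ⟨l, r⟩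
      (.inl ⟨habs.symm, rfl⟩)

/-- Every point off the curve is joined to one of its sides. -/
theorem inner_iff_side {y : ℂ} (hy : y ∉ bd v) :
    (Inner v y ↔ leftInner v 1) ∨ (Inner v y ↔ rightInner v 1) := by
  -- The segment from `y` to a nearest point of the curve meets the curve only at its end, just
  -- before which it is in one of the two sectors there.
  obtain ⟨x, hx, hxy⟩ := P.isCompact_bd.exists_infDist_eq_dist
    ⟨_, path_mem_bd v zero_le_one⟩ y
  obtain ⟨u, hu, -, rfl⟩ := P.exists_path hx
  obtain ⟨ε, hε, l, r, c⟩ := P.exists_side hu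
  have hne : y - path v u ≠ 0 := fun h => hy (by rw [sub_eq_zero.1 h]; exact hx)
  have hn := norm_pos_iff.2 hne
  set z : ℝ → ℂ := fun t => path v u + t * (y - path v u) with hz
  have hoff : ∀ t ∈ Ioc (0 : ℝ) 1, z t ∉ bd v := by
    intro t ht hb
    have h1 := Metric.infDist_le_dist_of_mem (x := y) hb
    rw [hxy, dist_eq_norm, dist_eq_norm] at h1
    have h2 : y - z t = (1 - t : ℝ) * (y - path v u) := by simp only [hz]; push_cast; ring
    rw [h2, norm_mul, Complex.norm_real, Real.norm_eq_abs, abs_of_nonneg (by linarith [ht.2])] at h1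
    nlinarith [ht.1]
  have hpre : IsPreconnected (z '' Ioc 0 1) := isPreconnected_Ioc.image _ (by fun_prop)
  set t := min 1 (ε / (2 * ‖y - path v u‖))
  have ht : t ∈ Ioc (0 : ℝ) 1 := ⟨lt_min one_pos (by positivity), min_le_left _ _⟩
  have hzt : ‖z t - path v u‖ < ε := by
    simp only [hz, add_sub_cancel_left, norm_mul, Complex.norm_real, Real.norm_eq_abs]
    rw [abs_of_pos ht.1]
    calc t * ‖y - path v u‖ ≤ ε / (2 * ‖y - path v u‖) * ‖y - path v u‖ := by
          gcongr; exact min_le_right _ _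
      _ = ε / 2 := by field_simp
      _ < ε := by linarith
  have h1 : Inner v y ↔ Inner v (z t) := by
    refine inner_iff_of_isPreconnected hpre ?_ ⟨1, by simp, by simp [hz]⟩ ⟨t, ht, rfl⟩
    rintro _ ⟨t, ht, rfl⟩
    exact hoff t ht
  rw [h1]
  rcases c _ (hoff t ht) hzt with h | h
  · left; rw [(l _ h).2]; exact (P.side_const hu one_pos).1
  · right; rw [(r _ h).2]; exact (P.side_const hu one_pos).2

end Poly

end FixedMCR

namespace FixedMCR

/-! ## The two sides of a simple closed curve -/

open Complex (exp I arg)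
open Real (pi)
open Set hiding pi
open Filter hiding pi
open Topology

/-- The total change of the argument along the curve, as seen from `y`. -/
noncomputable def winding (m : ℕ) (v : ℕ → ℂ) (y : ℂ) : ℝ :=
  ∑ i ∈ Finset.range m, arg ((v (i + 1) - y) / (v i - y))

/-- If `(b - y) / (a - y)` is a real number `s ≤ 0`, then `y` divides the segment, with parameter `1
/ (1 - s)`. So the principal argument is continuous off the segment. -/
theorem sub_ne_of_not_mem_segment {a b y : ℂ} (h : ∀ t ∈ Icc (0 : ℝ) 1, y ≠ a + t * (b - a)) :
    a - y ≠ 0 ∧ (b - y) / (a - y) ∈ Complex.slitPlane := by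
  have ha : a - y ≠ 0 := fun h0 => h 0 ⟨le_rfl, zero_le_one⟩ (by
    have := sub_eq_zero.1 h0
    simp [this])
  refine ⟨ha, ?_⟩
  by_contra hc
  rw [Complex.mem_slitPlane_iff, not_or, not_lt, not_not] at hc
  set s := ((b - y) / (a - y)).re with hs
  have hr : (b - y) / (a - y) = (s : ℂ) := by
    apply Complex.ext <;> simp [hs, hc.2]
  rw [div_eq_iff ha] at hr
  have hs1 : (0 : ℝ) < 1 - s := by linarith [hc.1]
  refine h (1 / (1 - s)) ⟨by positivity, by rw [div_le_one hs1]; linarith [hc.1]⟩ ?_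
  have h1 : (1 - s : ℂ) ≠ 0 := by exact_mod_cast hs1.ne'
  push_cast
  field_simp
  linear_combination -hr

theorem edge_not_mem {v : ℕ → ℂ} {y : ℂ} (hy : y ∉ bd v) (i : ℕ) :
    v i - y ≠ 0 ∧ (v (i + 1) - y) / (v i - y) ∈ Complex.slitPlane :=
  sub_ne_of_not_mem_segment fun t ht h => hy ⟨i, t, ht, h⟩

theorem continuousAt_edge_arg {a b y : ℂ} (h : a - y ≠ 0 ∧ (b - y) / (a - y) ∈ Complex.slitPlane) :
    ContinuousAt (fun y => arg ((b - y) / (a - y))) y :=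
  (Complex.continuousAt_arg h.2).comp (f := fun y => (b - y) / (a - y))
    (ContinuousAt.div (by fun_prop) (by fun_prop) h.1)

theorem continuousAt_winding (m : ℕ) {v : ℕ → ℂ} {y : ℂ} (hy : y ∉ bd v) : ContinuousAt (winding m v) y :=
  tendsto_finsetSum _ fun i _ => continuousAt_edge_arg (edge_not_mem hy i)

/-- From far away both ends of an edge are seen in nearly the same direction: each quotient tends to
`1`. -/
theorem tendsto_winding (m : ℕ) (v : ℕ → ℂ) : Tendsto (winding m v) (Bornology.cobounded ℂ) (𝓝 0) := by
  have : Tendsto (winding m v) (Bornology.cobounded ℂ) (𝓝 (∑ _i ∈ Finset.range m, 0)) := by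
    refine tendsto_finsetSum _ fun i _ => ?_
    have h1 : Tendsto (fun y => v i - y) (Bornology.cobounded ℂ) (Bornology.cobounded ℂ) :=
      tendsto_const_sub_cobounded (v i)
    have h2 : Tendsto (fun y => 1 + (v (i + 1) - v i) * (v i - y)⁻¹) (Bornology.cobounded ℂ) (𝓝 1) := by
      simpa using ((tendsto_inv₀_cobounded.comp h1).const_mul (v (i + 1) - v i)).const_add 1
    have h3 : Tendsto (fun y => (v (i + 1) - y) / (v i - y)) (Bornology.cobounded ℂ) (𝓝 1) := by
      refine h2.congr' ?_
      filter_upwards [Bornology.isBounded_def.1 (Bornology.isBounded_singleton (x := v i))] with y hy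
      have : v i - y ≠ 0 := fun h => hy (sub_eq_zero.1 h).symm
      field_simp
      ring
    have := (Complex.continuousAt_arg Complex.one_mem_slitPlane).tendsto.comp h3
    rw [Complex.arg_one] at this
    exact this
  simpa using this

/-- A point from which one can escape to infinity along a ray is not in the interior. -/
theorem not_inner_of_ray {v : ℕ → ℂ} {x d : ℂ} (hd : d ≠ 0) (h : ∀ t : ℝ, 0 ≤ t → x + t * d ∉ bd v) : ¬ Inner v x := by
  intro hx
  have hsub : (fun t : ℝ => x + t * d) '' Ici 0 ⊆ connectedComponentIn (bd v)ᶜ x := by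
    refine IsPreconnected.subset_connectedComponentIn
      ((convex_Ici (0 : ℝ)).isPreconnected.image _ (by fun_prop)) ⟨0, by simp, by simp⟩ ?_
    rintro _ ⟨t, ht, rfl⟩
    exact h t ht
  obtain ⟨R, hR⟩ := (hx.2.subset hsub).exists_norm_le
  have hdn : 0 < ‖d‖ := norm_pos_iff.2 hd
  have hR0 : 0 ≤ R := (norm_nonneg _).trans (hR (x + (0 : ℝ) * d) ⟨0, by simp, rfl⟩)
  have := hR _ ⟨(R + ‖x‖ + 1) / ‖d‖, by simp only [mem_Ici]; positivity, rfl⟩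
  have h2 : ‖((((R + ‖x‖ + 1) / ‖d‖ : ℝ)) : ℂ) * d‖ = R + ‖x‖ + 1 := by
    rw [norm_mul, Complex.norm_real, Real.norm_of_nonneg (by positivity)]
    field_simp
  have h3 := norm_sub_le (x + ((((R + ‖x‖ + 1) / ‖d‖ : ℝ)) : ℂ) * d) x
  rw [add_sub_cancel_left, h2] at h3
  dsimp only at this
  linarith

namespace Poly

variable {m : ℕ} {v : ℕ → ℂ} (P : Poly m v)
include P

/-- The product of the quotients telescopes to `1` because the curve is closed, so the sum of their
logarithms is an integral multiple of `2πi`. -/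
theorem exists_winding {y : ℂ} (hy : y ∉ bd v) : ∃ k : ℤ, winding m v y = k * (2 * pi) := by
  have key : ∀ k, ∏ i ∈ Finset.range k, (v (i + 1) - y) / (v i - y) = (v k - y) / (v 0 - y) := by
    intro k
    induction k with
    | zero => simp [div_self (edge_not_mem hy 0).1]
    | succ k ih =>
      rw [Finset.prod_range_succ, ih]
      have h1 := (edge_not_mem hy 0).1
      have h2 := (edge_not_mem hy k).1
      field_simp
  have h1 : exp (∑ i ∈ Finset.range m, Complex.log ((v (i + 1) - y) / (v i - y))) = 1 := by
    rw [Complex.exp_sum, Finset.prod_congr rfl fun i _ =>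
      Complex.exp_log (Complex.slitPlane_ne_zero (edge_not_mem hy i).2), key]
    have := P.per 0
    rw [zero_add] at this
    rw [this, div_self (edge_not_mem hy 0).1]
  obtain ⟨k, hk⟩ := Complex.exp_eq_one_iff.1 h1
  refine ⟨k, ?_⟩
  have := congrArg Complex.im hk
  rw [Complex.im_sum] at this
  simpa [winding, Complex.log_im] using this

/-- A continuous function with values in `2πℤ` is constant on a connected set; otherwise it would
assume a value `2πk + π`. -/
theorem winding_const {S : Set ℂ} (hS : IsPreconnected S) (h : ∀ y ∈ S, y ∉ bd v) {y z : ℂ}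
    (hy : y ∈ S) (hz : z ∈ S) : winding m v y = winding m v z := by
  have hc : ContinuousOn (winding m v) S := fun y hy => (continuousAt_winding m (h y hy)).continuousWithinAt
  have key : ∀ y ∈ S, ∀ z ∈ S, ¬ winding m v y < winding m v z := by
    intro y hy z hz hlt
    obtain ⟨k, hk⟩ := P.exists_winding (h y hy)
    obtain ⟨l, hl⟩ := P.exists_winding (h z hz)
    have hp := Real.pi_pos
    have hkl : k < l := by
      rw [hk, hl] at hlt
      exact_mod_cast (mul_lt_mul_iff_left₀ (by positivity : (0 : ℝ) < 2 * pi)).1 hlt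
    have hkl' : (k : ℝ) + 1 ≤ l := by exact_mod_cast hkl
    obtain ⟨x, hx, hxe⟩ := hS.intermediate_value hy hz hc
      (show winding m v y + pi ∈ _ from ⟨by linarith, by rw [hk, hl]; nlinarith⟩)
    obtain ⟨j, hj⟩ := P.exists_winding (h x hx)
    rw [hj, hk] at hxe
    have : ((2 * j : ℤ) : ℝ) = ((2 * k + 1 : ℤ) : ℝ) := by
      push_cast
      apply mul_right_cancel₀ hp.ne'
      linarith
    have := Int.cast_injective this
    lia
  exact le_antisymm (not_lt.1 (key z hz y hy)) (not_lt.1 (key y hy z hz))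

theorem eventually_winding : ∀ᶠ y in Bornology.cobounded ℂ, y ∉ bd v ∧ winding m v y = 0 := by
  filter_upwards [Bornology.isBounded_def.1 P.isCompact_bd.isBounded,
    (tendsto_winding m v).eventually (Metric.ball_mem_nhds 0 Real.two_pi_pos)] with y hy h
  refine ⟨hy, ?_⟩
  obtain ⟨k, hk⟩ := P.exists_winding hy
  rw [dist_zero_right, Real.norm_eq_abs, hk, abs_mul, abs_of_pos Real.two_pi_pos] at h
  have : |(k : ℝ)| < 1 := by
    by_contra h'
    nlinarith [Real.two_pi_pos]
  have hk0 : k = 0 := Int.abs_lt_one_iff.1 (by exact_mod_cast this)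
  simp [hk, hk0]

/-- An unbounded component contains points arbitrarily far away, where the winding number vanishes.
-/
theorem winding_eq_zero {y : ℂ} (hy : y ∉ bd v) (h : ¬ Inner v y) : winding m v y = 0 := by
  have hub : ¬ Bornology.IsBounded (connectedComponentIn (bd v)ᶜ y) := fun h' => h ⟨hy, h'⟩
  have : ∃ z ∈ connectedComponentIn (bd v)ᶜ y, z ∉ bd v ∧ winding m v z = 0 := by
    by_contra! hc
    apply hub
    have := P.eventually_winding
    rw [Bornology.isBounded_def]
    filter_upwards [this] with z hz hzc
    exact hc z hzc hz.1 hz.2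
  obtain ⟨z, hz, -, hz0⟩ := this
  rw [← hz0]
  exact P.winding_const isPreconnected_connectedComponentIn
    (fun x hx => connectedComponentIn_subset _ _ hx) (mem_connectedComponentIn hy) hz

/-- If both sides were interior, then every point off the curve would be, as each is joined to one
of the sides; but a point far out on the real axis is not. -/
theorem not_left_and_right {u : ℝ} (hu : 0 < u) : ¬ (leftInner v u ∧ rightInner v u) := by
  rintro ⟨h1, h2⟩
  obtain ⟨R, hR⟩ := P.isCompact_bd.isBounded.exists_norm_le
  have hr : ∀ t : ℝ, 0 ≤ t → ((|R| + 1 : ℝ) : ℂ) + t * 1 ∉ bd v := by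
    intro t ht hb
    have := hR _ hb
    rw [mul_one, ← Complex.ofReal_add, Complex.norm_real, Real.norm_of_nonneg (by positivity)] at this
    linarith [le_abs_self R]
  have hn := not_inner_of_ray one_ne_zero hr
  have hb := hr 0 le_rfl
  simp only [Complex.ofReal_zero, zero_mul, add_zero] at hb
  have hs := P.side_const hu one_pos
  rcases P.inner_iff_side hb with h | h
  · exact hn (h.2 (hs.1.1 h1))
  · exact hn (h.2 (hs.2.1 h2))

/-- If both sides were exterior, then the winding number would be `0` on both sides of the midpoint
of the first edge. The contribution `T` of the other edges is continuous there, whereas that of the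
first edge is above `π / 2` on the left and below `-π / 2` on the right. So `T` would have to be
both `≤ -π / 2` and `≥ π / 2`. -/
theorem left_or_right {u : ℝ} (hu : 0 < u) : leftInner v u ∨ rightInner v u := by
  by_contra! hc
  have hs := P.side_const hu (show (0 : ℝ) < 1 / 2 by norm_num)
  rw [hs.1, hs.2] at hc
  have hm := P.three_le
  have hf : ⌊(1 / 2 : ℝ)⌋₊ = 0 := floor_eq (by norm_num) (by norm_num)
  have hce : ⌈(1 / 2 : ℝ)⌉₊ = 0 + 1 := ceil_eq (by norm_num) (by norm_num)
  have hx : path v (1 / 2) = v 0 + (1 / 2 : ℂ) * (v 1 - v 0) := by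
    rw [path, hf]; push_cast; simp
  have hB : dirB v (1 / 2) = v 1 - v 0 := by rw [dirB, hf]
  have hA : dirA v (1 / 2) = v 1 - v 0 := by rw [dirA, hce]
  have hw := P.edge_ne_zero 0
  rw [zero_add] at hw
  have hψ := psi_straight (hA.trans hB.symm) (by rwa [hB])
  obtain ⟨ε, hε, hl, hr, -⟩ := P.exists_side (show (0 : ℝ) < 1 / 2 by norm_num)
  set w := v 1 - v 0 with hwd
  set x := path v (1 / 2) with hxd
  have hn : 0 < ‖w‖ := norm_pos_iff.2 hw
  have hp := Real.pi_pos
  -- the other edges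
  set T : ℂ → ℝ := fun y => ∑ i ∈ Finset.Ico 1 m, arg ((v (i + 1) - y) / (v i - y)) with hT
  have hsplit : ∀ y, winding m v y = arg ((v 1 - y) / (v 0 - y)) + T y := by
    intro y
    rw [winding, Finset.range_eq_Ico, Finset.sum_eq_sum_Ico_succ_bot (by lia)]
  have hTc : ContinuousAt T x := by
    refine tendsto_finsetSum _ fun i hi => continuousAt_edge_arg (sub_ne_of_not_mem_segment ?_)
    intro t ht he
    rw [Finset.mem_Ico] at hi
    rw [hx] at he
    have h2 : (1 / 2 : ℂ) = ((1 / 2 : ℝ) : ℂ) := by push_cast; rfl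
    rw [h2] at he
    rcases ht.2.lt_or_eq with h1 | h1
    · have := P.uniq 0 i (1 / 2) t ⟨by norm_num, by norm_num⟩ ⟨ht.1, h1⟩ (by rw [zero_add]; exact he)
      rw [Nat.zero_mod, Nat.mod_eq_of_lt hi.2] at this
      lia
    · have := P.uniq 0 (i + 1) (1 / 2) 0 ⟨by norm_num, by norm_num⟩ ⟨le_rfl, one_pos⟩
        (by rw [zero_add, he, h1]; push_cast; ring)
      norm_num at this
  have hpos : ∀ s : ℝ, s = 1 ∨ s = -1 → ∀ᶠ δ : ℝ in 𝓝[>] 0,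
      winding m v (x + (s * δ : ℝ) * (I * w)) = 0 ∧
        pi / 2 < s * arg ((v 1 - (x + (s * δ : ℝ) * (I * w))) / (v 0 - (x + (s * δ : ℝ) * (I * w)))) := by
    intro s hsv
    have e1 : ∀ᶠ δ : ℝ in 𝓝[>] 0, δ < ε / ‖w‖ :=
      (Filter.Eventually.filter_mono nhdsWithin_le_nhds (eventually_lt_nhds (by positivity)))
    have e2 : ∀ᶠ δ : ℝ in 𝓝[>] 0, δ < 1 / 2 :=
      (Filter.Eventually.filter_mono nhdsWithin_le_nhds (eventually_lt_nhds (by norm_num)))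
    filter_upwards [e1, e2, self_mem_nhdsWithin] with δ h1 h2 h0
    rw [mem_Ioi] at h0
    rw [lt_div_iff₀ hn] at h1
    have hss : s * s = 1 := by rcases hsv with h | h <;> rw [h] <;> norm_num
    constructor
    · rcases hsv with h | h
      · have hm : x + (s * δ : ℝ) * (I * w) ∈ leftAt v (1 / 2) ε := by
          have := mem_sector_polar (x := x) (B := w) (a := 0) (b := psi v (1 / 2)) (φ := pi / 2) hw h0 h1
            (by positivity) (by linarith) (by positivity) (by rw [hψ]; linarith)
          rw [leftAt, hB, ← hxd]
          convert this using 2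
          push_cast
          rw [Complex.exp_pi_div_two_mul_I, h]
          push_cast; ring
        obtain ⟨g1, g2⟩ := hl _ hm
        exact P.winding_eq_zero g1 fun hi => hc.1 (g2.1 hi)
      · have hm : x + (s * δ : ℝ) * (I * w) ∈ rightAt v (1 / 2) ε := by
          have := mem_sector_polar (x := x) (B := w) (a := psi v (1 / 2)) (b := 2 * pi)
            (φ := pi / 2 + pi) hw h0 h1
            (by positivity) (by linarith) (by rw [hψ]; linarith) (by linarith)
          rw [rightAt, hB, ← hxd]
          convert this using 2
          push_cast
          rw [add_mul, Complex.exp_add, Complex.exp_pi_div_two_mul_I, Complex.exp_pi_mul_I, h]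
          push_cast; ring
        obtain ⟨g1, g2⟩ := hr _ hm
        exact P.winding_eq_zero g1 fun hi => hc.2 (g2.1 hi)
    -- Seen from a point at the distance `δ * |w|` from the midpoint, perpendicular to the edge, the
    -- quotient is a positive multiple of `δ² - 1/4 + sδi`. For `δ < 1/2` its real part is negative,
    -- so that its argument exceeds `π / 2` in absolute value, with the sign of `s`.
    · have hq : (v 1 - (x + (s * δ : ℝ) * (I * w))) / (v 0 - (x + (s * δ : ℝ) * (I * w)))
          = ((1 / (1 / 4 + δ * δ) : ℝ) : ℂ) * ((δ * δ - 1 / 4 : ℝ) + (s * δ : ℝ) * I) := by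
        have hd : (v 0 - (x + (s * δ : ℝ) * (I * w))) ≠ 0 := by
          have : v 0 - (x + (s * δ : ℝ) * (I * w)) = (-(1 / 2) - (s * δ : ℝ) * I) * w := by
            rw [hx]; ring
          rw [this]
          refine mul_ne_zero (fun h => ?_) hw
          have := congrArg Complex.re h
          norm_num at this
        have h4 : (1 / 4 + δ * δ : ℂ) ≠ 0 := by
          have : (1 / 4 + δ * δ : ℝ) ≠ 0 := by positivity
          have h := Complex.ofReal_ne_zero.2 this
          push_cast at h
          exact h
        rw [div_eq_iff hd]
        have e0 : v 1 = v 0 + w := by rw [hwd]; ring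
        have hssc : (s : ℂ) * s = 1 := by exact_mod_cast hss
        have hII : I * I = -1 := Complex.I_mul_I
        push_cast
        have hcc : (1 / (1 / 4 + δ * δ) : ℂ) * (1 / 4 + δ * δ) = 1 := one_div_mul_cancel h4
        rw [hx, e0]
        generalize (1 / (1 / 4 + δ * δ) : ℂ) = c at hcc ⊢
        generalize v 0 = z
        generalize (s : ℂ) = σ at hssc ⊢
        linear_combination (-(w / 2 - σ * δ * I * w)) * hcc + c * w * δ ^ 2 * σ ^ 2 * hII - c * w * δ ^ 2 * hssc
      rw [hq, Complex.arg_real_mul _ (by positivity)]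
      set z : ℂ := ((δ * δ - 1 / 4 : ℝ) + (s * δ : ℝ) * I) with hz
      have hre : z.re < 0 := by
        have : z.re = δ * δ - 1 / 4 := by rw [hz]; simp
        rw [this]
        nlinarith
      have him : z.im = s * δ := by rw [hz]; simp
      have habs := Complex.abs_arg_le_pi_div_two_iff.not.2 (not_le.2 hre)
      rw [not_le] at habs
      rcases hsv with h | h
      · rw [abs_of_nonneg (Complex.arg_nonneg_iff.2 (by rw [him, h]; linarith))] at habs
        rw [h]; linarith
      · rw [abs_of_neg (Complex.arg_neg_iff.2 (by rw [him, h]; linarith))] at habs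
        rw [h]; linarith
  have hlim : ∀ s : ℝ, Tendsto (fun δ : ℝ => T (x + (s * δ : ℝ) * (I * w))) (𝓝[>] 0) (𝓝 (T x)) := by
    intro s
    have h1 : Tendsto (fun δ : ℝ => x + (s * δ : ℝ) * (I * w)) (𝓝[>] 0) (𝓝 x) := by
      have : Tendsto (fun δ : ℝ => x + (s * δ : ℝ) * (I * w)) (𝓝 0) (𝓝 (x + (s * 0 : ℝ) * (I * w))) :=
        Continuous.tendsto (by fun_prop) 0
      simp only [mul_zero, Complex.ofReal_zero, zero_mul, add_zero] at this
      exact this.mono_left nhdsWithin_le_nhds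
    exact hTc.tendsto.comp h1
  have g1 : T x ≤ -(pi / 2) := by
    refine le_of_tendsto (hlim 1) ?_
    filter_upwards [hpos 1 (Or.inl rfl)] with δ h
    rw [hsplit] at h
    linarith [h.1, h.2]
  have g2 : pi / 2 ≤ T x := by
    refine ge_of_tendsto (hlim (-1)) ?_
    filter_upwards [hpos (-1) (Or.inr rfl)] with δ h
    rw [hsplit] at h
    linarith [h.1, h.2]
  linarith

theorem left_iff_not_right {u : ℝ} (hu : 0 < u) : leftInner v u ↔ ¬ rightInner v u := by
  have h1 := P.not_left_and_right hu
  have h2 := P.left_or_right hu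
  tauto

end Poly
end FixedMCR

namespace FixedMCR

/-! ## Where a point on a circle enters and leaves the region -/

open Complex (exp I)
open Real (pi)
open Set hiding pi
open Filter hiding pi
open Topology

/-- The region that is bounded by a closed curve. -/
def Reg (v : ℕ → ℂ) : Set ℂ := bd v ∪ {y | Inner v y}

/-- The point `p` is in the region after a rotation around the origin by `θ`, but not just
before. -/
def Enters (v : ℕ → ℂ) (p : ℂ) (θ : ℝ) : Prop :=
  p * exp (θ * I) ∈ Reg v ∧ ∀ᶠ φ : ℝ in 𝓝[<] θ, p * exp (φ * I) ∉ Reg v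

/-- The point `p` is in the region after a rotation around the origin by `θ`, but not just
after. -/
def Leaves (v : ℕ → ℂ) (p : ℂ) (θ : ℝ) : Prop :=
  p * exp (θ * I) ∈ Reg v ∧ ∀ᶠ φ : ℝ in 𝓝[>] θ, p * exp (φ * I) ∉ Reg v

theorem mem_Reg_iff {v : ℕ → ℂ} {y : ℂ} (hy : y ∉ bd v) : y ∈ Reg v ↔ Inner v y :=
  ⟨fun h => h.resolve_left hy, Or.inr⟩

theorem eventually_small {c : ℝ} (hc : 0 < c) : ∀ᶠ δ : ℝ in 𝓝[>] 0, δ < c :=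
  Filter.Eventually.filter_mono nhdsWithin_le_nhds (eventually_lt_nhds hc)

theorem dirA_natCast (v : ℕ → ℂ) (i : ℕ) : dirA v ((i + 1 : ℕ) : ℝ) = v (i + 1) - v i := by
  rw [dirA, Nat.ceil_natCast]; rfl

theorem dirB_natCast (v : ℕ → ℂ) (i : ℕ) : dirB v (i : ℝ) = v (i + 1) - v i := by
  simp [dirB]

theorem path_natCast (v : ℕ → ℂ) (i : ℕ) : path v (i : ℝ) = v i := by
  simp [path]

namespace Poly

variable {m : ℕ} {v : ℕ → ℂ} (P : Poly m v)
include P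

/-- Exactly one side is interior, so a nearby point is interior if and only if being on the left and
the left side being interior are both true or both false. -/
theorem exists_turn {u : ℝ} (hu : 0 < u) : ∃ ε > 0, ∀ y, 0 < ‖y - path v u‖ → ‖y - path v u‖ < ε →
    0 < argPos ((y - path v u) / dirB v u) → argPos ((y - path v u) / dirB v u) ≠ psi v u →
    y ∉ bd v ∧ (Inner v y ↔ (argPos ((y - path v u) / dirB v u) < psi v u ↔ leftInner v 1)) := by
  obtain ⟨ε, hε, hl, hr, -⟩ := P.exists_side hu
  refine ⟨ε, hε, fun y h1 h2 h3 h4 => ?_⟩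
  rcases h4.lt_or_gt with h | h
  · obtain ⟨g1, g2⟩ := hl y ⟨h1, h2, h3, h⟩
    exact ⟨g1, by rw [g2, (P.side_const hu one_pos).1]; tauto⟩
  · obtain ⟨g1, g2⟩ := hr y ⟨h1, h2, h, argPos_lt _⟩
    refine ⟨g1, ?_⟩
    have := P.left_iff_not_right one_pos
    have h' := h.not_gt
    rw [g2, (P.side_const hu one_pos).2]
    tauto

/-- Moves along the circle from a point of the curve. -/
theorem eventually_turn {u : ℝ} (hu : 0 < u) {e : ℝ} (he : |e| = 1) (hx : path v u ≠ 0) {L : Prop}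
    (h : ∀ᶠ δ : ℝ in 𝓝[>] 0, ∃ γ : ℝ, 0 < γ ∧ γ ≠ psi v u ∧ (γ < psi v u ↔ L) ∧
      argPos (e * I * path v u / dirB v u * exp ((e * δ / 2 : ℝ) * I)) = γ) :
    ∀ᶠ δ : ℝ in 𝓝[>] 0, path v u * exp ((e * δ : ℝ) * I) ∉ bd v ∧
      (Inner v (path v u * exp ((e * δ : ℝ) * I)) ↔ (L ↔ leftInner v 1)) := by
  obtain ⟨ε, hε, H⟩ := P.exists_turn hu
  set x := path v u
  have hn : 0 < ‖x‖ := norm_pos_iff.2 hx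
  filter_upwards [h, eventually_small (show 0 < ε / ‖x‖ by positivity), eventually_small Real.pi_pos,
    self_mem_nhdsWithin] with δ ⟨γ, h1, h2, h3, h4⟩ h5 h6 h7
  rw [mem_Ioi] at h7
  rw [lt_div_iff₀ hn] at h5
  have hs : 0 < 2 * Real.sin (δ / 2) := by
    have := Real.sin_pos_of_pos_of_lt_pi (show 0 < δ / 2 by linarith) (by linarith)
    linarith
  -- `e = 1` moves counterclockwise and `e = -1` clockwise. In either case the chord has the
  -- direction of the tangent `e * I * x` turned by `e * δ / 2`.
  have hd : x * exp ((e * δ : ℝ) * I) - x =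
      (2 * Real.sin (δ / 2) : ℝ) * (e * I * x * exp ((e * δ / 2 : ℝ) * I)) := by
    have h8 : Real.sin (e * δ / 2) = e * Real.sin (δ / 2) := by
      rcases eq_or_eq_neg_of_abs_eq he with h | h
      · rw [h, one_mul, one_mul]
      · rw [h, show -1 * δ / 2 = -(δ / 2) by ring, Real.sin_neg, neg_one_mul]
    have h9 := exp_sub_one (e * δ)
    rw [h8] at h9
    calc x * exp ((e * δ : ℝ) * I) - x = x * (exp ((e * δ : ℝ) * I) - 1) := by ring
      _ = _ := by rw [h9]; push_cast; ring
  have hq : argPos ((x * exp ((e * δ : ℝ) * I) - x) / dirB v u) = γ := by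
    rw [hd, mul_div_assoc, argPos_ofReal_mul hs, ← h4]
    congr 1
    ring
  have hen : ‖(e : ℂ)‖ = 1 := by rw [Complex.norm_real, Real.norm_eq_abs, he]
  have := H (x * exp ((e * δ : ℝ) * I))
  rw [hq] at this
  rw [← h3]
  refine this ?_ ?_ h1 h2
  · rw [hd, norm_mul, norm_mul, norm_mul, norm_mul, hen, Complex.norm_I, Complex.norm_exp_ofReal_mul_I,
      Complex.norm_real, Real.norm_of_nonneg hs.le]
    simpa using mul_pos hs hn
  · rw [show x * exp ((e * δ : ℝ) * I) - x = x * (exp ((e * δ : ℝ) * I) - 1) by ring, norm_mul]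
    refine lt_of_le_of_lt (mul_le_mul_of_nonneg_left (norm_exp_sub_one_le _) (norm_nonneg _)) ?_
    rw [abs_mul, he, one_mul, abs_of_pos h7]
    linarith

/-- The chord has the angle `α + δ / 2`, where `α` is the angle of the tangent. So it is not one of
the two boundary directions for small `δ`, and `α < psi` decides, also for `α = 0` and `α = psi`. -/
theorem eventually_after {u : ℝ} (hu : 0 < u) (hx : path v u ≠ 0) :
    ∀ᶠ δ : ℝ in 𝓝[>] 0, path v u * exp (δ * I) ∉ bd v ∧ (Inner v (path v u * exp (δ * I)) ↔
      (afterLeft (path v u) (dirA v u) (dirB v u) ↔ leftInner v 1)) := by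
  have hB := P.dirB_ne u
  have hψ := psi_lt v u
  have := P.eventually_turn hu (e := 1) abs_one hx
    (L := afterLeft (path v u) (dirA v u) (dirB v u)) ?_
  · simpa using this
  rw [afterLeft, argPos_mul_conj hB, argPos_mul_conj hB]
  change ∀ᶠ δ : ℝ in 𝓝[>] 0, ∃ γ : ℝ, 0 < γ ∧ γ ≠ psi v u ∧ (γ < psi v u ↔ _ < psi v u) ∧ _
  set α := argPos (I * path v u / dirB v u)
  have h0 : 0 ≤ α := argPos_nonneg _
  have h2 : α < 2 * pi := argPos_lt _
  have key : ∀ᶠ δ : ℝ in 𝓝[>] 0, α + δ / 2 < 2 * pi ∧ (α < psi v u → α + δ / 2 < psi v u) := by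
    by_cases hc : α < psi v u
    · filter_upwards [eventually_small (show 0 < psi v u - α by linarith), self_mem_nhdsWithin] with δ h h'
      rw [mem_Ioi] at h'
      exact ⟨by linarith, fun _ => by linarith⟩
    · filter_upwards [eventually_small (show 0 < 2 * pi - α by linarith), self_mem_nhdsWithin] with δ h h'
      rw [mem_Ioi] at h'
      exact ⟨by linarith, fun h => absurd h hc⟩
  filter_upwards [key, self_mem_nhdsWithin] with δ h h'
  rw [mem_Ioi] at h'
  refine ⟨α + δ / 2, by linarith, fun he => ?_, ⟨fun h => by linarith, h.2⟩, ?_⟩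
  · by_cases hc : α < psi v u
    · linarith [h.2 hc]
    · linarith
  · rw [Complex.ofReal_one, one_mul, one_mul]
    exact argPos_mul_exp (div_ne_zero (mul_ne_zero Complex.I_ne_zero hx) hB) (by linarith) h.1

theorem eventually_before {u : ℝ} (hu : 0 < u) (hx : path v u ≠ 0) :
    ∀ᶠ δ : ℝ in 𝓝[>] 0, path v u * exp ((-δ : ℝ) * I) ∉ bd v ∧
      (Inner v (path v u * exp ((-δ : ℝ) * I)) ↔
        (beforeLeft (path v u) (dirA v u) (dirB v u) ↔ leftInner v 1)) := by
  have hB := P.dirB_ne u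
  have hψ := psi_lt v u
  have hψ0 := P.psi_pos hu
  have := P.eventually_turn hu (e := -1) (by simp) hx
    (L := beforeLeft (path v u) (dirA v u) (dirB v u)) ?_
  · simpa only [neg_one_mul] using this
  rw [beforeLeft, argPos_mul_conj hB, argPos_mul_conj hB]
  change ∀ᶠ δ : ℝ in 𝓝[>] 0, ∃ γ : ℝ, 0 < γ ∧ γ ≠ psi v u ∧ (γ < psi v u ↔ 0 < _ ∧ _ ≤ psi v u) ∧ _
  have hz : -(I * path v u) / dirB v u ≠ 0 :=
    div_ne_zero (neg_ne_zero.2 (mul_ne_zero Complex.I_ne_zero hx)) hB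
  have hze : ((-1 : ℝ) : ℂ) * I * path v u / dirB v u = -(I * path v u) / dirB v u := by
    push_cast; ring
  set β := argPos (-(I * path v u) / dirB v u)
  have h0 : 0 ≤ β := argPos_nonneg _
  have h2 : β < 2 * pi := argPos_lt _
  -- If the tangent is along `dirB`, then turning it clockwise gives the angle `2π - δ / 2`, which
  -- is on the right.
  rcases h0.eq_or_lt with hb | hb
  · filter_upwards [eventually_small (show 0 < 2 * pi - psi v u by linarith), self_mem_nhdsWithin] with δ h h'
    rw [mem_Ioi] at h'
    refine ⟨β + (2 * pi - δ / 2), by linarith, fun he => by linarith,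
      ⟨fun h => by linarith, fun h => by linarith [h.1]⟩, ?_⟩
    rw [hze, ← argPos_mul_exp hz (by linarith) (by linarith)]
    congr 2
    push_cast
    rw [sub_mul, Complex.exp_sub, Complex.exp_two_pi_mul_I, one_div, ← Complex.exp_neg]
    congr 1
    ring
  · have key : ∀ᶠ δ : ℝ in 𝓝[>] 0, 0 < β - δ / 2 ∧ (psi v u < β → psi v u < β - δ / 2) := by
      by_cases hc : psi v u < β
      · filter_upwards [eventually_small (show 0 < β - psi v u by linarith), self_mem_nhdsWithin] with δ h h'
        rw [mem_Ioi] at h'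
        exact ⟨by linarith, fun _ => by linarith⟩
      · filter_upwards [eventually_small hb, self_mem_nhdsWithin] with δ h h'
        rw [mem_Ioi] at h'
        exact ⟨by linarith, fun h => absurd h hc⟩
    filter_upwards [key, self_mem_nhdsWithin] with δ h h'
    rw [mem_Ioi] at h'
    have hc : psi v u < β ∨ β ≤ psi v u := lt_or_ge _ _
    refine ⟨β + -(δ / 2), by linarith, fun he => ?_, ⟨fun h1 => ⟨hb, ?_⟩, fun h1 => by linarith [h1.2]⟩, ?_⟩
    · rcases hc with hc | hc
      · linarith [h.2 hc]
      · linarith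
    · rcases hc with hc | hc
      · linarith [h.2 hc]
      · exact hc
    · rw [hze, ← argPos_mul_exp hz (by linarith) (by linarith)]
      congr 4
      ring_nf

theorem eventually_inner_iff {y : ℂ} (hy : y ∉ bd v) :
    ∀ᶠ z in 𝓝 y, z ∉ bd v ∧ (Inner v z ↔ Inner v y) := by
  obtain ⟨ε, hε, h⟩ := Metric.isOpen_iff.1 P.isCompact_bd.isClosed.isOpen_compl y hy
  filter_upwards [Metric.ball_mem_nhds y hε] with z hz
  exact ⟨h hz, inner_iff_of_isPreconnected (convex_ball y ε).isPreconnected (fun x hx => h hx) hz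
    (Metric.mem_ball_self hε)⟩

theorem eventually_rotated_inner_iff {p : ℂ} {θ : ℝ} (h : p * exp (θ * I) ∉ bd v) :
    ∀ᶠ φ : ℝ in 𝓝 θ, (p * exp (φ * I) ∈ Reg v ↔ p * exp (θ * I) ∈ Reg v) := by
  have hc : Tendsto (fun φ : ℝ => p * exp (φ * I)) (𝓝 θ) (𝓝 (p * exp (θ * I))) :=
    Continuous.tendsto (by fun_prop) θ
  filter_upwards [hc.eventually (P.eventually_inner_iff h)] with φ hφ
  rw [mem_Reg_iff hφ.1, mem_Reg_iff h, hφ.2]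

theorem eventually_lt_iff {p : ℂ} {θ u : ℝ} (hp : p ≠ 0) (hu : 0 < u) (hx : path v u = p * exp (θ * I)) :
    ∀ᶠ φ : ℝ in 𝓝[<] θ, (p * exp (φ * I) ∈ Reg v ↔
      (beforeLeft (path v u) (dirA v u) (dirB v u) ↔ leftInner v 1)) := by
  have ht : Tendsto (fun φ : ℝ => θ - φ) (𝓝[<] θ) (𝓝[>] 0) := by
    refine tendsto_nhdsWithin_of_tendsto_nhds_of_eventually_within _ ?_ ?_
    · have : Tendsto (fun φ : ℝ => θ - φ) (𝓝 θ) (𝓝 (θ - θ)) := Continuous.tendsto (by fun_prop) θ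
      rw [sub_self] at this
      exact this.mono_left nhdsWithin_le_nhds
    · filter_upwards [self_mem_nhdsWithin] with φ hφ
      exact mem_Ioi.2 (sub_pos.2 (mem_Iio.1 hφ))
  have := ht.eventually (P.eventually_before hu (by rw [hx]; exact mul_ne_zero hp (Complex.exp_ne_zero _)))
  filter_upwards [this] with φ hφ
  have he : path v u * exp ((-(θ - φ) : ℝ) * I) = p * exp (φ * I) := by
    rw [hx, mul_assoc, ← Complex.exp_add]
    congr 2
    push_cast
    ring
  rw [he] at hφ
  rw [mem_Reg_iff hφ.1, hφ.2]

theorem eventually_gt_iff {p : ℂ} {θ u : ℝ} (hp : p ≠ 0) (hu : 0 < u) (hx : path v u = p * exp (θ * I)) :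
    ∀ᶠ φ : ℝ in 𝓝[>] θ, (p * exp (φ * I) ∈ Reg v ↔
      (afterLeft (path v u) (dirA v u) (dirB v u) ↔ leftInner v 1)) := by
  have ht : Tendsto (fun φ : ℝ => φ - θ) (𝓝[>] θ) (𝓝[>] 0) := by
    refine tendsto_nhdsWithin_of_tendsto_nhds_of_eventually_within _ ?_ ?_
    · have : Tendsto (fun φ : ℝ => φ - θ) (𝓝 θ) (𝓝 (θ - θ)) := Continuous.tendsto (by fun_prop) θ
      rw [sub_self] at this
      exact this.mono_left nhdsWithin_le_nhds
    · filter_upwards [self_mem_nhdsWithin] with φ hφ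
      exact mem_Ioi.2 (sub_pos.2 (mem_Ioi.1 hφ))
  have := ht.eventually (P.eventually_after hu (by rw [hx]; exact mul_ne_zero hp (Complex.exp_ne_zero _)))
  filter_upwards [this] with φ hφ
  have he : path v u * exp ((φ - θ : ℝ) * I) = p * exp (φ * I) := by
    rw [hx, mul_assoc, ← Complex.exp_add]
    congr 2
    push_cast
    ring
  rw [he] at hφ
  rw [mem_Reg_iff hφ.1, hφ.2]

/-- On a circle, membership in the region is eventually constant on both sides of a place. -/
theorem eventually_const {p : ℂ} {θ : ℝ} : ∃ a b : Prop,
    (∀ᶠ φ : ℝ in 𝓝[<] θ, (p * exp (φ * I) ∈ Reg v ↔ a)) ∧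
    (∀ᶠ φ : ℝ in 𝓝[>] θ, (p * exp (φ * I) ∈ Reg v ↔ b)) ∧
    (p * exp (θ * I) ∉ Reg v → ¬ a ∧ ¬ b) := by
  by_cases hp : p = 0
  · refine ⟨(0 : ℂ) ∈ Reg v, (0 : ℂ) ∈ Reg v, ?_, ?_, ?_⟩ <;> simp [hp]
  by_cases hx : p * exp (θ * I) ∈ bd v
  · obtain ⟨u, hu, -, hux⟩ := P.exists_path hx
    exact ⟨_, _, P.eventually_lt_iff hp hu hux, P.eventually_gt_iff hp hu hux, fun h => absurd (Or.inl hx) h⟩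
  · have := P.eventually_rotated_inner_iff hx
    exact ⟨_, _, this.filter_mono nhdsWithin_le_nhds, this.filter_mono nhdsWithin_le_nhds, fun h => ⟨h, h⟩⟩

/-- Off the curve, membership in the region is locally constant, so it can only change on the curve;
and the point at the center does not move at all. -/
theorem exists_place {p : ℂ} {θ : ℝ} {l : Filter ℝ} [l.NeBot] (hl : l ≤ 𝓝 θ)
    (h : p * exp (θ * I) ∈ Reg v) (h' : ∀ᶠ φ : ℝ in l, p * exp (φ * I) ∉ Reg v) :
    p ≠ 0 ∧ ∃ u : ℝ, 0 < u ∧ u ≤ m ∧ path v u = p * exp (θ * I) := by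
  refine ⟨?_, ?_⟩
  · rintro rfl
    obtain ⟨φ, hφ⟩ := h'.exists
    simp only [zero_mul] at h hφ
    exact hφ h
  · by_contra hc
    have hx : p * exp (θ * I) ∉ bd v := fun hx => hc (P.exists_path hx)
    obtain ⟨φ, h1, h2⟩ := (h'.and ((P.eventually_rotated_inner_iff hx).filter_mono hl)).exists
    exact h1 (h2.2 h)

theorem enters_iff {p : ℂ} {θ : ℝ} : Enters v p θ ↔ p ≠ 0 ∧ ∃ u : ℝ, 0 < u ∧ u ≤ m ∧
    path v u = p * exp (θ * I) ∧ ¬ (beforeLeft (path v u) (dirA v u) (dirB v u) ↔ leftInner v 1) := by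
  constructor
  · rintro ⟨h1, h2⟩
    obtain ⟨hp, u, hu, hum, hx⟩ := P.exists_place nhdsWithin_le_nhds h1 h2
    obtain ⟨φ, h3, h4⟩ := (h2.and (P.eventually_lt_iff hp hu hx)).exists
    exact ⟨hp, u, hu, hum, hx, fun h => h3 (h4.2 h)⟩
  · rintro ⟨hp, u, hu, -, hx, h⟩
    refine ⟨Or.inl (hx ▸ path_mem_bd v hu.le), ?_⟩
    filter_upwards [P.eventually_lt_iff hp hu hx] with φ hφ
    rwa [hφ]

theorem leaves_iff {p : ℂ} {θ : ℝ} : Leaves v p θ ↔ p ≠ 0 ∧ ∃ u : ℝ, 0 < u ∧ u ≤ m ∧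
    path v u = p * exp (θ * I) ∧ ¬ (afterLeft (path v u) (dirA v u) (dirB v u) ↔ leftInner v 1) := by
  constructor
  · rintro ⟨h1, h2⟩
    obtain ⟨hp, u, hu, hum, hx⟩ := P.exists_place nhdsWithin_le_nhds h1 h2
    obtain ⟨φ, h3, h4⟩ := (h2.and (P.eventually_gt_iff hp hu hx)).exists
    exact ⟨hp, u, hu, hum, hx, fun h => h3 (h4.2 h)⟩
  · rintro ⟨hp, u, hu, -, hx, h⟩
    refine ⟨Or.inl (hx ▸ path_mem_bd v hu.le), ?_⟩
    filter_upwards [P.eventually_gt_iff hp hu hx] with φ hφ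
    rwa [hφ]

/-- The direction away from the origin at a farthest vertex leads out of the region. -/
theorem farthest {i : ℕ} (h : ∀ j, ‖v j‖ ≤ ‖v (i + 1)‖) :
    argPos (v (i + 1) / (v (i + 2) - v (i + 1))) <
      argPos (-(v (i + 1) - v i) / (v (i + 2) - v (i + 1))) ↔ ¬ leftInner v 1 := by
  have hu : (0 : ℝ) < (i + 1 : ℕ) := by positivity
  obtain ⟨ε, hε, H⟩ := P.exists_turn hu
  rw [psi, path_natCast, dirA_natCast, dirB_natCast] at H
  change ∀ y, _ → _ → 0 < argPos ((y - v (i + 1)) / (v (i + 2) - v (i + 1))) → _ at H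
  set x := v (i + 1)
  have hA : x - v i ≠ 0 := P.edge_ne_zero i
  have hB : v (i + 2) - x ≠ 0 := P.edge_ne_zero (i + 1)
  have hx : x ≠ 0 := by
    intro hx
    rw [hx, norm_zero] at h
    have h1 := norm_le_zero_iff.1 (h i)
    exact hA (by rw [hx, h1, sub_zero])
  have hn : 0 < ‖x‖ := norm_pos_iff.2 hx
  have hbd : ∀ y ∈ bd v, ‖y‖ ≤ ‖x‖ := by
    rintro _ ⟨j, t, ht, rfl⟩
    have := (convex_closedBall (0 : ℂ) ‖x‖) (x := v j) (y := v (j + 1)) (by simpa using h j)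
      (by simpa using h (j + 1)) (sub_nonneg.2 ht.2) ht.1 (by ring)
    rw [mem_closedBall_zero_iff] at this
    refine (congrArg norm ?_).trans_le this
    simp only [Complex.real_smul]
    push_cast
    ring
  have hlong : ∀ c : ℝ, 1 < c → ‖x‖ < ‖(c : ℂ) * x‖ := by
    intro c hc
    rw [norm_mul, Complex.norm_real, Real.norm_of_nonneg (by linarith)]
    nlinarith
  set κ := ε / (2 * ‖x‖) with hκ
  have hκ0 : 0 < κ := by positivity
  have hd : x + κ * x - x = κ * x := by ring
  have hγ : argPos ((x + κ * x - x) / (v (i + 2) - x)) = argPos (x / (v (i + 2) - x)) := by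
    rw [hd, mul_div_assoc, argPos_ofReal_mul hκ0]
  -- The whole curve is in the disk of radius `‖x‖`, and the ray outwards from this point stays
  -- outside of the disk.
  have hout : ¬ Inner v (x + κ * x) := by
    refine not_inner_of_ray hx fun t ht hb => ?_
    refine (hbd _ hb).not_gt ?_
    have := hlong (1 + κ + t) (by linarith)
    rwa [show x + κ * x + t * x = ((1 + κ + t : ℝ) : ℂ) * x by push_cast; ring]
  have hkx : ‖x + κ * x - x‖ = ε / 2 := by
    rw [hd, norm_mul, Complex.norm_real, Real.norm_of_nonneg hκ0.le, hκ]
    field_simp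
  have := H (x + κ * x) (by rw [hkx]; positivity) (by rw [hkx]; linarith)
  rw [hγ] at this
  -- The radial direction is neither that of the next edge nor that back along the previous one,
  -- since otherwise the neighbouring vertex would be farther away than `x`.
  have h2 := this ?_ ?_
  · tauto
  · refine (argPos_nonneg _).lt_of_ne' fun h0 => ?_
    obtain ⟨c, hc, he⟩ := exists_pos_mul_of_argPos_eq (div_ne_zero hx hB) one_ne_zero
      (h0.trans (by simpa using (argPos_ofReal_pos one_pos).symm))
    rw [mul_one, div_eq_iff hB] at he
    refine (h (i + 2)).not_gt ?_
    refine (hlong (1 + 1 / c) (by linarith [one_div_pos.2 hc])).trans_eq (congrArg norm ?_)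
    have hcc : (c : ℂ) ≠ 0 := by exact_mod_cast hc.ne'
    push_cast
    field_simp
    linear_combination he
  · intro h0
    obtain ⟨c, hc, he⟩ := exists_pos_mul_of_argPos_eq (div_ne_zero hx hB)
      (div_ne_zero (neg_ne_zero.2 hA) hB) h0
    rw [← mul_div_assoc, div_left_inj' hB] at he
    refine (h i).not_gt ?_
    refine (hlong (1 + 1 / c) (by linarith [one_div_pos.2 hc])).trans_eq (congrArg norm ?_)
    have hcc : (c : ℂ) ≠ 0 := by exact_mod_cast hc.ne'
    push_cast
    field_simp
    linear_combination he

end Poly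
end FixedMCR

namespace FixedMCR

/-! ## The items of the sweeps and the places of the boundary -/

open Complex (exp I normSq)
open Real (pi)
open Set hiding pi

theorem footTau_swap (a b : ℂ) : footTau b a = -(footTau a b + 1) ∨ a = b := by
  by_cases h : a = b
  · exact Or.inr h
  left
  have h1 : normSq (b - a) ≠ 0 := by simpa [sub_eq_zero] using Ne.symm h
  have h2 : normSq (a - b) = normSq (b - a) := by rw [← neg_sub, Complex.normSq_neg]
  rw [footTau, footTau, h2]
  field_simp
  rw [Complex.normSq_apply]
  simp only [Complex.mul_re, Complex.conj_re, Complex.conj_im, Complex.sub_re, Complex.sub_im]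
  ring

/-- Reversing an edge exchanges its two parts, so that all facts need to be proved only for the part
on which the distance increases. -/
theorem minusItem_eq {a b : ℂ} (h : a ≠ b) (l : ℕ) : minusItem a b l = plusItem b a l := by
  have ht := (footTau_swap a b).resolve_right h
  have hf : foot b a = foot a b := by rw [foot, foot, ht]; push_cast; ring
  have h2 : normSq (a - b) = normSq (b - a) := by rw [← neg_sub, Complex.normSq_neg]
  have h3 : ∀ x : ℝ, max (-x) 0 ^ 2 = min x 0 ^ 2 := by
    intro x
    rw [show max (-x) 0 = -min x 0 by rw [← max_neg_neg, neg_zero], neg_sq]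
  rw [minusItem, plusItem, hf, h2, ht, h3, show -(footTau a b + 1) + 1 = -footTau a b by ring, h3]
  congr 1
  push_cast
  ring

section edge

variable {a b : ℂ}

theorem foot_mul_conj (h : a ≠ b) : (foot a b * (starRingEnd ℂ) (b - a)).re = 0 := by
  have h1 : normSq (b - a) ≠ 0 := by simpa [sub_eq_zero] using Ne.symm h
  rw [foot, sub_mul, mul_assoc, Complex.mul_conj, Complex.sub_re, footTau, ← Complex.ofReal_mul,
    Complex.ofReal_re]
  field_simp
  ring

/-- Pythagoras: the foot is orthogonal to the edge. -/
theorem normSq_line (h : a ≠ b) (τ : ℝ) :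
    normSq (foot a b + τ * (b - a)) = normSq (foot a b) + τ ^ 2 * normSq (b - a) := by
  rw [Complex.normSq_add]
  have : (foot a b * (starRingEnd ℂ) ((τ : ℂ) * (b - a))).re = 0 := by
    rw [map_mul, Complex.conj_ofReal, mul_left_comm, Complex.re_ofReal_mul, foot_mul_conj h, mul_zero]
  rw [this, Complex.normSq_mul, Complex.normSq_ofReal]
  ring

theorem line_eq (a b : ℂ) (s : ℝ) : a + s * (b - a) = foot a b + (footTau a b + s : ℝ) * (b - a) := by
  rw [foot]; push_cast; ring

theorem plusItem_pos (l : ℕ) (h : a ≠ b) {τ : ℝ} (hτ : 0 ≤ τ) :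
    (plusItem a b l).pos (normSq (foot a b) + τ ^ 2 * normSq (b - a)) = foot a b + τ * (b - a) := by
  have h1 : 0 < normSq (b - a) := by
    rw [Complex.normSq_pos]; exact sub_ne_zero.2 (Ne.symm h)
  rw [Item.pos]
  simp only [plusItem]
  rw [add_sub_cancel_left, Real.sqrt_mul (sq_nonneg _), Real.sqrt_sq hτ]
  congr 1
  rw [← mul_assoc, ← Complex.ofReal_mul]
  congr 2
  have := Real.sqrt_pos.2 h1
  field_simp

/-- The squared distance is increasing in the parameter beyond the foot, so the radius determines
the parameter `T`, as a square root, and the bounds on `q` say that `T` is between those of the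
ends. -/
theorem plusItem_active (l : ℕ) (h : a ≠ b) {q : ℝ} :
    (rel false (plusItem a b l).lo q ∧ rel false q (plusItem a b l).hi) ↔
      ∃ s : ℝ, 0 < s ∧ s < 1 ∧ 0 < footTau a b + s ∧ normSq (a + s * (b - a)) = q := by
  have h1 : 0 < normSq (b - a) := by
    rw [Complex.normSq_pos]; exact sub_ne_zero.2 (Ne.symm h)
  set τ := footTau a b with hτd
  have hrel : (rel false (plusItem a b l).lo q ∧ rel false q (plusItem a b l).hi) ↔
      normSq (foot a b) + max τ 0 ^ 2 * normSq (b - a) < q ∧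
        q < normSq (foot a b) + max (τ + 1) 0 ^ 2 * normSq (b - a) := by
    simp [rel, plusItem, hτd]
  rw [hrel]
  constructor
  · rintro ⟨h2, h3⟩
    have h4 : 0 ≤ max τ 0 := le_max_right _ _
    have h5 : 0 ≤ max (τ + 1) 0 := le_max_right _ _
    set T := √((q - normSq (foot a b)) / normSq (b - a)) with hT
    have h6 : 0 ≤ (q - normSq (foot a b)) / normSq (b - a) := by
      apply div_nonneg _ h1.le
      nlinarith [mul_nonneg (sq_nonneg (max τ 0)) h1.le]
    have hq : normSq (foot a b) + T ^ 2 * normSq (b - a) = q := by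
      rw [hT, Real.sq_sqrt h6]; field_simp; ring
    rw [← hq] at h2 h3
    have h7 : max τ 0 < T := lt_of_pow_lt_pow_left₀ 2 (Real.sqrt_nonneg _)
      (lt_of_mul_lt_mul_right (by linarith) h1.le)
    have h8 : T < max (τ + 1) 0 := lt_of_pow_lt_pow_left₀ 2 h5
      (lt_of_mul_lt_mul_right (by linarith) h1.le)
    have h9 : τ < T := (le_max_left _ _).trans_lt h7
    have h10 : 0 < T := h4.trans_lt h7
    have h11 : T < τ + 1 := (lt_max_iff.1 h8).resolve_right (not_lt.2 h10.le)
    have he : a + ((T - τ : ℝ) : ℂ) * (b - a) = foot a b + T * (b - a) := by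
      rw [line_eq, ← hτd, add_sub_cancel]
    refine ⟨T - τ, by linarith, by linarith, by linarith, ?_⟩
    rw [he, normSq_line h, hq]
  · rintro ⟨s, h2, h3, h4, h5⟩
    rw [line_eq, normSq_line h] at h5
    have h6 : max τ 0 ^ 2 < (τ + s) ^ 2 :=
      pow_lt_pow_left₀ (max_lt (by linarith) h4) (le_max_right _ _) two_ne_zero
    have h7 : (τ + s) ^ 2 < max (τ + 1) 0 ^ 2 :=
      pow_lt_pow_left₀ (lt_max_of_lt_left (by linarith)) h4.le two_ne_zero
    rw [← h5]
    constructor <;> nlinarith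

theorem edge_swap (a b : ℂ) (s : ℝ) : a + s * (b - a) = b + ((1 - s : ℝ) : ℂ) * (a - b) := by
  push_cast; ring

theorem plusItem_pos' (l : ℕ) (h : a ≠ b) {s : ℝ} (hs : 0 < footTau a b + s) :
    (plusItem a b l).pos (normSq (a + s * (b - a))) = a + s * (b - a) := by
  rw [line_eq, normSq_line h, plusItem_pos l h hs.le]

theorem minusItem_pos (l : ℕ) (h : a ≠ b) {s : ℝ} (hs : footTau a b + s < 0) :
    (minusItem a b l).pos (normSq (a + s * (b - a))) = a + s * (b - a) := by
  have ht := (footTau_swap a b).resolve_right h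
  rw [minusItem_eq h, edge_swap, plusItem_pos' l h.symm]
  rw [ht]
  linarith

theorem minusItem_active (l : ℕ) (h : a ≠ b) {q : ℝ} :
    (rel false (minusItem a b l).lo q ∧ rel false q (minusItem a b l).hi) ↔
      ∃ s : ℝ, 0 < s ∧ s < 1 ∧ footTau a b + s < 0 ∧ normSq (a + s * (b - a)) = q := by
  have ht := (footTau_swap a b).resolve_right h
  rw [minusItem_eq h, plusItem_active l h.symm, ht]
  constructor
  · rintro ⟨s, h1, h2, h3, h4⟩
    rw [edge_swap] at h4
    exact ⟨1 - s, by linarith, by linarith, by linarith, h4⟩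
  · rintro ⟨s, h1, h2, h3, h4⟩
    rw [edge_swap] at h4
    exact ⟨1 - s, by linarith, by linarith, by linarith, h4⟩

theorem line_mul_conj (h : a ≠ b) (τ : ℝ) :
    ((foot a b + τ * (b - a)) * (starRingEnd ℂ) (b - a)).re = τ * normSq (b - a) := by
  rw [add_mul, Complex.add_re, foot_mul_conj h, mul_assoc, Complex.mul_conj, ← Complex.ofReal_mul,
    Complex.ofReal_re, zero_add]

/-- If the boundary leads outwards, then the counterclockwise tangent `I * x` is strictly to the
left of `w` and its opposite strictly to the right: the imaginary part relative to `w` is the scalar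
product of `x` and `w`. -/
theorem turn_of_pos {x w : ℂ} (h : 0 < (x * (starRingEnd ℂ) w).re) :
    ¬ beforeLeft x w w ∧ afterLeft x w w := by
  have hw : w ≠ 0 := by rintro rfl; simp at h
  have h0 : argPos (-w * (starRingEnd ℂ) w) = pi := by
    rw [neg_mul, Complex.mul_conj, ← mul_neg_one, argPos_ofReal_mul (Complex.normSq_pos.2 hw), argPos_neg_one]
  rw [beforeLeft, afterLeft, h0]
  constructor
  · rintro ⟨-, h2⟩
    refine h2.not_gt (argPos_of_im_neg ?_)
    rw [neg_mul, mul_assoc, Complex.neg_im, Complex.I_mul_im]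
    linarith
  · refine (argPos_of_im_pos ?_).2
    rw [mul_assoc, Complex.I_mul_im]
    exact h

theorem turn_of_neg {x w : ℂ} (h : (x * (starRingEnd ℂ) w).re < 0) :
    beforeLeft x w w ∧ ¬ afterLeft x w w := by
  have hw : w ≠ 0 := by rintro rfl; simp at h
  have h0 : argPos (-w * (starRingEnd ℂ) w) = pi := by
    rw [neg_mul, Complex.mul_conj, ← mul_neg_one, argPos_ofReal_mul (Complex.normSq_pos.2 hw), argPos_neg_one]
  rw [beforeLeft, afterLeft, h0]
  constructor
  · have := argPos_of_im_pos (z := -(I * x) * (starRingEnd ℂ) w) (by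
      rw [neg_mul, mul_assoc, Complex.neg_im, Complex.I_mul_im]
      linarith)
    exact ⟨this.1, this.2.le⟩
  · refine not_lt.2 (argPos_of_im_neg ?_).le
    rw [mul_assoc, Complex.I_mul_im]
    exact h

end edge

theorem nodeItem_active {c : Prop} {x : ℂ} {l : ℕ} {q : ℝ} :
    (rel true (nodeItem c x l).lo q ∧ rel true q (nodeItem c x l).hi) ↔ c ∧ x ≠ 0 ∧ normSq x = q := by
  simp only [rel, nodeItem, if_true]
  by_cases h : c ∧ 0 < normSq x
  · rw [if_pos h, ← Complex.normSq_pos]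
    constructor
    · rintro ⟨h1, h2⟩; exact ⟨h.1, h.2, le_antisymm h1 h2⟩
    · rintro ⟨-, -, h2⟩; exact ⟨h2.le, h2.ge⟩
  · rw [if_neg h, ← Complex.normSq_pos]
    constructor
    · rintro ⟨h1, h2⟩; linarith [Complex.normSq_nonneg x]
    · rintro ⟨h1, h2, -⟩; exact absurd ⟨h1, h2⟩ h

theorem nodeItem_pos (c : Prop) (x : ℂ) (l : ℕ) (q : ℝ) : (nodeItem c x l).pos q = x := by
  simp [nodeItem, Item.pos]

/-- The place `u` of the curve belongs to the item `t` of the first sweep. -/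
def StrictAt (v : ℕ → ℂ) (t : ℕ) (u : ℝ) : Prop :=
  ∃ s : ℝ, 0 < s ∧ s < 1 ∧ u = (t / 2 : ℕ) + s ∧
    (t % 2 = 0 ∧ 0 < footTau (v (t / 2)) (v (t / 2 + 1)) + s ∨
      t % 2 = 1 ∧ footTau (v (t / 2)) (v (t / 2 + 1)) + s < 0)

/-- The place `u` of the curve belongs to the item `t` of the second sweep. -/
def NodeAt (v : ℕ → ℂ) (t : ℕ) (u : ℝ) : Prop :=
  t % 4 < 2 ∧ u = (t / 4 + 1 : ℕ) ∨ 2 ≤ t % 4 ∧ ∃ s : ℝ, 0 < s ∧ s < 1 ∧ u = (t / 4 : ℕ) + s ∧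
    footTau (v (t / 4)) (v (t / 4 + 1)) + s = 0

theorem edge_spec (v : ℕ → ℂ) {i : ℕ} {s : ℝ} (h0 : 0 < s) (h1 : s < 1) :
    path v (i + s) = v i + s * (v (i + 1) - v i) ∧ dirA v (i + s) = v (i + 1) - v i ∧
      dirB v (i + s) = v (i + 1) - v i := by
  have hf : ⌊(i : ℝ)⌋₊ = i := Nat.floor_natCast i
  have := dirs_add (v := v) (u := (i : ℝ)) (s := s) (Nat.cast_nonneg i) h0 (by rw [hf]; linarith)
  rw [dirB_natCast] at this
  refine ⟨?_, this.1, this.2⟩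
  rw [path_eq (c := i) (by linarith) (by linarith), add_sub_cancel_left]

namespace Poly

variable {m : ℕ} {v : ℕ → ℂ} (P : Poly m v)
include P

theorem edge_ne (i : ℕ) : v i ≠ v (i + 1) := fun h => P.edge_ne_zero i (by rw [h, sub_self])

theorem strict_active {σ t : ℕ} {q : ℝ} :
    (rel false (strictItem v σ t).lo q ∧ rel false q (strictItem v σ t).hi) ↔
      ∃ u, StrictAt v t u ∧ normSq (path v u) = q := by
  have hn := P.edge_ne (t / 2)
  by_cases ht : t % 2 = 0
  · rw [strictItem, if_pos ht, plusItem_active _ hn]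
    constructor
    · rintro ⟨s, h1, h2, h3, h4⟩
      rw [← (edge_spec v h1 h2).1] at h4
      exact ⟨_, ⟨s, h1, h2, rfl, Or.inl ⟨ht, h3⟩⟩, h4⟩
    · rintro ⟨_, ⟨s, h1, h2, rfl, h3⟩, h4⟩
      rw [(edge_spec v h1 h2).1] at h4
      exact ⟨s, h1, h2, (h3.resolve_right (by lia)).2, h4⟩
  · rw [strictItem, if_neg ht, minusItem_active _ hn]
    constructor
    · rintro ⟨s, h1, h2, h3, h4⟩
      rw [← (edge_spec v h1 h2).1] at h4
      exact ⟨_, ⟨s, h1, h2, rfl, Or.inr ⟨by lia, h3⟩⟩, h4⟩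
    · rintro ⟨_, ⟨s, h1, h2, rfl, h3⟩, h4⟩
      rw [(edge_spec v h1 h2).1] at h4
      exact ⟨s, h1, h2, (h3.resolve_left (by lia)).2, h4⟩

theorem strict_pos {σ t : ℕ} {u : ℝ} (h : StrictAt v t u) :
    (strictItem v σ t).pos (normSq (path v u)) = path v u := by
  obtain ⟨s, h1, h2, rfl, h3⟩ := h
  rw [(edge_spec v h1 h2).1]
  rcases h3 with ⟨ht, h3⟩ | ⟨ht, h3⟩
  · rw [strictItem, if_pos ht, plusItem_pos' _ (P.edge_ne _) h3]
  · rw [strictItem, if_neg (by lia), minusItem_pos _ (P.edge_ne _) h3]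

/-- The crossing is transversal, so exactly one of the two kinds of events occurs, and the label is
the right one. Such a place is not the center, as it has a component along the edge. -/
theorem strict_label {σ t : ℕ} {u : ℝ} (hσ : σ ≤ 1) {L : Prop} (hL : 0 < σ ↔ L) (h : StrictAt v t u) :
    path v u ≠ 0 ∧
    ((strictItem v σ t).lab = 0 ∧ ¬ (beforeLeft (path v u) (dirA v u) (dirB v u) ↔ L) ∧
        (afterLeft (path v u) (dirA v u) (dirB v u) ↔ L) ∨
      (strictItem v σ t).lab = 1 ∧ (beforeLeft (path v u) (dirA v u) (dirB v u) ↔ L) ∧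
        ¬ (afterLeft (path v u) (dirA v u) (dirB v u) ↔ L)) := by
  obtain ⟨s, h1, h2, rfl, h3⟩ := h
  obtain ⟨e1, e2, e3⟩ := edge_spec v (i := t / 2) h1 h2
  have hn := P.edge_ne (t / 2)
  have hW := Complex.normSq_pos.2 (P.edge_ne_zero (t / 2))
  have hre := line_mul_conj hn (footTau (v (t / 2)) (v (t / 2 + 1)) + s)
  rw [← line_eq, ← e1] at hre
  rw [e2, e3]
  constructor
  · intro h
    rw [h, zero_mul, Complex.zero_re] at hre
    rcases h3 with h3 | h3 <;> nlinarith [h3.2]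
  rcases h3 with ⟨h3, h4⟩ | ⟨h3, h4⟩
  · obtain ⟨g1, g2⟩ := turn_of_pos (by rw [hre]; exact mul_pos h4 hW)
    rw [strictItem, if_pos h3, plusItem]
    simp only [g1, g2, ← hL]
    clear hre e1 e2 e3
    simp
    lia
  · obtain ⟨g1, g2⟩ := turn_of_neg (by rw [hre]; exact mul_neg_of_neg_of_pos h4 hW)
    rw [strictItem, if_neg (by lia), minusItem]
    simp only [g1, g2, ← hL]
    clear hre e1 e2 e3
    simp
    lia

end Poly

section nodes

variable {v : ℕ → ℂ}

theorem foot_spec {i : ℕ} {s : ℝ} (h0 : 0 < s) (h1 : s < 1) (h : footTau (v i) (v (i + 1)) + s = 0) :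
    path v (i + s) = foot (v i) (v (i + 1)) := by
  rw [(edge_spec v h0 h1).1, line_eq, h]
  simp

theorem node_label (v : ℕ → ℂ) (σ t : ℕ) : (pointItem v σ t).lab = t % 2 := by
  simp only [pointItem]
  split_ifs <;> simp only [nodeItem] <;> lia

theorem node_pos {σ t : ℕ} {u : ℝ} (h : NodeAt v t u) (q : ℝ) : (pointItem v σ t).pos q = path v u := by
  rcases h with ⟨h, rfl⟩ | ⟨h, s, h0, h1, rfl, h2⟩
  · have : (pointItem v σ t).pos q = v (t / 4 + 1) := by
      simp only [pointItem]
      split_ifs <;> first | exact nodeItem_pos _ _ _ _ | lia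
    rw [this, path_natCast]
  · rw [foot_spec h0 h1 h2]
    simp only [pointItem]
    split_ifs <;> first | exact nodeItem_pos _ _ _ _ | lia

theorem node_active {σ t : ℕ} {L : Prop} (hL : 0 < σ ↔ L) {q : ℝ} :
    (rel true (pointItem v σ t).lo q ∧ rel true q (pointItem v σ t).hi) ↔
      ∃ u, NodeAt v t u ∧ path v u ≠ 0 ∧ normSq (path v u) = q ∧
        (t % 2 = 0 ∧ ¬ (beforeLeft (path v u) (dirA v u) (dirB v u) ↔ L) ∨
          t % 2 = 1 ∧ ¬ (afterLeft (path v u) (dirA v u) (dirB v u) ↔ L)) := by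
  have hB : dirB v ((t / 4 + 1 : ℕ) : ℝ) = v (t / 4 + 2) - v (t / 4 + 1) := dirB_natCast v _
  -- `C` stands for `beforeLeft` or `afterLeft`, so that in-events and out-events are treated
  -- together; likewise for the feet below.
  have vert : ∀ C : ℂ → ℂ → ℂ → Prop, (∃ u, (t % 4 < 2 ∧ u = ((t / 4 + 1 : ℕ) : ℝ)) ∧ path v u ≠ 0 ∧
      normSq (path v u) = q ∧ ¬ (C (path v u) (dirA v u) (dirB v u) ↔ L)) ↔ t % 4 < 2 ∧
      (¬ (C (v (t / 4 + 1)) (v (t / 4 + 1) - v (t / 4)) (v (t / 4 + 2) - v (t / 4 + 1)) ↔ 0 < σ) ∧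
        v (t / 4 + 1) ≠ 0 ∧ normSq (v (t / 4 + 1)) = q) := by
    intro C
    rw [hL, ← dirA_natCast, ← hB, ← path_natCast v (t / 4 + 1)]
    constructor
    · rintro ⟨u, ⟨h, rfl⟩, h1, h2, h3⟩
      exact ⟨h, h3, h1, h2⟩
    · rintro ⟨h, h1, h2, h3⟩
      exact ⟨_, ⟨h, rfl⟩, h2, h3, h1⟩
  have ft : ∀ C : ℂ → ℂ → ℂ → Prop, (∃ u : ℝ, (2 ≤ t % 4 ∧ ∃ s : ℝ, 0 < s ∧ s < 1 ∧ u = (t / 4 : ℕ) + s ∧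
      footTau (v (t / 4)) (v (t / 4 + 1)) + s = 0) ∧ path v u ≠ 0 ∧
      normSq (path v u) = q ∧ ¬ (C (path v u) (dirA v u) (dirB v u) ↔ L)) ↔ 2 ≤ t % 4 ∧
      (((footTau (v (t / 4)) (v (t / 4 + 1)) < 0 ∧ 0 < footTau (v (t / 4)) (v (t / 4 + 1)) + 1) ∧
        ¬ (C (foot (v (t / 4)) (v (t / 4 + 1))) (v (t / 4 + 1) - v (t / 4)) (v (t / 4 + 1) - v (t / 4)) ↔
          0 < σ)) ∧ foot (v (t / 4)) (v (t / 4 + 1)) ≠ 0 ∧ normSq (foot (v (t / 4)) (v (t / 4 + 1))) = q) := by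
    intro C
    rw [hL]
    constructor
    · rintro ⟨u, ⟨h, s, h0, h1, rfl, hs⟩, h2, h3, h4⟩
      obtain ⟨-, e2, e3⟩ := edge_spec v (i := t / 4) h0 h1
      rw [e2, e3] at h4
      rw [foot_spec h0 h1 hs] at h2 h3 h4
      exact ⟨h, ⟨⟨by linarith, by linarith⟩, h4⟩, h2, h3⟩
    · rintro ⟨h, ⟨⟨h0, h1⟩, h4⟩, h2, h3⟩
      have h0' : 0 < -footTau (v (t / 4)) (v (t / 4 + 1)) := by linarith
      have h1' : -footTau (v (t / 4)) (v (t / 4 + 1)) < 1 := by linarith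
      obtain ⟨-, e2, e3⟩ := edge_spec v (i := t / 4) h0' h1'
      refine ⟨(t / 4 : ℕ) + -footTau (v (t / 4)) (v (t / 4 + 1)),
        ⟨h, -footTau (v (t / 4)) (v (t / 4 + 1)), h0', h1', rfl, by ring⟩, ?_⟩
      rw [e2, e3, foot_spec h0' h1' (by ring)]
      exact ⟨h2, h3, h4⟩
  have h4 : t % 4 = 0 ∨ t % 4 = 1 ∨ t % 4 = 2 ∨ t % 4 = 3 := by lia
  simp only [pointItem]
  rcases h4 with h | h | h | h
  · rw [if_pos h, nodeItem_active]
    refine (and_iff_right (show t % 4 < 2 by lia)).symm.trans ((vert beforeLeft).symm.trans (exists_congr fun u => ?_))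
    have e : t % 2 = 0 := by lia
    simp only [NodeAt, e, h]
    simp
  · rw [if_neg (by lia), if_pos h, nodeItem_active]
    refine (and_iff_right (show t % 4 < 2 by lia)).symm.trans ((vert afterLeft).symm.trans (exists_congr fun u => ?_))
    have e : t % 2 = 1 := by lia
    simp only [NodeAt, e, h]
    simp
  · rw [if_neg (by lia), if_neg (by lia), if_pos h, nodeItem_active]
    refine (and_iff_right (show 2 ≤ t % 4 by lia)).symm.trans ((ft beforeLeft).symm.trans (exists_congr fun u => ?_))
    have e : t % 2 = 0 := by lia
    simp only [NodeAt, e, h]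
    simp
  · rw [if_neg (by lia), if_neg (by lia), if_neg (by lia), nodeItem_active]
    refine (and_iff_right (show 2 ≤ t % 4 by lia)).symm.trans ((ft afterLeft).symm.trans (exists_congr fun u => ?_))
    have e : t % 2 = 1 := by lia
    simp only [NodeAt, e, h]
    simp

theorem add_inj {i j : ℕ} {s s' : ℝ} (h0 : 0 < s) (h1 : s ≤ 1) (h0' : 0 < s') (h1' : s' ≤ 1)
    (h : (i : ℝ) + s = j + s') : i = j ∧ s = s' := by
  have e1 : ⌈(i : ℝ) + s⌉₊ = i + 1 := ceil_eq (by linarith) (by linarith)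
  have e2 : ⌈(j : ℝ) + s'⌉₊ = j + 1 := ceil_eq (by linarith) (by linarith)
  rw [h, e2] at e1
  obtain rfl : i = j := by lia
  exact ⟨rfl, by linarith⟩

theorem StrictAt.unique {t t' : ℕ} {u : ℝ} (h : StrictAt v t u) (h' : StrictAt v t' u) : t = t' := by
  obtain ⟨s, h0, h1, hu, hs⟩ := h
  obtain ⟨s', h0', h1', hu', hs'⟩ := h'
  obtain ⟨e, rfl⟩ := add_inj h0 h1.le h0' h1'.le (hu.symm.trans hu')
  rw [← e] at hs'
  rcases hs with hs | hs <;> rcases hs' with hs' | hs'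
  · lia
  · linarith [hs.2, hs'.2]
  · linarith [hs.2, hs'.2]
  · lia

theorem StrictAt.not_nodeAt {t t' : ℕ} {u : ℝ} (h : StrictAt v t u) : ¬ NodeAt v t' u := by
  obtain ⟨s, h0, h1, hu, hs⟩ := h
  rintro (⟨-, hu'⟩ | ⟨-, s', h0', h1', hu', hs'⟩)
  · push_cast at hu'
    have := (add_inj h0 h1.le one_pos le_rfl (hu.symm.trans hu')).2
    linarith
  · obtain ⟨e, rfl⟩ := add_inj h0 h1.le h0' h1'.le (hu.symm.trans hu')
    rw [← e] at hs'
    rcases hs with hs | hs <;> linarith [hs.2]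

theorem NodeAt.unique {t t' : ℕ} {u : ℝ} (h : NodeAt v t u) (h' : NodeAt v t' u) (ht : t % 2 = t' % 2) :
    t = t' := by
  rcases h with ⟨h, hu⟩ | ⟨h, s, h0, h1, hu, hs⟩ <;> rcases h' with ⟨h', hu'⟩ | ⟨h', s', h0', h1', hu', hs'⟩
  · have : t / 4 + 1 = t' / 4 + 1 := by exact_mod_cast hu.symm.trans hu'
    lia
  · push_cast at hu
    have := (add_inj one_pos le_rfl h0' h1'.le (hu.symm.trans hu')).2
    linarith
  · push_cast at hu'
    have := (add_inj h0 h1.le one_pos le_rfl (hu.symm.trans hu')).2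
    linarith
  · have := (add_inj h0 h1.le h0' h1'.le (hu.symm.trans hu')).1
    lia

theorem StrictAt.mem {t m : ℕ} {u : ℝ} (h : StrictAt v t u) (ht : t < 2 * m) : 0 < u ∧ u ≤ m := by
  obtain ⟨s, h0, h1, hu, -⟩ := h
  have h2 : ((t / 2 + 1 : ℕ) : ℝ) ≤ m := by exact_mod_cast (show t / 2 + 1 ≤ m by lia)
  push_cast at h2
  exact ⟨by rw [hu]; positivity, by linarith⟩

theorem NodeAt.mem {t m : ℕ} {u : ℝ} (h : NodeAt v t u) (ht : t < 4 * m) : 0 < u ∧ u ≤ m := by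
  have h2 : ((t / 4 + 1 : ℕ) : ℝ) ≤ m := by exact_mod_cast (show t / 4 + 1 ≤ m by lia)
  rcases h with ⟨h, hu⟩ | ⟨h, s, h0, h1, hu, hs⟩
  · exact ⟨by rw [hu]; positivity, by rw [hu]; exact h2⟩
  · push_cast at h2
    exact ⟨by rw [hu]; positivity, by linarith⟩

end nodes

/-- The items cover the curve: an interior point of an edge that is not its foot belongs to one of
the two parts, and a vertex or a foot has one item for each label. -/
theorem exists_item (v : ℕ → ℂ) {m : ℕ} {u : ℝ} (h0 : 0 < u) (hm : u ≤ m) : (∃ t < 2 * m, StrictAt v t u) ∨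
    ∀ l < 2, ∃ t < 4 * m, t % 2 = l ∧ NodeAt v t u := by
  obtain ⟨h1, h2⟩ := ceil_spec h0
  set i := ⌈u⌉₊ - 1
  have him : i < m := by exact_mod_cast h1.trans_le hm
  have e2 : 2 * i / 2 = i := by lia
  have e3 : (2 * i + 1) / 2 = i := by lia
  have e4 : ∀ l < 4, (4 * i + l) / 4 = i ∧ (4 * i + l) % 4 = l := fun l hl => by lia
  rcases h2.lt_or_eq with h2 | h2
  · rcases lt_trichotomy (footTau (v i) (v (i + 1)) + (u - i)) 0 with h | h | h
    · exact Or.inl ⟨2 * i + 1, by lia, u - i, by linarith, by linarith, by rw [e3]; ring,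
        Or.inr ⟨by lia, by rwa [e3]⟩⟩
    · refine Or.inr fun l hl => ⟨4 * i + (2 + l), by lia, by lia, Or.inr ⟨by lia, ?_⟩⟩
      rw [(e4 (2 + l) (by lia)).1]
      exact ⟨u - i, by linarith, by linarith, by ring, h⟩
    · exact Or.inl ⟨2 * i, by lia, u - i, by linarith, by linarith, by rw [e2]; ring,
        Or.inl ⟨by lia, by rwa [e2]⟩⟩
  · refine Or.inr fun l hl => ⟨4 * i + l, by lia, by lia, Or.inl ⟨by lia, ?_⟩⟩
    rw [(e4 l (by lia)).1, h2]
    push_cast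
    rfl

namespace Poly

variable {m : ℕ} {v : ℕ → ℂ} (P : Poly m v)
include P

/-- The parameters `0` and `m` denote the same vertex, but only `m` is in the range. -/
theorem path_injOn {u u' : ℝ} (h0 : 0 < u) (hm : u ≤ m) (h0' : 0 < u') (hm' : u' ≤ m)
    (h : path v u = path v u') : u = u' := by
  obtain ⟨h1, h2⟩ := P.path_inj h0.le h0'.le h
  have hf : ⌊u⌋₊ ≤ m := Nat.floor_le_of_le hm
  have hf' : ⌊u'⌋₊ ≤ m := Nat.floor_le_of_le hm'
  have h3 := Nat.floor_le h0.le
  have h3' := Nat.floor_le h0'.le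
  have key : ∀ {a b : ℝ}, 0 < b → a ≤ m → (⌊a⌋₊ : ℝ) ≤ a → ⌊a⌋₊ = m → ⌊b⌋₊ % m = 0 → ⌊b⌋₊ ≤ m →
      a - ⌊a⌋₊ = b - ⌊b⌋₊ → ⌊a⌋₊ = ⌊b⌋₊ := by
    intro a b hb ha ha' hfa hfb hfb' he
    rcases hfb'.lt_or_eq with h | h
    · rw [Nat.mod_eq_of_lt h] at hfb
      rw [hfb, hfa, Nat.cast_zero] at he
      linarith
    · rw [hfa, h]
  have : ⌊u⌋₊ = ⌊u'⌋₊ := by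
    rcases hf.lt_or_eq with hl | he
    · rcases hf'.lt_or_eq with hl' | he'
      · rwa [Nat.mod_eq_of_lt hl, Nat.mod_eq_of_lt hl'] at h1
      · exact (key h0 hm' h3' he' (by rw [h1, he', Nat.mod_self]) hf h2.symm).symm
    · exact key h0' hm h3 he (by rw [← h1, he, Nat.mod_self]) hf' h2
  rw [this] at h2
  linarith

end Poly
end FixedMCR

namespace FixedMCR

/-! ## The events of a point -/

open Complex (exp I normSq)
open Real (pi)
open Set hiding pi

/-- The events of the point `p` that the two sweeps produce. -/
noncomputable def pointEvents (m : ℕ) (v : ℕ → ℂ) (σ : ℕ) (p : ℂ) : Multiset (ℝ × ℕ) :=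
  (itemsOf (strictItem v σ)).events false (2 * m) (fun t => (strictItem v σ t).lo) (normSq p) (argPos p) +
    (itemsOf (pointItem v σ)).events true (4 * m) (fun t => (pointItem v σ t).lo) (normSq p) (argPos p)

/-- The point `p` has an in-event (if `l = 0`) or an out-event (if `l = 1`) when it gets to the
place `u` of the curve. -/
def EventAt (m : ℕ) (v : ℕ → ℂ) (p : ℂ) (u : ℝ) (l : ℕ) : Prop :=
  0 < u ∧ u ≤ m ∧ path v u ≠ 0 ∧ normSq (path v u) = normSq p ∧
    (l = 0 ∧ ¬ (beforeLeft (path v u) (dirA v u) (dirB v u) ↔ leftInner v 1) ∨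
      l = 1 ∧ ¬ (afterLeft (path v u) (dirA v u) (dirB v u) ↔ leftInner v 1))

theorem norm_eq_of_normSq_eq {x p : ℂ} (h : normSq x = normSq p) : ‖x‖ = ‖p‖ := by
  rw [Complex.norm_def, Complex.norm_def, h]

theorem events_card_le (D : Items) (c : Bool) (N : ℕ) (lo : ℕ → ℝ) (q β : ℝ) :
    Multiset.card (D.events c N lo q β) ≤ N := by
  rw [Items.events, Multiset.card_map]
  exact card_active_le c N lo D.hi q

theorem node_event {m σ : ℕ} {v : ℕ → ℂ} (hL : 0 < σ ↔ leftInner v 1) {p : ℂ} {t : ℕ} :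
    t ∈ active true (4 * m) (fun t => (pointItem v σ t).lo) (itemsOf (pointItem v σ)).hi (normSq p) ↔
      t < 4 * m ∧ ∃ u, NodeAt v t u ∧ EventAt m v p u (t % 2) ∧
        (itemsOf (pointItem v σ)).key t (normSq p) = argPos (path v u) := by
  rw [mem_active]
  refine and_congr_right fun ht => (node_active hL).trans (exists_congr fun u => ?_)
  refine and_congr_right fun hu => ?_
  rw [itemsOf_key, node_pos hu, EventAt]
  have := hu.mem ht
  tauto

namespace Poly

variable {m σ : ℕ} {v : ℕ → ℂ} (P : Poly m v)
include P

theorem strict_event (hσ : σ ≤ 1) (hL : 0 < σ ↔ leftInner v 1) {p : ℂ} {t : ℕ} :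
    t ∈ active false (2 * m) (fun t => (strictItem v σ t).lo) (itemsOf (strictItem v σ)).hi (normSq p) ↔
      t < 2 * m ∧ ∃ u, StrictAt v t u ∧ EventAt m v p u (strictItem v σ t).lab ∧
        (itemsOf (strictItem v σ)).key t (normSq p) = argPos (path v u) := by
  rw [mem_active]
  refine and_congr_right fun ht => (P.strict_active (σ := σ) (t := t)).trans (exists_congr fun u => ?_)
  refine and_congr_right fun hu => ?_
  obtain ⟨h1, h2⟩ := P.strict_label hσ hL hu
  refine ⟨fun h => ⟨⟨(hu.mem ht).1, (hu.mem ht).2, h1, h, ?_⟩, ?_⟩, fun h => h.1.2.2.2.1⟩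
  · exact h2.imp (fun h => ⟨h.1, h.2.1⟩) fun h => ⟨h.1, h.2.2⟩
  · rw [itemsOf_key, ← h, P.strict_pos hu]

theorem strict_event_label (hσ : σ ≤ 1) (hL : 0 < σ ↔ leftInner v 1) {p : ℂ} {t l : ℕ} {u : ℝ}
    (hu : StrictAt v t u) (h : EventAt m v p u l) : l = (strictItem v σ t).lab := by
  have h2 := (P.strict_label hσ hL hu).2
  have h3 := h.2.2.2.2
  rcases h2 with h2 | h2 <;> rcases h3 with h3 | h3
  · rw [h2.1, h3.1]
  · exact absurd h2.2.2 h3.2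
  · exact absurd h2.2.1 h3.2
  · rw [h2.1, h3.1]

theorem mem_pointEvents (hσ : σ ≤ 1) (hL : 0 < σ ↔ leftInner v 1) {p : ℂ} {θ : ℝ} {l : ℕ} :
    (θ, l) ∈ pointEvents m v σ p ↔ ∃ u, EventAt m v p u l ∧ wrap (argPos (path v u) - argPos p) = θ := by
  rw [pointEvents, Multiset.mem_add, Items.events, Items.events, Multiset.mem_map, Multiset.mem_map]
  constructor
  · rintro (⟨t, ht, he⟩ | ⟨t, ht, he⟩)
    · obtain ⟨-, u, -, h1, h2⟩ := (P.strict_event hσ hL).1 ht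
      rw [h2, Prod.mk.injEq] at he
      exact ⟨u, he.2 ▸ h1, he.1⟩
    · obtain ⟨-, u, -, h1, h2⟩ := (node_event hL).1 ht
      rw [h2, Prod.mk.injEq] at he
      rw [← node_label v σ t] at h1
      exact ⟨u, he.2 ▸ h1, he.1⟩
  · rintro ⟨u, h, rfl⟩
    rcases exists_item v h.1 h.2.1 with ⟨t, ht, hu⟩ | hu
    · have hl := P.strict_event_label hσ hL hu h
      have hk : (itemsOf (strictItem v σ)).key t (normSq p) = argPos (path v u) := by
        rw [itemsOf_key, ← h.2.2.2.1, P.strict_pos hu]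
      exact Or.inl ⟨t, (P.strict_event hσ hL).2 ⟨ht, u, hu, hl ▸ h, hk⟩, by rw [hk, hl]; rfl⟩
    · obtain ⟨t, ht, hl, hu⟩ := hu l (by rcases h.2.2.2.2 with h | h <;> lia)
      have hk : (itemsOf (pointItem v σ)).key t (normSq p) = argPos (path v u) := by
        rw [itemsOf_key, node_pos hu]
      refine Or.inr ⟨t, (node_event hL).2 ⟨ht, u, hu, hl.symm ▸ h, hk⟩, ?_⟩
      rw [hk]
      exact Prod.ext rfl ((node_label v σ t).trans hl)

/-- The angle determines the rotated point, and the point determines its place on the curve. -/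
theorem event_unique {p : ℂ} {u u' : ℝ} {l l' : ℕ} (h : EventAt m v p u l) (h' : EventAt m v p u' l')
    (he : wrap (argPos (path v u) - argPos p) = wrap (argPos (path v u') - argPos p)) : u = u' := by
  refine P.path_injOn h.1 h.2.1 h'.1 h'.2.1 ?_
  rw [← mul_exp_wrap (norm_eq_of_normSq_eq h.2.2.2.1), he, mul_exp_wrap (norm_eq_of_normSq_eq h'.2.2.2.1)]

/-- No event is produced twice, neither within a sweep nor by both. Hence the sizes of the lists,
which govern time and space, are the true numbers of events. -/
theorem nodup_pointEvents (hσ : σ ≤ 1) (hL : 0 < σ ↔ leftInner v 1) (p : ℂ) :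
    (pointEvents m v σ p).Nodup := by
  have hr : ∀ (c : Bool) (N : ℕ) (lo hi : ℕ → ℝ) (q : ℝ), (active c N lo hi q).Nodup := fun c N lo hi q => by
    classical exact Multiset.Nodup.filter _ (Multiset.nodup_range N)
  rw [pointEvents, Multiset.nodup_add, Items.events, Items.events]
  refine ⟨(hr _ _ _ _ _).map_on ?_, (hr _ _ _ _ _).map_on ?_, ?_⟩
  · intro t ht t' ht' he
    obtain ⟨-, u, hu, h1, h2⟩ := (P.strict_event hσ hL).1 ht
    obtain ⟨-, u', hu', h1', h2'⟩ := (P.strict_event hσ hL).1 ht'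
    rw [h2, h2', Prod.mk.injEq] at he
    exact hu.unique (P.event_unique h1 h1' he.1 ▸ hu')
  · intro t ht t' ht' he
    obtain ⟨-, u, hu, h1, h2⟩ := (node_event hL).1 ht
    obtain ⟨-, u', hu', h1', h2'⟩ := (node_event hL).1 ht'
    rw [h2, h2', Prod.mk.injEq] at he
    have hl : t % 2 = t' % 2 := by rw [← node_label v σ t, ← node_label v σ t']; exact he.2
    exact hu.unique (P.event_unique h1 h1' he.1 ▸ hu') hl
  · rw [Multiset.disjoint_left]
    rintro e he he'
    obtain ⟨t, ht, rfl⟩ := Multiset.mem_map.1 he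
    obtain ⟨t', ht', he⟩ := Multiset.mem_map.1 he'
    obtain ⟨-, u, hu, h1, h2⟩ := (P.strict_event hσ hL).1 ht
    obtain ⟨-, u', hu', h1', h2'⟩ := (node_event hL).1 ht'
    rw [h2, h2', Prod.mk.injEq] at he
    exact hu.not_nodeAt (P.event_unique h1 h1' he.1.symm ▸ hu')

/-- Places and angles are translated into each other by `path v u = p * exp (θ * I)`, with the same
modulus on both sides. -/
theorem mem_pointEvents_iff (hσ : σ ≤ 1) (hL : 0 < σ ↔ leftInner v 1) {p : ℂ} {θ : ℝ} {l : ℕ} :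
    (θ, l) ∈ pointEvents m v σ p ↔ θ ∈ Ico 0 (2 * pi) ∧ (l = 0 ∧ Enters v p θ ∨ l = 1 ∧ Leaves v p θ) := by
  rw [P.mem_pointEvents hσ hL]
  have key : ∀ u, (p ≠ 0 ∧ path v u = p * exp (θ * I) ∧ θ ∈ Ico 0 (2 * pi) ↔
      path v u ≠ 0 ∧ normSq (path v u) = normSq p ∧ wrap (argPos (path v u) - argPos p) = θ) := by
    intro u
    constructor
    · rintro ⟨hp, hx, hθ⟩
      have hn : ‖path v u‖ = ‖p‖ := by rw [hx, norm_mul, Complex.norm_exp_ofReal_mul_I, mul_one]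
      refine ⟨by rw [hx]; exact mul_ne_zero hp (Complex.exp_ne_zero _), ?_, ?_⟩
      · rw [Complex.normSq_eq_norm_sq, Complex.normSq_eq_norm_sq, hn]
      · exact exp_injOn (wrap_argPos_sub _ _) hθ
          (mul_left_cancel₀ hp ((mul_exp_wrap hn).trans hx))
    · rintro ⟨h1, h2, rfl⟩
      have hn := norm_eq_of_normSq_eq h2
      refine ⟨?_, (mul_exp_wrap hn).symm, wrap_argPos_sub _ _⟩
      rintro rfl
      rw [norm_zero, norm_eq_zero] at hn
      exact h1 hn
  rw [P.enters_iff, P.leaves_iff]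
  constructor
  · rintro ⟨u, ⟨h1, h2, h3, h4, h5⟩, h6⟩
    obtain ⟨hp, hx, hθ⟩ := (key u).2 ⟨h3, h4, h6⟩
    exact ⟨hθ, h5.imp (fun h => ⟨h.1, hp, u, h1, h2, hx, h.2⟩) fun h => ⟨h.1, hp, u, h1, h2, hx, h.2⟩⟩
  · rintro ⟨hθ, ⟨hl, hp, u, h1, h2, hx, h⟩ | ⟨hl, hp, u, h1, h2, hx, h⟩⟩
    · obtain ⟨h3, h4, h5⟩ := (key u).1 ⟨hp, hx, hθ⟩
      exact ⟨u, ⟨h1, h2, h3, h4, Or.inl ⟨hl, h⟩⟩, h5⟩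
    · obtain ⟨h3, h4, h5⟩ := (key u).1 ⟨hp, hx, hθ⟩
      exact ⟨u, ⟨h1, h2, h3, h4, Or.inr ⟨hl, h⟩⟩, h5⟩

end Poly
end FixedMCR

namespace FixedMCR

/-! ## The order of the items on a growing circle -/

open Complex (exp I normSq arg)
open Real (pi)
open Set hiding pi

/-- Lifted angles that increase within a window of length `2π` have at most one descent after
reduction modulo `2π`: every descent raises the number `k` of turns by one, and two of them would
exceed the window. -/
theorem desc_le_one {f α : ℕ → ℝ} {k : ℕ → ℤ} {w : ℕ} (hf : ∀ j < w, f j ∈ Ico 0 (2 * pi))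
    (hk : ∀ j < w, α j = f j + k j * (2 * pi)) (h : ∀ a b, a < b → b < w → α a < α b ∧ α b < α a + 2 * pi) :
    desc f 0 w ≤ 1 := by
  have hp := Real.two_pi_pos
  have mono : ∀ a b, a ≤ b → b < w → k a ≤ k b := by
    intro a b hab hb
    rcases hab.eq_or_lt with rfl | hab
    · rfl
    by_contra hc
    have h1 := (h a b hab hb).1
    have h2 : (k b : ℝ) + 1 ≤ k a := by exact_mod_cast (not_le.1 hc : k b < k a)
    rw [hk a (hab.trans hb), hk b hb] at h1
    have h3 := (hf a (hab.trans hb)).1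
    have h4 := (hf b hb).2
    nlinarith
  have step : ∀ l, 0 < l → l < w → f l < f (l - 1) → k (l - 1) + 1 ≤ k l := by
    intro l h0 hl hd
    by_contra hc
    have h1 := (h (l - 1) l (by lia) hl).1
    have h2 : (k l : ℝ) ≤ k (l - 1) := by exact_mod_cast (show k l ≤ k (l - 1) by lia)
    rw [hk _ hl, hk (l - 1) (by lia)] at h1
    nlinarith
  have key : ∀ l l', 0 < l → l < l' → l' < w → f l < f (l - 1) → ¬ f l' < f (l' - 1) := by
    intro l l' h0 hl hl' hd hd'
    have h1 := step l h0 (hl.trans hl') hd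
    have h2 := step l' (by lia) hl' hd'
    have h3 := mono l (l' - 1) (by lia) (by lia)
    have h4 := (h (l - 1) l' (by lia) hl').2
    have h5 : (k (l - 1) : ℝ) + 2 ≤ k l' := by exact_mod_cast (show k (l - 1) + 2 ≤ k l' by lia)
    rw [hk _ hl', hk (l - 1) (by lia)] at h4
    have h6 := (hf l' hl').1
    have h7 := (hf (l - 1) (by lia)).2
    nlinarith
  rw [desc, Finset.card_le_one]
  intro a ha b hb
  rw [Finset.mem_filter, Finset.mem_Ioo] at ha hb
  rcases lt_trichotomy a b with hab | hab | hab
  · exact absurd hb.2 (key a b ha.1.1 hab hb.1.2 ha.2)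
  · exact hab
  · exact absurd ha.2 (key b a hb.1.1 hab ha.1.2 hb.2)

theorem mem_Ioo_of_avoids {D : ℝ → ℝ} {a b c : ℝ} (hab : a ≤ b) (hD : ContinuousOn D (Icc a b))
    (h0 : ∀ s ∈ Icc a b, D s ≠ 0 ∧ D s ≠ c) (ha : D a ∈ Ioo 0 c) : D b ∈ Ioo 0 c := by
  constructor
  · by_contra hc
    obtain ⟨s, hs, he⟩ := intermediate_value_Icc' hab hD ⟨not_lt.1 hc, ha.1.le⟩
    exact (h0 s hs).1 he
  · by_contra hc
    obtain ⟨s, hs, he⟩ := intermediate_value_Icc hab hD ⟨ha.2.le, not_lt.1 hc⟩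
    exact (h0 s hs).2 he

theorem exp_eq_of_ratio {z x : ℂ} (hz : z ≠ 0) :
    (‖x‖ : ℂ) * exp ((argPos z + arg (x / z) : ℝ) * I) = x := by
  have h1 := norm_mul_exp_argPos z
  have h2 := Complex.norm_mul_exp_arg_mul_I (x / z)
  rw [norm_div] at h2
  have hn : (‖z‖ : ℂ) ≠ 0 := by exact_mod_cast (norm_ne_zero_iff.2 hz)
  push_cast at h2 ⊢
  rw [add_mul, Complex.exp_add]
  calc (‖x‖ : ℂ) * (exp (argPos z * I) * exp (arg (x / z) * I))
      = (‖z‖ * exp (argPos z * I)) * (‖x‖ / ‖z‖ * exp (arg (x / z) * I)) := by field_simp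
    _ = x := by rw [h1, h2, mul_div_cancel₀ _ hz]

namespace Poly

variable {m : ℕ} {v : ℕ → ℂ} (P : Poly m v) (σ : ℕ)
include P

/-- Two points of the same part are seen from the origin at an angle below `π / 2`, because their
parameters from the foot have the same sign. So the angle swept by an item can be measured with the
continuous principal argument. -/
theorem strict_same_side {t : ℕ} {u u' : ℝ} (h : StrictAt v t u) (h' : StrictAt v t u') :
    0 < (path v u * (starRingEnd ℂ) (path v u')).re := by
  obtain ⟨s, h0, h1, rfl, hs⟩ := h
  obtain ⟨s', h0', h1', rfl, hs'⟩ := h'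
  have hn := P.edge_ne (t / 2)
  have hW := Complex.normSq_pos.2 (P.edge_ne_zero (t / 2))
  rw [(edge_spec v h0 h1).1, (edge_spec v h0' h1').1, line_eq, line_eq]
  set a := v (t / 2)
  set b := v (t / 2 + 1)
  have h2 := foot_mul_conj hn
  have h3 : ∀ τ τ' : ℝ, ((foot a b + τ * (b - a)) * (starRingEnd ℂ) (foot a b + τ' * (b - a))).re =
      normSq (foot a b) + τ * τ' * normSq (b - a) := by
    intro τ τ'
    rw [Complex.mul_re, Complex.conj_re, Complex.conj_im] at h2
    simp only [Complex.mul_re, Complex.add_re, Complex.add_im, map_add, map_mul, Complex.conj_re,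
      Complex.conj_im, Complex.conj_ofReal, Complex.normSq_apply, Complex.mul_im, Complex.ofReal_re,
      Complex.ofReal_im]
    linear_combination (τ + τ') * h2
  rw [h3]
  have h4 := Complex.normSq_nonneg (foot a b)
  have h5 : 0 < (footTau a b + s) * (footTau a b + s') := by
    rcases hs with hs | hs <;> rcases hs' with hs' | hs'
    · exact mul_pos hs.2 hs'.2
    · lia
    · lia
    · exact mul_pos_of_neg_of_neg hs.2 hs'.2
  have := mul_pos h5 hW
  linarith

/-- Follow continuous lifts of the angles of the items while the circle grows. Different items never
meet, as the polygon is simple, so the difference of two lifts never becomes `0` or `2π` and remains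
in the window in which it was at the beginning. -/
theorem keepsOrder_strict :
    KeepsOrder false (2 * m) (fun t => (strictItem v σ t).lo) (itemsOf (strictItem v σ)) := by
  intro p w q q' hq hact hinj hsort
  have hp := Real.two_pi_pos
  set z : ℕ → ℝ → ℂ := fun j s => (strictItem v σ (p j)).pos s with hz
  have hkey : ∀ j s, (itemsOf (strictItem v σ)).key (p j) s = argPos (z j s) := fun j s => itemsOf_key _ _ _
  simp only [hkey] at hsort ⊢
  have hpl : ∀ j < w, ∀ s ∈ Icc q q', ∃ u, StrictAt v (p j) u ∧ normSq (z j s) = s ∧ z j s = path v u ∧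
      0 < u ∧ u ≤ m := by
    intro j hj s hs
    obtain ⟨h1, h2⟩ := hact j hj
    rw [mem_active] at h1 h2
    obtain ⟨u, hu, hun⟩ := P.strict_active.1 (show rel false (strictItem v σ (p j)).lo s ∧
        rel false s (strictItem v σ (p j)).hi by
      have h3 := h1.2.1
      have h4 := h2.2.2
      simp only [rel, itemsOf] at h3 h4 ⊢
      exact ⟨lt_of_lt_of_le h3 hs.1, lt_of_le_of_lt hs.2 h4⟩)
    have h5 : z j s = path v u := by rw [hz]; dsimp only; rw [← hun, P.strict_pos hu]
    exact ⟨u, hu, by rw [h5, hun], h5, hu.mem h1.1⟩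
  have hqm : q ∈ Icc q q' := ⟨le_rfl, hq⟩
  have hqm' : q' ∈ Icc q q' := ⟨hq, le_rfl⟩
  have hre : ∀ j < w, ∀ s ∈ Icc q q', z j q ≠ 0 ∧ 0 < (z j s / z j q).re := by
    intro j hj s hs
    obtain ⟨u, hu, -, h1, -⟩ := hpl j hj s hs
    obtain ⟨u', hu', -, h2, -⟩ := hpl j hj q hqm
    have h3 := P.strict_same_side hu hu'
    rw [← h1, ← h2] at h3
    have h4 : z j q ≠ 0 := by
      intro h; rw [h] at h3; simp at h3
    refine ⟨h4, ?_⟩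
    rw [div_eq_mul_inv, Complex.inv_def, ← mul_assoc, Complex.re_mul_ofReal]
    exact mul_pos h3 (inv_pos.2 (Complex.normSq_pos.2 h4))
  -- The lift starts at the reduced angle at `q` and adds the argument of the quotient of the
  -- positions, which has positive real part.
  set α : ℕ → ℝ → ℝ := fun j s => argPos (z j q) + arg (z j s / z j q) with hα
  have hexp : ∀ j < w, ∀ s ∈ Icc q q', (√s : ℂ) * exp (α j s * I) = z j s := by
    intro j hj s hs
    obtain ⟨-, -, h1, -⟩ := hpl j hj s hs
    rw [← exp_eq_of_ratio (x := z j s) (hre j hj q hqm).1, Complex.norm_def, h1]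
  have hcont : ∀ j < w, ContinuousOn (α j) (Icc q q') := by
    intro j hj s hs
    have h1 : ContinuousAt (fun s => z j s / z j q) s := by
      have : Continuous (fun s => z j s) := by
        simp only [hz, Item.pos]
        fun_prop
      exact this.continuousAt.div_const _
    exact (((Complex.continuousAt_arg (Or.inl (hre j hj s hs).2)).comp (f := fun s => z j s / z j q)
      h1).const_add _).continuousWithinAt
  have hne : ∀ j < w, ∀ k < w, j ≠ k → ∀ s ∈ Icc q q', z j s ≠ z k s := by
    intro j hj k hk hjk s hs he
    obtain ⟨u, hu, -, h1, h2, h3⟩ := hpl j hj s hs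
    obtain ⟨u', hu', -, h1', h2', h3'⟩ := hpl k hk s hs
    rw [h1, h1'] at he
    obtain rfl := P.path_injOn h2 h3 h2' h3' he
    exact hjk (hinj j hj k hk (hu.unique hu'))
  have hα0 : ∀ j < w, α j q = argPos (z j q) := by
    intro j hj
    rw [hα]
    dsimp only
    rw [div_self (hre j hj q hqm).1, Complex.arg_one, add_zero]
  have hwin : ∀ a b, a < b → b < w → α b q' - α a q' ∈ Ioo 0 (2 * pi) := by
    intro a b hab hb
    have ha := hab.trans hb
    -- All positions at `s` have the modulus `√s`, so equal angles modulo `2π` would be a common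
    -- point of two items.
    have hav : ∀ s ∈ Icc q q', α b s - α a s ≠ 0 ∧ α b s - α a s ≠ 2 * pi := by
      intro s hs
      have h1 := hne a ha b hb hab.ne s hs
      rw [← hexp a ha s hs, ← hexp b hb s hs] at h1
      constructor
      · intro h
        rw [sub_eq_zero.1 h] at h1
        exact h1 rfl
      · intro h
        rw [show α b s = α a s + 2 * pi by linarith] at h1
        push_cast at h1
        rw [add_mul, Complex.exp_add, Complex.exp_two_pi_mul_I, mul_one] at h1
        exact h1 rfl
    refine mem_Ioo_of_avoids (D := fun s => α b s - α a s) hq ((hcont b hb).sub (hcont a ha)) hav ?_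
    have h1 := hav q hqm
    have h2 := hsort a b hab.le hb
    rw [hα0 a ha, hα0 b hb] at h1 ⊢
    exact ⟨lt_of_le_of_ne (by linarith) h1.1.symm, by linarith [argPos_lt (z b q), argPos_nonneg (z a q)]⟩
  have hk : ∀ j, ∃ k : ℤ, j < w → α j q' = argPos (z j q') + k * (2 * pi) := by
    intro j
    by_cases hj : j < w
    · have h1 := hexp j hj q' hqm'
      obtain ⟨-, -, h2, -⟩ := hpl j hj q' hqm'
      have h3 := norm_mul_exp_argPos (z j q')
      rw [Complex.norm_def, h2] at h3
      have h0 : (√q' : ℂ) ≠ 0 := by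
        intro h0
        rw [h0, zero_mul] at h1
        have := (hre j hj q' hqm').2
        rw [← h1] at this
        simp at this
      obtain ⟨k, hk⟩ := Complex.exp_eq_exp_iff_exists_int.1 (mul_left_cancel₀ h0 (h1.trans h3.symm))
      refine ⟨k, fun _ => ?_⟩
      have := congrArg Complex.im hk
      simpa using this
    · exact ⟨0, fun h => absurd h hj⟩
  choose k hk using hk
  exact desc_le_one (α := fun j => α j q') (k := k) (fun j _ => ⟨argPos_nonneg _, argPos_lt _⟩)
    (fun j hj => hk j hj) fun a b hab hb => by
      have := hwin a b hab hb
      exact ⟨by linarith [this.1], by linarith [this.2]⟩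

end Poly

/-- A node is live at one squared radius only, so the two radii are equal unless the list is empty.
-/
theorem keepsOrder_node {v : ℕ → ℂ} {m σ : ℕ} :
    KeepsOrder true (4 * m) (fun t => (pointItem v σ t).lo) (itemsOf (pointItem v σ)) := by
  intro p w q q' hq hact hinj hsort
  refine (desc_eq_zero fun l h0 hl => ?_).trans_le zero_le_one
  have hqq : q = q' := by
    obtain ⟨h1, h2⟩ := hact l hl
    rw [mem_active] at h1 h2
    obtain ⟨u, hu, -, hun, -⟩ := (node_active (L := 0 < σ) Iff.rfl).1 h1.2
    obtain ⟨u', hu', -, hun', -⟩ := (node_active (L := 0 < σ) Iff.rfl).1 h2.2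
    rw [← hun, ← hun', ← node_pos (σ := σ) hu q, node_pos hu' q]
  rw [← hqq]
  exact hsort (l - 1) l (by lia) hl

end FixedMCR

namespace FixedMCR

/-! ## Counting with events -/

open Complex (exp I normSq)
open Real (pi)
open Set hiding pi
open Filter hiding pi
open Topology

theorem cnt_eq_card_filter {α : Type*} (E : Multiset α) (p : α → Prop) [h : DecidablePred p] :
    cnt E p = Multiset.card (E.filter p) := by
  rw [cnt, show Classical.decPred p = h from Subsingleton.elim _ _, Multiset.countP_eq_card_filter]

theorem ncard_of_nodup {E : Multiset (ℝ × ℕ)} (hE : E.Nodup) {l : ℕ} {q : ℝ → Prop} {S : Set ℝ}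
    (h : ∀ θ, θ ∈ S ↔ (θ, l) ∈ E ∧ q θ) : S.Finite ∧ S.ncard = cnt E (fun e => e.2 = l ∧ q e.1) := by
  classical
  have hS : S = ((E.toFinset.filter fun e => e.2 = l ∧ q e.1).image Prod.fst : Finset ℝ) := by
    ext θ
    simp only [h, Finset.coe_image, Finset.coe_filter, Multiset.mem_toFinset, mem_image, mem_ofPred_eq]
    constructor
    · rintro ⟨h1, h2⟩
      exact ⟨_, ⟨h1, rfl, h2⟩, rfl⟩
    · rintro ⟨⟨θ, l'⟩, ⟨h1, rfl, h2⟩, rfl⟩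
      exact ⟨h1, h2⟩
  refine ⟨hS ▸ Finset.finite_toSet _, ?_⟩
  rw [hS, Set.ncard_coe_finset, Finset.card_image_of_injOn, cnt_eq_card_filter]
  · rw [Finset.card_def, Finset.filter_val, Multiset.toFinset_val, hE.dedup]
  · rintro ⟨a, b⟩ ha ⟨a', b'⟩ ha' he
    simp only [Finset.coe_filter, mem_ofPred_eq] at ha ha'
    exact Prod.ext he (ha.2.1.trans ha'.2.1.symm)

open Classical in
theorem cnt_single {E : Multiset (ℝ × ℕ)} (hE : E.Nodup) (θ : ℝ) (l : ℕ) :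
    cnt E (fun e => e.2 = l ∧ e.1 = θ) = if (θ, l) ∈ E then 1 else 0 := by
  rw [← (ncard_of_nodup hE (S := {x | (x, l) ∈ E ∧ x = θ}) fun x => Iff.rfl).2]
  split_ifs with h
  · rw [Set.ncard_eq_one]
    refine ⟨θ, ?_⟩
    ext x
    simp only [mem_ofPred_eq, mem_singleton_iff]
    exact ⟨fun h => h.2, fun hx => ⟨hx ▸ h, hx⟩⟩
  · rw [show {x | (x, l) ∈ E ∧ x = θ} = ∅ from ?_, Set.ncard_empty]
    ext x
    simp only [mem_ofPred_eq, mem_empty_iff_false, iff_false]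
    rintro ⟨h1, rfl⟩
    exact h h1

theorem cnt_le_eq (E : Multiset (ℝ × ℕ)) (θ : ℝ) (l : ℕ) : cnt E (fun e => e.2 = l ∧ e.1 ≤ θ) =
    cnt E (fun e => e.2 = l ∧ e.1 < θ) + cnt E (fun e => e.2 = l ∧ e.1 = θ) := by
  classical
  induction E using Multiset.induction_on with
  | empty => rfl
  | cons e E ih =>
    simp only [cnt, Multiset.countP_cons] at ih ⊢
    rw [ih]
    rcases lt_trichotomy e.1 θ with h | h | h
    · by_cases hl : e.2 = l <;> simp [h, h.le, h.ne, hl]; lia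
    · by_cases hl : e.2 = l <;> simp [h, hl]; lia
    · by_cases hl : e.2 = l <;> simp [h.not_ge, h.not_gt, h.ne', hl]

theorem eventually_forall_mem {E : Multiset (ℝ × ℕ)} {l : Filter ℝ} {R : ℝ → ℝ → Prop}
    (h : ∀ x, ∀ᶠ φ in l, R x φ) : ∀ᶠ φ in l, ∀ e ∈ E, R e.1 φ := by
  classical
  have := (Filter.eventually_all_finset E.toFinset (l := l) (p := fun e φ => R e.1 φ)).2 fun e _ => h e.1
  filter_upwards [this] with φ hφ e he
  exact hφ e (Multiset.mem_toFinset.2 he)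

/-- Passing an angle changes the out-count just after it and the in-count at it; this asymmetry is
that of `≤` for in-events and `<` for out-events, which is right as the region is closed. -/
theorem eventually_gt_counts (E : Multiset (ℝ × ℕ)) (θ : ℝ) : ∀ᶠ φ in 𝓝[>] θ,
    insE E φ = insE E θ ∧ outsE E φ = cnt E (fun e => e.2 = 1 ∧ e.1 ≤ θ) := by
  have : ∀ x : ℝ, ∀ᶠ φ in 𝓝[>] θ, (x ≤ φ ↔ x ≤ θ) ∧ (x < φ ↔ x ≤ θ) := by
    intro x
    rcases le_or_gt x θ with h | h
    · filter_upwards [self_mem_nhdsWithin] with φ hφ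
      have := h.trans_lt (mem_Ioi.1 hφ)
      simp [h, this, this.le]
    · filter_upwards [Filter.Eventually.filter_mono nhdsWithin_le_nhds (eventually_lt_nhds h)] with φ hφ
      simp [h.not_ge, hφ.not_gt, hφ.not_ge]
  filter_upwards [eventually_forall_mem (E := E) this] with φ hφ
  exact ⟨cnt_congr fun e he => by rw [(hφ e he).1], cnt_congr fun e he => by rw [(hφ e he).2]⟩

theorem eventually_lt_counts (E : Multiset (ℝ × ℕ)) (θ : ℝ) : ∀ᶠ φ in 𝓝[<] θ,
    insE E φ = cnt E (fun e => e.2 = 0 ∧ e.1 < θ) ∧ outsE E φ = outsE E θ := by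
  have : ∀ x : ℝ, ∀ᶠ φ in 𝓝[<] θ, (x ≤ φ ↔ x < θ) ∧ (x < φ ↔ x < θ) := by
    intro x
    rcases lt_or_ge x θ with h | h
    · filter_upwards [Filter.Eventually.filter_mono nhdsWithin_le_nhds (eventually_gt_nhds h)] with φ hφ
      simp [h, hφ, hφ.le]
    · filter_upwards [self_mem_nhdsWithin] with φ hφ
      have := (mem_Iio.1 hφ).trans_le h
      simp [h.not_gt, this.not_ge, this.not_gt]
  filter_upwards [eventually_forall_mem (E := E) this] with φ hφ
  exact ⟨cnt_congr fun e he => by rw [(hφ e he).1], cnt_congr fun e he => by rw [(hφ e he).2]⟩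

open Classical in
/-- The indicator of the region along a circle. -/
noncomputable def inside (v : ℕ → ℂ) (p : ℂ) (θ : ℝ) : ℕ := if p * exp (θ * I) ∈ Reg v then 1 else 0

namespace Poly

variable {m σ : ℕ} {v : ℕ → ℂ} (P : Poly m v)
include P

/-- The indicator minus the in-count plus the out-count is locally constant: an in-event at `θ`
makes both the indicator and the in-count jump on arrival at `θ`, an out-event makes the indicator
drop and the out-count jump just after. The interval of angles is connected. -/
theorem inside_count (hσ : σ ≤ 1) (hL : 0 < σ ↔ leftInner v 1) (p : ℂ) : ∃ c : ℤ, ∀ φ ∈ Ico 0 (2 * pi),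
    (inside v p φ : ℤ) = c + insE (pointEvents m v σ p) φ - outsE (pointEvents m v σ p) φ := by
  classical
  set E := pointEvents m v σ p with hE
  have hnd : E.Nodup := P.nodup_pointEvents hσ hL p
  set g : ℝ → ℤ := fun φ => inside v p φ - insE E φ + outsE E φ with hg
  have hloc : ∀ θ ∈ Ico 0 (2 * pi), ∀ᶠ φ in 𝓝 θ, g θ = g φ := by
    intro θ hθ
    obtain ⟨a, b, ha, hb, hab⟩ := P.eventually_const (p := p) (θ := θ)
    have hin : (θ, 0) ∈ E ↔ Enters v p θ := by
      rw [hE, P.mem_pointEvents_iff hσ hL]; simp [hθ.1, hθ.2]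
    have hout : (θ, 1) ∈ E ↔ Leaves v p θ := by
      rw [hE, P.mem_pointEvents_iff hσ hL]; simp [hθ.1, hθ.2]
    have hin' : Enters v p θ ↔ p * exp (θ * I) ∈ Reg v ∧ ¬ a := by
      refine and_congr_right fun _ => ⟨fun h => ?_, fun h => ?_⟩
      · obtain ⟨φ, h1, h2⟩ := (h.and ha).exists
        exact fun h => h1 (h2.2 h)
      · filter_upwards [ha] with φ hφ
        rwa [hφ]
    have hout' : Leaves v p θ ↔ p * exp (θ * I) ∈ Reg v ∧ ¬ b := by
      refine and_congr_right fun _ => ⟨fun h => ?_, fun h => ?_⟩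
      · obtain ⟨φ, h1, h2⟩ := (h.and hb).exists
        exact fun h => h1 (h2.2 h)
      · filter_upwards [hb] with φ hφ
        rwa [hφ]
    -- A neighbourhood consists of the angles before `θ`, the angle `θ` itself and the angles after
    -- it.
    rw [← nhdsLT_sup_nhdsGE, ← Ioi_insert, nhdsWithin_insert, eventually_sup, eventually_sup]
    refine ⟨?_, by simp, ?_⟩
    · filter_upwards [ha, eventually_lt_counts E θ] with φ h1 h2
      have h3 := cnt_le_eq E θ 0
      rw [cnt_single hnd] at h3
      simp only [hg, h2.1, h2.2]
      rw [insE, h3, inside, inside, if_congr h1 rfl rfl, if_congr (hin.trans hin') rfl rfl]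
      by_cases hx : p * exp (θ * I) ∈ Reg v
      · by_cases a <;> simp [*]
      · simp [hx, (hab hx).1]
    · filter_upwards [hb, eventually_gt_counts E θ] with φ h1 h2
      have h3 := cnt_le_eq E θ 1
      rw [cnt_single hnd] at h3
      simp only [hg, h2.1, h2.2]
      rw [outsE, h3, inside, inside, if_congr h1 rfl rfl, if_congr (hout.trans hout') rfl rfl]
      by_cases hx : p * exp (θ * I) ∈ Reg v
      · by_cases b <;> simp [*]; ring
      · simp [hx, (hab hx).2]
  refine ⟨g 0, fun φ hφ => ?_⟩
  have h0 : (0 : ℝ) ∈ Ico 0 (2 * pi) := ⟨le_rfl, Real.two_pi_pos⟩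
  have : g 0 = g φ := by
    refine isPreconnected_Ico.induction₂ (s := Ico (0 : ℝ) (2 * pi)) (fun x y => g x = g y)
      (fun x hx => (hloc x hx).filter_mono nhdsWithin_le_nhds) (fun x y z _ _ _ => Eq.trans)
      (fun x y _ _ h => h.symm) h0 hφ
  rw [this, hg]
  ring

end Poly

/-! ## Instances -/

namespace Instance

variable {n m : ℕ} (J : Instance n m)

/-- The vertices of the polygon relative to the center, with period `m`. -/
noncomputable def vert (i : ℕ) : ℂ :=
  J.polygon.vertices ⟨i % m, Nat.mod_lt _ (by have := J.three_le; lia)⟩ - J.center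

theorem vert_eq (i : Fin m) (k : ℕ) (h : k % m = i) : J.vert k = J.polygon.vertices i - J.center := by
  rw [vert]
  congr 2
  exact Fin.ext h

theorem finRotate_val (i : Fin m) : (finRotate m i : ℕ) = (i + 1) % m := by
  have : NeZero m := i.neZero
  rw [finRotate_apply, Fin.val_add]
  simp

theorem mem_edgeSet {i : Fin m} {k : ℕ} (h : k % m = i) {x : ℂ} :
    x + J.center ∈ J.polygon.edgeSet ℝ i ↔ ∃ t ∈ Icc (0 : ℝ) 1, x = J.vert k + t * (J.vert (k + 1) - J.vert k) := by
  rw [J.vert_eq i k h, J.vert_eq (finRotate m i) (k + 1) (by rw [finRotate_val, Nat.add_mod, h]; simp),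
    Polygon.edgeSet, affineSegment, mem_image]
  refine exists_congr fun t => and_congr_right fun _ => ?_
  rw [AffineMap.lineMap_apply, vsub_eq_sub, vadd_eq_add, Complex.real_smul]
  constructor
  · intro h; linear_combination -h
  · intro h; linear_combination -h

/-- Every edge is taken without its end. Then consecutive edges become disjoint too, because they
share only the end of the first one. -/
theorem poly : Poly m J.vert where
  three_le := J.three_le
  per i := by simp [vert]
  uniq := by
    intro i j s t hs ht he
    have hm := J.three_le
    have hm0 : 0 < m := by lia
    obtain ⟨hinj, hadj, hdis⟩ := J.simple
    set a : Fin m := ⟨i % m, Nat.mod_lt _ hm0⟩ with ha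
    set b : Fin m := ⟨j % m, Nat.mod_lt _ hm0⟩ with hb
    have hrot : ∀ c : Fin m, finRotate m c ≠ c := by
      intro c hc
      have h1 := congrArg Fin.val hc
      rw [finRotate_val] at h1
      have h2 := c.isLt
      rcases lt_or_ge ((c : ℕ) + 1) m with h | h
      · rw [Nat.mod_eq_of_lt h] at h1; lia
      · rw [show (c : ℕ) + 1 = m by lia, Nat.mod_self] at h1; lia
    have hnext : ∀ (c : Fin m) (k : ℕ), k % m = c → J.vert (k + 1) = J.polygon (finRotate m c) - J.center :=
      fun c k h => J.vert_eq _ _ (by rw [finRotate_val, Nat.add_mod, h]; simp)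
    have hedge : ∀ (c : Fin m) (k : ℕ), k % m = c → J.vert (k + 1) - J.vert k ≠ 0 := by
      intro c k h h0
      rw [hnext c k h, J.vert_eq c k h, sub_sub_sub_cancel_right, sub_eq_zero] at h0
      exact hrot c (hinj h0)
    have hx := (J.mem_edgeSet (i := a) (k := i) rfl).2 ⟨s, ⟨hs.1, hs.2.le⟩, rfl⟩
    have hy := (J.mem_edgeSet (i := b) (k := j) rfl).2 ⟨t, ⟨ht.1, ht.2.le⟩, rfl⟩
    -- A point of an edge with parameter below `1` is not the end of the edge.
    have hend : ∀ (c : Fin m) (k : ℕ) (r : ℝ), k % m = c → r ∈ Ico (0 : ℝ) 1 →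
        J.vert k + r * (J.vert (k + 1) - J.vert k) + J.center ≠ J.polygon (finRotate m c) := by
      intro c k r hk hr h
      have h1 := hnext c k hk
      have h2 : ((r - 1 : ℝ) : ℂ) * (J.vert (k + 1) - J.vert k) = 0 := by
        push_cast
        linear_combination h - h1
      rcases mul_eq_zero.1 h2 with h3 | h3
      · have : r - 1 = 0 := by exact_mod_cast h3
        linarith [hr.2]
      · exact hedge c k hk h3
    have hab : a = b := by
      by_contra hab
      by_cases h1 : b = finRotate m a
      · have : J.vert i + s * (J.vert (i + 1) - J.vert i) + J.center ∈
            J.polygon.edgeSet ℝ a ∩ J.polygon.edgeSet ℝ (finRotate m a) := ⟨hx, by rw [he, ← h1]; exact hy⟩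
        rw [hadj] at this
        exact hend a i s rfl hs this
      by_cases h2 : a = finRotate m b
      · have : J.vert j + t * (J.vert (j + 1) - J.vert j) + J.center ∈
            J.polygon.edgeSet ℝ b ∩ J.polygon.edgeSet ℝ (finRotate m b) := ⟨hy, by rw [← he, ← h2]; exact hx⟩
        rw [hadj] at this
        exact hend b j t rfl ht this
      exact Set.disjoint_left.1 (hdis a b (Ne.symm hab) h1 h2) hx (he ▸ hy)
    have hmod : i % m = j % m := congrArg Fin.val hab
    refine ⟨hmod, ?_⟩
    rw [J.vert_eq a i rfl, J.vert_eq a j hmod.symm, hnext a i rfl, hnext a j hmod.symm] at he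
    have h3 := hedge a i rfl
    rw [J.vert_eq a i rfl, hnext a i rfl] at h3
    have := mul_right_cancel₀ h3 (add_left_cancel he)
    exact_mod_cast this

theorem mem_boundary {x : ℂ} : x + J.center ∈ J.polygon.boundary ℝ ↔ x ∈ bd J.vert := by
  have hm := J.three_le
  rw [Polygon.boundary, mem_iUnion]
  constructor
  · rintro ⟨i, hi⟩
    exact ⟨i, (J.mem_edgeSet (Nat.mod_eq_of_lt i.isLt)).1 hi⟩
  · rintro ⟨i, hi⟩
    exact ⟨⟨i % m, Nat.mod_lt _ (by lia)⟩, (J.mem_edgeSet rfl).2 hi⟩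

/-- The translation by the center is a homeomorphism and an isometry, so it preserves components of
the complement and their boundedness. -/
theorem mem_region {x : ℂ} : x + J.center ∈ region J.polygon ↔ x ∈ Reg J.vert := by
  rw [region, Reg, mem_union, mem_union, J.mem_boundary]
  refine or_congr_right (and_congr_left' (not_congr J.mem_boundary) |>.trans (and_congr_right fun hx => ?_))
  set e : ℂ ≃ᵢ ℂ := IsometryEquiv.addRight J.center
  have h1 : e.toHomeomorph '' (bd J.vert)ᶜ = (J.polygon.boundary ℝ)ᶜ := by
    ext y
    constructor
    · rintro ⟨z, hz, rfl⟩
      exact fun h => hz (J.mem_boundary.1 h)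
    · intro hy
      exact ⟨y - J.center, fun h => hy (by simpa using J.mem_boundary.2 h), sub_add_cancel y J.center⟩
  have h2 := e.toHomeomorph.image_connectedComponentIn (show x ∈ (bd J.vert)ᶜ from hx)
  rw [h1] at h2
  change Bornology.IsBounded (connectedComponentIn _ (e.toHomeomorph x)) ↔ _
  rw [← h2]
  constructor
  · intro h
    have := e.isometry.antilipschitz.isBounded_preimage h
    rwa [show ⇑e.toHomeomorph = e from rfl, preimage_image_eq _ e.injective] at this
  · exact fun h => e.isometry.lipschitz.isBounded_image h

theorem mem_placement {z : ℂ} {θ : ℝ} :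
    z ∈ J.placement θ ↔ (z - J.center) * exp (θ * I) ∈ Reg J.vert := by
  rw [← J.mem_region, placement, mem_image]
  constructor
  · rintro ⟨y, hy, rfl⟩
    convert hy using 1
    rw [rotateCW, add_sub_cancel_left, mul_right_comm, ← Complex.exp_add]
    simp
  · intro h
    refine ⟨_, h, ?_⟩
    rw [rotateCW, add_sub_cancel_right, mul_left_comm, ← Complex.exp_add]
    simp

end Instance
end FixedMCR

/-! ### The events of an instance, and the input of the program -/

namespace FixedMCR

open Complex (exp I normSq)
open Real (pi)
open Set hiding pi

theorem KeepsOrder.of_items {c : Bool} {N : ℕ} {D D' : ℕ → Item} (h : ∀ t < N, D' t = D t)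
    (H : KeepsOrder c N (fun t => (D t).lo) (itemsOf D)) :
    KeepsOrder c N (fun t => (D' t).lo) (itemsOf D') := by
  intro p w q q' hq h1 h2 h3
  have ha : ∀ s, active c N (fun t => (D' t).lo) (itemsOf D').hi s =
      active c N (fun t => (D t).lo) (itemsOf D).hi s :=
    fun s => active_congr fun t ht => by simp [itemsOf, h t ht]
  rw [ha, ha] at h1
  have hk : ∀ j < w, ∀ s, (itemsOf D').key (p j) s = (itemsOf D).key (p j) s := fun j hj s => by
    rw [itemsOf_key, itemsOf_key, h _ (mem_active.1 (h1 j hj).1).1]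
  rw [desc_congr fun l _ hl => hk l hl q']
  refine H p w q q' hq h1 h2 fun a b hab hb => ?_
  rw [← hk a (hab.trans_lt hb), ← hk b hb]
  exact h3 a b hab hb

theorem events_of_items {c : Bool} {N : ℕ} {D D' : ℕ → Item} (h : ∀ t < N, D' t = D t) (q β : ℝ) :
    (itemsOf D').events c N (fun t => (D' t).lo) q β = (itemsOf D).events c N (fun t => (D t).lo) q β := by
  have ha : active c N (fun t => (D' t).lo) (itemsOf D').hi q =
      active c N (fun t => (D t).lo) (itemsOf D).hi q :=
    active_congr fun t ht => by simp [itemsOf, h t ht]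
  rw [Items.events, Items.events, ha]
  refine Multiset.map_congr rfl fun t ht => ?_
  have := h t (mem_active.1 ht).1
  rw [itemsOf_key, itemsOf_key, this]
  simp [itemsOf, this]

theorem cnt_sum {α ι : Type*} (s : Finset ι) (E : ι → Multiset α) (p : α → Prop) :
    cnt (∑ j ∈ s, E j) p = ∑ j ∈ s, cnt (E j) p := by
  classical
  induction s using Finset.induction_on with
  | empty => rfl
  | insert a s ha ih => rw [Finset.sum_insert ha, Finset.sum_insert ha, cnt_add, ih]

namespace Instance

variable {n m : ℕ} (J : Instance n m)

open Classical in
/-- `1` if the interior is to the left of the boundary, and `0` otherwise. -/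
noncomputable def side : ℕ := if leftInner J.vert 1 then 1 else 0

theorem side_le : J.side ≤ 1 := by
  rw [side]; split_ifs <;> lia

theorem side_pos : 0 < J.side ↔ leftInner J.vert 1 := by
  rw [side]; split_ifs with h <;> simp [h]

/-- The events of the `j`-th point. -/
noncomputable def eventsAt (j : Fin n) : Multiset (ℝ × ℕ) :=
  pointEvents m J.vert J.side (J.point j - J.center)

theorem mem_eventsAt {j : Fin n} {θ : ℝ} {l : ℕ} :
    (θ, l) ∈ J.eventsAt j ↔ l = 0 ∧ θ ∈ J.inEvents j ∨ l = 1 ∧ θ ∈ J.outEvents j := by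
  rw [eventsAt, J.poly.mem_pointEvents_iff J.side_le J.side_pos]
  simp only [inEvents, outEvents, Enters, Leaves, J.mem_placement, mem_ofPred_eq]
  tauto

theorem nodup_eventsAt (j : Fin n) : (J.eventsAt j).Nodup :=
  J.poly.nodup_pointEvents J.side_le J.side_pos _

theorem inEvents_finite (j : Fin n) : (J.inEvents j).Finite ∧
    (J.inEvents j).ncard = cnt (J.eventsAt j) fun e => e.2 = 0 ∧ True :=
  ncard_of_nodup (q := fun _ => True) (J.nodup_eventsAt j) fun θ => by rw [mem_eventsAt]; simp

theorem outEvents_finite (j : Fin n) : (J.outEvents j).Finite ∧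
    (J.outEvents j).ncard = cnt (J.eventsAt j) fun e => e.2 = 1 ∧ True :=
  ncard_of_nodup (q := fun _ => True) (J.nodup_eventsAt j) fun θ => by rw [mem_eventsAt]; simp

theorem card_eventsAt (j : Fin n) :
    Multiset.card (J.eventsAt j) = (J.inEvents j).ncard + (J.outEvents j).ncard := by
  classical
  rw [(J.inEvents_finite j).2, (J.outEvents_finite j).2, cnt_eq_card_filter, cnt_eq_card_filter,
    ← Multiset.card_add]
  conv_lhs => rw [← Multiset.filter_add_not (fun e => e.2 = 0 ∧ True) (J.eventsAt j)]
  congr 2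
  refine Multiset.filter_congr fun e he => ?_
  have := J.mem_eventsAt.1 (show (e.1, e.2) ∈ J.eventsAt j from he)
  simp only [and_true]
  lia

/-- Each of the `2 * m` and `4 * m` items contributes at most one event. -/
theorem card_eventsAt_le (j : Fin n) : Multiset.card (J.eventsAt j) ≤ 6 * m := by
  rw [eventsAt, pointEvents, Multiset.card_add]
  have h1 := events_card_le (itemsOf (strictItem J.vert J.side)) false (2 * m)
    (fun t => (strictItem J.vert J.side t).lo) (normSq (J.point j - J.center)) (argPos (J.point j - J.center))
  have h2 := events_card_le (itemsOf (pointItem J.vert J.side)) true (4 * m)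
    (fun t => (pointItem J.vert J.side t).lo) (normSq (J.point j - J.center)) (argPos (J.point j - J.center))
  lia

/-- All events. -/
noncomputable def events : Multiset (ℝ × ℕ) := ∑ j, J.eventsAt j

theorem card_events : Multiset.card J.events = J.eventCount := by
  rw [events, eventCount, Multiset.card_sum]
  exact Finset.sum_congr rfl fun j _ => J.card_eventsAt j

theorem eventCount_le : J.eventCount ≤ 6 * (n * m) := by
  rw [← card_events, events, Multiset.card_sum]
  refine (Finset.sum_le_sum fun j _ => J.card_eventsAt_le j).trans (le_of_eq ?_)
  simp
  ring

theorem mem_events {e : ℝ × ℕ} (he : e ∈ J.events) : e.1 ∈ Ico 0 (2 * pi) ∧ e.2 ≤ 1 := by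
  obtain ⟨j, -, hj⟩ := Multiset.mem_sum.1 he
  have := (J.poly.mem_pointEvents_iff J.side_le J.side_pos).1 (show (e.1, e.2) ∈ J.eventsAt j from hj)
  exact ⟨this.1, by rcases this.2 with h | h <;> lia⟩

theorem cover_eq (θ : ℝ) : J.cover θ = ∑ j, inside J.vert (J.point j - J.center) θ := by
  classical
  rw [cover, Set.ncard_eq_toFinset_card', Set.toFinset_ofPred, Finset.card_filter]
  refine Finset.sum_congr rfl fun j _ => ?_
  rw [inside]
  exact if_congr J.mem_placement rfl rfl

theorem cover_count : ∃ c : ℤ, ∀ φ ∈ Ico 0 (2 * pi),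
    (J.cover φ : ℤ) = c + insE J.events φ - outsE J.events φ := by
  choose c hc using fun j => J.poly.inside_count J.side_le J.side_pos (J.point j - J.center)
  refine ⟨∑ j, c j, fun φ hφ => ?_⟩
  rw [cover_eq, insE, outsE, events, cnt_sum, cnt_sum]
  push_cast
  rw [← Finset.sum_add_distrib, ← Finset.sum_sub_distrib]
  exact Finset.sum_congr rfl fun j _ => hc j φ hφ

theorem isSolution {θ : ℝ} (h : ∀ φ, insE J.events φ + outsE J.events θ ≤ insE J.events θ + outsE J.events φ)
    (h' : θ = 0 ∨ ∃ e ∈ J.events, θ = e.1) : J.IsSolution θ := by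
  have hθ : θ ∈ Ico 0 (2 * pi) := by
    rcases h' with rfl | ⟨e, he, rfl⟩
    · exact ⟨le_rfl, Real.two_pi_pos⟩
    · exact (J.mem_events he).1
  refine ⟨hθ, fun φ hφ => ?_⟩
  obtain ⟨c, hc⟩ := J.cover_count
  have h1 := hc φ hφ
  have h2 := hc θ hθ
  have h3 := h φ
  lia

theorem valid {V Q : ℕ → ℂ} (hV : ∀ i ≤ m + 1, V i = J.vert i) (hQ : ∀ j : Fin n, Q j = J.point j - J.center) :
    Valid m n V Q J.side J.events := by
  have hm := J.three_le
  have hs : ∀ t < 2 * m, strictItem V J.side t = strictItem J.vert J.side t := by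
    intro t ht
    rw [strictItem, strictItem, hV _ (by lia), hV _ (by lia)]
  have hp : ∀ t < 4 * m, pointItem V J.side t = pointItem J.vert J.side t := by
    intro t ht
    rw [pointItem, pointItem, hV _ (by lia), hV _ (by lia), hV _ (by lia)]
  refine ⟨J.side_le, fun i hi hfar => ?_, .of_items hs (J.poly.keepsOrder_strict _),
    .of_items hp keepsOrder_node, ?_, fun e he => ⟨(J.mem_events he).1.1, (J.mem_events he).2⟩⟩
  · have hB := J.poly.edge_ne_zero (i + 1)
    rw [hV _ (by lia), hV _ (by lia), hV _ (by lia), argPos_mul_conj hB, argPos_mul_conj hB,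
      J.poly.farthest, ← side_pos, not_lt, Nat.le_zero]
    intro j
    -- The program inspects the vertices with numbers from `1` to `m`, so an arbitrary vertex is
    -- shifted into this range.
    have h1 : J.vert j = J.vert ((j + m - 1) % m + 1) := by
      refine J.poly.congr ?_
      rw [Nat.mod_add_mod, show j + m - 1 + 1 = j + m by lia, Nat.add_mod_right]
    have h2 := hfar ((j + m - 1) % m) (Nat.mod_lt _ (by lia))
    have h3 : (j + m - 1) % m < m := Nat.mod_lt _ (by lia)
    rw [hV _ (by lia), hV _ (by lia), ← h1] at h2
    rw [Complex.norm_def, Complex.norm_def]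
    exact Real.sqrt_le_sqrt h2
  · rw [Finset.sum_range, events]
    refine Finset.sum_congr rfl fun j _ => ?_
    rw [hQ, events_of_items hs, events_of_items hp]
    rfl

theorem flatMap_getD (L : List ℂ) (i : ℕ) :
    (L.flatMap fun z => [z.re, z.im]).getD (2 * i) 0 = (L.getD i 0).re ∧
      (L.flatMap fun z => [z.re, z.im]).getD (2 * i + 1) 0 = (L.getD i 0).im := by
  induction L generalizing i with
  | nil => simp
  | cons z L ih =>
    cases i with
    | zero => simp
    | succ i =>
      have := ih i
      simpa [Nat.mul_add] using this

/-- The input, as a list of points. -/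
theorem coordinates_getD (i : ℕ) (z : ℂ)
    (h : (J.center :: (List.ofFn J.polygon.vertices ++ List.ofFn J.point)).getD i 0 = z) :
    J.initial.rmem (2 * i) = z.re ∧ J.initial.rmem (2 * i + 1) = z.im := by
  have := flatMap_getD (J.center :: (List.ofFn J.polygon.vertices ++ List.ofFn J.point)) i
  rw [h] at this
  exact this

theorem rmem_center : J.initial.rmem 0 = J.center.re ∧ J.initial.rmem 1 = J.center.im :=
  J.coordinates_getD 0 _ rfl

theorem rmem_vertex (i : Fin m) : J.initial.rmem (2 * (1 + i)) = (J.polygon i).re ∧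
    J.initial.rmem (2 * (1 + i) + 1) = (J.polygon i).im := by
  refine J.coordinates_getD (1 + i) _ ?_
  rw [add_comm, List.getD_cons_succ, List.getD_append _ _ _ _ (by simp)]
  simp

theorem rmem_point (j : Fin n) : J.initial.rmem (2 * (1 + m + j)) = (J.point j).re ∧
    J.initial.rmem (2 * (1 + m + j) + 1) = (J.point j).im := by
  refine J.coordinates_getD (1 + m + j) _ ?_
  rw [show 1 + m + (j : ℕ) = (m + j) + 1 by ring, List.getD_cons_succ,
    List.getD_append_right _ _ _ _ (by simp)]
  simp

/-- The state in which the main part of the program starts. -/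
noncomputable def start : St where
  len := 2 * (1 + m + n)
  inp := J.initial.rmem
  iv := fun v => if v = 0 then n else if v = 1 then m else 0
  rv := fun _ => 0
  ia := fun _ _ => 0
  -- The real arrays begin with whatever the memory contains there; every cell is written before its
  -- value matters.
  ra := fun k j => J.initial.rmem (2 * (1 + m + n) + 16 * j + k)

end Instance

/-- Sets up the base address of the arrays. -/
def prologue : Program :=
  -- The variables `x₀` and `x₁` are kept in registers `0` and `2`. So `n` is already in place, `m`
  -- is moved, and register `1` receives the length `2 * (m + 1 + n)` of the input.
  .seq (.instr (.imove 2 1)) (.seq (.instr (.iconst 3 1)) (.seq (.instr (.iadd 1 1 3))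
    (.seq (.instr (.iadd 1 1 0)) (.instr (.iadd 1 1 1)))))

theorem prologue_halts {n m : ℕ} (J : Instance n m) (B : ℕ) :
    Halts B prologue J.initial 5 (Rep J.start) := by
  refine ⟨_, _, _, .seq (.instr _ _) (.seq (.instr _ _) (.seq (.instr _ _) (.seq (.instr _ _)
    (.instr _ _)))), le_rfl, by simp [Instr.cells], ?_⟩
  constructor
  · simp [Instr.step, Instance.start, Instance.initial, Function.update]
    ring
  · intro v
    rcases v with _ | _ | v
    · simp [Instr.step, Instance.start, Instance.initial, Function.update]
    · simp [Instr.step, Instance.start, Instance.initial, Function.update]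
    · have h1 : 2 * (v + 1 + 1) ≠ 1 := by lia
      have h2 : 2 * (v + 1 + 1) ≠ 2 := by lia
      have h3 : 2 * (v + 1 + 1) ≠ 3 := by lia
      simp [Instr.step, Instance.start, Instance.initial, Function.update, h1, h2, h3]
  · intro v; rfl
  · intro k _ j; rfl
  · intro k _ j; rfl
  · intro a _; rfl

/-! ### Final bounds -/

theorem log_bound {a : ℕ} (ha : 2 ≤ a) : (Nat.log 2 (4 * a) : ℝ) + 1 ≤ 8 * Real.log a := by
  have h2 : (1 / 2 : ℝ) < Real.log 2 := by linarith [Real.log_two_gt_d9]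
  have ha' : (0 : ℝ) < a := by positivity
  have h1 : (Nat.log 2 (4 * a) : ℝ) ≤ Real.logb 2 ((4 * a : ℕ) : ℝ) := by
    exact_mod_cast Real.natLog_le_logb (4 * a) 2
  have h4 : Real.log ((4 * a : ℕ) : ℝ) = 2 * Real.log 2 + Real.log a := by
    push_cast
    rw [Real.log_mul (by norm_num) ha'.ne', show (4 : ℝ) = 2 ^ 2 by norm_num, Real.log_pow]
    push_cast; ring
  have h3 : Real.log 2 ≤ Real.log a := Real.log_le_log two_pos (by exact_mod_cast ha)
  rw [Real.logb, h4, le_div_iff₀ (by linarith)] at h1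
  nlinarith

/-- Logarithms to the base 2 are replaced by natural ones, and the additive constants are absorbed.
Since `m ≥ 3`, `m * Real.log m` is at least `m`, hence it can take up everything that is linear in
`m`. -/
theorem time_bound {n m K : ℕ} (hm : 3 ≤ m) (hK : K ≤ 6 * (n * m)) :
    (((n + K + 1) * (Nat.log 2 (4 * n) + 1) + m * (Nat.log 2 (4 * m) + 1) : ℕ) : ℝ) ≤
      28 * (((n : ℝ) + K) * Real.log n + m * Real.log m) ∧ (1 : ℝ) ≤ m * Real.log m := by
  have hm' : (3 : ℝ) ≤ m := by exact_mod_cast hm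
  have hl : 1 ≤ Real.log m := by
    rw [Real.le_log_iff_exp_le (by linarith)]
    linarith [Real.exp_one_lt_d9]
  have hml : (m : ℝ) ≤ m * Real.log m := le_mul_of_one_le_right (by linarith) hl
  refine ⟨?_, by linarith⟩
  have h1 : (m : ℝ) * (Nat.log 2 (4 * m) + 1) ≤ 8 * (m * Real.log m) := by
    have := mul_le_mul_of_nonneg_left (log_bound (show 2 ≤ m by lia)) (show (0 : ℝ) ≤ m by linarith)
    linarith
  have hn0 : (0 : ℝ) ≤ (n + K) * Real.log n :=
    mul_nonneg (by positivity) (Real.log_natCast_nonneg n)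
  have h2 : ((n : ℝ) + K + 1) * (Nat.log 2 (4 * n) + 1) ≤
      16 * ((n + K) * Real.log n) + 20 * (m * Real.log m) := by
    rcases le_or_gt 2 n with hn | hn
    · have h3 := log_bound hn
      have h4 : (2 : ℝ) ≤ n := by exact_mod_cast hn
      have h5 : (0 : ℝ) ≤ K := by positivity
      have h6 := mul_le_mul (show (n : ℝ) + K + 1 ≤ 2 * (n + K) by linarith) h3 (by positivity) (by linarith)
      nlinarith
    -- For `n ≤ 1` the term with `Real.log n` vanishes, but then there are at most `6 * m` events
    -- and `m * Real.log m` pays for them.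
    · have h3 : Nat.log 2 (4 * n) + 1 ≤ 3 := by
        have : Nat.log 2 (4 * n) ≤ Nat.log 2 4 := Nat.log_mono_right (by lia)
        have h4 : Nat.log 2 4 = 2 := Nat.log_eq_of_pow_le_of_lt_pow (by norm_num) (by norm_num)
        lia
      have h4 : n + K + 1 ≤ 6 * m + 2 := by
        have : n * m ≤ 1 * m := Nat.mul_le_mul_right m (by lia)
        have : K ≤ 6 * m := by lia
        lia
      have h5 : (n + K + 1) * (Nat.log 2 (4 * n) + 1) ≤ (6 * m + 2) * 3 := Nat.mul_le_mul h4 h3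
      have h6 : ((n : ℝ) + K + 1) * (Nat.log 2 (4 * n) + 1) ≤ (6 * m + 2) * 3 := by exact_mod_cast h5
      linarith
  push_cast
  linarith

theorem program_spec {n m : ℕ} (J : Instance n m) : ∃ (s : Store) (t c : ℕ),
    Runs (.seq prologue mainCode.comp) J.initial s t c ∧ J.IsSolution (s.rreg 0) ∧
      t ≤ 5 + mainCode.fac * (2000 * ((n + J.eventCount + 1) * (Nat.log 2 (4 * n) + 1) +
        m * (Nat.log 2 (4 * m) + 1))) ∧
      c ≤ 2 * (1 + m + n) + 16 * (n + 4 * m + J.eventCount + 3) := by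
  have hm := J.three_le
  obtain ⟨h', t, he, hsol, ht⟩ := mainCode_wp (M := n + 4 * m + J.eventCount + 3) (n := n) (m := m)
    (E := J.events) (h := J.start) (τ := 0) (Q := fun h' τ' => J.IsSolution (h'.rv 0) ∧
      τ' ≤ 0 + 2000 * ((n + J.eventCount + 1) * (Nat.log 2 (4 * n) + 1) + m * (Nat.log 2 (4 * m) + 1)))
    rfl rfl hm rfl J.card_events le_rfl
    (fun V h1 h2 h3 => ⟨J.side, J.valid (fun i hi => by
      have hvt : ∀ i < m, J.start.vtx i = J.vert i := by
        intro i hi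
        have := J.rmem_vertex ⟨i, hi⟩
        have hc := J.rmem_center
        rw [J.vert_eq ⟨i, hi⟩ i (Nat.mod_eq_of_lt hi), St.vtx]
        apply Complex.ext
        · exact congrArg₂ (· - ·) this.1 hc.1
        · exact congrArg₂ (· - ·) this.2 hc.2
      rcases lt_or_ge i m with h | h
      · rw [h1 i h, hvt i h]
      · rcases h.eq_or_lt with h | h
        · rw [← h, h2, hvt 0 (by lia), ← J.poly.per 0, zero_add]
        · obtain rfl : i = m + 1 := by lia
          rw [h3, hvt 1 (by lia), ← J.poly.per 1, add_comm 1 m]) fun j => by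
      have := J.rmem_point j
      have hc := J.rmem_center
      rw [St.pt]
      apply Complex.ext
      · exact congrArg₂ (· - ·) this.1 hc.1
      · exact congrArg₂ (· - ·) this.2 hc.2⟩)
    fun h' τ' h1 h2 h3 => ⟨J.isSolution h1 h2, h3⟩
  obtain ⟨s, t', c, hr, ht', hc, hR⟩ := (prologue_halts J _).seq fun s hs =>
    Cmd.comp_halts (B := 2 * (1 + m + n) + 16 * (n + 4 * m + J.eventCount + 3)) mainCode he le_rfl hs
  refine ⟨s, t', c, hr, ?_, ht'.trans ?_, hc⟩
  · have := hR.rv 0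
    rw [mul_zero] at this
    rwa [this]
  · rw [zero_add, zero_add] at ht
    exact Nat.add_le_add_left (Nat.mul_le_mul_left _ ht) _

end FixedMCR

theorem theorem3 :
    (∃ C : ℕ, ∀ (n m : ℕ) (I : FixedMCR.Instance n m),
      (∀ j : Fin n, (I.inEvents j).Finite ∧ (I.outEvents j).Finite) ∧
      I.eventCount ≤ C * (n * m)) ∧
    ∃ (p : FixedMCR.Program) (C : ℝ), ∀ (n m : ℕ) (I : FixedMCR.Instance n m),
      ∃ (s : FixedMCR.Store) (t c : ℕ),
        FixedMCR.Runs p I.initial s t c ∧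
        I.IsSolution (s.rreg 0) ∧
        (t : ℝ) ≤ C * (((n : ℝ) + I.eventCount) * Real.log n + m * Real.log m) ∧
        (c : ℝ) ≤ C * ((n : ℝ) + m + I.eventCount) := by
  refine ⟨⟨6, fun n m I => ⟨fun j => ⟨(I.inEvents_finite j).1, (I.outEvents_finite j).1⟩, I.eventCount_le⟩⟩,
    -- For the time, `56000 = 2000 * 28`. For the space, `18n + 66m + 16k + 50` is bounded with `50
    -- ≤ 17m`, and `66 + 17 = 83`; this also covers the five steps of the prologue.
    .seq FixedMCR.prologue FixedMCR.mainCode.comp, 83 + FixedMCR.mainCode.fac * 56000, fun n m I => ?_⟩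
  obtain ⟨s, t, c, hr, hsol, ht, hc⟩ := FixedMCR.program_spec I
  refine ⟨s, t, c, hr, hsol, ?_, ?_⟩
  · obtain ⟨h1, h2⟩ := FixedMCR.time_bound I.three_le I.eventCount_le
    have h3 : (0 : ℝ) ≤ ((n : ℝ) + I.eventCount) * Real.log n :=
      mul_nonneg (by positivity) (Real.log_natCast_nonneg n)
    set X := ((n : ℝ) + I.eventCount) * Real.log n + m * Real.log m with hX
    have h4 : (t : ℝ) ≤ 5 + FixedMCR.mainCode.fac * (2000 * (((n + I.eventCount + 1) *
        (Nat.log 2 (4 * n) + 1) + m * (Nat.log 2 (4 * m) + 1) : ℕ) : ℝ)) := by exact_mod_cast ht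
    have h5 : (FixedMCR.mainCode.fac : ℝ) * (2000 * (((n + I.eventCount + 1) *
        (Nat.log 2 (4 * n) + 1) + m * (Nat.log 2 (4 * m) + 1) : ℕ) : ℝ)) ≤
        FixedMCR.mainCode.fac * (2000 * (28 * X)) :=
      mul_le_mul_of_nonneg_left (mul_le_mul_of_nonneg_left h1 (by norm_num)) (Nat.cast_nonneg _)
    have h6 : (1 : ℝ) ≤ X := by linarith
    linarith
  · have h1 : (c : ℝ) ≤ 2 * (1 + m + n) + 16 * (n + 4 * m + I.eventCount + 3) := by exact_mod_cast hc
    have h2 : (3 : ℝ) ≤ m := by exact_mod_cast I.three_le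
    have h3 : (0 : ℝ) ≤ (FixedMCR.mainCode.fac * 56000) * ((n : ℝ) + m + I.eventCount) := by positivity
    have h4 : (0 : ℝ) ≤ n := Nat.cast_nonneg _
    have h5 : (0 : ℝ) ≤ I.eventCount := Nat.cast_nonneg _
    linarith
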